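/- We work on the deterministic word RAM with $w$-bit words: memory cells and registers hold words, and each word operation (arithmetic modulo $2^w$, division, remainder, bitwise operations, shifts, comparisons), memory access, or branching test costs one step. A program is a fixed finite object, independent of the input and of $w$. There are two programs, a preprocessing program and a query program, and an exponent $e\in\mathbb{N}$ such that for every $k\in\mathbb{N}$ there are constants $\kappa, K\in\mathbb{N}$ with the following property. Let $n\ge 2$, let the word length $w$ satisfy $2^w\ge n^{\kappa}$ (i.e. $w\ge\kappa\log_2 n$), and let $A,B\subseteq\{0,1,\dots,n^k-1\}$ be two sets of exactly $n$ integers each, given as arrays in arbitrary order. Then: 1. The preprocessing program, run on $n$, $A$ and $B$, halts after at most $K\cdot n^2\log n$ steps. 2. After the preprocessing, and after any finite number of earlier queries, the following holds for every query consisting of subsets $A'\subseteq A$, $B'\subseteq B$ and an arbitrary set $C'$ of $n$ integers that fit into signed $w$-bit words (each set given as an array in arbitrary order): the query program halts after at most $K\cdot T(\log T)^{e}$ steps, where $T=n^{1.5}$ (so its running time is $\widetilde{O}(n^{1.5})$), and it outputs for every $c\in C'$ whether there exist $a\in A'$ and $b\in B'$ with $a+b=c$. -/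

import Mathlib

/-!
# The word RAM, and the 3SUM problem in preprocessed universes with unknown `C`

Machine model: a random access machine with `w`-bit words, a memory of `2 ^ w` words, finitely many
registers, unit-cost word operations, indirect addressing and structured control flow (sequencing,
branching, loops). A program is a fixed finite object: it depends neither on the input nor on `w`.
-/

namespace WordRAM

/-- The contents of the registers and of the memory. A program mentions only finitely many
registers, and it can address only the memory cells `0, …, 2 ^ w - 1`. -/
structure State where
  reg : ℕ → ℕ
  mem : ℕ → ℕ

/-- The binary word operations. -/
inductive Op
  | add | sub | mul | div | mod | and | or | xor | shl | shr | lt | eq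

/-- The result of a word operation on unsigned `w`-bit words: arithmetic is modulo `2 ^ w`, and the
comparisons return `1` or `0`. -/
def Op.eval (w : ℕ) : Op → ℕ → ℕ → ℕ
  | .add, x, y => (x + y) % 2 ^ w
  | .sub, x, y => (x + 2 ^ w - y) % 2 ^ w
  | .mul, x, y => (x * y) % 2 ^ w
  | .div, x, y => x / y
  | .mod, x, y => x % y
  | .and, x, y => x &&& y
  | .or, x, y => x ||| y
  | .xor, x, y => x ^^^ y
  | .shl, x, y => (x <<< y) % 2 ^ w
  | .shr, x, y => x >>> y
  | .lt, x, y => if x < y then 1 % 2 ^ w else 0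
  | .eq, x, y => if x = y then 1 % 2 ^ w else 0

/-- Programs. Numerical arguments `d`, `x`, `y` are names of registers. -/
inductive Prog
  /-- do nothing -/
  | skip
  /-- put the constant `v` into register `d` -/
  | const (d v : ℕ)
  /-- copy register `x` into register `d` -/
  | copy (d x : ℕ)
  /-- apply `o` to registers `x` and `y` and put the result into register `d` -/
  | op (o : Op) (d x y : ℕ)
  /-- put the memory cell whose address is in register `x` into register `d` -/
  | load (d x : ℕ)
  /-- put register `y` into the memory cell whose address is in register `x` -/
  | store (x y : ℕ)
  /-- run `p`, then `q` -/
  | seq (p q : Prog)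
  /-- run `p` if register `x` is nonzero, and `q` otherwise -/
  | ite (x : ℕ) (p q : Prog)
  /-- run `p` as long as register `x` is nonzero -/
  | loop (x : ℕ) (p : Prog)

/-- `Exec w p s t s'`: on a machine with `w`-bit words, `p` started in state `s` halts in
state `s'` after exactly `t` steps. Every instruction and every test of a branch or of a loop is
one step. -/
inductive Exec (w : ℕ) : Prog → State → ℕ → State → Prop
  | skip (s : State) : Exec w .skip s 1 s
  | const (d v : ℕ) (s : State) :
      Exec w (.const d v) s 1 ⟨Function.update s.reg d (v % 2 ^ w), s.mem⟩
  | copy (d x : ℕ) (s : State) :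
      Exec w (.copy d x) s 1 ⟨Function.update s.reg d (s.reg x), s.mem⟩
  | op (o : Op) (d x y : ℕ) (s : State) :
      Exec w (.op o d x y) s 1
        ⟨Function.update s.reg d (o.eval w (s.reg x) (s.reg y)), s.mem⟩
  | load (d x : ℕ) (s : State) :
      Exec w (.load d x) s 1 ⟨Function.update s.reg d (s.mem (s.reg x)), s.mem⟩
  | store (x y : ℕ) (s : State) :
      Exec w (.store x y) s 1 ⟨s.reg, Function.update s.mem (s.reg x) (s.reg y)⟩
  | seq {p q : Prog} {s s₁ s₂ : State} {t₁ t₂ : ℕ} :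
      Exec w p s t₁ s₁ → Exec w q s₁ t₂ s₂ → Exec w (.seq p q) s (t₁ + t₂) s₂
  | ite_true {x : ℕ} {p q : Prog} {s s' : State} {t : ℕ} :
      s.reg x ≠ 0 → Exec w p s t s' → Exec w (.ite x p q) s (t + 1) s'
  | ite_false {x : ℕ} {p q : Prog} {s s' : State} {t : ℕ} :
      s.reg x = 0 → Exec w q s t s' → Exec w (.ite x p q) s (t + 1) s'
  | loop_stop {x : ℕ} {p : Prog} {s : State} :
      s.reg x = 0 → Exec w (.loop x p) s 1 s
  | loop_step {x : ℕ} {p : Prog} {s s₁ s₂ : State} {t₁ t₂ : ℕ} :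
      s.reg x ≠ 0 → Exec w p s t₁ s₁ → Exec w (.loop x p) s₁ t₂ s₂ →
        Exec w (.loop x p) s (t₁ + t₂ + 1) s₂

/-- The machine is deterministic: the final state and the number of steps are determined by the
program and the initial state. -/
theorem Exec.deterministic {w : ℕ} {p : Prog} {s s₁ s₂ : State} {t₁ t₂ : ℕ}
    (h₁ : Exec w p s t₁ s₁) (h₂ : Exec w p s t₂ s₂) : t₁ = t₂ ∧ s₁ = s₂ := by
  induction h₁ generalizing t₂ s₂ with
  | skip | const | copy | op | load | store => cases h₂; exact ⟨rfl, rfl⟩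
  | seq _ _ ih₁ ih₂ =>
    cases h₂ with
    | seq a b =>
      obtain ⟨rfl, rfl⟩ := ih₁ a
      obtain ⟨rfl, rfl⟩ := ih₂ b
      exact ⟨rfl, rfl⟩
  | ite_true hx _ ih =>
    cases h₂ with
    | ite_true _ a => obtain ⟨rfl, rfl⟩ := ih a; exact ⟨rfl, rfl⟩
    | ite_false hx' _ => exact absurd hx' hx
  | ite_false hx _ ih =>
    cases h₂ with
    | ite_true hx' _ => exact absurd hx hx'
    | ite_false _ a => obtain ⟨rfl, rfl⟩ := ih a; exact ⟨rfl, rfl⟩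
  | loop_stop hx =>
    cases h₂ with
    | loop_stop => exact ⟨rfl, rfl⟩
    | loop_step hx' _ _ => exact absurd hx hx'
  | loop_step hx _ _ ih₁ ih₂ =>
    cases h₂ with
    | loop_stop hx' => exact absurd hx' hx
    | loop_step _ a b =>
      obtain ⟨rfl, rfl⟩ := ih₁ a
      obtain ⟨rfl, rfl⟩ := ih₂ b
      exact ⟨rfl, rfl⟩

/-- All registers and all memory cells are zero. -/
def State.zero : State := ⟨fun _ => 0, fun _ => 0⟩

/-- Put the value `v` into register `d`. -/
def State.setReg (s : State) (d v : ℕ) : State := ⟨Function.update s.reg d v, s.mem⟩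

/-- Write the list `l` into the consecutive memory cells that begin at address `base`. -/
def State.write (s : State) (base : ℕ) (l : List ℕ) : State :=
  ⟨s.reg, fun i => if base ≤ i ∧ i < base + l.length then l.getD (i - base) 0 else s.mem i⟩

/-- The `w`-bit two's complement representation of an integer. -/
def ofInt (w : ℕ) (c : ℤ) : ℕ := (c % 2 ^ w).toNat

end WordRAM

namespace ThreeSum

open WordRAM

/-- `l` lists, without repetition and in any order, a set of `n` integers in
`{0, 1, …, n ^ k - 1}`. -/
def IsUniverse (n k : ℕ) (l : List ℕ) : Prop :=
  l.Nodup ∧ l.length = n ∧ ∀ a ∈ l, a < n ^ k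

/-- The three sets of a query, each given as a list of its elements. -/
structure Query where
  A' : List ℕ
  B' : List ℕ
  C' : List ℤ

/-- `A'` is a subset of `A`, `B'` is a subset of `B`, and `C'` is a set of `n` integers, arbitrary
except that each fits into a signed `w`-bit word; the lists have no repetition, and may be in
any order. -/
def Query.Valid (w n : ℕ) (A B : List ℕ) (q : Query) : Prop :=
  (q.A'.Nodup ∧ q.A' ⊆ A) ∧ (q.B'.Nodup ∧ q.B' ⊆ B) ∧
    (q.C'.Nodup ∧ q.C'.length = n ∧ ∀ c ∈ q.C', -(2 : ℤ) ^ w ≤ 2 * c ∧ 2 * c < 2 ^ w)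

/-- The state in which the preprocessing starts: `n` is in register `0`, the arrays `A` and `B` are
at the addresses `0` and `n`, and everything else is zero. -/
def start (n : ℕ) (A B : List ℕ) : State :=
  ((State.zero.setReg 0 n).write 0 A).write n B

/-- The arrival of a query: `n`, `|A'|`, `|B'|` are put into the registers `0`, `1`, `2`, and the
arrays `A'`, `B'`, `C'` at the addresses `2 n`, `3 n`, `4 n`; nothing else changes. -/
def Query.arrive (w n : ℕ) (q : Query) (s : State) : State :=
  ((((((s.setReg 0 n).setReg 1 q.A'.length).setReg 2 q.B'.length).write (2 * n) q.A').write
    (3 * n) q.B').write (4 * n) (q.C'.map (ofInt w)))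

/-- The answers to the query are in the `n` cells from address `5 n` on: for the `j`-th element `c`
of `C'`, the `j`-th of them is `1` if `c = a + b` for some `a ∈ A'`, `b ∈ B'`, and `0` if not. -/
def Query.Answered (n : ℕ) (q : Query) (s : State) : Prop :=
  ∀ (j : ℕ) (hj : j < q.C'.length),
    ((∃ a ∈ q.A', ∃ b ∈ q.B', (a : ℤ) + (b : ℤ) = q.C'[j]) → s.mem (5 * n + j) = 1) ∧
    ((¬ ∃ a ∈ q.A', ∃ b ∈ q.B', (a : ℤ) + (b : ℤ) = q.C'[j]) → s.mem (5 * n + j) = 0)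

/-- The states in which the data structure waits for a query: the one in which the preprocessing
halts, and those in which it is after any finite number of queries. -/
inductive Ready (w : ℕ) (pre query : Prog) (n : ℕ) (A B : List ℕ) : State → Prop
  | preprocessed {t : ℕ} {s : State} :
      Exec w pre (start n A B) t s → Ready w pre query n A B s
  | queried {s s' : State} {t : ℕ} {q : Query} :
      Ready w pre query n A B s → q.Valid w n A B → Exec w query (q.arrive w n s) t s' →
        Ready w pre query n A B s'

end ThreeSum

set_option linter.constructorNameAsVariable false
set_option linter.unusedSimpArgs false
set_option linter.unusedVariables false

/-!
# A structured language over the word RAM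

Named variables live in registers, named arrays are interleaved in the memory, and expressions are
evaluated over the natural numbers under the side condition that nothing overflows.
-/

namespace WordRAM

/-! Tabulate all n² sums a + b with a in A and b in B. A sum attained by at most √n pairs is
harmless: a query c of this kind is answered by walking through its pairs and testing them for
membership in A' and B'. The sums attained more often are popular. Their fibres are disjoint, so
there are at most about n^(3/2) of them (`length_popList_mul_le`).

For popular sums, work modulo some m of size at most about n^(3/2). One convolution of the
histograms of A' and B' modulo m counts, for every residue at once, the pairs of A' × B' with sum in
that residue class. For a given c the count is too large by the pairs whose sum is congruent but not
equal to c. If only few pairs of A × B collide with c in this way, they can be enumerated from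
buckets built in the preprocessing; c is a sum of the subsets exactly if the convolution exceeds the
number of collisions inside A' × B' (`wp_check`).

Suitable moduli exist because a nonzero difference below 2^Λ has at most Λ prime divisors: when a
prime q ≤ X is appended to m, the number of collisions drops on average by the factor Λ / π(X)
(`exists_totalColl_le`). Four factors with X about n^(3/8) leave about √n collisions per popular
sum, up to logarithms (`wp_select`). By Markov's inequality (`length_filter_le`) at least half of
the remaining popular sums have at most twice the average. These are labelled with the modulus, the
others enter the next round, and O(log n) rounds leave none. The search is deterministic: the number
of collisions is read off exactly from a convolution (`pairCount_eq_add`), and the best factor is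
taken greedily. Building m from four small factors is what makes this affordable, since only 4X
convolutions of length O(X⁴) are needed per round, which is n^(15/8) up to logarithms and hence
O(n²).

The convolution takes place in (ℤ/2^w)[x]/(x^N + 1). With y = x^M and N = L M one has y^L = -1, so
powers of y serve as roots of unity and multiplication by them is a shift with a change of sign. A
Fourier transform over these roots (`partialDFT_succ`, `negMul_transform`) reduces length N to
lengths about √N, and recursion does the rest. Since 2 is not a unit modulo 2^w, the inverse
transform keeps a known power of two as a factor; the true result times this power is less than 2^w,
so an exact division removes it at the end (`wp_mulCmd`).

The programs are compiled from a small structured language (`HExec.sim`), and correctness and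
running time are proved together by a calculus of weakest preconditions with a clock. All quantities
are less than V = n^(k+30), and all overflow conditions reduce to bounds on the degree of an
expression, because V^14 ≤ 2^w (`Ex.bd.ok_lt`). The initial memory is zero and long enough for a sum
to be used directly as an array index, so no hashing is needed. -/

/-- The variables of the structured language. -/
inductive Var
  | n | la | lb
  | top | pop | X | x | u | N | J | m | q | best | bq | phi | stage | p | s | r
  | mm | oA | oB | lA | lB
  | pw | ui | L | M | Z | h | dv | i | k | l | o | g | b | e | t
  | j | c | acc | ans | y | z | d
  deriving DecidableEq

/-- The arrays of the structured language; `raw` is the input and output area. -/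
inductive Arr
  | raw | head | nxt | cnt | popular | label | moduli | bhead | bnxt | flagA | flagB | work | temp
  deriving DecidableEq

/-- The number of interleaved arrays. -/
def numArr : ℕ := 16

/-- The first register that holds intermediate results. -/
def firstTemp : ℕ := 64

theorem Var.ctorIdx_lt (x : Var) : x.ctorIdx < firstTemp := by
  cases x <;> decide

theorem Var.ctorIdx_inj {x y : Var} (h : x.ctorIdx = y.ctorIdx) : x = y := by
  rw [← Var.ofNat_ctorIdx x, h, Var.ofNat_ctorIdx]

theorem Arr.ctorIdx_lt (x : Arr) : x.ctorIdx < numArr := by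
  cases x <;> decide

theorem Arr.ctorIdx_inj {x y : Arr} (h : x.ctorIdx = y.ctorIdx) : x = y := by
  rw [← Arr.ofNat_ctorIdx x, h, Arr.ofNat_ctorIdx]

/-- The values of the variables and of the arrays. -/
structure Store where
  v : Var → ℕ
  a : Arr → ℕ → ℕ

/-- Assign a value to a variable. -/
def Store.set (σ : Store) (x : Var) (z : ℕ) : Store := ⟨Function.update σ.v x z, σ.a⟩

/-- Assign a value to an array entry. -/
def Store.put (σ : Store) (a : Arr) (i z : ℕ) : Store :=
  ⟨σ.v, Function.update σ.a a (Function.update (σ.a a) i z)⟩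

@[simp] theorem Store.set_v (σ : Store) (x y : Var) (z : ℕ) :
    (σ.set x z).v y = if y = x then z else σ.v y := by
  simp [Store.set, Function.update_apply]

@[simp] theorem Store.set_a (σ : Store) (x : Var) (z : ℕ) : (σ.set x z).a = σ.a := rfl

@[simp] theorem Store.put_v (σ : Store) (a : Arr) (i z : ℕ) : (σ.put a i z).v = σ.v := rfl

@[simp] theorem Store.put_a (σ : Store) (a b : Arr) (i z : ℕ) :
    (σ.put a i z).a b = if b = a then Function.update (σ.a a) i z else σ.a b := by
  by_cases h : b = a
  · subst h; simp [Store.put]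
  · simp [Store.put, h]

/-- Binary operations of the structured language; the operations with suffix `W` wrap around. -/
inductive BOp
  | add | sub | mul | div | mod | lt | eq | addW | subW | mulW | shl

/-- The machine operation behind an operation of the structured language. -/
def BOp.toOp : BOp → Op
  | .add => .add | .sub => .sub | .mul => .mul | .div => .div | .mod => .mod | .lt => .lt
  | .eq => .eq | .addW => .add | .subW => .sub | .mulW => .mul | .shl => .shl

/-- The value of an operation. -/
def BOp.eval (w : ℕ) : BOp → ℕ → ℕ → ℕ
  | .add, x, y => x + y
  | .sub, x, y => x - y
  | .mul, x, y => x * y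
  | .div, x, y => x / y
  | .mod, x, y => x % y
  | .lt, x, y => if x < y then 1 else 0
  | .eq, x, y => if x = y then 1 else 0
  | .addW, x, y => (x + y) % 2 ^ w
  | .subW, x, y => (x + 2 ^ w - y) % 2 ^ w
  | .mulW, x, y => (x * y) % 2 ^ w
  | .shl, x, y => x * 2 ^ y

/-- The side condition under which the machine computes the value of an operation. -/
def BOp.ok (w : ℕ) : BOp → ℕ → ℕ → Prop
  | .add, x, y => x + y < 2 ^ w
  | .sub, x, y => y ≤ x ∧ x < 2 ^ w
  | .mul, x, y => x * y < 2 ^ w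
  | .div, _, _ => True
  | .mod, _, _ => True
  | .lt, _, _ => 1 < 2 ^ w
  | .eq, _, _ => 1 < 2 ^ w
  | .addW, _, _ => True
  | .subW, _, _ => True
  | .mulW, _, _ => True
  | .shl, x, y => x * 2 ^ y < 2 ^ w

/-- The side condition rules out every wrap-around, so the reductions modulo 2^w disappear; for
subtraction the added 2^w is the only multiple that is removed. -/
theorem BOp.eval_toOp {w : ℕ} {o : BOp} {x y : ℕ} (h : o.ok w x y) :
    o.toOp.eval w x y = o.eval w x y := by
  cases o <;> simp only [BOp.ok] at h <;> simp only [BOp.toOp, Op.eval, BOp.eval]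
  · exact Nat.mod_eq_of_lt h
  · rw [show x + 2 ^ w - y = (x - y) + 2 ^ w by omega, Nat.add_mod_right]
    exact Nat.mod_eq_of_lt (by omega)
  · exact Nat.mod_eq_of_lt h
  · rw [Nat.mod_eq_of_lt h]
  · rw [Nat.mod_eq_of_lt h]
  · rw [Nat.shiftLeft_eq]; exact Nat.mod_eq_of_lt h

/-- Expressions. -/
inductive Ex
  | c (k : ℕ)
  | v (x : Var)
  | rd (a : Arr) (i : Ex)
  | bin (o : BOp) (x y : Ex)

instance : Coe Var Ex := ⟨Ex.v⟩
instance : Add Ex := ⟨Ex.bin .add⟩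
instance : Sub Ex := ⟨Ex.bin .sub⟩
instance : Mul Ex := ⟨Ex.bin .mul⟩
instance : Div Ex := ⟨Ex.bin .div⟩
instance : Mod Ex := ⟨Ex.bin .mod⟩

/-- The value of an expression. -/
def Ex.ev (w : ℕ) (σ : Store) : Ex → ℕ
  | .c k => k
  | .v x => σ.v x
  | .rd a i => σ.a a (i.ev w σ)
  | .bin o x y => o.eval w (x.ev w σ) (y.ev w σ)

/-- The array entry `a i` lies in the addressable memory. -/
def okAddr (w n : ℕ) (a : Arr) (i : ℕ) : Prop :=
  if a = .raw then i < 6 * n else i * numArr + 6 * n + numArr < 2 ^ w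

/-- No operation in the expression overflows, and every access is within bounds. -/
def Ex.ok (w : ℕ) (σ : Store) : Ex → Prop
  | .c k => k < 2 ^ w
  | .v _ => True
  | .rd a i => i.ok w σ ∧ okAddr w (σ.v .n) a (i.ev w σ)
  | .bin o x y => x.ok w σ ∧ y.ok w σ ∧ o.ok w (x.ev w σ) (y.ev w σ)

/-- The cost of computing an address from an index. -/
def addrCost (a : Arr) : ℕ := if a = .raw then 0 else 7

/-- The number of steps that the evaluation of an expression takes. -/
def Ex.cost : Ex → ℕ
  | .c _ => 1
  | .v _ => 1
  | .rd a i => i.cost + addrCost a + 1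
  | .bin _ x y => x.cost + y.cost + 1

/-! ### Values, costs and degrees of expressions. -/

section simps

variable (w : ℕ) (σ : Store) (k : ℕ) (z : Var) (a : Arr) (x y : Ex)

@[simp] theorem Ex.ev_c : (Ex.c k).ev w σ = k := rfl
@[simp] theorem Ex.ev_v : (Ex.v z).ev w σ = σ.v z := rfl
@[simp] theorem Ex.ev_rd : (Ex.rd a x).ev w σ = σ.a a (x.ev w σ) := rfl
@[simp] theorem Ex.ev_add : (x + y).ev w σ = x.ev w σ + y.ev w σ := rfl
@[simp] theorem Ex.ev_sub : (x - y).ev w σ = x.ev w σ - y.ev w σ := rfl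
@[simp] theorem Ex.ev_mul : (x * y).ev w σ = x.ev w σ * y.ev w σ := rfl
@[simp] theorem Ex.ev_div : (x / y).ev w σ = x.ev w σ / y.ev w σ := rfl
@[simp] theorem Ex.ev_mod : (x % y).ev w σ = x.ev w σ % y.ev w σ := rfl
@[simp] theorem Ex.ev_lt :
    (Ex.bin .lt x y).ev w σ = if x.ev w σ < y.ev w σ then 1 else 0 := rfl
@[simp] theorem Ex.ev_eq :
    (Ex.bin .eq x y).ev w σ = if x.ev w σ = y.ev w σ then 1 else 0 := rfl
@[simp] theorem Ex.ev_addW :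
    (Ex.bin .addW x y).ev w σ = (x.ev w σ + y.ev w σ) % 2 ^ w := rfl
@[simp] theorem Ex.ev_subW :
    (Ex.bin .subW x y).ev w σ = (x.ev w σ + 2 ^ w - y.ev w σ) % 2 ^ w := rfl
@[simp] theorem Ex.ev_mulW :
    (Ex.bin .mulW x y).ev w σ = (x.ev w σ * y.ev w σ) % 2 ^ w := rfl
@[simp] theorem Ex.ev_shl : (Ex.bin .shl x y).ev w σ = x.ev w σ * 2 ^ y.ev w σ := rfl

@[simp] theorem Ex.cost_c : (Ex.c k).cost = 1 := rfl
@[simp] theorem Ex.cost_v : (Ex.v z).cost = 1 := rfl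
@[simp] theorem Ex.cost_rd : (Ex.rd a x).cost = x.cost + addrCost a + 1 := rfl
@[simp] theorem Ex.cost_add : (x + y).cost = x.cost + y.cost + 1 := rfl
@[simp] theorem Ex.cost_sub : (x - y).cost = x.cost + y.cost + 1 := rfl
@[simp] theorem Ex.cost_mul : (x * y).cost = x.cost + y.cost + 1 := rfl
@[simp] theorem Ex.cost_div : (x / y).cost = x.cost + y.cost + 1 := rfl
@[simp] theorem Ex.cost_mod : (x % y).cost = x.cost + y.cost + 1 := rfl
@[simp] theorem Ex.cost_bin (o : BOp) : (Ex.bin o x y).cost = x.cost + y.cost + 1 := rfl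

theorem addrCost_le : addrCost a ≤ 7 := by unfold addrCost; split_ifs <;> omega

/-- A bound on the degree of an expression, seen as a polynomial in its variables. -/
def Ex.deg : Ex → ℕ
  | .c _ => 1
  | .v _ => 1
  | .rd _ i => max 1 i.deg
  | .bin .add x y => x.deg + y.deg
  | .bin .mul x y => x.deg + y.deg
  | .bin _ x y => max 1 (max x.deg y.deg)

/-- All variables and array entries that occur in the expression are less than `V`. -/
def Ex.bd (w V : ℕ) (σ : Store) : Ex → Prop
  | .c k => k < V
  | .v x => σ.v x < V
  | .rd a i => i.bd w V σ ∧ (a = .raw → i.ev w σ < 6 * σ.v .n) ∧ σ.a a (i.ev w σ) < V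
  | .bin .add x y => x.bd w V σ ∧ y.bd w V σ
  | .bin .sub x y => x.bd w V σ ∧ y.bd w V σ ∧ y.ev w σ ≤ x.ev w σ
  | .bin .mul x y => x.bd w V σ ∧ y.bd w V σ
  | .bin .div x y => x.bd w V σ ∧ y.bd w V σ
  | .bin .mod x y => x.bd w V σ ∧ y.bd w V σ
  | .bin .lt x y => x.bd w V σ ∧ y.bd w V σ
  | .bin .eq x y => x.bd w V σ ∧ y.bd w V σ
  | .bin .shl x y => x.bd w V σ ∧ y.bd w V σ ∧ x.ev w σ * 2 ^ y.ev w σ < V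
  | .bin _ _ _ => False

variable (V : ℕ)

@[simp] theorem Ex.bd_c : (Ex.c k).bd w V σ ↔ k < V := .rfl
@[simp] theorem Ex.bd_v : (Ex.v z).bd w V σ ↔ σ.v z < V := .rfl
@[simp] theorem Ex.bd_rd : (Ex.rd a x).bd w V σ ↔
    x.bd w V σ ∧ (a = .raw → x.ev w σ < 6 * σ.v .n) ∧ σ.a a (x.ev w σ) < V := .rfl
@[simp] theorem Ex.bd_add : (x + y).bd w V σ ↔ x.bd w V σ ∧ y.bd w V σ := .rfl
@[simp] theorem Ex.bd_sub :
    (x - y).bd w V σ ↔ x.bd w V σ ∧ y.bd w V σ ∧ y.ev w σ ≤ x.ev w σ := .rfl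
@[simp] theorem Ex.bd_mul : (x * y).bd w V σ ↔ x.bd w V σ ∧ y.bd w V σ := .rfl
@[simp] theorem Ex.bd_div : (x / y).bd w V σ ↔ x.bd w V σ ∧ y.bd w V σ := .rfl
@[simp] theorem Ex.bd_mod : (x % y).bd w V σ ↔ x.bd w V σ ∧ y.bd w V σ := .rfl
@[simp] theorem Ex.bd_lt : (Ex.bin .lt x y).bd w V σ ↔ x.bd w V σ ∧ y.bd w V σ := .rfl
@[simp] theorem Ex.bd_eq : (Ex.bin .eq x y).bd w V σ ↔ x.bd w V σ ∧ y.bd w V σ := .rfl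
@[simp] theorem Ex.bd_shl : (Ex.bin .shl x y).bd w V σ ↔
    x.bd w V σ ∧ y.bd w V σ ∧ x.ev w σ * 2 ^ y.ev w σ < V := .rfl

end simps

theorem Ex.deg_pos (e : Ex) : 1 ≤ e.deg := by
  induction e with
  | c => simp [deg]
  | v => simp [deg]
  | rd => simp [deg]
  | bin o x y => cases o <;> simp only [deg] <;> omega

/-- The words are long enough for polynomials of degree `14` in numbers less than `V`. -/
structure Fits (w n V : ℕ) : Prop where
  pow : V ^ 14 ≤ 2 ^ w
  six : 6 * n < V
  num : numArr < V

section Fits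

variable {w n V : ℕ} (hV : Fits w n V)
include hV

theorem Fits.two_le : 2 ≤ V := by have := hV.num; simp only [numArr] at this; omega

theorem Fits.pow_le {d : ℕ} (hd : d ≤ 14) : V ^ d ≤ 2 ^ w :=
  (Nat.pow_le_pow_right (by have := hV.two_le; omega) hd).trans hV.pow

theorem Fits.lt {x : ℕ} (hx : x < V) : x < 2 ^ w :=
  hx.trans_le (by simpa using hV.pow_le (d := 1) (by norm_num))

theorem Fits.one_lt : 1 < 2 ^ w := hV.lt hV.two_le

theorem Fits.pow_mono {a b : ℕ} (hab : a ≤ b) : V ^ a ≤ V ^ b :=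
  Nat.pow_le_pow_right (by have := hV.two_le; omega) hab

/-- Both powers are at least 2, so their sum is at most their product. This is why a sum may be
charged the same degree as a product. -/
theorem Fits.add_le {a b : ℕ} (ha : 1 ≤ a) (hb : 1 ≤ b) : V ^ a + V ^ b ≤ V ^ (a + b) := by
  have h2 := hV.two_le
  have h3 : 2 ≤ V ^ a := h2.trans (by simpa using hV.pow_mono ha)
  have h4 : 2 ≤ V ^ b := h2.trans (by simpa using hV.pow_mono hb)
  rw [pow_add]
  nlinarith

/-- Turning an index into an address multiplies once and adds twice by numbers below V, which costs
three degrees. This is the gap between the bound 11 for expressions and the exponent 14 of the word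
length. -/
theorem Fits.okAddr {a : Arr} {i d : ℕ} (hd : d + 3 ≤ 14) (hd1 : 1 ≤ d) (hi : i < V ^ d)
    (hr : a = .raw → i < 6 * n) : okAddr w n a i := by
  unfold WordRAM.okAddr
  split_ifs with h
  · exact hr h
  · refine lt_of_lt_of_le ?_ (hV.pow_le hd)
    have h1 : V ^ (d + 1) + V ^ 1 ≤ V ^ (d + 1 + 1) := hV.add_le (by omega) le_rfl
    have h2 : V ^ (d + 2) + V ^ 1 ≤ V ^ (d + 2 + 1) := hV.add_le (by omega) le_rfl
    have h3 : i * numArr < V ^ (d + 1) := by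
      rw [pow_succ]; exact Nat.mul_lt_mul'' hi hV.num
    have := hV.six
    have := hV.num
    rw [pow_one] at h1 h2
    rw [show d + 1 + 1 = d + 2 by ring] at h1
    rw [show d + 2 + 1 = d + 3 by ring] at h2
    omega

/-- Absence of overflow and the bound by a power of V are proved in one induction, since the side
condition of an operation needs the bounds for its operands. Only sums and products raise the
degree; a value that is read from an array or produced by a shift is below V by assumption. -/
theorem Ex.bd.ok_lt {σ : Store} (hn : σ.v .n = n) {e : Ex} (he : e.bd w V σ)
    (hd : e.deg ≤ 11) : e.ok w σ ∧ e.ev w σ < V ^ e.deg := by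
  have one : ∀ {x d : ℕ}, x < V → 1 ≤ d → x < V ^ d := fun h h' =>
    h.trans_le (by simpa using hV.pow_mono h')
  induction e with
  | c k => exact ⟨hV.lt he, one he le_rfl⟩
  | v x => exact ⟨trivial, one he le_rfl⟩
  | rd a i ih =>
    simp only [deg] at hd ⊢
    obtain ⟨h₁, h₂⟩ := ih he.1 (by omega)
    refine ⟨⟨h₁, ?_⟩, one he.2.2 (by omega)⟩
    rw [hn]
    exact hV.okAddr (by omega) (Ex.deg_pos i) h₂ (by simpa [hn] using he.2.1)
  | bin o x y ihx ihy =>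
    have hx := Ex.deg_pos x
    have hy := Ex.deg_pos y
    cases o
    case add =>
      simp only [deg] at hd ⊢
      obtain ⟨h₁, h₂⟩ := ihx he.1 (by omega)
      obtain ⟨h₃, h₄⟩ := ihy he.2 (by omega)
      have h₅ : x.ev w σ + y.ev w σ < V ^ (x.deg + y.deg) :=
        (add_lt_add h₂ h₄).trans_le (hV.add_le hx hy)
      exact ⟨⟨h₁, h₃, h₅.trans_le (hV.pow_le (by omega))⟩, h₅⟩
    case mul =>
      simp only [deg] at hd ⊢
      obtain ⟨h₁, h₂⟩ := ihx he.1 (by omega)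
      obtain ⟨h₃, h₄⟩ := ihy he.2 (by omega)
      have h₅ : x.ev w σ * y.ev w σ < V ^ (x.deg + y.deg) := by
        rw [pow_add]; exact Nat.mul_lt_mul'' h₂ h₄
      exact ⟨⟨h₁, h₃, h₅.trans_le (hV.pow_le (by omega))⟩, h₅⟩
    case addW => exact he.elim
    case subW => exact he.elim
    case mulW => exact he.elim
    case sub =>
      simp only [deg] at hd ⊢
      obtain ⟨h₁, h₂⟩ := ihx he.1 (by omega)
      obtain ⟨h₃, h₄⟩ := ihy he.2.1 (by omega)
      have h₅ : x.ev w σ < V ^ max 1 (max x.deg y.deg) := h₂.trans_le (hV.pow_mono (by omega))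
      exact ⟨⟨h₁, h₃, he.2.2, h₅.trans_le (hV.pow_le (by omega))⟩, (Nat.sub_le _ _).trans_lt h₅⟩
    case shl =>
      simp only [deg] at hd ⊢
      obtain ⟨h₁, h₂⟩ := ihx he.1 (by omega)
      obtain ⟨h₃, h₄⟩ := ihy he.2.1 (by omega)
      exact ⟨⟨h₁, h₃, hV.lt he.2.2⟩, one he.2.2 (by omega)⟩
    all_goals
      simp only [deg] at hd ⊢
      obtain ⟨h₁, h₂⟩ := ihx he.1 (by omega)
      obtain ⟨h₃, h₄⟩ := ihy he.2 (by omega)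
      have h₅ : x.ev w σ < V ^ max 1 (max x.deg y.deg) := h₂.trans_le (hV.pow_mono (by omega))
      have h₆ : ∀ p : Prop, [Decidable p] →
          (if p then 1 else 0) < V ^ max 1 (max x.deg y.deg) := fun p _ =>
        one (lt_of_le_of_lt (by split_ifs <;> omega) (show 1 < V from hV.two_le)) (by omega)
    · exact ⟨⟨h₁, h₃, trivial⟩, (Nat.div_le_self _ _).trans_lt h₅⟩
    · exact ⟨⟨h₁, h₃, trivial⟩, (Nat.mod_le _ _).trans_lt h₅⟩
    · exact ⟨⟨h₁, h₃, hV.one_lt⟩, h₆ _⟩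
    · exact ⟨⟨h₁, h₃, hV.one_lt⟩, h₆ _⟩

theorem Ex.bd.ok {σ : Store} (hn : σ.v .n = n) {e : Ex} (he : e.bd w V σ)
    (hd : e.deg ≤ 11) : e.ok w σ := (Ex.bd.ok_lt hV hn he hd).1

theorem Ex.bd.okAddr {σ : Store} (hn : σ.v .n = n) {e : Ex} (he : e.bd w V σ)
    (hd : e.deg ≤ 11) {a : Arr} (ha : a = .raw → e.ev w σ < 6 * n) :
    WordRAM.okAddr w (σ.v .n) a (e.ev w σ) := by
  rw [hn]
  exact hV.okAddr (by omega) (Ex.deg_pos e) (Ex.bd.ok_lt hV hn he hd).2 ha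

end Fits

/-! ### Memory layout and compilation of expressions. -/

/-- The memory cell of an array entry. -/
def addr (n : ℕ) (a : Arr) (i : ℕ) : ℕ :=
  if a = .raw then i else i * numArr + 6 * n + a.ctorIdx

/-- Turn the index in register `d` into an address. -/
def compAddr (a : Arr) (d : ℕ) : Prog :=
  if a = .raw then .skip else
    .seq (.const (d + 1) numArr) <| .seq (.op .mul d d (d + 1)) <|
    .seq (.const (d + 1) 6) <| .seq (.op .mul (d + 1) (d + 1) 0) <|
    .seq (.op .add d d (d + 1)) <| .seq (.const (d + 1) a.ctorIdx) (.op .add d d (d + 1))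

/-- Evaluate an expression into register `d`, using only the registers from `d` on. -/
def Ex.comp : Ex → ℕ → Prog
  | .c k, d => .const d k
  | .v x, d => .copy d x.ctorIdx
  | .rd a i, d =>
    if a = .raw then .seq (i.comp d) (.load d d)
    else .seq (i.comp d) (.seq (compAddr a d) (.load d d))
  | .bin o x y, d => .seq (x.comp d) (.seq (y.comp (d + 1)) (.op o.toOp d d (d + 1)))

/-- The machine state represents the store. -/
structure Sim (s : State) (σ : Store) : Prop where
  reg : ∀ x : Var, s.reg x.ctorIdx = σ.v x
  mem : ∀ a i, (a = Arr.raw → i < 6 * σ.v .n) → s.mem (addr (σ.v .n) a i) = σ.a a i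

/-- The input and output area occupies the cells below 6n. Above it, the distance from 6n determines
the array by its remainder modulo `numArr` and the index by its quotient. -/
theorem addr_inj {n : ℕ} {a b : Arr} {i j : ℕ} (hi : a = Arr.raw → i < 6 * n)
    (hj : b = Arr.raw → j < 6 * n) (h : addr n a i = addr n b j) : a = b ∧ i = j := by
  have ha := a.ctorIdx_lt
  have hb := b.ctorIdx_lt
  unfold addr at h
  simp only [numArr] at *
  split_ifs at h with h1 h2 h2
  · exact ⟨h1.trans h2.symm, h⟩
  · have := hi h1; omega
  · have := hj h2; omega
  · have h3 : a.ctorIdx = b.ctorIdx := by omega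
    exact ⟨Arr.ctorIdx_inj h3, by omega⟩

/-- Two machine states agree except on the registers from `d` on. -/
def EqBelow (d : ℕ) (s s' : State) : Prop := (∀ r < d, s'.reg r = s.reg r) ∧ s'.mem = s.mem

theorem EqBelow.sim {d : ℕ} {s s' : State} {σ : Store} (h : EqBelow d s s')
    (hd : firstTemp ≤ d) (hs : Sim s σ) : Sim s' σ :=
  ⟨fun x => by rw [h.1 _ (lt_of_lt_of_le x.ctorIdx_lt hd), hs.reg],
    fun a i hi => by rw [h.2]; exact hs.mem a i hi⟩

theorem exec_compAddr {w : ℕ} {s : State} {σ : Store} (hs : Sim s σ) {a : Arr} {d i : ℕ}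
    (ha : a ≠ .raw) (hd : firstTemp ≤ d) (hi : s.reg d = i) (hok : okAddr w (σ.v .n) a i) :
    ∃ s', Exec w (compAddr a d) s 7 s' ∧ EqBelow d s s' ∧
      s'.reg d = addr (σ.v .n) a i := by
  have h0 : s.reg 0 = σ.v .n := hs.reg .n
  have hal := a.ctorIdx_lt
  simp only [okAddr, ha, if_false] at hok
  simp only [compAddr, ha, if_false, addr]
  have hd0 : d ≠ 0 := by simp only [firstTemp] at hd; omega
  refine ⟨_, .seq (.const _ _ _) (.seq (.op _ _ _ _ _) (.seq (.const _ _ _) (.seq (.op _ _ _ _ _)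
    (.seq (.op _ _ _ _ _) (.seq (.const _ _ _) (.op _ _ _ _ _)))))), ⟨?_, rfl⟩, ?_⟩
  · intro r hr
    simp [Function.update_apply, hr.ne, (show r ≠ d + 1 by omega)]
  · have h1 : numArr % 2 ^ w = numArr := Nat.mod_eq_of_lt (by omega)
    have h2 : 6 % 2 ^ w = 6 := Nat.mod_eq_of_lt (by simp only [numArr] at hok; omega)
    have h3 : a.ctorIdx % 2 ^ w = a.ctorIdx := Nat.mod_eq_of_lt (by omega)
    have h4 : i * numArr % 2 ^ w = i * numArr := Nat.mod_eq_of_lt (by omega)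
    have h5 : 6 * σ.v .n % 2 ^ w = 6 * σ.v .n := Nat.mod_eq_of_lt (by omega)
    have h6 : (i * numArr + 6 * σ.v .n) % 2 ^ w = i * numArr + 6 * σ.v .n :=
      Nat.mod_eq_of_lt (by omega)
    have h7 : (i * numArr + 6 * σ.v .n + a.ctorIdx) % 2 ^ w
        = i * numArr + 6 * σ.v .n + a.ctorIdx := Nat.mod_eq_of_lt (by omega)
    simp [Function.update_apply, Op.eval, hi, h0, h1, h2, h3, h4, h5, h6, h7, hd0.symm]

/-- Registers from d on act as a stack: the left operand rests in d while the right one is evaluated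
from d + 1 on, and `EqBelow` guarantees that it survives. -/
theorem Ex.exec_comp {w : ℕ} {σ : Store} (e : Ex) : ∀ {s : State} {d : ℕ}, Sim s σ →
    firstTemp ≤ d → e.ok w σ →
    ∃ s', Exec w (e.comp d) s e.cost s' ∧ EqBelow d s s' ∧ s'.reg d = e.ev w σ := by
  induction e with
  | c k =>
    intro s d hs hd hok
    refine ⟨_, .const _ _ _, ⟨fun r hr => ?_, rfl⟩, ?_⟩
    · simp [Function.update_apply, hr.ne]
    · simpa [Ex.ev] using Nat.mod_eq_of_lt hok
  | v x =>
    intro s d hs hd hok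
    refine ⟨_, .copy _ _ _, ⟨fun r hr => ?_, rfl⟩, ?_⟩
    · simp [Function.update_apply, hr.ne]
    · simpa [Ex.ev] using hs.reg x
  | rd a i ih =>
    intro s d hs hd hok
    obtain ⟨s₁, h₁, h₂, h₃⟩ := ih hs hd hok.1
    have hs₁ := h₂.sim hd hs
    have hok2 := hok.2
    by_cases ha : a = .raw
    · subst ha
      simp only [okAddr, if_true] at hok2
      simp only [Ex.comp, Ex.cost, addrCost, if_true, Nat.add_zero]
      refine ⟨_, .seq h₁ (.load _ _ _), ⟨fun r hr => ?_, h₂.2⟩, ?_⟩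
      · simp [Function.update_apply, hr.ne, h₂.1 r hr]
      · have := hs₁.mem .raw (i.ev w σ) (fun _ => hok2)
        simpa [Ex.ev, h₃, addr] using this
    · obtain ⟨s₂, g₁, g₂, g₃⟩ := exec_compAddr hs₁ ha hd h₃ hok2
      have hs₂ := g₂.sim hd hs₁
      simp only [Ex.comp, Ex.cost, addrCost, ha, if_false]
      rw [Nat.add_assoc]
      refine ⟨_, .seq h₁ (.seq g₁ (.load _ _ _)), ⟨fun r hr => ?_, g₂.2.trans h₂.2⟩, ?_⟩
      · simp [Function.update_apply, hr.ne, h₂.1 r hr, g₂.1 r hr]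
      · have := hs₂.mem a (i.ev w σ) (fun h => absurd h ha)
        simpa [Ex.ev, g₃] using this
  | bin o x y ihx ihy =>
    intro s d hs hd hok
    obtain ⟨s₁, h₁, h₂, h₃⟩ := ihx hs hd hok.1
    have hs₁ := h₂.sim hd hs
    obtain ⟨s₂, g₁, g₂, g₃⟩ := ihy hs₁ (hd.trans d.le_succ) hok.2.1
    rw [Ex.cost, Nat.add_assoc]
    refine ⟨_, .seq h₁ (.seq g₁ (.op _ _ _ _ _)), ⟨fun r hr => ?_, g₂.2.trans h₂.2⟩, ?_⟩
    · simp [Function.update_apply, hr.ne, h₂.1 r hr, g₂.1 r (hr.trans d.lt_succ_self)]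
    · simp [Ex.ev, g₃, g₂.1 d d.lt_succ_self, h₃, BOp.eval_toOp hok.2.2]

/-! ### Commands, their semantics and their translation. -/

/-- Commands. -/
inductive Cmd
  | skip
  | set (x : Var) (e : Ex)
  | wr (a : Arr) (i e : Ex)
  | seq (p q : Cmd)
  | ite (e : Ex) (p q : Cmd)
  | loop (e : Ex) (p : Cmd)

infix:60 " ≔ " => Cmd.set
infixr:50 " ;; " => Cmd.seq

/-- Translate a command into a program. -/
def Cmd.comp : Cmd → Prog
  | .skip => .skip
  | .set x e => .seq (e.comp firstTemp) (.copy x.ctorIdx firstTemp)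
  | .wr a i e => .seq (i.comp firstTemp) <| .seq (compAddr a firstTemp) <|
      .seq (e.comp (firstTemp + 1)) (.store firstTemp (firstTemp + 1))
  | .seq p q => .seq p.comp q.comp
  | .ite e p q => .seq (e.comp firstTemp) (.ite firstTemp p.comp q.comp)
  | .loop e p => .seq (e.comp firstTemp) (.loop firstTemp (.seq p.comp (e.comp firstTemp)))

/-- `HExec w p σ t σ'`: the command `p` started in `σ` halts in `σ'` after `t` machine steps, and
nothing overflows. -/
inductive HExec (w : ℕ) : Cmd → Store → ℕ → Store → Prop
  | skip (σ : Store) : HExec w .skip σ 1 σ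
  | set {x : Var} {e : Ex} {σ : Store} : x ≠ .n → e.ok w σ →
      HExec w (.set x e) σ (e.cost + 1) (σ.set x (e.ev w σ))
  | wr {a : Arr} {i e : Ex} {σ : Store} : i.ok w σ → okAddr w (σ.v .n) a (i.ev w σ) → e.ok w σ →
      HExec w (.wr a i e) σ (i.cost + (max 1 (addrCost a) + (e.cost + 1)))
        (σ.put a (i.ev w σ) (e.ev w σ))
  | seq {p q : Cmd} {σ σ₁ σ₂ : Store} {t₁ t₂ : ℕ} : HExec w p σ t₁ σ₁ → HExec w q σ₁ t₂ σ₂ →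
      HExec w (.seq p q) σ (t₁ + t₂) σ₂
  | ite_true {e : Ex} {p q : Cmd} {σ σ' : Store} {t : ℕ} : e.ok w σ → e.ev w σ ≠ 0 →
      HExec w p σ t σ' → HExec w (.ite e p q) σ (e.cost + (t + 1)) σ'
  | ite_false {e : Ex} {p q : Cmd} {σ σ' : Store} {t : ℕ} : e.ok w σ → e.ev w σ = 0 →
      HExec w q σ t σ' → HExec w (.ite e p q) σ (e.cost + (t + 1)) σ'
  | loop_exit {e : Ex} {p : Cmd} {σ : Store} : e.ok w σ → e.ev w σ = 0 →
      HExec w (.loop e p) σ (e.cost + 1) σ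
  | loop_step {e : Ex} {p : Cmd} {σ σ₁ σ₂ : Store} {t₁ t₂ : ℕ} : e.ok w σ → e.ev w σ ≠ 0 →
      HExec w p σ t₁ σ₁ → HExec w (.loop e p) σ₁ t₂ σ₂ →
      HExec w (.loop e p) σ (e.cost + (t₁ + t₂ + 1)) σ₂

/-- The variable `n` is excluded because all addresses depend on it: changing it would move every
array. -/
theorem Sim.setReg {s : State} {σ : Store} (hs : Sim s σ) {x : Var} (hx : x ≠ .n) (z : ℕ) :
    Sim ⟨Function.update s.reg x.ctorIdx z, s.mem⟩ (σ.set x z) := by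
  constructor
  · intro y
    by_cases h : y = x
    · subst h; simp
    · have : y.ctorIdx ≠ x.ctorIdx := fun h' => h (Var.ctorIdx_inj h')
      simp [Function.update_apply, this, h, hs.reg]
  · intro a i hi
    simp only [Store.set_v, hx.symm, if_false, Store.set_a] at hi ⊢
    exact hs.mem a i hi

theorem Sim.store {s : State} {σ : Store} (hs : Sim s σ) {a : Arr} {i : ℕ}
    (hi : a = .raw → i < 6 * σ.v .n) (z : ℕ) :
    Sim ⟨s.reg, Function.update s.mem (addr (σ.v .n) a i) z⟩ (σ.put a i z) := by
  constructor
  · intro y; simpa using hs.reg y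
  · intro b j hj
    simp only [Store.put_v, Store.put_a] at hj ⊢
    by_cases h : addr (σ.v .n) b j = addr (σ.v .n) a i
    · obtain ⟨rfl, rfl⟩ := addr_inj hj hi h
      simp
    · rw [Function.update_of_ne h, hs.mem b j hj]
      by_cases hb : b = a
      · subst hb
        have : j ≠ i := fun h' => h (by rw [h'])
        simp [this]
      · simp [hb]

/-- The translation is correct. -/
theorem HExec.sim {w : ℕ} {p : Cmd} {σ σ' : Store} {t : ℕ} (h : HExec w p σ t σ') :
    ∀ {s : State}, Sim s σ → ∃ s', Exec w p.comp s t s' ∧ Sim s' σ' := by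
  induction h with
  | skip σ => exact fun hs => ⟨_, .skip _, hs⟩
  | set hx hok =>
    intro s hs
    obtain ⟨s₁, h₁, h₂, h₃⟩ := Ex.exec_comp _ hs le_rfl hok
    refine ⟨_, .seq h₁ (.copy _ _ _), ?_⟩
    rw [h₃]
    exact (h₂.sim le_rfl hs).setReg hx _
  | @wr a i e σ hi ha he =>
    intro s hs
    obtain ⟨s₁, h₁, h₂, h₃⟩ := Ex.exec_comp _ hs le_rfl hi
    have hs₁ := h₂.sim le_rfl hs
    obtain ⟨s₂, g₁, g₂, g₃⟩ : ∃ s', Exec w (compAddr a firstTemp) s₁ (max 1 (addrCost a)) s' ∧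
        EqBelow firstTemp s₁ s' ∧ s'.reg firstTemp = addr (σ.v .n) a (i.ev w σ) := by
      by_cases hr : a = .raw
      · subst hr
        exact ⟨s₁, .skip _, ⟨fun _ _ => rfl, rfl⟩, by simpa [addr] using h₃⟩
      · have := exec_compAddr hs₁ hr le_rfl h₃ ha
        simpa [addrCost, hr] using this
    have hs₂ := g₂.sim le_rfl hs₁
    obtain ⟨s₃, k₁, k₂, k₃⟩ := Ex.exec_comp e hs₂ (Nat.le_succ firstTemp) he
    have hs₃ := k₂.sim (Nat.le_succ firstTemp) hs₂
    refine ⟨_, .seq h₁ (.seq g₁ (.seq k₁ (.store _ _ _))), ?_⟩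
    rw [k₃, k₂.1 _ (Nat.lt_succ_self _), g₃]
    exact hs₃.store (fun h => by simpa [okAddr, h] using ha) _
  | seq _ _ ih₁ ih₂ =>
    intro s hs
    obtain ⟨s₁, h₁, h₂⟩ := ih₁ hs
    obtain ⟨s₂, h₃, h₄⟩ := ih₂ h₂
    exact ⟨s₂, .seq h₁ h₃, h₄⟩
  | ite_true hok hne _ ih =>
    intro s hs
    obtain ⟨s₁, h₁, h₂, h₃⟩ := Ex.exec_comp _ hs le_rfl hok
    obtain ⟨s₂, h₄, h₅⟩ := ih (h₂.sim le_rfl hs)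
    exact ⟨s₂, .seq h₁ (.ite_true (by rwa [h₃]) h₄), h₅⟩
  | ite_false hok hne _ ih =>
    intro s hs
    obtain ⟨s₁, h₁, h₂, h₃⟩ := Ex.exec_comp _ hs le_rfl hok
    obtain ⟨s₂, h₄, h₅⟩ := ih (h₂.sim le_rfl hs)
    exact ⟨s₂, .seq h₁ (.ite_false (by rwa [h₃]) h₄), h₅⟩
  | loop_exit hok h0 =>
    intro s hs
    obtain ⟨s₁, h₁, h₂, h₃⟩ := Ex.exec_comp _ hs le_rfl hok
    exact ⟨s₁, .seq h₁ (Exec.loop_stop (by rwa [h₃])), h₂.sim le_rfl hs⟩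
  | loop_step hok hne _ _ ih₁ ih₂ =>
    intro s hs
    obtain ⟨s₁, h₁, h₂, h₃⟩ := Ex.exec_comp _ hs le_rfl hok
    obtain ⟨s₂, g₁, g₂⟩ := ih₁ (h₂.sim le_rfl hs)
    obtain ⟨s₃, k₁, k₂⟩ := ih₂ g₂
    refine ⟨s₃, ?_, k₂⟩
    -- The compiled loop evaluates its guard once in front and again at the end of each pass. The
    -- guard evaluation that the induction hypothesis places in front of the remaining loop
    -- therefore has to be moved to the end of the present pass.
    cases k₁ with
    | seq a b =>
      refine .seq h₁ ?_
      rw [← Nat.add_assoc]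
      exact .loop_step (by rwa [h₃]) (.seq g₁ a) b

/-- The variables that a command may change. -/
def Cmd.mv : Cmd → Var → Bool
  | .skip, _ => false
  | .set x _, y => x = y
  | .wr _ _ _, _ => false
  | .seq p q, y => p.mv y || q.mv y
  | .ite _ p q, y => p.mv y || q.mv y
  | .loop _ p, y => p.mv y

/-- The arrays that a command may change. -/
def Cmd.ma : Cmd → Arr → Bool
  | .skip, _ => false
  | .set _ _, _ => false
  | .wr a _ _, b => a = b
  | .seq p q, y => p.ma y || q.ma y
  | .ite _ p q, y => p.ma y || q.ma y
  | .loop _ p, y => p.ma y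

/-- The stores agree on everything that the command cannot change. -/
structure Frame (p : Cmd) (σ σ' : Store) : Prop where
  v : ∀ x, p.mv x = false → σ'.v x = σ.v x
  a : ∀ b, p.ma b = false → σ'.a b = σ.a b

/-- What a command may change is computed from its syntax, so for concrete commands the preservation
of a variable or an array is settled by `decide`. -/
theorem HExec.frame {w : ℕ} {p : Cmd} {σ σ' : Store} {t : ℕ} (h : HExec w p σ t σ') :
    Frame p σ σ' := by
  induction h with
  | skip σ => exact ⟨fun _ _ => rfl, fun _ _ => rfl⟩
  | set hx hok =>
    refine ⟨fun y hy => ?_, fun _ _ => rfl⟩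
    simp only [Cmd.mv, decide_eq_false_iff_not] at hy
    simp [Ne.symm hy]
  | wr =>
    refine ⟨fun y hy => rfl, fun b hb => ?_⟩
    simp only [Cmd.ma, decide_eq_false_iff_not] at hb
    simp [Ne.symm hb]
  | seq _ _ ih₁ ih₂ =>
    refine ⟨fun y hy => ?_, fun b hb => ?_⟩
    · simp only [Cmd.mv, Bool.or_eq_false_iff] at hy
      rw [ih₂.v y hy.2, ih₁.v y hy.1]
    · simp only [Cmd.ma, Bool.or_eq_false_iff] at hb
      rw [ih₂.a b hb.2, ih₁.a b hb.1]
  | ite_true _ _ _ ih =>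
    refine ⟨fun y hy => ?_, fun b hb => ?_⟩
    · simp only [Cmd.mv, Bool.or_eq_false_iff] at hy
      exact ih.v y hy.1
    · simp only [Cmd.ma, Bool.or_eq_false_iff] at hb
      exact ih.a b hb.1
  | ite_false _ _ _ ih =>
    refine ⟨fun y hy => ?_, fun b hb => ?_⟩
    · simp only [Cmd.mv, Bool.or_eq_false_iff] at hy
      exact ih.v y hy.2
    · simp only [Cmd.ma, Bool.or_eq_false_iff] at hb
      exact ih.a b hb.2
  | loop_exit => exact ⟨fun _ _ => rfl, fun _ _ => rfl⟩
  | loop_step _ _ _ _ ih₁ ih₂ =>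
    exact ⟨fun y hy => by rw [ih₂.v y hy, ih₁.v y hy], fun b hb => by rw [ih₂.a b hb, ih₁.a b hb]⟩

/-! ### Weakest preconditions with a clock. -/

/-- Started in `σ` at time `t`, the command halts, in a store and at a time that satisfy `Q`. -/
def WP (w : ℕ) (p : Cmd) (Q : Store → ℕ → Prop) (σ : Store) (t : ℕ) : Prop :=
  ∃ t' σ', HExec w p σ t' σ' ∧ Q σ' (t + t')

section WP

variable {w : ℕ} {Q : Store → ℕ → Prop} {σ : Store} {t : ℕ}

theorem WP.mono {p : Cmd} {R : Store → ℕ → Prop} (h : WP w p R σ t)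
    (hR : ∀ σ' t', Frame p σ σ' → R σ' t' → Q σ' t') : WP w p Q σ t := by
  obtain ⟨t', σ', h₁, h₂⟩ := h
  exact ⟨t', σ', h₁, hR _ _ h₁.frame h₂⟩

theorem wp_skip (h : Q σ (t + 1)) : WP w .skip Q σ t := ⟨_, _, .skip _, h⟩

theorem wp_set {x : Var} {e : Ex} (hx : x ≠ .n) (hok : e.ok w σ)
    (h : Q (σ.set x (e.ev w σ)) (t + (e.cost + 1))) : WP w (.set x e) Q σ t :=
  ⟨_, _, .set hx hok, h⟩

theorem wp_wr {a : Arr} {i e : Ex} (hi : i.ok w σ) (ha : okAddr w (σ.v .n) a (i.ev w σ))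
    (he : e.ok w σ) (h : Q (σ.put a (i.ev w σ) (e.ev w σ))
      (t + (i.cost + (max 1 (addrCost a) + (e.cost + 1))))) :
    WP w (.wr a i e) Q σ t :=
  ⟨_, _, .wr hi ha he, h⟩

theorem wp_seq {p q : Cmd} (h : WP w p (WP w q Q) σ t) : WP w (.seq p q) Q σ t := by
  obtain ⟨t₁, σ₁, h₁, t₂, σ₂, h₂, h₃⟩ := h
  exact ⟨_, _, .seq h₁ h₂, by rwa [← Nat.add_assoc]⟩

theorem wp_ite {e : Ex} {p q : Cmd} (hok : e.ok w σ)
    (ht : e.ev w σ ≠ 0 → WP w p Q σ (t + (e.cost + 1)))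
    (hf : e.ev w σ = 0 → WP w q Q σ (t + (e.cost + 1))) : WP w (.ite e p q) Q σ t := by
  by_cases h : e.ev w σ = 0
  · obtain ⟨t', σ', h₁, h₂⟩ := hf h
    refine ⟨_, _, .ite_false hok h h₁, ?_⟩
    rwa [show t + (e.cost + (t' + 1)) = t + (e.cost + 1) + t' by ring]
  · obtain ⟨t', σ', h₁, h₂⟩ := ht h
    refine ⟨_, _, .ite_true hok h h₁, ?_⟩
    rwa [show t + (e.cost + (t' + 1)) = t + (e.cost + 1) + t' by ring]

/-- A loop with a variant `k` that decreases by one in each iteration. -/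
theorem wp_loop {e : Ex} {p : Cmd} (inv : ℕ → Store → ℕ → Prop) (k : ℕ) (h0 : inv k σ t)
    (hok : ∀ k σ t, inv k σ t → e.ok w σ ∧ (e.ev w σ = 0 ↔ k = 0))
    (hstep : ∀ k σ t, inv (k + 1) σ t → WP w p (inv k) σ (t + (e.cost + 1)))
    (hQ : ∀ σ t, inv 0 σ t → Q σ (t + (e.cost + 1))) : WP w (.loop e p) Q σ t := by
  induction k generalizing σ t with
  | zero =>
    obtain ⟨h₁, h₂⟩ := hok _ _ _ h0
    exact ⟨_, _, .loop_exit h₁ (h₂.2 rfl), hQ _ _ h0⟩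
  | succ k ih =>
    obtain ⟨h₁, h₂⟩ := hok _ _ _ h0
    obtain ⟨t₁, σ₁, g₁, g₂⟩ := hstep _ _ _ h0
    obtain ⟨t₂, σ₂, k₁, k₂⟩ := ih g₂
    refine ⟨_, _, .loop_step h₁ (fun h => by simpa using h₂.1 h) g₁ k₁, ?_⟩
    rwa [show t + (e.cost + (t₁ + t₂ + 1)) = t + (e.cost + 1) + t₁ + t₂ by ring]

end WP

/-- `for i < b do p`. -/
def Cmd.for (i b : Var) (p : Cmd) : Cmd :=
  i ≔ .c 0 ;; .loop (.bin .lt i b) (p ;; i ≔ i + Ex.c 1)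

/-- The constants are exact costs: 2 steps for the initial assignment, 4 for evaluating and testing
the guard, 4 for the increment. The counter never overflows because it is at most the bound, which
is a word. -/
theorem wp_for {w : ℕ} {Q : Store → ℕ → Prop} {σ : Store} {t : ℕ} {i b : Var} {p : Cmd}
    (inv : ℕ → Store → ℕ → Prop)
    (hin : i ≠ .n) (hib : i ≠ b) (hpi : p.mv i = false) (hpb : p.mv b = false)
    (hb : σ.v b < 2 ^ w) (hw : 1 < 2 ^ w)
    (h0 : inv 0 (σ.set i 0) (t + 2))
    (hstep : ∀ k σ' t', k < σ.v b → σ'.v i = k → σ'.v b = σ.v b → inv k σ' t' →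
      WP w p (fun σ₁ t₁ => inv (k + 1) (σ₁.set i (k + 1)) (t₁ + 4)) σ' (t' + 4))
    (hQ : ∀ σ' t', σ'.v i = σ.v b → σ'.v b = σ.v b → inv (σ.v b) σ' t' → Q σ' (t' + 4)) :
    WP w (.for i b p) Q σ t := by
  refine wp_seq (wp_set hin (by simp only [Ex.ok]; omega) ?_)
  refine wp_loop (fun k σ' t' => k ≤ σ.v b ∧ σ'.v i = σ.v b - k ∧ σ'.v b = σ.v b ∧
    inv (σ.v b - k) σ' t') (σ.v b) ?_ ?_ ?_ ?_
  · simpa [Ne.symm hib] using h0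
  · rintro k σ' t' ⟨h₁, h₂, h₃, -⟩
    refine ⟨⟨trivial, trivial, hw⟩, ?_⟩
    simp only [Ex.ev_lt, Ex.ev_v, h₂, h₃]
    split_ifs <;> simp <;> omega
  · rintro k σ' t' ⟨h₁, h₂, h₃, h₄⟩
    refine wp_seq ((hstep (σ.v b - (k + 1)) σ' _ (by omega) h₂ h₃ h₄).mono ?_)
    intro σ₁ t₁ hf h₅
    have hi : σ₁.v i = σ.v b - (k + 1) := (hf.v i hpi).trans h₂
    refine wp_set hin ⟨trivial, hw, ?_⟩ ?_
    · simp only [BOp.ok, Ex.ev_v, Ex.ev_c, hi]; omega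
    · simp only [Ex.ev_add, Ex.ev_v, Ex.ev_c, hi]
      rw [show σ.v b - (k + 1) + 1 = σ.v b - k by omega] at h₅ ⊢
      refine ⟨by omega, by simp, ?_, h₅⟩
      simp [Ne.symm hib, hf.v b hpb, h₃]
  · rintro σ' t' ⟨-, h₂, h₃, h₄⟩
    exact hQ _ _ (by simpa using h₂) h₃ (by simpa using h₄)

end WordRAM

section

open Finset

/-!
# Negacyclic convolution

A vector with `L` entries is extended to an antiperiodic function on `ℤ`. Its convolutions reduce
to shorter ones by a Fourier transform whose roots of unity are shifts.
-/

namespace Negacyclic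

variable {R : Type*} [CommRing R]

/-- `f` changes its sign under translation by `L`. -/
def Anti (L : ℕ) (f : ℤ → R) : Prop := ∀ l, f (l + L) = -f l

/-- The translation by `e`. -/
def sh (e : ℤ) (f : ℤ → R) : ℤ → R := fun l => f (l - e)

/-- The negacyclic convolution of length `L`. -/
def negMul (L : ℕ) (f g : ℤ → R) : ℤ → R := fun k => ∑ i ∈ range L, f i * g (k - i)

theorem Anti.sub {L : ℕ} {f : ℤ → R} (hf : Anti L f) (l : ℤ) : f (l - L) = -f l := by
  have := hf (l - L)
  rw [sub_add_cancel] at this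
  rw [this, neg_neg]

theorem Anti.add_two_mul {L : ℕ} {f : ℤ → R} (hf : Anti L f) (l c : ℤ) :
    f (l + c * (2 * L)) = f l := by
  have h2 : ∀ l, f (l + 2 * L) = f l := fun l => by
    rw [two_mul, ← add_assoc, hf, hf, neg_neg]
  induction c using Int.induction_on generalizing l with
  | zero => simp
  | succ c ih => rw [add_mul, one_mul, ← add_assoc, h2, ih]
  | pred c ih =>
    rw [← h2, ← ih l]; congr 1; ring

theorem Anti.shift {L : ℕ} {f : ℤ → R} (hf : Anti L f) (e : ℤ) : Anti L (sh e f) := by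
  intro l
  simp only [sh]
  rw [show l + L - e = (l - e) + L by ring, hf]

theorem Anti.zero (L : ℕ) : Anti L (0 : ℤ → R) := fun l => by simp

theorem Anti.sum {ι : Type*} {L : ℕ} {s : Finset ι} {f : ι → ℤ → R} (hf : ∀ i, Anti L (f i)) :
    Anti L (∑ i ∈ s, f i) := by
  intro l
  simp only [Finset.sum_apply, hf _ l, Finset.sum_neg_distrib]

theorem Anti.smul {L : ℕ} {f : ℤ → R} (hf : Anti L f) (c : R) : Anti L (c • f) := by
  intro l; simp [hf l]

theorem Anti.negMul {L : ℕ} {f g : ℤ → R} (hg : Anti L g) : Anti L (negMul L f g) := by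
  intro k
  simp only [Negacyclic.negMul, ← Finset.sum_neg_distrib]
  refine Finset.sum_congr rfl fun i _ => ?_
  rw [show k + L - i = (k - i) + L by ring, hg]; ring

omit [CommRing R] in
theorem sh_sh (a b : ℤ) (f : ℤ → R) : sh a (sh b f) = sh (a + b) f := by
  funext l; simp only [sh]; congr 1; ring

omit [CommRing R] in
theorem sh_zero (f : ℤ → R) : sh 0 f = f := by
  funext l; simp [sh]

theorem sh_sub (e : ℤ) (f g : ℤ → R) : sh e (f - g) = sh e f - sh e g := rfl

theorem sh_sum {ι : Type*} (e : ℤ) (s : Finset ι) (f : ι → ℤ → R) :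
    sh e (∑ i ∈ s, f i) = ∑ i ∈ s, sh e (f i) := by
  funext l; simp [sh]

theorem Anti.sh_mul_two {L : ℕ} {f : ℤ → R} (hf : Anti L f) (e c : ℤ) :
    sh (e + c * (2 * L)) f = sh e f := by
  funext l
  simp only [sh]
  rw [← hf.add_two_mul (l - e) (-c)]; congr 1; ring

theorem Anti.sh_half {L : ℕ} {f : ℤ → R} (hf : Anti L f) (e : ℤ) :
    sh (e + L) f = -sh e f := by
  funext l
  simp only [sh, Pi.neg_apply]
  rw [← hf.sub]; congr 1; ring

/-- The value of a shifted antiperiodic function, in terms of its values on a period. -/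
theorem Anti.apply_eq {L : ℕ} {f : ℤ → R} (hf : Anti L f) {k : ℤ} {t : ℕ} {c : ℤ}
    (h : k = t + c * (2 * L)) : f k = if t < L then f t else -f ((t - L : ℕ) : ℤ) := by
  rw [h, hf.add_two_mul]
  split_ifs with ht
  · rfl
  · rw [← hf]; congr 1; push_cast [Nat.le_of_not_lt ht]; ring

theorem sum_range_shift {L : ℕ} {h : ℤ → R} (hh : ∀ i, h (i + L) = h i) (e : ℤ) :
    ∑ i ∈ range L, h (i + e) = ∑ i ∈ range L, h i := by
  have key : ∀ e : ℤ, ∑ i ∈ range L, h (i + (e + 1)) = ∑ i ∈ range L, h (i + e) := by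
    intro e
    have h1 := Finset.sum_range_succ (fun i : ℕ => h (i + e)) L
    have h2 := Finset.sum_range_succ' (fun i : ℕ => h (i + e)) L
    rw [h1] at h2
    have h3 : h (L + e) = h e := by rw [add_comm, hh]
    simp only [Nat.cast_zero, zero_add, h3, add_left_inj] at h2
    rw [h2]
    refine Finset.sum_congr rfl fun i _ => ?_
    congr 1; push_cast; ring
  induction e using Int.induction_on with
  | zero => simp
  | succ c ih => rw [key, ih]
  | pred c ih => rw [← key, ← ih]; simp

theorem negMul_sh_right (L : ℕ) (f g : ℤ → R) (e : ℤ) :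
    negMul L f (sh e g) = sh e (negMul L f g) := by
  funext k
  simp only [negMul, sh]
  refine Finset.sum_congr rfl fun i _ => ?_
  congr 2; ring

/-- As a function of i the summand f (i - e) g (k - i) has period L, since the two changes of sign
cancel; hence the sum over a period may be translated by e. -/
theorem negMul_sh_left {L : ℕ} {f g : ℤ → R} (hf : Anti L f) (hg : Anti L g) (e : ℤ) :
    negMul L (sh e f) g = sh e (negMul L f g) := by
  funext k
  simp only [negMul, sh]
  rw [← sum_range_shift (h := fun i => f (i - e) * g (k - i)) (fun i => ?_) e]
  · refine Finset.sum_congr rfl fun i _ => ?_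
    congr 2 <;> ring
  · rw [show i + L - e = (i - e) + L by ring, show k - (i + L) = (k - i) - L by ring, hf, hg.sub]
    ring

theorem negMul_sum_left {ι : Type*} (L : ℕ) (s : Finset ι) (f : ι → ℤ → R) (g : ℤ → R) :
    negMul L (∑ i ∈ s, f i) g = ∑ i ∈ s, negMul L (f i) g := by
  funext k
  simp only [negMul, Finset.sum_apply, Finset.sum_mul]
  exact Finset.sum_comm

theorem negMul_sum_right {ι : Type*} (L : ℕ) (s : Finset ι) (f : ℤ → R) (g : ι → ℤ → R) :
    negMul L f (∑ i ∈ s, g i) = ∑ i ∈ s, negMul L f (g i) := by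
  funext k
  simp only [negMul, Finset.sum_apply, Finset.mul_sum]
  exact Finset.sum_comm

/-- The exponent of the point at which block `G` is evaluated after `s` stages of the transform
of length `2 ^ a`. -/
def theta (L a : ℕ) : ℕ → ℕ → ℤ
  | 0, _ => 0
  | s + 1, G => theta L a s (G / 2) + (G % 2 : ℕ) * (L / 2 ^ (a - (s + 1)) : ℕ)

/-- The partial transform after `s` stages: block `G`, offset `o`. -/
def partialDFT (L a : ℕ) (f : ℕ → ℤ → R) (s G o : ℕ) : ℤ → R :=
  ∑ j ∈ range (2 ^ s), sh (theta L a s G * (o + j * 2 ^ (a - s) : ℕ)) (f (o + j * 2 ^ (a - s)))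

theorem partialDFT_zero (L a : ℕ) (f : ℕ → ℤ → R) (o : ℕ) : partialDFT L a f 0 0 o = f o := by
  simp [partialDFT, theta, sh_zero]

theorem partialDFT_anti {L a : ℕ} {f : ℕ → ℤ → R} (hf : ∀ j, Anti L (f j)) (s G o : ℕ) :
    Anti L (partialDFT L a f s G o) :=
  Anti.sum fun _ => (hf _).shift _

theorem partialDFT_last (L a : ℕ) (f : ℕ → ℤ → R) (G : ℕ) :
    partialDFT L a f a G 0 = ∑ j ∈ range (2 ^ a), sh (theta L a a G * j) (f j) := by
  simp [partialDFT]

theorem sum_range_two_mul {A : Type*} [AddCommMonoid A] (F : ℕ → A) (n : ℕ) :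
    ∑ j ∈ range (2 * n), F j = ∑ j ∈ range n, (F (2 * j) + F (2 * j + 1)) := by
  induction n with
  | zero => simp
  | succ n ih =>
    rw [show 2 * (n + 1) = 2 * n + 1 + 1 by ring, sum_range_succ, sum_range_succ, ih,
      sum_range_succ, add_assoc]

/-- The butterfly of decimation in frequency. Splitting j by parity separates the offsets o and o +
h. In an odd block the exponent grows by L / h per index: the part from multiples of 2h is a
multiple of 2L and acts trivially, the part from a single h is L and gives the minus sign, and the
part from o is the common shift in front. -/
theorem partialDFT_succ {L a h s : ℕ} {f : ℕ → ℤ → R} (hf : ∀ j, Anti L (f j))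
    (hs : s < a) (hh : h = 2 ^ (a - (s + 1))) (hL : h ∣ L) (G o : ℕ) :
    partialDFT L a f (s + 1) (2 * G) o = partialDFT L a f s G o + partialDFT L a f s G (o + h) ∧
    partialDFT L a f (s + 1) (2 * G + 1) o =
      sh ((L / h : ℕ) * o) (partialDFT L a f s G o - partialDFT L a f s G (o + h)) := by
  have h2 : 2 ^ (a - s) = 2 * h := by
    rw [hh, ← pow_succ']; congr 1; omega
  obtain ⟨E, rfl⟩ := hL
  have hpos : 0 < h := by rw [hh]; positivity
  have hE : h * E / h = E := Nat.mul_div_cancel_left _ hpos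
  simp only [partialDFT, theta, ← hh, h2, hE, pow_succ', sum_range_two_mul]
  rw [show (2 * G) / 2 = G by omega, show (2 * G) % 2 = 0 by omega,
    show (2 * G + 1) / 2 = G by omega, show (2 * G + 1) % 2 = 1 by omega]
  constructor
  · rw [← Finset.sum_add_distrib]
    refine Finset.sum_congr rfl fun j _ => ?_
    rw [show o + 2 * j * h = o + j * (2 * h) by ring,
      show o + (2 * j + 1) * h = o + h + j * (2 * h) by ring]
    simp
  · rw [← Finset.sum_sub_distrib, sh_sum]
    refine Finset.sum_congr rfl fun j _ => ?_
    rw [show o + 2 * j * h = o + j * (2 * h) by ring,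
      show o + (2 * j + 1) * h = o + h + j * (2 * h) by ring, sh_sub, sh_sh, sh_sh, sub_eq_add_neg]
    congr 1
    · rw [← (hf _).sh_mul_two _ (-j)]
      congr 1; push_cast; ring
    · rw [← (hf _).sh_half, ← (hf _).sh_mul_two _ (-j)]
      congr 1; push_cast; ring

/-- The `j`-th of the `M` interleaved slices of `f`. -/
def slice (M : ℕ) (f : ℤ → R) (j : ℕ) : ℤ → R := if j < M then fun l => f (l * M + j) else 0

theorem slice_anti {L M : ℕ} {f : ℤ → R} (hf : Anti (L * M) f) (j : ℕ) :
    Anti L (slice M f j) := by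
  unfold slice
  split_ifs
  · intro l
    have := hf (l * M + j)
    rw [← this]; push_cast; ring_nf
  · exact Anti.zero L

/-- The coefficients of the product of two polynomials whose coefficients are the slices. -/
def sliceMul (L M : ℕ) (f g : ℤ → R) (k : ℕ) : ℤ → R :=
  ∑ i ∈ range M, if i ≤ k ∧ k < i + M then negMul L (slice M f i) (slice M g (k - i)) else 0

theorem sliceMul_anti {L M : ℕ} {f g : ℤ → R} (hg : Anti (L * M) g) (k : ℕ) :
    Anti L (sliceMul L M f g k) := by
  refine Anti.sum fun i => ?_
  split_ifs
  · exact (slice_anti hg _).negMul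
  · exact Anti.zero L

/-- Evaluation of polynomials at a power of y is multiplicative. The slices vanish from index M on,
so the product has fewer than 2M = 2^a coefficients and the sums run over all of them. No
orthogonality of roots of unity enters: the inverse transform undoes the butterflies one by one. -/
theorem negMul_transform {L M a : ℕ} (ha : 2 ^ a = 2 * M) {f g : ℤ → R} (hf : Anti (L * M) f)
    (hg : Anti (L * M) g) (G : ℕ) :
    negMul L (partialDFT L a (slice M f) a G 0) (partialDFT L a (slice M g) a G 0) =
      partialDFT L a (sliceMul L M f g) a G 0 := by
  have hcut : ∀ f : ℤ → R, ∑ j ∈ range (2 ^ a), sh (theta L a a G * j) (slice M f j) =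
      ∑ j ∈ range M, sh (theta L a a G * j) (slice M f j) := by
    intro f
    refine (Finset.sum_subset (range_subset_range.2 (by omega)) fun j _ hj => ?_).symm
    rw [mem_range, not_lt] at hj
    rw [slice, if_neg (by omega)]
    rfl
  rw [partialDFT_last, partialDFT_last, partialDFT_last, hcut, hcut, negMul_sum_left]
  simp only [sliceMul, sh_sum]
  rw [Finset.sum_comm]
  refine Finset.sum_congr rfl fun i hi => ?_
  rw [mem_range] at hi
  rw [negMul_sum_right]
  have hz : ∀ k ∈ range (2 ^ a), k ∉ Ico i (i + M) → sh (theta L a a G * k)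
      (if i ≤ k ∧ k < i + M then negMul L (slice M f i) (slice M g (k - i)) else 0) = 0 := by
    intro k _ hk
    rw [Finset.mem_Ico] at hk
    rw [if_neg hk]; rfl
  rw [← Finset.sum_subset (fun k hk => by rw [mem_Ico] at hk; rw [mem_range]; omega) hz,
    Finset.sum_Ico_eq_sum_range, Nat.add_sub_cancel_left]
  refine Finset.sum_congr rfl fun j hj => ?_
  rw [mem_range] at hj
  rw [if_pos ⟨by omega, by omega⟩, Nat.add_sub_cancel_left, negMul_sh_right,
    negMul_sh_left (slice_anti hf _) (slice_anti hg _), sh_sh]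
  congr 1; push_cast; ring

theorem sum_range_mul {A : Type*} [AddCommMonoid A] (F : ℕ → A) (L M : ℕ) :
    ∑ k ∈ range (L * M), F k = ∑ i ∈ range M, ∑ l ∈ range L, F (l * M + i) := by
  rw [Finset.sum_comm]
  induction L with
  | zero => simp
  | succ L ih => rw [sum_range_succ, ← ih, add_mul, one_mul, Finset.sum_range_add]

/-- Reassemble the negacyclic convolution of length `L * M` from its slices. -/
theorem negMul_eq_sliceMul {L M : ℕ} (f g : ℤ → R) (l : ℤ) {i : ℕ} (hi : i < M) :
    negMul (L * M) f g (l * M + i) =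
      sliceMul L M f g i l + sliceMul L M f g (i + M) (l - 1) := by
  simp only [negMul, sliceMul, Finset.sum_apply]
  rw [sum_range_mul, ← Finset.sum_add_distrib]
  refine Finset.sum_congr rfl fun i' hi' => ?_
  rw [mem_range] at hi'
  -- A slice with index i' meets the slice i - i' if i' ≤ i, and otherwise the slice i + M - i' with
  -- a carry of one into y; exactly one of the two inner sums contains it.
  by_cases h : i' ≤ i
  · rw [if_pos ⟨h, by omega⟩, if_neg (by omega)]
    simp only [slice, hi', if_true, show i - i' < M by omega, Pi.zero_apply, add_zero, negMul]
    refine Finset.sum_congr rfl fun l' _ => ?_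
    push_cast [h]
    congr 2; ring
  · rw [if_neg (by omega), if_pos ⟨by omega, by omega⟩]
    simp only [slice, hi', if_true, show i + M - i' < M by omega, Pi.zero_apply, zero_add, negMul]
    refine Finset.sum_congr rfl fun l' _ => ?_
    push_cast [show i' ≤ i + M by omega]
    congr 2; ring

/-- The transform of a sequence of blocks of length `L * M` into blocks of length `L`. -/
def blocks (L M a : ℕ) (f : ℕ → ℤ → R) (b : ℕ) : ℤ → R :=
  partialDFT L a (slice M (f (b / 2 ^ a))) a (b % 2 ^ a) 0

theorem blocks_anti {L M a : ℕ} {f : ℕ → ℤ → R} (hf : ∀ b, Anti (L * M) (f b)) (b : ℕ) :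
    Anti L (blocks L M a f b) :=
  partialDFT_anti (slice_anti (hf _)) _ _ _

/-- The antiperiodic function with given values on a period. -/
def ext (L : ℕ) (F : ℕ → R) : ℤ → R :=
  fun k => if k / L % 2 = 0 then F (k % L).toNat else -F (k % L).toNat

theorem ext_anti {L : ℕ} (hL : 0 < L) (F : ℕ → R) : Anti L (ext L F) := by
  intro k
  have hL' : (L : ℤ) ≠ 0 := by exact_mod_cast hL.ne'
  simp only [ext, Int.add_ediv_of_dvd_right (dvd_refl (L : ℤ)), Int.ediv_self hL',
    Int.add_emod_right]
  rcases Int.emod_two_eq_zero_or_one (k / L) with h | h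
  · rw [if_pos h, if_neg (show ¬(k / L + 1) % 2 = 0 by omega)]
  · rw [if_neg (show ¬k / L % 2 = 0 by omega), if_pos (show (k / L + 1) % 2 = 0 by omega), neg_neg]

theorem ext_apply {L : ℕ} (F : ℕ → R) {l : ℕ} (hl : l < L) : ext L F l = F l := by
  have h1 : ((l : ℤ) / L) = 0 := Int.ediv_eq_zero_of_lt (by positivity) (by exact_mod_cast hl)
  have h2 : ((l : ℤ) % L) = l := Int.emod_eq_of_lt (by positivity) (by exact_mod_cast hl)
  simp [ext, h1, h2]

/-- Without wrap-around, the negacyclic convolution is the product of polynomials. -/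
theorem negMul_ext {N m : ℕ} (hm : 2 * m ≤ N) {F G : ℕ → R} (hF : ∀ i, m ≤ i → F i = 0)
    (hG : ∀ i, m ≤ i → G i = 0) {k : ℕ} (hk : k < N) :
    negMul N (ext N F) (ext N G) k = ∑ i ∈ range (k + 1), F i * G (k - i) := by
  have hz : ∀ i ∈ range N, i ∉ range (k + 1) → ext N F i * ext N G ((k : ℤ) - i) = 0 := by
    intro i hi hik
    rw [mem_range] at hi hik
    rw [ext_apply F hi]
    rcases le_or_gt m i with h | h
    · rw [hF i h, zero_mul]
    · have h3 : (k : ℤ) - i = ((N + k - i : ℕ) : ℤ) - N := by omega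
      rw [h3, (ext_anti (by omega) G).sub, ext_apply G (by omega), hG _ (by omega)]
      simp
  rw [negMul, ← Finset.sum_subset (range_subset_range.2 (by omega)) hz]
  refine Finset.sum_congr rfl fun i hi => ?_
  rw [mem_range] at hi
  rw [ext_apply F (by omega), show (k : ℤ) - i = ((k - i : ℕ) : ℤ) by omega,
    ext_apply G (by omega)]

end Negacyclic

/-! ### One pass of the transform as a formula for array entries. -/

namespace Negacyclic

/-- The array `X` holds, in rows of length `L`, the functions `ψ 0, …, ψ (n - 1)` modulo `2 ^ w`. -/
def Rep (w : ℕ) (X : ℕ → ℕ) (n L : ℕ) (ψ : ℕ → ℤ → ZMod (2 ^ w)) : Prop :=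
  ∀ r < n, ∀ l < L, X (r * L + l) < 2 ^ w ∧ (X (r * L + l) : ZMod (2 ^ w)) = ψ r l

theorem Rep.congr {w : ℕ} {X : ℕ → ℕ} {n L : ℕ} {ψ χ : ℕ → ℤ → ZMod (2 ^ w)}
    (h : Rep w X n L ψ) (hχ : ∀ r < n, ψ r = χ r) : Rep w X n L χ := by
  intro r hr l hl
  rw [← hχ r hr]
  exact h r hr l hl

section values

variable (w L M h : ℕ) (X : ℕ → ℕ) (k : ℕ)

/-- Addition of words. -/
def addw (w x y : ℕ) : ℕ := (x + y) % 2 ^ w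

/-- Subtraction of words. -/
def subw (w x y : ℕ) : ℕ := (x + 2 ^ w - y) % 2 ^ w

/-- Multiplication of words. -/
def mulw (w x y : ℕ) : ℕ := (x * y) % 2 ^ w

/-- Entry `k` of the array of slices. -/
def expandVal : ℕ :=
  if k / L % (2 * M) < M then X ((k / L / (2 * M) * L + k % L) * M + k / L % (2 * M)) else 0

/-- The first of the two entries combined into entry `k` by a butterfly is in this row. -/
def bflyRow : ℕ := k / L / h / 2 * (2 * h) + k / L % h

/-- Entry `k` after a butterfly. -/
def bflyVal : ℕ :=
  if k / L / h % 2 = 0 then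
    addw w (X (bflyRow L h k * L + k % L)) (X (bflyRow L h k * L + h * L + k % L))
  else if (k % L + 2 * L - L / h * (k / L % h)) % (2 * L) < L then
    subw w (X (bflyRow L h k * L + (k % L + 2 * L - L / h * (k / L % h)) % (2 * L)))
      (X (bflyRow L h k * L + h * L + (k % L + 2 * L - L / h * (k / L % h)) % (2 * L)))
  else
    subw w (X (bflyRow L h k * L + h * L + ((k % L + 2 * L - L / h * (k / L % h)) % (2 * L) - L)))
      (X (bflyRow L h k * L + ((k % L + 2 * L - L / h * (k / L % h)) % (2 * L) - L)))

/-- Entry `k` after an inverse butterfly. -/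
def invVal : ℕ :=
  if (k % L + L / h * (k / L % h)) % (2 * L) < L then
    if k / L / h % 2 = 0 then
      addw w (X (bflyRow L h k * L + k % L))
        (X (bflyRow L h k * L + h * L + (k % L + L / h * (k / L % h)) % (2 * L)))
    else
      subw w (X (bflyRow L h k * L + k % L))
        (X (bflyRow L h k * L + h * L + (k % L + L / h * (k / L % h)) % (2 * L)))
  else if 1 - k / L / h % 2 = 0 then
    addw w (X (bflyRow L h k * L + k % L))
      (X (bflyRow L h k * L + h * L + ((k % L + L / h * (k / L % h)) % (2 * L) - L)))
  else
    subw w (X (bflyRow L h k * L + k % L))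
      (X (bflyRow L h k * L + h * L + ((k % L + L / h * (k / L % h)) % (2 * L) - L)))

/-- Entry `k` of the pointwise product of two sequences of blocks of length `2`, the second of
which begins at `Z`. -/
def baseVal (Z : ℕ) : ℕ :=
  if k % 2 = 0 then
    subw w (mulw w (X k) (X (Z + k))) (mulw w (X (k + 1)) (X (Z + k + 1)))
  else addw w (mulw w (X (k - 1)) (X (Z + k))) (mulw w (X k) (X (Z + k - 1)))

/-- Entry `k` of the blocks that are reassembled from their slices. -/
def foldVal : ℕ :=
  if k / M % L = 0 then
    subw w (X ((k / M / L * (2 * M) + k % M) * L + k / M % L))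
      (X ((k / M / L * (2 * M) + k % M + M) * L + (L - 1)))
  else
    addw w (X ((k / M / L * (2 * M) + k % M) * L + k / M % L))
      (X ((k / M / L * (2 * M) + k % M + M) * L + (k / M % L - 1)))

end values

section casts

variable {w x y : ℕ} {p q : ZMod (2 ^ w)}

theorem addw_spec (hx : (x : ZMod (2 ^ w)) = p) (hy : (y : ZMod (2 ^ w)) = q) :
    addw w x y < 2 ^ w ∧ (addw w x y : ZMod (2 ^ w)) = p + q := by
  refine ⟨Nat.mod_lt _ (by positivity), ?_⟩
  rw [addw, ZMod.natCast_mod]; push_cast; rw [hx, hy]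

theorem mulw_spec (hx : (x : ZMod (2 ^ w)) = p) (hy : (y : ZMod (2 ^ w)) = q) :
    mulw w x y < 2 ^ w ∧ (mulw w x y : ZMod (2 ^ w)) = p * q := by
  refine ⟨Nat.mod_lt _ (by positivity), ?_⟩
  rw [mulw, ZMod.natCast_mod]; push_cast; rw [hx, hy]

theorem subw_spec (hx : (x : ZMod (2 ^ w)) = p) (hy : y < 2 ^ w ∧ (y : ZMod (2 ^ w)) = q) :
    subw w x y < 2 ^ w ∧ (subw w x y : ZMod (2 ^ w)) = p - q := by
  refine ⟨Nat.mod_lt _ (by positivity), ?_⟩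
  rw [subw, ZMod.natCast_mod, Nat.cast_sub (by omega), Nat.cast_add, ZMod.natCast_self, add_zero,
    hx, hy.2]

end casts

variable {w : ℕ} {X Y : ℕ → ℕ}

theorem mul_add_div_mod (a : ℕ) {b c : ℕ} (hb : b < c) :
    (a * c + b) / c = a ∧ (a * c + b) % c = b :=
  ⟨by rw [mul_comm, Nat.mul_add_div (by omega), Nat.div_eq_of_lt hb, add_zero],
    by rw [Nat.mul_add_mod_self_right, Nat.mod_eq_of_lt hb]⟩

theorem Rep.expand {L M Q : ℕ} {φ : ℕ → ℤ → ZMod (2 ^ w)} (hX : Rep w X Q (L * M) φ)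
    (hY : ∀ k < Q * (2 * M) * L, Y k = expandVal L M X k) :
    Rep w Y (Q * (2 * M)) L fun r => slice M (φ (r / (2 * M))) (r % (2 * M)) := by
  intro r hr l hl
  have hk : r * L + l < Q * (2 * M) * L := by nlinarith
  obtain ⟨h1, h2⟩ := mul_add_div_mod r hl
  rw [hY _ hk, expandVal, h1, h2]
  have hq : r / (2 * M) < Q := Nat.div_lt_of_lt_mul (by rwa [mul_comm])
  split_ifs with h
  · have := hX _ hq (l * M + r % (2 * M)) (by nlinarith)
    rw [show r / (2 * M) * (L * M) + (l * M + r % (2 * M)) =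
      (r / (2 * M) * L + l) * M + r % (2 * M) by ring] at this
    refine ⟨this.1, this.2.trans ?_⟩
    simp [slice, h]
  · exact ⟨by positivity, by simp [slice, h]⟩

/-- A butterfly reads the two rows r₀ and r₀ + h, where r₀ is `bflyRow`. They are offsets o and o +
h of one group of 2h rows, and equally offset o of two neighbouring groups of h rows. The forward
pass goes from the first reading to the second, and the inverse pass back. -/
theorem row_facts {L h B r l : ℕ} (hh : 0 < h) (hr : r < B * (2 * h)) (hl : l < L) :
    (r * L + l) / L = r ∧ (r * L + l) % L = l ∧ r * L + l < B * (2 * h) * L ∧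
    bflyRow L h (r * L + l) = r / h / 2 * (2 * h) + r % h ∧
    r / h / 2 * (2 * h) + r % h + h < B * (2 * h) ∧
    (r / h / 2 * (2 * h) + r % h) / (2 * h) = r / h / 2 ∧
    (r / h / 2 * (2 * h) + r % h) % (2 * h) = r % h ∧
    (r / h / 2 * (2 * h) + r % h + h) / (2 * h) = r / h / 2 ∧
    (r / h / 2 * (2 * h) + r % h + h) % (2 * h) = r % h + h ∧
    (r / h / 2 * (2 * h) + r % h) / h = 2 * (r / h / 2) ∧
    (r / h / 2 * (2 * h) + r % h) % h = r % h ∧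
    (r / h / 2 * (2 * h) + r % h + h) / h = 2 * (r / h / 2) + 1 ∧
    (r / h / 2 * (2 * h) + r % h + h) % h = r % h := by
  obtain ⟨h1, h2⟩ := mul_add_div_mod r hl
  have ho : r % h < h := Nat.mod_lt _ hh
  have hg : r / h / 2 < B := by
    rw [Nat.div_div_eq_div_mul]
    exact Nat.div_lt_of_lt_mul (by rwa [mul_comm h 2, mul_comm _ B])
  have key := fun a b c (hb : b < c) => mul_add_div_mod a hb
  refine ⟨h1, h2, by nlinarith, by rw [bflyRow, h1], by nlinarith,
    (key _ _ _ (by omega)).1, (key _ _ _ (by omega)).2, ?_, ?_, ?_, ?_, ?_, ?_⟩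
  · rw [add_assoc]; exact (key _ _ _ (by omega)).1
  · rw [add_assoc]; exact (key _ _ _ (by omega)).2
  · rw [show r / h / 2 * (2 * h) + r % h = (2 * (r / h / 2)) * h + r % h by ring]
    exact (key _ _ _ ho).1
  · rw [show r / h / 2 * (2 * h) + r % h = (2 * (r / h / 2)) * h + r % h by ring]
    exact (key _ _ _ ho).2
  · rw [show r / h / 2 * (2 * h) + r % h + h = (2 * (r / h / 2) + 1) * h + r % h by ring]
    exact (key _ _ _ ho).1
  · rw [show r / h / 2 * (2 * h) + r % h + h = (2 * (r / h / 2) + 1) * h + r % h by ring]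
    exact (key _ _ _ ho).2

/-- The shift e is at most L, so adding 2L before the reduction modulo 2L keeps the index a natural
number. If the reduced index t is at least L, the value is minus the one at t - L, and the sign is
absorbed by exchanging the two operands of the subtraction. -/
theorem Rep.bfly {L h B : ℕ} (hh : 0 < h) (hL : h ∣ L) {A : ℕ → ℕ → ℤ → ZMod (2 ^ w)}
    (hA : ∀ g o, Anti L (A g o))
    (hX : Rep w X (B * (2 * h)) L fun r => A (r / (2 * h)) (r % (2 * h)))
    (hY : ∀ k < B * (2 * h) * L, Y k = bflyVal w L h X k) :
    Rep w Y (B * (2 * h)) L fun r =>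
      if r / h % 2 = 0 then A (r / h / 2) (r % h) + A (r / h / 2) (r % h + h)
      else sh ((L / h : ℕ) * (r % h : ℕ)) (A (r / h / 2) (r % h) - A (r / h / 2) (r % h + h)) := by
  intro r hr l hl
  obtain ⟨h1, h2, h3, h4, h5, h6, h7, h8, h9, -⟩ := row_facts hh hr hl
  have r0 := fun t (ht : t < L) => hX (r / h / 2 * (2 * h) + r % h) (by omega) t ht
  have r1 := fun t (ht : t < L) => hX (r / h / 2 * (2 * h) + r % h + h) (by omega) t ht
  simp only [h6, h7, h8, h9] at r0 r1
  simp only [add_mul (_ + _) h L] at r1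
  rw [hY _ h3, bflyVal, h1, h2, h4]
  by_cases hb : r / h % 2 = 0
  · simp only [hb, if_true]
    exact addw_spec (r0 l hl).2 (r1 l hl).2
  · simp only [hb, if_false]
    set e := L / h * (r % h) with he
    have hel : e ≤ L := (Nat.mul_le_mul_left _ (Nat.mod_lt r hh).le).trans
      (Nat.div_mul_le_self L h)
    set t := (l + 2 * L - e) % (2 * L) with htd
    have htl : t < 2 * L := Nat.mod_lt _ (by omega)
    obtain ⟨c, hc⟩ : ∃ c, l + 2 * L - e = t + c * (2 * L) :=
      ⟨(l + 2 * L - e) / (2 * L), by rw [htd]; exact (Nat.mod_add_div' _ _).symm⟩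
    have hk : ((l : ℤ) - (L / h : ℕ) * (r % h : ℕ)) = t + (c - 1 : ℤ) * (2 * L) := by
      rw [← Nat.cast_mul, ← he]
      zify [show e ≤ l + 2 * L by omega] at hc
      linarith
    simp only [sh, Pi.sub_apply, (hA _ _).apply_eq hk]
    by_cases ht : t < L
    · simp only [ht, if_true]
      exact subw_spec (r0 t ht).2 (r1 t ht)
    · simp only [ht, if_false]
      rw [neg_sub_neg]
      exact subw_spec (r1 (t - L) (by omega)).2 (r0 (t - L) (by omega))

/-- Only the second row is shifted back before the sum and the difference are formed. When the
shifted index passes L, the change of sign turns the sum into a difference and vice versa. -/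
theorem Rep.inv {L h B : ℕ} (hh : 0 < h) (hL : h ∣ L) {A : ℕ → ℕ → ℤ → ZMod (2 ^ w)}
    (hA : ∀ g o, Anti L (A g o))
    (hX : Rep w X (B * (2 * h)) L fun r => A (r / h) (r % h))
    (hY : ∀ k < B * (2 * h) * L, Y k = invVal w L h X k) :
    Rep w Y (B * (2 * h)) L fun r =>
      if r / h % 2 = 0 then A (2 * (r / h / 2)) (r % h) +
        sh (-((L / h : ℕ) * (r % h : ℕ))) (A (2 * (r / h / 2) + 1) (r % h))
      else A (2 * (r / h / 2)) (r % h) -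
        sh (-((L / h : ℕ) * (r % h : ℕ))) (A (2 * (r / h / 2) + 1) (r % h)) := by
  intro r hr l hl
  obtain ⟨h1, h2, h3, h4, h5, -, -, -, -, h6, h7, h8, h9⟩ := row_facts hh hr hl
  have r0 := fun t (ht : t < L) => hX (r / h / 2 * (2 * h) + r % h) (by omega) t ht
  have r1 := fun t (ht : t < L) => hX (r / h / 2 * (2 * h) + r % h + h) (by omega) t ht
  simp only [h6, h7, h8, h9] at r0 r1
  simp only [add_mul (_ + _) h L] at r1
  rw [hY _ h3, invVal, h1, h2, h4]
  set e := L / h * (r % h) with he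
  have hel : e ≤ L := (Nat.mul_le_mul_left _ (Nat.mod_lt r hh).le).trans
    (Nat.div_mul_le_self L h)
  set t := (l + e) % (2 * L) with htd
  have htl : t < 2 * L := Nat.mod_lt _ (by omega)
  obtain ⟨c, hc⟩ : ∃ c, l + e = t + c * (2 * L) :=
    ⟨(l + e) / (2 * L), by rw [htd]; exact (Nat.mod_add_div' _ _).symm⟩
  have hk : ((l : ℤ) - -((L / h : ℕ) * (r % h : ℕ))) = t + (c : ℤ) * (2 * L) := by
    rw [← Nat.cast_mul, ← he]
    zify at hc
    linarith
  have hb := Nat.mod_two_eq_zero_or_one (r / h)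
  by_cases ht : t < L
  · rw [if_pos ht]
    rcases hb with hb | hb
    · simp only [hb, if_true, Pi.add_apply, sh, (hA _ _).apply_eq hk, ht]
      exact addw_spec (r0 l hl).2 (r1 t ht).2
    · simp only [hb, one_ne_zero, if_false, Pi.sub_apply, sh, (hA _ _).apply_eq hk, ht, if_true]
      exact subw_spec (r0 l hl).2 (r1 t ht)
  · rw [if_neg ht]
    have ht' : t - L < L := by omega
    rcases hb with hb | hb
    · simp only [hb, Nat.sub_zero, one_ne_zero, if_true, Pi.add_apply, sh, (hA _ _).apply_eq hk, ht,
        if_false, ← sub_eq_add_neg]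
      exact subw_spec (r0 l hl).2 (r1 _ ht')
    · simp only [hb, one_ne_zero, if_false, Pi.sub_apply, sh, (hA _ _).apply_eq hk, ht, if_true,
        Nat.sub_self]
      rw [sub_neg_eq_add]
      exact addw_spec (r0 l hl).2 (r1 _ ht').2

/-- The recursion ends with products modulo y² + 1, multiplied as Gaussian integers are; the minus
sign is the value at -1. -/
theorem Rep.base {Q : ℕ} {φ : ℕ → ℤ → ZMod (2 ^ w)} (hφ : ∀ b, Anti 2 (φ b))
    (hX : Rep w X (2 * Q) 2 φ) (hY : ∀ k < Q * 2, Y k = baseVal w X k (Q * 2)) :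
    Rep w Y Q 2 fun b => negMul 2 (φ b) (φ (Q + b)) := by
  intro r hr l hl
  have f0 := hX r (by omega) 0 (by norm_num)
  have f1 := hX r (by omega) 1 (by norm_num)
  have g0 := hX (Q + r) (by omega) 0 (by norm_num)
  have g1 := hX (Q + r) (by omega) 1 (by norm_num)
  rw [hY _ (by omega), baseVal]
  simp only [negMul, sum_range_succ, range_zero, sum_empty, zero_add]
  obtain rfl | rfl : l = 0 ∨ l = 1 := by omega
  · rw [if_pos (by omega)]
    have hm : φ (Q + r) (-1) = -φ (Q + r) 1 := by
      rw [← (hφ _).sub]; norm_num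
    simp only [Nat.cast_zero, Nat.cast_one, sub_zero, zero_sub, hm, mul_neg, ← sub_eq_add_neg]
    rw [show Q * 2 + (r * 2 + 0) = (Q + r) * 2 + 0 by ring,
      show (Q + r) * 2 + 0 + 1 = (Q + r) * 2 + 1 by ring]
    exact subw_spec (mulw_spec f0.2 g0.2).2 (mulw_spec f1.2 g1.2)
  · rw [if_neg (by omega)]
    simp only [Nat.cast_zero, Nat.cast_one, sub_zero, sub_self]
    rw [show Q * 2 + (r * 2 + 1) = (Q + r) * 2 + 1 by ring, Nat.add_sub_cancel,
      Nat.add_sub_cancel]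
    exact addw_spec (mulw_spec f0.2 g1.2).2 (mulw_spec f1.2 g0.2).2

/-- Coefficients i and i + M overlap after a shift by one in y. At l = 0 the shifted index is -1,
that is, minus the last entry of the row, which is why the first column is subtracted and all others
are added. -/
theorem Rep.fold {L M Q : ℕ} (hL : 0 < L) {f : ℕ → ℕ → ℤ → ZMod (2 ^ w)}
    (hf : ∀ q j, Anti L (f q j))
    (hX : Rep w X (Q * (2 * M)) L fun r => f (r / (2 * M)) (r % (2 * M)))
    {φ : ℕ → ℤ → ZMod (2 ^ w)}
    (hφ : ∀ q, ∀ l : ℤ, ∀ j < M, φ q (l * M + j) = f q j l + f q (j + M) (l - 1))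
    (hY : ∀ k < Q * (L * M), Y k = foldVal w L M X k) :
    Rep w Y Q (L * M) φ := by
  intro q hq k hk
  have hM : 0 < M := Nat.pos_of_ne_zero fun h => by simp [h] at hk
  have hj : k % M < M := Nat.mod_lt _ hM
  have hl : k / M < L := Nat.div_lt_of_lt_mul (by rwa [mul_comm])
  have hkk : k = k / M * M + k % M := by rw [mul_comm]; exact (Nat.div_add_mod k M).symm
  have e1 : (q * (L * M) + k) % M = k % M := by
    rw [← mul_assoc, Nat.mul_add_mod_self_right]
  have e2 : (q * (L * M) + k) / M = q * L + k / M := by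
    rw [← mul_assoc, mul_comm, Nat.mul_add_div hM]
  have e3 : (q * L + k / M) / L = q := by
    rw [mul_comm, Nat.mul_add_div hL, Nat.div_eq_of_lt hl, add_zero]
  have e4 : (q * L + k / M) % L = k / M := (mul_add_div_mod q hl).2
  have key : ∀ b < 2 * M, (q * (2 * M) + b) / (2 * M) = q ∧ (q * (2 * M) + b) % (2 * M) = b :=
    fun b hb => mul_add_div_mod q hb
  have r0 := fun l (hl : l < L) => hX (q * (2 * M) + k % M) (by nlinarith) l hl
  have r1 := fun l (hl : l < L) => hX (q * (2 * M) + k % M + M) (by nlinarith) l hl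
  simp only [add_assoc _ (k % M) M, (key (k % M) (by omega)).1, (key (k % M) (by omega)).2,
    (key (k % M + M) (by omega)).1, (key (k % M + M) (by omega)).2] at r0 r1
  have hv : φ q k = f q (k % M) ((k / M : ℕ) : ℤ) + f q (k % M + M) ((k / M : ℕ) - 1) := by
    rw [← hφ q _ _ hj]; congr 1; exact_mod_cast hkk
  rw [hY _ (by nlinarith), foldVal, e1, e2, e3, e4, hv]
  simp only [add_assoc _ (k % M) M]
  split_ifs with h0
  · have : f q (k % M + M) ((k / M : ℕ) - 1) = -f q (k % M + M) ((L - 1 : ℕ) : ℤ) := by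
      rw [h0, ← (hf _ _).sub]; congr 1; push_cast [show 1 ≤ L by omega]; ring
    rw [this, ← sub_eq_add_neg]
    exact subw_spec (r0 _ hl).2 (r1 _ (by omega))
  · rw [show ((k / M : ℕ) : ℤ) - 1 = ((k / M - 1 : ℕ) : ℤ) by omega]
    exact addw_spec (r0 _ hl).2 (r1 _ (by omega)).2

end Negacyclic

/-! ### Rules for bounded expressions and for passes over arrays. -/

namespace WordRAM

section rules

variable {w n V : ℕ} {Q : Store → ℕ → Prop} {σ : Store} {t : ℕ}

/-- The value z is given by hand so that the postcondition mentions a mathematical term and not the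
evaluation of an expression; overflow is reduced to bounds on the atoms and a decidable bound on the
degree. -/
theorem wp_set_bd (hV : Fits w n V) (hn : σ.v .n = n) {x : Var} {e : Ex} (z : ℕ) (hx : x ≠ .n)
    (he : e.bd w V σ) (hd : e.deg ≤ 11) (hz : e.ev w σ = z)
    (h : Q (σ.set x z) (t + (e.cost + 1))) : WP w (.set x e) Q σ t :=
  wp_set hx (he.ok hV hn hd) (by rwa [hz])

theorem wp_wr_bd (hV : Fits w n V) (hn : σ.v .n = n) {a : Arr} {i e : Ex} (y z : ℕ)
    (hi : i.bd w V σ) (hdi : i.deg ≤ 11) (hr : a = .raw → i.ev w σ < 6 * n)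
    (he : e.ok w σ) (hy : i.ev w σ = y) (hz : e.ev w σ = z)
    (h : Q (σ.put a y z) (t + (i.cost + 8 + (e.cost + 1)))) (hQ : ∀ σ t t', t' ≤ t → Q σ t → Q σ t') :
    WP w (.wr a i e) Q σ t := by
  refine wp_wr (hi.ok hV hn hdi) (hi.okAddr hV hn hdi hr) he ?_
  rw [hy, hz]
  refine hQ _ _ _ ?_ h
  have := addrCost_le a
  omega

theorem ok_rd (hV : Fits w n V) (hn : σ.v .n = n) {a : Arr} {i : Ex}
    (hi : i.bd w V σ) (hdi : i.deg ≤ 11) (hr : a = .raw → i.ev w σ < 6 * n) :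
    (Ex.rd a i).ok w σ :=
  ⟨hi.ok hV hn hdi, hi.okAddr hV hn hdi hr⟩

theorem wp_ite_bd (hV : Fits w n V) (hn : σ.v .n = n) {e : Ex} {p q : Cmd}
    (he : e.bd w V σ) (hd : e.deg ≤ 11)
    (ht : e.ev w σ ≠ 0 → WP w p Q σ (t + (e.cost + 1)))
    (hf : e.ev w σ = 0 → WP w q Q σ (t + (e.cost + 1))) : WP w (.ite e p q) Q σ t :=
  wp_ite (he.ok hV hn hd) ht hf

/-- A loop whose `k`-th iteration writes `val k` into entry `k` of an array. -/
theorem wp_for_map {i b : Var} {dst : Arr} {p : Cmd} (val : ℕ → ℕ) (B : ℕ)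
    (hin : i ≠ .n) (hib : i ≠ b) (hpi : p.mv i = false) (hpb : p.mv b = false)
    (hma : ∀ a, a ≠ dst → p.ma a = false)
    (hb : σ.v b < 2 ^ w) (hw : 1 < 2 ^ w)
    (hbody : ∀ k τ t, k < σ.v b → τ.v i = k → (∀ x, x ≠ i → p.mv x = false → τ.v x = σ.v x) →
      (∀ a, a ≠ dst → τ.a a = σ.a a) →
      WP w p (fun τ' t' => τ'.a dst = Function.update (τ.a dst) k (val k) ∧ t' ≤ t + B) τ t)
    (hQ : ∀ σ' t', Frame (.for i b p) σ σ' →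
      (σ'.a dst = fun k => if k < σ.v b then val k else σ.a dst k) →
      t' ≤ t + σ.v b * (B + 8) + 6 → Q σ' t') :
    WP w (.for i b p) Q σ t := by
  refine WP.mono (R := fun σ' t' => (σ'.a dst = fun k => if k < σ.v b then val k else σ.a dst k) ∧
      t' ≤ t + σ.v b * (B + 8) + 6) ?_ (fun σ' t' hf h => hQ σ' t' hf h.1 h.2)
  refine wp_for (fun k σ' t' => (∀ x, x ≠ i → p.mv x = false → σ'.v x = σ.v x) ∧
      (∀ a, a ≠ dst → σ'.a a = σ.a a) ∧
      (σ'.a dst = fun j => if j < k then val j else σ.a dst j) ∧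
      t' ≤ t + k * (B + 8) + 2) hin hib hpi hpb hb hw ?_ ?_ ?_
  · exact ⟨fun x hx _ => by simp [hx], fun a _ => rfl, by simp, by omega⟩
  · rintro k τ t' hk hi hb' ⟨h₁, h₂, h₃, h₄⟩
    refine (hbody k τ _ hk hi h₁ h₂).mono ?_
    rintro τ' t'' hf ⟨h₅, h₆⟩
    refine ⟨fun x hx hm => ?_, fun a ha => ?_, ?_, ?_⟩
    · simp only [Store.set_v, hx, if_false]
      rw [hf.v x hm, h₁ x hx hm]
    · rw [Store.set_a, hf.a a (hma a ha), h₂ a ha]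
    · rw [Store.set_a, h₅, h₃]
      funext j
      rw [Function.update_apply]
      split_ifs with g₁ g₂ g₃ <;> first | rfl | (exfalso; omega) | rw [g₁]
    · rw [add_mul, one_mul]; omega
  · rintro σ' t' - - ⟨-, -, h₃, h₄⟩
    exact ⟨h₃, by omega⟩

/-- Recompute the first `Z` entries of the array `work`, by way of the array `temp`. -/
def passCmd (p : Cmd) : Cmd :=
  .for .i .Z p ;; .for .i .Z (.wr .work (.v .i) (.rd .temp (.v .i)))

/-- New entries depend on old entries at other positions, so they are collected in `temp` and copied
back only after all have been computed. The body may change no array but `temp`, hence `val` can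
refer to the array `work` before the pass. -/
theorem wp_pass (hV : Fits w n V) (hn : σ.v .n = n) {p : Cmd} (val : ℕ → ℕ) (B : ℕ)
    (hpi : p.mv .i = false) (hpb : p.mv .Z = false) (hpn : p.mv .n = false)
    (hma : ∀ a, a ≠ .temp → p.ma a = false)
    (hb : σ.v .Z < V)
    (hbody : ∀ k τ t, k < σ.v .Z → τ.v .i = k → (∀ x, x ≠ .i → p.mv x = false → τ.v x = σ.v x) →
      (∀ a, a ≠ .temp → τ.a a = σ.a a) →
      WP w p (fun τ' t' => τ'.a .temp = Function.update (τ.a .temp) k (val k) ∧ t' ≤ t + B) τ t)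
    (hQ : ∀ σ' t', Frame (passCmd p) σ σ' →
      (σ'.a .work = fun k => if k < σ.v .Z then val k else σ.a .work k) →
      t' ≤ t + σ.v .Z * (B + 36) + 12 → Q σ' t') :
    WP w (passCmd p) Q σ t := by
  refine WP.mono (R := fun σ' t' =>
    (σ'.a .work = fun k => if k < σ.v .Z then val k else σ.a .work k) ∧
      t' ≤ t + σ.v .Z * (B + 36) + 12) ?_ (fun σ' t' hf h => hQ σ' t' hf h.1 h.2)
  refine wp_seq ?_
  refine wp_for_map (dst := .temp) val B (by decide) (by decide) hpi hpb hma (hV.lt hb) hV.one_lt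
    hbody ?_
  intro σ₁ t₁ hf h₁ h₂
  have hZ : σ₁.v .Z = σ.v .Z := hf.v _ (by simp [Cmd.for, Cmd.mv, hpb])
  have hn₁ : σ₁.v .n = n := by rw [hf.v _ (by simp [Cmd.for, Cmd.mv, hpn]), hn]
  have hw₁ : σ₁.a .work = σ.a .work := hf.a _ (by simp [Cmd.for, Cmd.ma, hma])
  refine wp_for_map (dst := .work) val 20 (by decide) (by decide) rfl rfl ?_
    (hV.lt (by rwa [hZ])) hV.one_lt ?_ ?_
  · intro a ha; simp [Cmd.ma, ha.symm]
  · intro k τ t hk hi hv ha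
    have hkV : k < V := by rw [hZ] at hk; omega
    have hn' : τ.v .n = n := by rw [hv _ (by decide) rfl, hn₁]
    refine wp_wr_bd hV hn' k (val k) (by simp [hi, hkV]) (by decide) (by simp)
      (ok_rd hV hn' (by simp [hi, hkV]) (by decide) (by simp)) (by simp [hi]) ?_ ?_ ?_
    · simp only [Ex.ev_rd, Ex.ev_v, hi, ha .temp (by decide), h₁]
      rw [if_pos (by rwa [hZ] at hk)]
    · simp [addrCost]
    · rintro σ t t' ht ⟨h, h'⟩
      exact ⟨h, by omega⟩
  · intro σ₂ t₂ hf₂ h₃ h₄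
    rw [hZ] at h₃ h₄
    refine ⟨by rw [h₃, hw₁], ?_⟩
    rw [mul_add] at *
    omega

end rules

open Negacyclic

/-! ### The passes of the transform as commands. -/

/-- Split blocks into slices. -/
def expandBody : Cmd :=
  .l ≔ Ex.v .i % .v .L ;; .o ≔ Ex.v .i / .v .L % (.c 2 * .v .M) ;;
  .g ≔ Ex.v .i / .v .L / (.c 2 * .v .M) ;;
  .ite (.bin .lt (.v .o) (.v .M))
    (.wr .temp (.v .i) (.rd .work ((Ex.v .g * .v .L + .v .l) * .v .M + .v .o)))
    (.wr .temp (.v .i) (.c 0))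

/-- Compute the indices that a butterfly needs. -/
def bflyIdx : Cmd :=
  .l ≔ Ex.v .i % .v .L ;; .o ≔ Ex.v .i / .v .L % .v .h ;; .b ≔ Ex.v .i / .v .L / .v .h % .c 2 ;;
  .g ≔ (Ex.v .i / .v .L / .v .h / .c 2 * (.c 2 * .v .h) + .v .o) * .v .L ;;
  .e ≔ Ex.v .g + .v .h * .v .L

/-- A butterfly of the transform. -/
def bflyBody : Cmd :=
  bflyIdx ;;
  .ite (.bin .eq (.v .b) (.c 0))
    (.wr .temp (.v .i) (.bin .addW (.rd .work (Ex.v .g + .v .l)) (.rd .work (Ex.v .e + .v .l))))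
    (.t ≔ (Ex.v .l + .c 2 * .v .L - .v .L / .v .h * .v .o) % (.c 2 * .v .L) ;;
      .ite (.bin .lt (.v .t) (.v .L))
        (.wr .temp (.v .i) (.bin .subW (.rd .work (Ex.v .g + .v .t)) (.rd .work (Ex.v .e + .v .t))))
        (.wr .temp (.v .i) (.bin .subW (.rd .work (Ex.v .e + (.v .t - .v .L)))
          (.rd .work (Ex.v .g + (.v .t - .v .L))))))

/-- A butterfly of the inverse transform. -/
def invBody : Cmd :=
  bflyIdx ;;
  .t ≔ (Ex.v .l + .v .L / .v .h * .v .o) % (.c 2 * .v .L) ;;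
  .ite (.bin .lt (.v .t) (.v .L))
    (.ite (.bin .eq (.v .b) (.c 0))
      (.wr .temp (.v .i) (.bin .addW (.rd .work (Ex.v .g + .v .l)) (.rd .work (Ex.v .e + .v .t))))
      (.wr .temp (.v .i) (.bin .subW (.rd .work (Ex.v .g + .v .l)) (.rd .work (Ex.v .e + .v .t)))))
    (.ite (.bin .eq (Ex.c 1 - .v .b) (.c 0))
      (.wr .temp (.v .i)
        (.bin .addW (.rd .work (Ex.v .g + .v .l)) (.rd .work (Ex.v .e + (.v .t - .v .L)))))
      (.wr .temp (.v .i)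
        (.bin .subW (.rd .work (Ex.v .g + .v .l)) (.rd .work (Ex.v .e + (.v .t - .v .L))))))

/-- The products of blocks of length `2`. -/
def baseBody : Cmd :=
  .ite (.bin .eq (Ex.v .i % .c 2) (.c 0))
    (.wr .temp (.v .i) (.bin .subW (.bin .mulW (.rd .work (.v .i)) (.rd .work (Ex.v .Z + .v .i)))
      (.bin .mulW (.rd .work (Ex.v .i + .c 1)) (.rd .work (Ex.v .Z + .v .i + .c 1)))))
    (.wr .temp (.v .i) (.bin .addW (.bin .mulW (.rd .work (Ex.v .i - .c 1)) (.rd .work (Ex.v .Z + .v .i)))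
      (.bin .mulW (.rd .work (.v .i)) (.rd .work (Ex.v .Z + .v .i - .c 1)))))

/-- Reassemble blocks from slices. -/
def foldBody : Cmd :=
  .l ≔ Ex.v .i / .v .M % .v .L ;;
  .g ≔ Ex.v .i / .v .M / .v .L * (.c 2 * .v .M) + Ex.v .i % .v .M ;;
  .ite (.bin .eq (.v .l) (.c 0))
    (.wr .temp (.v .i) (.bin .subW (.rd .work (Ex.v .g * .v .L + .v .l))
      (.rd .work ((Ex.v .g + .v .M) * .v .L + (.v .L - .c 1)))))
    (.wr .temp (.v .i) (.bin .addW (.rd .work (Ex.v .g * .v .L + .v .l))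
      (.rd .work ((Ex.v .g + .v .M) * .v .L + (.v .l - .c 1)))))

section bodies

variable {w n V : ℕ} {Q : Store → ℕ → Prop} {σ : Store} {t : ℕ}

theorem wp_expand (hV : Fits w n V) (hn : σ.v .n = n) (hZ : σ.v .Z < V) (hL : σ.v .L < V)
    (hM : σ.v .M < V)
    (hQ : ∀ σ' t', Frame (passCmd expandBody) σ σ' →
      (∀ k < σ.v .Z, σ'.a .work k = expandVal (σ.v .L) (σ.v .M) (σ.a .work) k) →
      t' ≤ t + σ.v .Z * 200 + 12 → Q σ' t') :
    WP w (passCmd expandBody) Q σ t := by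
  refine wp_pass hV hn (expandVal (σ.v .L) (σ.v .M) (σ.a .work)) 100 (by decide) (by decide)
    (by decide) ?_ hZ ?_ ?_
  · intro a ha; cases a <;> first | rfl | exact absurd rfl ha
  · intro k τ t hk hi hv ha
    have hkV : k < V := hk.trans hZ
    have hn' : τ.v .n = n := by rw [hv _ (by decide) (by decide), hn]
    have hL' : τ.v .L = σ.v .L := hv _ (by decide) (by decide)
    have hM' : τ.v .M = σ.v .M := hv _ (by decide) (by decide)
    have hw' := ha .work (by decide)
    have h2 := hV.two_le
    have h17 := hV.num
    simp only [numArr] at h17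
    have hd : ∀ a b, a < V → a / b < V := fun a b h => (Nat.div_le_self _ _).trans_lt h
    have hm : ∀ a b, a < V → a % b < V := fun a b h => (Nat.mod_le _ _).trans_lt h
    generalize σ.v .L = L at *
    generalize σ.v .M = M at *
    refine wp_seq (wp_set_bd hV hn' (k % L) (by decide) (by simp [hi, hL', *]) (by decide)
      (by simp [hi, hL']) ?_)
    refine wp_seq (wp_set_bd hV (by simp [hn']) (k / L % (2 * M)) (by decide)
      (by simp [hi, hL', hM', *]; omega) (by decide) (by simp [hi, hL', hM']) ?_)
    refine wp_seq (wp_set_bd hV (by simp [hn']) (k / L / (2 * M)) (by decide)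
      (by simp [hi, hL', hM', *]; omega) (by decide) (by simp [hi, hL', hM']) ?_)
    refine wp_ite_bd hV (by simp [hn']) (by simp [hM', hm, hd, hkV, hM]) (by decide) ?_ ?_
    · intro h
      have h : k / L % (2 * M) < M := by simpa [hM'] using h
      refine wp_wr_bd hV (by simp [hn']) k (expandVal L M (σ.a .work) k) (by simp [hi, hkV])
        (by decide) (by simp) (ok_rd hV (by simp [hn'])
          (by simp [hi, hL', hM', hm, hd, hkV, hM, hL]) (by decide) (by simp)) (by simp [hi]) ?_ ?_ ?_
      · simp [expandVal, h, hw', hL', hM']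
      · simp [addrCost]
      · rintro σ t t' ht ⟨h, h'⟩
        exact ⟨h, by omega⟩
    · intro h
      have h : ¬ k / L % (2 * M) < M := by simpa [hM'] using h
      refine wp_wr_bd hV (by simp [hn']) k (expandVal L M (σ.a .work) k) (by simp [hi, hkV])
        (by decide) (by simp) (Ex.bd.ok hV (n := n) (by simp [hn']) (by simp; omega) (by decide))
          (by simp [hi]) ?_ ?_ ?_
      · simp [expandVal, h]
      · simp [addrCost]
      · rintro σ t t' ht ⟨h, h'⟩
        exact ⟨h, by omega⟩
  · intro σ' t' hf h₁ h₂
    refine hQ σ' t' hf (fun k hk => by rw [h₁]; exact if_pos hk) (by omega)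

/-- The first row of a butterfly never lies behind the row being written, so the reads are bounded
in terms of k and the distance h L. -/
theorem bflyRow_mul_le (L h k : ℕ) : bflyRow L h k * L ≤ k := by
  have h1 : bflyRow L h k ≤ k / L := by
    rw [bflyRow, ← mul_assoc]
    calc k / L / h / 2 * 2 * h + k / L % h ≤ k / L / h * h + k / L % h := by
          gcongr; exact Nat.div_mul_le_self _ _
      _ = k / L := Nat.div_add_mod' _ _
  exact (Nat.mul_le_mul_right _ h1).trans (Nat.div_mul_le_self _ _)

theorem wp_bflyIdx (hV : Fits w n V) (hn : σ.v .n = n) (hi : σ.v .i < V) (hL : σ.v .L < V)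
    (hh : σ.v .h < V) (hr : σ.v .i + σ.v .h * σ.v .L < V)
    (hQ : ∀ σ' t', (∀ x, bflyIdx.mv x = false → σ'.v x = σ.v x) → σ'.a = σ.a →
      σ'.v .l = σ.v .i % σ.v .L → σ'.v .o = σ.v .i / σ.v .L % σ.v .h →
      σ'.v .b = σ.v .i / σ.v .L / σ.v .h % 2 →
      σ'.v .g = bflyRow (σ.v .L) (σ.v .h) (σ.v .i) * σ.v .L →
      σ'.v .e = bflyRow (σ.v .L) (σ.v .h) (σ.v .i) * σ.v .L + σ.v .h * σ.v .L →
      t' ≤ t + 50 → Q σ' t') :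
    WP w bflyIdx Q σ t := by
  refine WP.mono (R := fun σ' t' => σ'.a = σ.a ∧
      σ'.v .l = σ.v .i % σ.v .L ∧ σ'.v .o = σ.v .i / σ.v .L % σ.v .h ∧
      σ'.v .b = σ.v .i / σ.v .L / σ.v .h % 2 ∧
      σ'.v .g = bflyRow (σ.v .L) (σ.v .h) (σ.v .i) * σ.v .L ∧
      σ'.v .e = bflyRow (σ.v .L) (σ.v .h) (σ.v .i) * σ.v .L + σ.v .h * σ.v .L ∧
      t' ≤ t + 50) ?_ (fun σ' t' hf h => hQ σ' t' hf.v h.1 h.2.1 h.2.2.1 h.2.2.2.1 h.2.2.2.2.1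
        h.2.2.2.2.2.1 h.2.2.2.2.2.2)
  have h17 := hV.num
  simp only [numArr] at h17
  have hd : ∀ a b, a < V → a / b < V := fun a b h => (Nat.div_le_self _ _).trans_lt h
  have hm : ∀ a b, a < V → a % b < V := fun a b h => (Nat.mod_le _ _).trans_lt h
  have hrow := bflyRow_mul_le (σ.v .L) (σ.v .h) (σ.v .i)
  have h2 : 2 < V := by omega
  have hg : bflyRow (σ.v .L) (σ.v .h) (σ.v .i) * σ.v .L < V := by omega
  refine wp_seq (wp_set_bd hV hn (σ.v .i % σ.v .L) (by decide) (by simp [hi, hL]) (by decide)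
    (by simp) ?_)
  refine wp_seq (wp_set_bd hV (by simp [hn]) (σ.v .i / σ.v .L % σ.v .h) (by decide)
    (by simp [hi, hL, hh]) (by decide) (by simp) ?_)
  refine wp_seq (wp_set_bd hV (by simp [hn]) (σ.v .i / σ.v .L / σ.v .h % 2) (by decide)
    (by simp [hi, hL, hh, h2]) (by decide) (by simp) ?_)
  refine wp_seq (wp_set_bd hV (by simp [hn]) (bflyRow (σ.v .L) (σ.v .h) (σ.v .i) * σ.v .L)
    (by decide) (by simp [hi, hL, hh, h2, hd, hm]) (by decide) (by simp [bflyRow]) ?_)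
  refine wp_set_bd hV (by simp [hn])
    (bflyRow (σ.v .L) (σ.v .h) (σ.v .i) * σ.v .L + σ.v .h * σ.v .L)
    (by decide) (by simp [hL, hh, hg]) (by decide) (by simp) ?_
  simp

theorem wp_bfly (hV : Fits w n V) (hn : σ.v .n = n) (hL : 2 * σ.v .L < V)
    (hh : σ.v .h < V) (hr : σ.v .Z + σ.v .h * σ.v .L < V)
    (hQ : ∀ σ' t', Frame (passCmd bflyBody) σ σ' →
      (∀ k < σ.v .Z, σ'.a .work k = bflyVal w (σ.v .L) (σ.v .h) (σ.a .work) k) →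
      t' ≤ t + σ.v .Z * 200 + 12 → Q σ' t') :
    WP w (passCmd bflyBody) Q σ t := by
  refine wp_pass hV hn (bflyVal w (σ.v .L) (σ.v .h) (σ.a .work)) 150 (by decide) (by decide)
    (by decide) ?_ (by omega) ?_ ?_
  · intro a ha; cases a <;> first | rfl | exact absurd rfl ha
  · intro k τ t hk hi hv ha
    have hn' : τ.v .n = n := by rw [hv _ (by decide) (by decide), hn]
    have hL' : τ.v .L = σ.v .L := hv _ (by decide) (by decide)
    have hh' : τ.v .h = σ.v .h := hv _ (by decide) (by decide)
    have hw' := ha .work (by decide)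
    have h17 := hV.num
    simp only [numArr] at h17
    have h2 : 2 < V := by omega
    have h0 : 0 < V := by omega
    have hd : ∀ a b, a < V → a / b < V := fun a b h => (Nat.div_le_self _ _).trans_lt h
    have hm : ∀ a b, a < V → a % b < V := fun a b h => (Nat.mod_le _ _).trans_lt h
    generalize σ.v .L = L at *
    generalize σ.v .h = h at *
    have hkV : k < V := by omega
    have hLV : L < V := by omega
    have hrow := bflyRow_mul_le L h k
    refine wp_seq (wp_bflyIdx hV hn' (by rw [hi]; omega) (by omega) (by omega)
      (by rw [hi, hL', hh']; omega) ?_)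
    rw [hi, hL', hh']
    intro σ₁ t₁ hv₁ ha₁ hl ho hb hg he ht₁
    have hi₁ : σ₁.v .i = k := by rw [hv₁ _ (by decide), hi]
    have hn₁ : σ₁.v .n = n := by rw [hv₁ _ (by decide), hn']
    have hL₁ : σ₁.v .L = L := by rw [hv₁ _ (by decide), hL']
    have hh₁ : σ₁.v .h = h := by rw [hv₁ _ (by decide), hh']
    have hw₁ : σ₁.a .work = σ.a .work := by rw [ha₁, hw']
    have hgV : bflyRow L h k * L < V := by omega
    have heV : bflyRow L h k * L + h * L < V := by omega
    have hlV : k % L < V := hm _ _ hkV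
    have hoV : k / L % h < V := hm _ _ (hd _ _ hkV)
    have hzero : σ₁.a .temp = τ.a .temp := by rw [ha₁]
    refine wp_ite_bd hV hn₁ (by simp only [Ex.bd_eq, Ex.bd_v, Ex.bd_c, hb]; omega) (by decide) ?_ ?_
    · intro hc
      have hc : k / L / h % 2 = 0 := by simpa [hb] using hc
      refine wp_wr_bd hV hn₁ k (bflyVal w L h (σ.a .work) k) (by simp [hi₁, hkV]) (by decide)
        (by simp) ⟨ok_rd hV hn₁ (by simp [hg, hl, hgV, hlV]) (by decide) (by simp),
          ok_rd hV hn₁ (by simp [he, hl, heV, hlV]) (by decide) (by simp), trivial⟩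
        (by simp [hi₁]) ?_ ?_ ?_
      · simp [bflyVal, hc, addw, hg, hl, he, hw₁]
      · simp [addrCost, hzero]; omega
      · rintro σ t t' ht ⟨h, h'⟩
        exact ⟨h, by omega⟩
    · intro hc
      have hc : ¬k / L / h % 2 = 0 := by simpa [hb] using hc
      have hle : L / h * (k / L % h) ≤ k % L + 2 * L := by
        rcases Nat.eq_zero_or_pos h with h0 | h0
        · simp [h0]
        · exact ((Nat.mul_le_mul_left _ (Nat.mod_lt _ h0).le).trans
            (Nat.div_mul_le_self L h)).trans (by omega)
      refine wp_seq (wp_set_bd hV hn₁ ((k % L + 2 * L - L / h * (k / L % h)) % (2 * L)) (by decide)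
        ?_ (by decide) ?_ ?_)
      · simpa [hl, hL₁, hh₁, ho, hlV, h2, hd, hm, hoV, hLV] using ⟨by omega, hle⟩
      · simp [hl, hL₁, hh₁, ho]
      set T := (k % L + 2 * L - L / h * (k / L % h)) % (2 * L) with hT
      have hTV : T < V := by
        rcases Nat.eq_zero_or_pos L with h0 | h0
        · simp [hT, h0]; omega
        · exact (Nat.mod_lt _ (by omega)).trans hL
      refine wp_ite_bd hV (by simp [hn₁]) (by simp [hL₁, hTV, hLV]) (by decide) ?_ ?_
      · intro hc'
        have hc' : T < L := by simpa [hL₁] using hc'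
        refine wp_wr_bd hV (by simp [hn₁]) k (bflyVal w L h (σ.a .work) k) (by simp [hi₁, hkV])
          (by decide) (by simp) ⟨ok_rd hV (by simp [hn₁]) (by simp [hg, hgV, hTV]) (by decide)
            (by simp), ok_rd hV (by simp [hn₁]) (by simp [he, heV, hTV]) (by decide) (by simp),
            trivial⟩ (by simp [hi₁]) ?_ ?_ ?_
        · simp [bflyVal, hc, ← hT, hc', subw, hg, he, hw₁]
        · simp [addrCost, hzero]; omega
        · rintro σ t t' ht ⟨h, h'⟩
          exact ⟨h, by omega⟩
      · intro hc'
        have hc' : ¬T < L := by simpa [hL₁] using hc'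
        have hc'' : L ≤ T := by omega
        refine wp_wr_bd hV (by simp [hn₁]) k (bflyVal w L h (σ.a .work) k) (by simp [hi₁, hkV])
          (by decide) (by simp) ⟨ok_rd hV (by simp [hn₁])
            (by simp [he, heV, hTV, hL₁, hLV, hc'']) (by decide) (by simp),
            ok_rd hV (by simp [hn₁]) (by simp [hg, hgV, hTV, hL₁, hLV, hc'']) (by decide)
            (by simp), trivial⟩ (by simp [hi₁]) ?_ ?_ ?_
        · simp [bflyVal, hc, ← hT, hc', subw, hg, he, hw₁, hL₁]
        · simp [addrCost, hzero]; omega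
        · rintro σ t t' ht ⟨h, h'⟩
          exact ⟨h, by omega⟩
  · intro σ' t' hf h₁ h₂
    refine hQ σ' t' hf (fun k hk => by rw [h₁]; exact if_pos hk) (by omega)

theorem wp_inv (hV : Fits w n V) (hn : σ.v .n = n) (hL : 2 * σ.v .L < V)
    (hh : σ.v .h < V) (hr : σ.v .Z + σ.v .h * σ.v .L < V)
    (hQ : ∀ σ' t', Frame (passCmd invBody) σ σ' →
      (∀ k < σ.v .Z, σ'.a .work k = invVal w (σ.v .L) (σ.v .h) (σ.a .work) k) →
      t' ≤ t + σ.v .Z * 200 + 12 → Q σ' t') :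
    WP w (passCmd invBody) Q σ t := by
  refine wp_pass hV hn (invVal w (σ.v .L) (σ.v .h) (σ.a .work)) 150 (by decide) (by decide)
    (by decide) ?_ (by omega) ?_ ?_
  · intro a ha; cases a <;> first | rfl | exact absurd rfl ha
  · intro k τ t hk hi hv ha
    have hn' : τ.v .n = n := by rw [hv _ (by decide) (by decide), hn]
    have hL' : τ.v .L = σ.v .L := hv _ (by decide) (by decide)
    have hh' : τ.v .h = σ.v .h := hv _ (by decide) (by decide)
    have hw' := ha .work (by decide)
    have h17 := hV.num
    simp only [numArr] at h17
    have h2 : 2 < V := by omega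
    have h1 : 1 < V := by omega
    have h0 : 0 < V := by omega
    have hd : ∀ a b, a < V → a / b < V := fun a b h => (Nat.div_le_self _ _).trans_lt h
    have hm : ∀ a b, a < V → a % b < V := fun a b h => (Nat.mod_le _ _).trans_lt h
    generalize σ.v .L = L at *
    generalize σ.v .h = h at *
    have hkV : k < V := by omega
    have hLV : L < V := by omega
    have hrow := bflyRow_mul_le L h k
    refine wp_seq (wp_bflyIdx hV hn' (by rw [hi]; omega) (by omega) (by omega)
      (by rw [hi, hL', hh']; omega) ?_)
    rw [hi, hL', hh']
    intro σ₁ t₁ hv₁ ha₁ hl ho hb hg he ht₁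
    have hi₁ : σ₁.v .i = k := by rw [hv₁ _ (by decide), hi]
    have hn₁ : σ₁.v .n = n := by rw [hv₁ _ (by decide), hn']
    have hL₁ : σ₁.v .L = L := by rw [hv₁ _ (by decide), hL']
    have hh₁ : σ₁.v .h = h := by rw [hv₁ _ (by decide), hh']
    have hw₁ : σ₁.a .work = σ.a .work := by rw [ha₁, hw']
    have hgV : bflyRow L h k * L < V := by omega
    have heV : bflyRow L h k * L + h * L < V := by omega
    have hlV : k % L < V := hm _ _ hkV
    have hoV : k / L % h < V := hm _ _ (hd _ _ hkV)
    have hb1 : k / L / h % 2 ≤ 1 := by omega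
    have hbV : k / L / h % 2 < V := by omega
    have hzero : σ₁.a .temp = τ.a .temp := by rw [ha₁]
    refine wp_seq (wp_set_bd hV hn₁ ((k % L + L / h * (k / L % h)) % (2 * L)) (by decide)
      (by simp [hl, hL₁, hh₁, ho, hlV, h2, hd, hm, hoV, hLV]; omega) (by decide)
      (by simp [hl, hL₁, hh₁, ho]) ?_)
    set T := (k % L + L / h * (k / L % h)) % (2 * L) with hT
    have hTV : T < V := by
      rcases Nat.eq_zero_or_pos L with h0 | h0
      · simp only [hT, h0]; simp; omega
      · exact (Nat.mod_lt _ (by omega)).trans hL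
    refine wp_ite_bd hV (by simp [hn₁]) (by simp [hL₁, hTV, hLV]) (by decide) ?_ ?_
    · intro hc'
      have hc' : T < L := by simpa [hL₁] using hc'
      refine wp_ite_bd hV (by simp [hn₁]) (by simp [hb, hbV, h0]) (by decide) ?_ ?_
      all_goals
        intro hc
        have hc := hc
        simp only [Ex.ev_eq, Ex.ev_v, Ex.ev_c, Store.set_v, reduceCtorEq, if_false, hb, ne_eq,
          ite_eq_right_iff, one_ne_zero, imp_false, not_not] at hc
        refine wp_wr_bd hV (by simp [hn₁]) k (invVal w L h (σ.a .work) k) (by simp [hi₁, hkV])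
          (by decide) (by simp) ⟨ok_rd hV (by simp [hn₁]) (by simp [hg, hgV, hl, hlV]) (by decide)
            (by simp), ok_rd hV (by simp [hn₁]) (by simp [he, heV, hTV]) (by decide) (by simp),
            trivial⟩ (by simp [hi₁]) ?_ ?_ ?_
        · simp [invVal, hc, ← hT, hc', addw, subw, hg, he, hw₁, hl]
        · simp [addrCost, hzero]; omega
        · rintro σ t t' ht ⟨h, h'⟩
          exact ⟨h, by omega⟩
    · intro hc'
      have hc' : ¬T < L := by simpa [hL₁] using hc'
      have hc'' : L ≤ T := by omega
      refine wp_ite_bd hV (by simp [hn₁]) (by simpa [hb, hbV, h0, h1] using hb1) (by decide) ?_ ?_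
      all_goals
        intro hc
        have hc := hc
        simp only [Ex.ev_eq, Ex.ev_v, Ex.ev_c, Ex.ev_sub, Store.set_v, reduceCtorEq, if_false, hb,
          ne_eq, ite_eq_right_iff, one_ne_zero, imp_false, not_not] at hc
        refine wp_wr_bd hV (by simp [hn₁]) k (invVal w L h (σ.a .work) k) (by simp [hi₁, hkV])
          (by decide) (by simp) ⟨ok_rd hV (by simp [hn₁]) (by simp [hg, hgV, hl, hlV]) (by decide)
            (by simp), ok_rd hV (by simp [hn₁]) (by simp [he, heV, hTV, hL₁, hLV, hc''])
            (by decide) (by simp), trivial⟩ (by simp [hi₁]) ?_ ?_ ?_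
        · simp only [Ex.ev_addW, Ex.ev_subW, Ex.ev_rd, Ex.ev_add, Ex.ev_sub, Ex.ev_v, Store.set_v,
            reduceCtorEq, if_false, if_true, Store.set_a, hg, he, hw₁, hl, hL₁, invVal, ← hT, hc',
            hc, addw, subw]
        · simp [addrCost, hzero]; omega
        · rintro σ t t' ht ⟨h, h'⟩
          exact ⟨h, by omega⟩
  · intro σ' t' hf h₁ h₂
    refine hQ σ' t' hf (fun k hk => by rw [h₁]; exact if_pos hk) (by omega)

theorem wp_base (hV : Fits w n V) (hn : σ.v .n = n) (hZ : σ.v .Z < V)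
    (hQ : ∀ σ' t', Frame (passCmd baseBody) σ σ' →
      (∀ k < σ.v .Z, σ'.a .work k = baseVal w (σ.a .work) k (σ.v .Z)) →
      t' ≤ t + σ.v .Z * 200 + 12 → Q σ' t') :
    WP w (passCmd baseBody) Q σ t := by
  refine wp_pass hV hn (fun k => baseVal w (σ.a .work) k (σ.v .Z)) 150 (by decide) (by decide)
    (by decide) ?_ hZ ?_ ?_
  · intro a ha; cases a <;> first | rfl | exact absurd rfl ha
  · intro k τ t hk hi hv ha
    have hn' : τ.v .n = n := by rw [hv _ (by decide) (by decide), hn]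
    have hZ' : τ.v .Z = σ.v .Z := hv _ (by decide) (by decide)
    have hw' := ha .work (by decide)
    have h17 := hV.num
    simp only [numArr] at h17
    generalize σ.v .Z = Z at *
    have hkV : k < V := by omega
    have h2 : 2 < V := by omega
    have h1 : 1 < V := by omega
    have h0 : 0 < V := by omega
    refine wp_ite_bd hV hn' (by simp [hi, hkV, h2, h0]) (by decide) ?_ ?_
    · intro hc
      have hc : k % 2 = 0 := by simpa [hi] using hc
      refine wp_wr_bd hV hn' k (baseVal w (σ.a .work) k Z) (by simp [hi, hkV]) (by decide)
        (by simp) ⟨⟨ok_rd hV hn' (by simp [hi, hkV]) (by decide) (by simp),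
          ok_rd hV hn' (by simp [hi, hkV, hZ', hZ]) (by decide) (by simp), trivial⟩,
          ⟨ok_rd hV hn' (by simp [hi, hkV, h1]) (by decide) (by simp),
          ok_rd hV hn' (by simp [hi, hkV, hZ', hZ, h1]) (by decide) (by simp), trivial⟩, trivial⟩
        (by simp [hi]) ?_ ?_ ?_
      · simp [baseVal, hc, subw, mulw, hi, hZ', hw']
      · simp [addrCost]
      · rintro σ t t' ht ⟨h, h'⟩
        exact ⟨h, by omega⟩
    · intro hc
      have hc : ¬ k % 2 = 0 := by simpa [hi] using hc
      have hk1 : 1 ≤ k := by omega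
      refine wp_wr_bd hV hn' k (baseVal w (σ.a .work) k Z) (by simp [hi, hkV]) (by decide)
        (by simp) ⟨⟨ok_rd hV hn' (by simp [hi, hkV, h1, hk1]) (by decide) (by simp),
          ok_rd hV hn' (by simp [hi, hkV, hZ', hZ]) (by decide) (by simp), trivial⟩,
          ⟨ok_rd hV hn' (by simp [hi, hkV, h1]) (by decide) (by simp),
          ok_rd hV hn' (by simp [hi, hkV, hZ', hZ, h1]; omega) (by decide) (by simp), trivial⟩,
          trivial⟩ (by simp [hi]) ?_ ?_ ?_
      · simp [baseVal, hc, addw, mulw, hi, hZ', hw']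
      · simp [addrCost]
      · rintro σ t t' ht ⟨h, h'⟩
        exact ⟨h, by omega⟩
  · intro σ' t' hf h₁ h₂
    refine hQ σ' t' hf (fun k hk => by rw [h₁]; exact if_pos hk) (by omega)

theorem wp_fold (hV : Fits w n V) (hn : σ.v .n = n) (hZ : σ.v .Z < V) (hL : σ.v .L < V)
    (hL0 : 0 < σ.v .L) (hM : σ.v .M < V) (hr : 2 * σ.v .Z + 2 * σ.v .M < V)
    (hQ : ∀ σ' t', Frame (passCmd foldBody) σ σ' →
      (∀ k < σ.v .Z, σ'.a .work k = foldVal w (σ.v .L) (σ.v .M) (σ.a .work) k) →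
      t' ≤ t + σ.v .Z * 200 + 12 → Q σ' t') :
    WP w (passCmd foldBody) Q σ t := by
  refine wp_pass hV hn (foldVal w (σ.v .L) (σ.v .M) (σ.a .work)) 150 (by decide) (by decide)
    (by decide) ?_ hZ ?_ ?_
  · intro a ha; cases a <;> first | rfl | exact absurd rfl ha
  · intro k τ t hk hi hv ha
    have hn' : τ.v .n = n := by rw [hv _ (by decide) (by decide), hn]
    have hL' : τ.v .L = σ.v .L := hv _ (by decide) (by decide)
    have hM' : τ.v .M = σ.v .M := hv _ (by decide) (by decide)
    have hw' := ha .work (by decide)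
    have h17 := hV.num
    simp only [numArr] at h17
    have hd : ∀ a b, a < V → a / b < V := fun a b h => (Nat.div_le_self _ _).trans_lt h
    have hm : ∀ a b, a < V → a % b < V := fun a b h => (Nat.mod_le _ _).trans_lt h
    generalize σ.v .Z = Z at *
    generalize σ.v .L = L at *
    generalize σ.v .M = M at *
    have hkV : k < V := by omega
    have h2 : 2 < V := by omega
    have h1 : 1 < V := by omega
    have h0 : 0 < V := by omega
    have hlV : k / M % L < V := hm _ _ (hd _ _ hkV)
    -- Folding halves the number of rows, so the row that is read can have about twice the index k;
    -- it is at most 2k + M.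
    have hgV : k / M / L * (2 * M) + k % M < V := by
      have e1 : k / M / L * M ≤ k :=
        (Nat.mul_le_mul_right _ (Nat.div_le_self _ _)).trans (Nat.div_mul_le_self _ _)
      have e2 : k % M ≤ k := Nat.mod_le _ _
      have e3 : k % M ≤ M ∨ M = 0 := by
        rcases Nat.eq_zero_or_pos M with h | h
        · exact .inr h
        · exact .inl (Nat.mod_lt _ h).le
      rw [show k / M / L * (2 * M) = 2 * (k / M / L * M) by ring]
      rcases e3 with e3 | rfl
      · omega
      · simp; omega
    refine wp_seq (wp_set_bd hV hn' (k / M % L) (by decide)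
      (by simp [hi, hL', hM', hd, hkV, hL, hM]) (by decide) (by simp [hi, hL', hM']) ?_)
    refine wp_seq (wp_set_bd hV (by simp [hn']) (k / M / L * (2 * M) + k % M) (by decide)
      (by simp [hi, hL', hM', hd, hkV, hL, hM, h2]) (by decide) (by simp [hi, hL', hM']) ?_)
    refine wp_ite_bd hV (by simp [hn']) (by simp [hlV, h0]) (by decide) ?_ ?_
    · intro hc
      have hc : k / M % L = 0 := by simpa using hc
      refine wp_wr_bd hV (by simp [hn']) k (foldVal w L M (σ.a .work) k) (by simp [hi, hkV])
        (by decide) (by simp) ⟨ok_rd hV (by simp [hn']) (by simp [hgV, hL', hL, hlV]) (by decide)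
          (by simp), ok_rd hV (by simp [hn']) (by simp [hgV, hL', hL, hM', hM, h1]; omega)
          (by decide) (by simp), trivial⟩ (by simp [hi]) ?_ ?_ ?_
      · simp [foldVal, hc, subw, hL', hM', hw']
      · simp [addrCost]
      · rintro σ t t' ht ⟨h, h'⟩
        exact ⟨h, by omega⟩
    · intro hc
      have hc : ¬ k / M % L = 0 := by simpa using hc
      refine wp_wr_bd hV (by simp [hn']) k (foldVal w L M (σ.a .work) k) (by simp [hi, hkV])
        (by decide) (by simp) ⟨ok_rd hV (by simp [hn']) (by simp [hgV, hL', hL, hlV]) (by decide)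
          (by simp), ok_rd hV (by simp [hn']) (by simp [hgV, hL', hL, hM', hM, h1, hlV]; omega)
          (by decide) (by simp), trivial⟩ (by simp [hi]) ?_ ?_ ?_
      · simp [foldVal, hc, addw, hL', hM', hw']
      · simp [addrCost]
      · rintro σ t t' ht ⟨h, h'⟩
        exact ⟨h, by omega⟩
  · intro σ' t' hf h₁ h₂
    refine hQ σ' t' hf (fun k hk => by rw [h₁]; exact if_pos hk) (by omega)

end bodies

end WordRAM

/-! ### All stages of one transform, for many inputs at once. -/

namespace Negacyclic

variable {R : Type*} [CommRing R]

/-- The partial transforms of a sequence of inputs, blocks of all inputs counted together. -/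
def seqDFT (L a : ℕ) (f : ℕ → ℕ → ℤ → R) (s g o : ℕ) : ℤ → R :=
  partialDFT L a (f (g / 2 ^ s)) s (g % 2 ^ s) o

theorem seqDFT_anti {L a : ℕ} {f : ℕ → ℕ → ℤ → R} (hf : ∀ q j, Anti L (f q j)) (s g o : ℕ) :
    Anti L (seqDFT L a f s g o) :=
  partialDFT_anti (hf _) _ _ _

theorem seqDFT_zero (L a : ℕ) (f : ℕ → ℕ → ℤ → R) (g o : ℕ) : seqDFT L a f 0 g o = f g o := by
  simp [seqDFT, Nat.mod_one, partialDFT_zero]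

/-- The low bit of the block number g is the bit added by the new stage, and the high part names the
input. Halving g thus leads to the parent block of the same input, and all inputs share one pass. -/
theorem seqDFT_succ {L a h s : ℕ} {f : ℕ → ℕ → ℤ → R} (hf : ∀ q j, Anti L (f q j))
    (hs : s < a) (hh : h = 2 ^ (a - (s + 1))) (hL : h ∣ L) (g o : ℕ) :
    seqDFT L a f (s + 1) g o =
      if g % 2 = 0 then seqDFT L a f s (g / 2) o + seqDFT L a f s (g / 2) (o + h)
      else sh ((L / h : ℕ) * o)
        (seqDFT L a f s (g / 2) o - seqDFT L a f s (g / 2) (o + h)) := by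
  have h1 : g / 2 ^ (s + 1) = g / 2 / 2 ^ s := by rw [pow_succ', Nat.div_div_eq_div_mul]
  have h2 : g % 2 ^ (s + 1) = g % 2 + 2 * (g / 2 % 2 ^ s) := by rw [pow_succ', Nat.mod_mul]
  have key := partialDFT_succ (hf (g / 2 / 2 ^ s)) hs hh hL (g / 2 % 2 ^ s) o
  unfold seqDFT
  rw [h1, h2]
  rcases Nat.mod_two_eq_zero_or_one g with h | h
  · rw [if_pos h, h, zero_add]; exact key.1
  · rw [if_neg (by omega), h, add_comm 1]; exact key.2

end Negacyclic

namespace WordRAM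

open Negacyclic

/-- The lengths of the blocks and the number of slices on a level. -/
def paramsCmd : Cmd :=
  .L ≔ .bin .shl (.c 1) (Ex.v .ui / .c 2 + .c 1) ;;
  .M ≔ .bin .shl (.c 1) (Ex.v .ui - .v .ui / .c 2)

/-- The butterflies of all stages. -/
def stagesCmd : Cmd := .h ≔ .v .M ;; .loop (.v .h) (passCmd bflyBody ;; .h ≔ Ex.v .h / .c 2)

/-- One level of the transform. -/
def fwdLevel : Cmd :=
  paramsCmd ;; .Z ≔ Ex.c 4 * .v .N * .v .pw ;; passCmd expandBody ;; stagesCmd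

/-- The inverse butterflies of all stages. -/
def invStagesCmd : Cmd :=
  .h ≔ .c 1 ;; .loop (.bin .lt (.v .h) (Ex.c 2 * .v .M)) (passCmd invBody ;; .h ≔ Ex.c 2 * .v .h)

/-- One level of the inverse transform. -/
def bwdLevel : Cmd :=
  paramsCmd ;; .Z ≔ Ex.c 2 * .v .N * .v .pw ;; invStagesCmd ;;
  .Z ≔ Ex.v .N * .v .pw ;; passCmd foldBody ;; .dv ≔ Ex.v .dv * (.c 2 * .v .M)

section levels

variable {w n V : ℕ} {Q : Store → ℕ → Prop} {σ : Store} {t : ℕ}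

theorem wp_params (hV : Fits w n V) (hn : σ.v .n = n) (U : ℕ) (hU : σ.v .ui = U)
    (hUV : U < V) (hL : 2 ^ (U / 2 + 1) < V)
    (hM : 2 ^ (U - U / 2) < V)
    (hQ : Q ((σ.set .L (2 ^ (U / 2 + 1))).set .M (2 ^ (U - U / 2))) (t + 16)) :
    WP w paramsCmd Q σ t := by
  have h17 := hV.num
  simp only [numArr] at h17
  have h1 : 1 < V := by omega
  have h2 : 2 < V := by omega
  refine wp_seq (wp_set_bd hV hn (2 ^ (U / 2 + 1)) (by decide)
    (by simp [hU, h1, h2, hUV, hL]) (by decide) (by simp [hU]) ?_)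
  refine wp_set_bd hV (by simp [hn]) (2 ^ (U - U / 2)) (by decide)
    (by simp [hU, h1, h2, hUV, hM]; omega) (by decide) (by simp [hU]) ?_
  simpa using hQ

theorem wp_stages (hV : Fits w n V) (hn : σ.v .n = n) {L a B : ℕ} (hL : σ.v .L = L)
    (hM : σ.v .M = 2 ^ a) (hZ : σ.v .Z = B * 2 ^ (a + 1) * L) (hLV : 2 * L < V)
    (hZV : 2 * σ.v .Z < V) (haL : 2 ^ a ∣ L) (hB : 0 < B) (hL0 : 0 < L)
    {f : ℕ → ℕ → ℤ → ZMod (2 ^ w)} (hf : ∀ q j, Anti L (f q j))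
    (hX : Rep w (σ.a .work) (B * 2 ^ (a + 1)) L fun r => f (r / 2 ^ (a + 1)) (r % 2 ^ (a + 1)))
    (hQ : ∀ σ' t', Frame stagesCmd σ σ' →
      Rep w (σ'.a .work) (B * 2 ^ (a + 1)) L (fun r => seqDFT L (a + 1) f (a + 1) r 0) →
      t' ≤ t + 10 + (a + 1) * (σ.v .Z * 200 + 24) → Q σ' t') :
    WP w stagesCmd Q σ t := by
  refine WP.mono (R := fun σ' t' =>
    Rep w (σ'.a .work) (B * 2 ^ (a + 1)) L (fun r => seqDFT L (a + 1) f (a + 1) r 0) ∧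
      t' ≤ t + 10 + (a + 1) * (σ.v .Z * 200 + 24)) ?_ (fun σ' t' hf h => hQ σ' t' hf h.1 h.2)
  have h17 := hV.num
  simp only [numArr] at h17
  have hpow : ∀ k ≤ a + 1, 2 * 2 ^ k * L ≤ 2 * σ.v .Z := by
    intro k hk
    rw [hZ, mul_assoc, mul_assoc B]
    refine Nat.mul_le_mul_left _ ?_
    calc 2 ^ k * L ≤ 2 ^ (a + 1) * L := by gcongr; norm_num
      _ ≤ _ := Nat.le_mul_of_pos_left _ hB
  have hpV : ∀ k ≤ a + 1, 2 ^ k < V := by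
    intro k hk
    have h1 := hpow k hk
    have h2 : 2 * 2 ^ k ≤ 2 * 2 ^ k * L := Nat.le_mul_of_pos_right _ hL0
    omega
  refine wp_seq (wp_set_bd hV hn (2 ^ a) (by decide) (by simp [hM, hpV a (by omega)]) (by decide)
    (by simp [hM]) ?_)
  -- Here k counts the stages still to come. The value 2^k / 2 is zero exactly for k = 0, so the
  -- half-distance itself serves as the guard of the loop.
  refine wp_loop (fun k σ' t' => k ≤ a + 1 ∧ σ'.v .n = n ∧ σ'.v .L = L ∧ σ'.v .Z = σ.v .Z ∧
    σ'.v .h = 2 ^ k / 2 ∧ Rep w (σ'.a .work) (B * 2 ^ (a + 1)) L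
      (fun r => seqDFT L (a + 1) f (a + 1 - k) (r / 2 ^ k) (r % 2 ^ k)) ∧
    t' + k * (σ.v .Z * 200 + 24) ≤ t + 8 + (a + 1) * (σ.v .Z * 200 + 24)) (a + 1) ?_ ?_ ?_ ?_
  · refine ⟨le_rfl, by simp [hn], by simp [hL], by simp, by simp [pow_succ], ?_, by simp⟩
    refine hX.congr fun r _ => ?_
    rw [Nat.sub_self, seqDFT_zero]
  · rintro k σ' t' ⟨-, -, -, -, hh, -, -⟩
    refine ⟨trivial, ?_⟩
    simp only [Ex.ev_v, hh]
    cases k with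
    | zero => simp
    | succ k => simp [pow_succ]
  · rintro k σ' t' ⟨hk, hn', hL', hZ', hh, hX', ht'⟩
    have hh : σ'.v .h = 2 ^ k := by rw [hh, pow_succ]; simp
    have hpk := hpow k (by omega)
    have hsplit : B * 2 ^ (a + 1) = B * 2 ^ (a - k) * (2 * 2 ^ k) := by
      rw [← pow_succ', mul_assoc, ← pow_add]; congr 2; omega
    refine wp_seq (wp_bfly hV hn' (by omega) (by rw [hh]; exact hpV k (by omega))
      (by rw [hZ', hh, hL']; rw [mul_assoc] at hpk; omega) ?_)
    intro σ₁ t₁ hf₁ hw₁ ht₁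
    have hh₁ : σ₁.v .h = 2 ^ k := by rw [hf₁.v _ (by decide), hh]
    have hn₁ : σ₁.v .n = n := by rw [hf₁.v _ (by decide), hn']
    have hL₁ : σ₁.v .L = L := by rw [hf₁.v _ (by decide), hL']
    have hZ₁ : σ₁.v .Z = σ.v .Z := by rw [hf₁.v _ (by decide), hZ']
    refine wp_set_bd hV hn₁ (2 ^ k / 2) (by decide)
      (by simp [hh₁, hpV k (by omega)]; omega) (by decide) (by simp [hh₁]) ?_
    refine ⟨by omega, by simp [hn₁], by simp [hL₁], by simp [hZ₁], by simp, ?_, ?_⟩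
    · have hdvd : 2 ^ k ∣ L := (pow_dvd_pow 2 (by omega)).trans haL
      rw [Store.set_a, hsplit]
      rw [hsplit] at hX'
      refine (Rep.bfly (A := fun g o => seqDFT L (a + 1) f (a - k) g o) (by positivity) hdvd
        (fun g o => seqDFT_anti hf _ _ _) (hX'.congr fun r _ => ?_) ?_).congr fun r _ => ?_
      · rw [← pow_succ', show a + 1 - (k + 1) = a - k by omega]
      · intro j hj
        rw [hw₁ j (by rw [hZ', hZ, hsplit]; exact hj), hL', hh]
      · rw [show a + 1 - k = a - k + 1 by omega, seqDFT_succ hf (by omega) (by congr 1; omega) hdvd]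
    · rw [hZ'] at ht₁
      rw [add_mul, one_mul] at ht'
      simp at ht₁ ⊢
      omega
  · rintro σ' t' ⟨-, -, -, -, -, hX', ht'⟩
    refine ⟨hX'.congr fun r _ => by simp [Nat.mod_one], ?_⟩
    simp
    omega

/-- Adding and subtracting F + G and F - G gives 2F and 2G. The factor 2 cannot be cancelled modulo
2^w, so every stage doubles the scalar in front; a scalar c on entry makes the statement fit for use
on all levels of the recursion. -/
theorem wp_invStages (hV : Fits w n V) (hn : σ.v .n = n) {L a B : ℕ} (hL : σ.v .L = L)
    (hM : σ.v .M = 2 ^ a) (hZ : σ.v .Z = B * 2 ^ (a + 1) * L) (hLV : 2 * L < V)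
    (hZV : 2 * σ.v .Z < V) (haL : 2 ^ a ∣ L) (hB : 0 < B) (hL0 : 0 < L)
    {f : ℕ → ℕ → ℤ → ZMod (2 ^ w)} (hf : ∀ q j, Anti L (f q j)) {c : ℕ}
    (hX : Rep w (σ.a .work) (B * 2 ^ (a + 1)) L
      fun r => (c : ZMod (2 ^ w)) • seqDFT L (a + 1) f (a + 1) r 0)
    (hQ : ∀ σ' t', Frame invStagesCmd σ σ' →
      Rep w (σ'.a .work) (B * 2 ^ (a + 1)) L (fun r => ((c * 2 ^ (a + 1) : ℕ) : ZMod (2 ^ w)) •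
        f (r / 2 ^ (a + 1)) (r % 2 ^ (a + 1))) →
      t' ≤ t + 10 + (a + 1) * (σ.v .Z * 200 + 24) → Q σ' t') :
    WP w invStagesCmd Q σ t := by
  refine WP.mono (R := fun σ' t' =>
    Rep w (σ'.a .work) (B * 2 ^ (a + 1)) L (fun r => ((c * 2 ^ (a + 1) : ℕ) : ZMod (2 ^ w)) •
        f (r / 2 ^ (a + 1)) (r % 2 ^ (a + 1))) ∧
      t' ≤ t + 10 + (a + 1) * (σ.v .Z * 200 + 24)) ?_ (fun σ' t' hf h => hQ σ' t' hf h.1 h.2)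
  have h17 := hV.num
  simp only [numArr] at h17
  have hpow : ∀ k ≤ a + 1, 2 * 2 ^ k * L ≤ 2 * σ.v .Z := by
    intro k hk
    rw [hZ, mul_assoc, mul_assoc B]
    refine Nat.mul_le_mul_left _ ?_
    calc 2 ^ k * L ≤ 2 ^ (a + 1) * L := by gcongr; norm_num
      _ ≤ _ := Nat.le_mul_of_pos_left _ hB
  have hpV : ∀ k ≤ a + 1, 2 ^ k < V := by
    intro k hk
    have h1 := hpow k hk
    have h2 : 2 * 2 ^ k ≤ 2 * 2 ^ k * L := Nat.le_mul_of_pos_right _ hL0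
    omega
  refine wp_seq (wp_set_bd hV hn 1 (by decide) (by simp; omega) (by decide) (by simp) ?_)
  refine wp_loop (fun k σ' t' => k ≤ a + 1 ∧ σ'.v .n = n ∧ σ'.v .L = L ∧ σ'.v .Z = σ.v .Z ∧
    σ'.v .M = 2 ^ a ∧ σ'.v .h = 2 ^ (a + 1 - k) ∧ Rep w (σ'.a .work) (B * 2 ^ (a + 1)) L
      (fun r => ((c * 2 ^ (a + 1 - k) : ℕ) : ZMod (2 ^ w)) •
        seqDFT L (a + 1) f k (r / 2 ^ (a + 1 - k)) (r % 2 ^ (a + 1 - k))) ∧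
    t' + k * (σ.v .Z * 200 + 24) ≤ t + 2 + (a + 1) * (σ.v .Z * 200 + 24)) (a + 1) ?_ ?_ ?_ ?_
  · refine ⟨le_rfl, by simp [hn], by simp [hL], by simp, by simp [hM], by simp, ?_, by simp⟩
    refine hX.congr fun r _ => ?_
    simp [Nat.mod_one]
  · rintro k σ' t' ⟨hk, hn', -, -, hM', hh, -, -⟩
    refine ⟨Ex.bd.ok hV hn' ?_ (by decide), ?_⟩
    · simp only [Ex.bd_lt, Ex.bd_v, Ex.bd_mul, Ex.bd_c, hh, hM']
      exact ⟨hpV _ (by omega), by omega, hpV _ (by omega)⟩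
    · have hlt : 2 ^ (a + 1 - k) < 2 * 2 ^ a ↔ k ≠ 0 := by
        rw [← pow_succ', Nat.pow_lt_pow_iff_right (by norm_num)]; omega
      simp only [Ex.ev_lt, Ex.ev_v, Ex.ev_mul, Ex.ev_c, hh, hM', hlt]
      split_ifs <;> simp_all
  · rintro k σ' t' ⟨hk, hn', hL', hZ', hM', hh, hX', ht'⟩
    have hpk := hpow (a + 1 - (k + 1)) (by omega)
    have hsplit : B * 2 ^ (a + 1) = B * 2 ^ k * (2 * 2 ^ (a + 1 - (k + 1))) := by
      rw [← pow_succ', mul_assoc, ← pow_add]; congr 2; omega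
    refine wp_seq (wp_inv hV hn' (by omega) (by rw [hh]; exact hpV _ (by omega))
      (by rw [hZ', hh, hL']; rw [mul_assoc] at hpk; omega) ?_)
    intro σ₁ t₁ hf₁ hw₁ ht₁
    have hh₁ : σ₁.v .h = 2 ^ (a + 1 - (k + 1)) := by rw [hf₁.v _ (by decide), hh]
    have hn₁ : σ₁.v .n = n := by rw [hf₁.v _ (by decide), hn']
    have hL₁ : σ₁.v .L = L := by rw [hf₁.v _ (by decide), hL']
    have hM₁ : σ₁.v .M = 2 ^ a := by rw [hf₁.v _ (by decide), hM']
    have hZ₁ : σ₁.v .Z = σ.v .Z := by rw [hf₁.v _ (by decide), hZ']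
    have hexp : 2 ^ (a + 1 - k) = 2 * 2 ^ (a + 1 - (k + 1)) := by
      rw [← pow_succ']; congr 1; omega
    refine wp_set_bd hV hn₁ (2 ^ (a + 1 - k)) (by decide)
      (by simp only [Ex.bd_mul, Ex.bd_c, Ex.bd_v, hh₁]; exact ⟨by omega, hpV _ (by omega)⟩)
      (by decide) (by simp only [Ex.ev_mul, Ex.ev_c, Ex.ev_v, hh₁, hexp]) ?_
    refine ⟨by omega, by simp [hn₁], by simp [hL₁], by simp [hZ₁], by simp [hM₁], by simp, ?_, ?_⟩
    · set h := 2 ^ (a + 1 - (k + 1)) with hhd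
      have hdvd : h ∣ L := (pow_dvd_pow 2 (by omega)).trans haL
      rw [Store.set_a, hsplit, hexp]
      rw [hsplit] at hX'
      refine (Rep.inv (A := fun g o => ((c * h : ℕ) : ZMod (2 ^ w)) • seqDFT L (a + 1) f (k + 1) g o)
        (by positivity) hdvd (fun g o => (seqDFT_anti hf _ _ _).smul _) hX' ?_).congr
        fun r _ => ?_
      · intro j hj
        rw [hw₁ j (by rw [hZ', hZ, hsplit]; exact hj), hL', hh]
      · have hA0 := seqDFT_succ (s := k) hf (by omega) hhd hdvd (2 * (r / h / 2)) (r % h)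
        have hA1 := seqDFT_succ (s := k) hf (by omega) hhd hdvd (2 * (r / h / 2) + 1) (r % h)
        rw [if_pos (by omega), show 2 * (r / h / 2) / 2 = r / h / 2 by omega] at hA0
        rw [if_neg (by omega), show (2 * (r / h / 2) + 1) / 2 = r / h / 2 by omega] at hA1
        have e1 : r / (2 * h) = r / h / 2 := by rw [mul_comm, Nat.div_div_eq_div_mul]
        have e2 : r % (2 * h) = r % h + h * (r / h % 2) := by rw [mul_comm, Nat.mod_mul]
        have e3 : ∀ (e : ℤ) (x : ZMod (2 ^ w)) (F : ℤ → ZMod (2 ^ w)),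
          sh (-e) (x • sh e F) = x • F := by
          intro e x F
          have : sh (-e) (x • sh e F) = x • sh (-e) (sh e F) := rfl
          rw [this, sh_sh, neg_add_cancel, sh_zero]
        rw [hA0, hA1, e1, e2, e3]
        rcases Nat.mod_two_eq_zero_or_one (r / h) with hb | hb
        · rw [if_pos hb, hb, mul_zero, add_zero, ← smul_add]
          push_cast
          rw [show ∀ F G : ℤ → ZMod (2 ^ w), F + G + (F - G) = (2 : ZMod (2 ^ w)) • F by
            intro F G; rw [two_smul]; ring, smul_smul]
          congr 1; ring
        · rw [if_neg (by omega), hb, mul_one, ← smul_sub]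
          push_cast
          rw [show ∀ F G : ℤ → ZMod (2 ^ w), F + G - (F - G) = (2 : ZMod (2 ^ w)) • G by
            intro F G; rw [two_smul]; ring, smul_smul]
          congr 1; ring
    · rw [hZ'] at ht₁
      rw [add_mul, one_mul] at ht'
      simp at ht₁ ⊢
      omega
  · rintro σ' t' ⟨-, -, -, -, -, -, hX', ht'⟩
    refine ⟨hX'.congr fun r _ => by simp [seqDFT_zero], ?_⟩
    simp
    omega

end levels

end WordRAM

/-! ### The recursion of the transform and the product of polynomials. -/

namespace Negacyclic

variable {R : Type*} [CommRing R]

/-- The blocks on level `i` of the recursion that begins with blocks of length `2 ^ (u + 1)`. -/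
def levels (u : ℕ) (φ : ℕ → ℤ → R) : ℕ → ℕ → ℤ → R
  | 0 => φ
  | i + 1 => blocks (2 ^ (u / 2 ^ i / 2 + 1)) (2 ^ (u / 2 ^ i - u / 2 ^ i / 2))
      (u / 2 ^ i - u / 2 ^ i / 2 + 1) (levels u φ i)

/-- The number of blocks on level `i` that come from one initial block. -/
def rows (u : ℕ) : ℕ → ℕ
  | 0 => 1
  | i + 1 => rows u i * 2 ^ (u / 2 ^ i - u / 2 ^ i / 2 + 1)

theorem half_mul (U : ℕ) : 2 ^ (U / 2 + 1) * 2 ^ (U - U / 2) = 2 ^ (U + 1) := by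
  rw [← pow_add]; congr 1; omega

theorem div_two_pow_succ (u i : ℕ) : u / 2 ^ (i + 1) = u / 2 ^ i / 2 := by
  rw [pow_succ, Nat.div_div_eq_div_mul]

theorem levels_anti {u : ℕ} {φ : ℕ → ℤ → R} (hφ : ∀ b, Anti (2 ^ (u + 1)) (φ b)) (i b : ℕ) :
    Anti (2 ^ (u / 2 ^ i + 1)) (levels u φ i b) := by
  induction i generalizing b with
  | zero => simpa [levels] using hφ b
  | succ i ih =>
    rw [div_two_pow_succ]
    exact blocks_anti (fun b => by rw [half_mul]; exact ih b) b

theorem rows_pos (u i : ℕ) : 0 < rows u i := by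
  induction i with
  | zero => simp [rows]
  | succ i ih => rw [rows]; positivity

/-- Each level pads M slices to 2M rows and thereby doubles the amount of data. -/
theorem rows_mul (u i : ℕ) : rows u i * 2 ^ (u / 2 ^ i + 1) = 2 ^ (u + 1) * 2 ^ i := by
  induction i with
  | zero => simp [rows]
  | succ i ih =>
    rw [rows, div_two_pow_succ, mul_assoc, ← pow_add]
    generalize u / 2 ^ i = U at ih ⊢
    rw [show U - U / 2 + 1 + (U / 2 + 1) = U + 1 + 1 by omega, pow_succ 2 (U + 1), ← mul_assoc, ih]
    ring

end Negacyclic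

namespace WordRAM

open Negacyclic

theorem wp_wr_val {w n V : ℕ} {Q : Store → ℕ → Prop} {σ : Store} {t : ℕ} (hV : Fits w n V)
    (hn : σ.v .n = n) {a : Arr} {i e : Ex} (y z : ℕ)
    (hi : i.bd w V σ) (hdi : i.deg ≤ 11) (hr : a = .raw → i.ev w σ < 6 * n)
    (he : e.ok w σ) (hy : i.ev w σ = y) (hz : e.ev w σ = z)
    (h : Q (σ.put a y z) (t + (i.cost + (max 1 (addrCost a) + (e.cost + 1))))) :
    WP w (.wr a i e) Q σ t := by
  refine wp_wr (hi.ok hV hn hdi) (hi.okAddr hV hn hdi hr) he ?_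
  rwa [hy, hz]

/-- A loop with an invariant and a bound `B k` on the number of steps in the `k`-th iteration. -/
theorem wp_for_frame {w : ℕ} {Q : Store → ℕ → Prop} {σ : Store} {t : ℕ} {i b : Var} {p : Cmd}
    (inv : ℕ → Store → Prop) (B : ℕ → ℕ)
    (hin : i ≠ .n) (hib : i ≠ b) (hpi : p.mv i = false) (hpb : p.mv b = false)
    (hb : σ.v b < 2 ^ w) (hw : 1 < 2 ^ w) (h0 : inv 0 (σ.set i 0))
    (hbody : ∀ k τ t, k < σ.v b → τ.v i = k → τ.v b = σ.v b → Frame (.for i b p) σ τ → inv k τ →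
      WP w p (fun τ' t' => inv (k + 1) (τ'.set i (k + 1)) ∧ t' ≤ t + B k) τ t)
    (hQ : ∀ σ' t', Frame (.for i b p) σ σ' → inv (σ.v b) σ' →
      t' ≤ t + ∑ k ∈ range (σ.v b), (B k + 8) + 6 → Q σ' t') :
    WP w (.for i b p) Q σ t := by
  refine WP.mono (R := fun σ' t' => inv (σ.v b) σ' ∧ t' ≤ t + ∑ k ∈ range (σ.v b), (B k + 8) + 6) ?_
    (fun σ' t' hf h => hQ σ' t' hf h.1 h.2)
  refine wp_for (fun k σ' t' => Frame (.for i b p) σ σ' ∧ inv k σ' ∧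
      t' ≤ t + ∑ k ∈ range k, (B k + 8) + 2) hin hib hpi hpb hb hw ?_ ?_ ?_
  · refine ⟨⟨fun x hx => ?_, fun _ _ => rfl⟩, h0, by simp⟩
    simp only [Cmd.for, Cmd.mv, Bool.or_eq_false_iff, decide_eq_false_iff_not] at hx
    simp [Ne.symm hx.1]
  · rintro k τ t' hk hi hb' ⟨h₁, h₂, h₃⟩
    refine (hbody k τ _ hk hi hb' h₁ h₂).mono ?_
    rintro τ' t'' hf ⟨h₄, h₅⟩
    refine ⟨⟨fun x hx => ?_, fun c hc => ?_⟩, h₄, by rw [sum_range_succ]; omega⟩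
    · have hx' := hx
      simp only [Cmd.for, Cmd.mv, Bool.or_eq_false_iff, decide_eq_false_iff_not] at hx'
      simp [Ne.symm hx'.1, hf.v x hx'.2.1, h₁.v x hx]
    · have hc' := hc
      simp only [Cmd.for, Cmd.ma, Bool.or_eq_false_iff] at hc'
      rw [Store.set_a, hf.a c hc'.2.1, h₁.a c hc]
  · rintro σ' t' - - ⟨-, h₃, h₄⟩
    exact ⟨h₃, by omega⟩

/-- All levels of the transform. -/
def fwdCmd : Cmd :=
  .pw ≔ .c 1 ;; .ui ≔ .v .u ;;
  .loop (.v .ui) (fwdLevel ;; .pw ≔ Ex.c 2 * .v .pw ;; .ui ≔ Ex.v .u / .v .pw)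

/-- All levels of the inverse transform. -/
def bwdCmd : Cmd :=
  .dv ≔ .c 1 ;;
  .loop (.bin .lt (.c 1) (.v .pw))
    (.pw ≔ Ex.v .pw / .c 2 ;; .ui ≔ Ex.v .u / .v .pw ;; bwdLevel)

/-- The product of two polynomials that are held in the two halves of the array `work`. -/
def mulCmd : Cmd :=
  fwdCmd ;; .Z ≔ Ex.v .N * .v .pw ;; passCmd baseBody ;; bwdCmd ;;
  .for .i .N (.wr .work (.v .i) (Ex.rd .work (.v .i) / .v .dv))

section mul

variable {w n V : ℕ} {Q : Store → ℕ → Prop} {σ : Store} {t : ℕ}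

/-- Both factors of the product lie behind one another in `work` and are transformed together, which
explains 2NP entries before the level; padding doubles this to 4NP. -/
theorem wp_fwdLevel (hV : Fits w n V) (hn : σ.v .n = n) {U P N B : ℕ} (hU : σ.v .ui = U)
    (hP : σ.v .pw = P) (hN : σ.v .N = N) (hUV : U < V) (hNP : 2 * N * P = B * 2 ^ (U + 1))
    (hNV : 8 * N * P < V) (hP0 : 0 < P) (hB : 0 < B) {φ : ℕ → ℤ → ZMod (2 ^ w)}
    (hφ : ∀ b, Anti (2 ^ (U + 1)) (φ b)) (hX : Rep w (σ.a .work) B (2 ^ (U + 1)) φ)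
    (hQ : ∀ σ' t', Frame fwdLevel σ σ' →
      Rep w (σ'.a .work) (B * 2 ^ (U - U / 2 + 1)) (2 ^ (U / 2 + 1))
        (blocks (2 ^ (U / 2 + 1)) (2 ^ (U - U / 2)) (U - U / 2 + 1) φ) →
      t' ≤ t + 60 + (U + 2) * (4 * N * P * 200 + 24) → Q σ' t') :
    WP w fwdLevel Q σ t := by
  refine WP.mono (R := fun σ' t' => _ ∧ _) ?_ (fun σ' t' hf h => hQ σ' t' hf h.1 h.2)
  have h17 := hV.num
  simp only [numArr] at h17
  have hbig : 2 ^ (U + 1) ≤ 2 * N * P := hNP ▸ Nat.le_mul_of_pos_left _ hB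
  have hLM := half_mul U
  have hM0 : 0 < 2 ^ (U - U / 2) := by positivity
  have hL0 : 0 < 2 ^ (U / 2 + 1) := by positivity
  set L := 2 ^ (U / 2 + 1) with hLd
  set a := U - U / 2 with had
  have hM1 : 2 ^ (a + 1) = 2 * 2 ^ a := pow_succ' _ _
  have hLV : L ≤ 2 ^ (U + 1) := hLM ▸ Nat.le_mul_of_pos_right _ hM0
  have hMV : 2 ^ a ≤ 2 ^ (U + 1) := hLM ▸ Nat.le_mul_of_pos_left _ hL0
  have hNPV : 8 * N * P = 4 * (2 * N * P) := by ring
  have hZ4 : 4 * N * P = B * 2 ^ (a + 1) * L := by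
    rw [hM1, show 4 * N * P = 2 * (2 * N * P) by ring, hNP, ← hLM]; ring
  have hNPle : 4 * N ≤ 4 * N * P := Nat.le_mul_of_pos_right _ hP0
  have hPN : 0 < N := Nat.pos_of_ne_zero fun h => by simp [h] at hNP; omega
  have hPle : P ≤ 4 * N * P := Nat.le_mul_of_pos_left _ (by omega)
  have hZ2 : 4 * N * P = 2 * (2 * N * P) := by ring
  have hZV : 4 * N * P < V := by omega
  have hL1 : L < V := by omega
  have ha1 : 2 ^ a < V := by omega
  refine wp_seq (wp_params hV hn U hU hUV hL1 ha1 ?_)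
  refine wp_seq (wp_set_bd hV (by simp [hn]) (4 * N * P) (by decide)
    (by simp [hP, hN]; omega) (by decide) (by simp [hP, hN]) ?_)
  refine wp_seq (wp_expand hV (by simp [hn]) (by simpa using hZV) (by simpa using hL1)
    (by simpa using ha1) ?_)
  intro σ₁ t₁ hf₁ hw₁ ht₁
  have hL₁ : σ₁.v .L = L := by rw [hf₁.v _ (by decide)]; simp [hLd]
  have hM₁ : σ₁.v .M = 2 ^ a := by rw [hf₁.v _ (by decide)]; simp [had]
  have hZ₁ : σ₁.v .Z = 4 * N * P := by rw [hf₁.v _ (by decide)]; simp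
  have hn₁ : σ₁.v .n = n := by rw [hf₁.v _ (by decide)]; simp [hn]
  have hX₁ := Rep.expand (L := L) (M := 2 ^ a) (Q := B) (Y := σ₁.a .work) (φ := φ)
    (by rw [hLM]; exact hX) (by
      intro k hk
      rw [hw₁ k (by rw [← hM1, ← hZ4] at hk; simpa using hk)]
      simp [hLd, had])
  rw [← hM1] at hX₁
  -- The divisibility argument is M ∣ L, which holds because U - U / 2 ≤ U / 2 + 1. It provides the
  -- shift by L / M, a root of unity of order 2M.
  refine wp_stages hV hn₁ (f := fun q => slice (2 ^ a) (φ q)) hL₁ hM₁ (by rw [hZ₁, hZ4])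
    (by omega) (by rw [hZ₁]; omega) (pow_dvd_pow 2 (by omega)) hB hL0
    (fun q j => slice_anti (by rw [hLM]; exact hφ q) j) hX₁ ?_
  intro σ₂ t₂ hf₂ hX₂ ht₂
  refine ⟨hX₂, ?_⟩
  rw [hZ₁] at ht₂
  have h1 : (a + 1) * (4 * N * P * 200 + 24) ≤ (U + 1) * (4 * N * P * 200 + 24) :=
    Nat.mul_le_mul_right _ (by omega)
  have h2 : (U + 2) * (4 * N * P * 200 + 24) =
    (U + 1) * (4 * N * P * 200 + 24) + (4 * N * P * 200 + 24) := by ring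
  simp at ht₁
  omega

/-- Block q belongs to the first factor and block B + q to the second. By `negMul_transform` the
products of their transforms are the transform of `sliceMul`, so undoing the butterflies and folding
yields the product one level up, multiplied by the length of the transform. -/
theorem wp_bwdLevel (hV : Fits w n V) (hn : σ.v .n = n) {U P N B c : ℕ} (hU : σ.v .ui = U)
    (hP : σ.v .pw = P) (hN : σ.v .N = N) (hc : σ.v .dv = c) (hUV : U < V)
    (hNP : N * P = B * 2 ^ (U + 1)) (hcV : c * 2 ^ (U - U / 2 + 1) < V) (hc0 : 0 < c)
    (hNV : 8 * N * P < V) (hP0 : 0 < P) (hB : 0 < B) {φ : ℕ → ℤ → ZMod (2 ^ w)}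
    (hφ : ∀ b, Anti (2 ^ (U + 1)) (φ b))
    (hX : Rep w (σ.a .work) (B * 2 ^ (U - U / 2 + 1)) (2 ^ (U / 2 + 1)) fun r =>
      (c : ZMod (2 ^ w)) • negMul (2 ^ (U / 2 + 1))
        (blocks (2 ^ (U / 2 + 1)) (2 ^ (U - U / 2)) (U - U / 2 + 1) φ r)
        (blocks (2 ^ (U / 2 + 1)) (2 ^ (U - U / 2)) (U - U / 2 + 1) φ
          (B * 2 ^ (U - U / 2 + 1) + r)))
    (hQ : ∀ σ' t', Frame bwdLevel σ σ' → σ'.v .dv = c * 2 ^ (U - U / 2 + 1) →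
      Rep w (σ'.a .work) B (2 ^ (U + 1)) (fun q =>
        ((c * 2 ^ (U - U / 2 + 1) : ℕ) : ZMod (2 ^ w)) •
          negMul (2 ^ (U + 1)) (φ q) (φ (B + q))) →
      t' ≤ t + 60 + (U + 2) * (2 * N * P * 200 + 24) → Q σ' t') :
    WP w bwdLevel Q σ t := by
  refine WP.mono (R := fun σ' t' => _ ∧ _ ∧ _) ?_
    (fun σ' t' hf h => hQ σ' t' hf h.1 h.2.1 h.2.2)
  have h17 := hV.num
  simp only [numArr] at h17
  have hbig : 2 ^ (U + 1) ≤ N * P := hNP ▸ Nat.le_mul_of_pos_left _ hB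
  have hLM := half_mul U
  have hM0 : 0 < 2 ^ (U - U / 2) := by positivity
  have hL0 : 0 < 2 ^ (U / 2 + 1) := by positivity
  set L := 2 ^ (U / 2 + 1) with hLd
  set a := U - U / 2 with had
  have hM1 : 2 ^ (a + 1) = 2 * 2 ^ a := pow_succ' _ _
  have hLV : L ≤ 2 ^ (U + 1) := hLM ▸ Nat.le_mul_of_pos_right _ hM0
  have hMV : 2 ^ a ≤ 2 ^ (U + 1) := hLM ▸ Nat.le_mul_of_pos_left _ hL0
  have hNPV : 8 * N * P = 8 * (N * P) := by ring
  have hNP2 : 2 * N * P = 2 * (N * P) := by ring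
  have hZ2 : 2 * N * P = B * 2 ^ (a + 1) * L := by
    rw [hM1, hNP2, hNP, ← hLM]; ring
  have hNPle : N ≤ N * P := Nat.le_mul_of_pos_right _ hP0
  have hPN : 0 < N := Nat.pos_of_ne_zero fun h => by simp [h] at hNP; omega
  have hPle : P ≤ N * P := Nat.le_mul_of_pos_left _ (by omega)
  have hL1 : L < V := by omega
  have ha1 : 2 ^ a < V := by omega
  refine wp_seq (wp_params hV hn U hU hUV hL1 ha1 ?_)
  refine wp_seq (wp_set_bd hV (by simp [hn]) (2 * N * P) (by decide)
    (by simp [hP, hN]; omega) (by decide) (by simp [hP, hN]) ?_)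
  have hf : ∀ q j, Anti L (sliceMul L (2 ^ a) (φ q) (φ (B + q)) j) :=
    fun q j => sliceMul_anti (by rw [hLM]; exact hφ _) j
  refine wp_seq (wp_invStages hV (by simp [hn]) (L := L) (a := a) (B := B) (c := c)
    (f := fun q => sliceMul L (2 ^ a) (φ q) (φ (B + q)))
    (by simp [hLd]) (by simp [had]) (by simpa using hZ2) (by omega)
    (by simp; omega) (pow_dvd_pow 2 (by omega)) hB hL0 hf (hX.congr fun r hr => ?_) ?_)
  · congr 1
    have hpos : 0 < 2 ^ (a + 1) := by positivity
    have e1 : (B * 2 ^ (a + 1) + r) / 2 ^ (a + 1) = B + r / 2 ^ (a + 1) := by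
      rw [mul_comm, Nat.mul_add_div hpos]
    have e2 : (B * 2 ^ (a + 1) + r) % 2 ^ (a + 1) = r % 2 ^ (a + 1) :=
      Nat.mul_add_mod_self_right _ _ _
    rw [blocks, blocks, e1, e2]
    exact negMul_transform hM1 (by rw [hLM]; exact hφ _) (by rw [hLM]; exact hφ _) _
  intro σ₁ t₁ hf₁ hX₁ ht₁
  have hL₁ : σ₁.v .L = L := by rw [hf₁.v _ (by decide)]; simp [hLd]
  have hM₁ : σ₁.v .M = 2 ^ a := by rw [hf₁.v _ (by decide)]; simp [had]
  have hn₁ : σ₁.v .n = n := by rw [hf₁.v _ (by decide)]; simp [hn]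
  have hN₁ : σ₁.v .N = N := by rw [hf₁.v _ (by decide)]; simp [hN]
  have hP₁ : σ₁.v .pw = P := by rw [hf₁.v _ (by decide)]; simp [hP]
  have hc₁ : σ₁.v .dv = c := by rw [hf₁.v _ (by decide)]; simp [hc]
  refine wp_seq (wp_set_bd hV hn₁ (N * P) (by decide)
    (by simp [hP₁, hN₁]; omega) (by decide) (by simp [hP₁, hN₁]) ?_)
  refine wp_seq (wp_fold hV (by simp [hn₁]) (by simp; omega) (by simp [hL₁]; omega)
    (by simp [hL₁, hL0]) (by simp [hM₁]; omega) (by simp [hM₁]; omega) ?_)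
  intro σ₂ t₂ hf₂ hw₂ ht₂
  have hn₂ : σ₂.v .n = n := by rw [hf₂.v _ (by decide)]; simp [hn₁]
  have hM₂ : σ₂.v .M = 2 ^ a := by rw [hf₂.v _ (by decide)]; simp [hM₁]
  have hc₂ : σ₂.v .dv = c := by rw [hf₂.v _ (by decide)]; simp [hc₁]
  have hcV' : c < V := lt_of_le_of_lt (Nat.le_mul_of_pos_right _ (by positivity)) hcV
  refine wp_set_bd hV hn₂ (c * 2 ^ (a + 1)) (by decide)
    (by simp [hM₂, hc₂]; omega) (by decide) (by simp [hM₂, hc₂, hM1]) ?_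
  refine ⟨by simp, ?_, ?_⟩
  · rw [Store.set_a]
    rw [hM1] at hX₁
    rw [← hLM]
    refine Rep.fold (L := L) (M := 2 ^ a) hL0
      (f := fun q j => ((c * (2 * 2 ^ a) : ℕ) : ZMod (2 ^ w)) •
        sliceMul L (2 ^ a) (φ q) (φ (B + q)) j) (fun q j => (hf q j).smul _) hX₁ ?_ ?_
    · intro q l j hj
      simp only [Pi.smul_apply, negMul_eq_sliceMul _ _ l hj, smul_add, hM1]
    · intro k hk
      rw [hw₂ k (by simpa [hNP, ← hLM] using hk)]
      simp [hL₁, hM₁]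
  · have h1 : (a + 1) * (2 * N * P * 200 + 24) ≤ (U + 1) * (2 * N * P * 200 + 24) :=
      Nat.mul_le_mul_right _ (by omega)
    have h2 : (U + 2) * (2 * N * P * 200 + 24) =
      (U + 1) * (2 * N * P * 200 + 24) + (2 * N * P * 200 + 24) := by ring
    simp at ht₁ ht₂ ⊢
    omega

theorem wp_fwdCmd (hV : Fits w n V) (hn : σ.v .n = n) {u : ℕ} (hu : σ.v .u = u)
    (hN : σ.v .N = 2 ^ (u + 1)) (hNV : 8 * 2 ^ (u + 1) * 2 ^ u.size < V)
    {φ : ℕ → ℤ → ZMod (2 ^ w)} (hφ : ∀ b, Anti (2 ^ (u + 1)) (φ b))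
    (hX : Rep w (σ.a .work) 2 (2 ^ (u + 1)) φ)
    (hQ : ∀ σ' t', Frame fwdCmd σ σ' → σ'.v .pw = 2 ^ u.size →
      Rep w (σ'.a .work) (2 * rows u u.size) 2 (levels u φ u.size) →
      t' ≤ t + 10 + u.size * (100 + (u + 2) * (4 * 2 ^ (u + 1) * 2 ^ u.size * 200 + 24)) →
      Q σ' t') :
    WP w fwdCmd Q σ t := by
  refine WP.mono (R := fun σ' t' => _ ∧ _ ∧ _) ?_
    (fun σ' t' hf h => hQ σ' t' hf h.1 h.2.1 h.2.2)
  have h17 := hV.num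
  simp only [numArr] at h17
  set D := u.size with hD
  have hzero : u / 2 ^ D = 0 := Nat.div_eq_of_lt (Nat.lt_size_self u)
  have huV : u < V := by
    have h1 : u < 2 ^ (u + 1) := u.lt_two_pow_self.trans_le (Nat.pow_le_pow_right (by norm_num) (by omega))
    have h2 : 8 * 2 ^ (u + 1) ≤ 8 * 2 ^ (u + 1) * 2 ^ D := Nat.le_mul_of_pos_right _ (by positivity)
    omega
  have hpV : ∀ i ≤ D, 8 * 2 ^ (u + 1) * 2 ^ i < V := fun i hi =>
    lt_of_le_of_lt (Nat.mul_le_mul_left _ (Nat.pow_le_pow_right (by norm_num) hi)) hNV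
  have hpV' : ∀ i ≤ D, 2 ^ i < V := fun i hi =>
    lt_of_le_of_lt (Nat.le_mul_of_pos_left _ (by positivity)) (hpV i hi)
  refine wp_seq (wp_set_bd hV hn 1 (by decide) (by simp; omega) (by decide) (by simp) ?_)
  refine wp_seq (wp_set_bd hV (by simp [hn]) u (by decide) (by simp [hu, huV]) (by decide)
    (by simp [hu]) ?_)
  set Bd := 100 + (u + 2) * (4 * 2 ^ (u + 1) * 2 ^ D * 200 + 24) with hBd
  refine wp_loop (fun k σ' t' => k ≤ D ∧ σ'.v .n = n ∧ σ'.v .u = u ∧ σ'.v .N = 2 ^ (u + 1) ∧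
    σ'.v .pw = 2 ^ (D - k) ∧ σ'.v .ui = u / 2 ^ (D - k) ∧
    Rep w (σ'.a .work) (2 * rows u (D - k)) (2 ^ (u / 2 ^ (D - k) + 1)) (levels u φ (D - k)) ∧
    t' + k * Bd ≤ t + 4 + D * Bd) D ?_ ?_ ?_ ?_
  · refine ⟨le_rfl, by simp [hn], by simp [hu], by simp [hN], by simp, by simp, ?_, by simp⟩
    simpa [rows, levels] using hX
  · rintro k σ' t' ⟨hk, -, -, -, -, hui, -, -⟩
    refine ⟨trivial, ?_⟩
    -- The exponent u / 2^i first vanishes when i is the number of binary digits of u, which is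
    -- therefore the depth of the recursion.
    rw [Ex.ev_v, hui, Nat.div_eq_zero_iff, ← Nat.size_le, ← hD]
    have : 2 ^ (D - k) ≠ 0 := by positivity
    omega
  · rintro k σ' t' ⟨hk, hn', hu', hN', hpw, hui, hX', ht'⟩
    set i := D - (k + 1) with hi
    have hi1 : D - k = i + 1 := by omega
    have hpi := hpV i (by omega)
    refine wp_seq (wp_fwdLevel hV hn' hui hpw hN' ((Nat.div_le_self _ _).trans_lt huV)
      (B := 2 * rows u i) (by rw [mul_assoc, mul_assoc 2 (rows u i), rows_mul])
      hpi (by positivity)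
      (by have := rows_pos u i; omega) (fun b => levels_anti hφ i b) hX' ?_)
    intro σ₁ t₁ hf₁ hX₁ ht₁
    have hn₁ : σ₁.v .n = n := by rw [hf₁.v _ (by decide), hn']
    have hu₁ : σ₁.v .u = u := by rw [hf₁.v _ (by decide), hu']
    have hN₁ : σ₁.v .N = 2 ^ (u + 1) := by rw [hf₁.v _ (by decide), hN']
    have hpw₁ : σ₁.v .pw = 2 ^ i := by rw [hf₁.v _ (by decide), hpw]
    refine wp_seq (wp_set_bd hV hn₁ (2 ^ (i + 1)) (by decide)
      (by simp [hpw₁, hpV' i (by omega)]; omega) (by decide) (by simp [hpw₁, pow_succ']) ?_)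
    refine wp_set_bd hV (by simp [hn₁]) (u / 2 ^ (i + 1)) (by decide)
      (by simp [hu₁, huV, hpV' (i + 1) (by omega)]) (by decide) (by simp [hu₁]) ?_
    refine ⟨by omega, by simp [hn₁], by simp [hu₁], by simp [hN₁], by simp [hi1], by simp [hi1], ?_, ?_⟩
    · simp only [Store.set_a, hi1]
      rw [rows, levels, div_two_pow_succ, ← mul_assoc]
      exact hX₁
    · have h1 : (u / 2 ^ i + 2) * (4 * 2 ^ (u + 1) * 2 ^ i * 200 + 24) ≤
          (u + 2) * (4 * 2 ^ (u + 1) * 2 ^ D * 200 + 24) := by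
        gcongr
        · exact Nat.div_le_self _ _
        · norm_num
        · omega
      rw [add_mul k, one_mul] at ht'
      simp at ht₁ ⊢
      omega
  · rintro σ' t' ⟨-, -, -, -, hpw, -, hX', ht'⟩
    simp only [Nat.sub_zero, hzero, zero_add, pow_one] at hpw hX'
    refine ⟨hpw, hX', ?_⟩
    simp
    omega

/-- The accumulated scalar `dv` times the number of rows on the current level is constant: what the
rows lose in a level, the scalar gains. At the top one row per factor is left, so the scalar is the
initial number of rows. -/
theorem wp_bwdCmd (hV : Fits w n V) (hn : σ.v .n = n) {u : ℕ} (hu : σ.v .u = u)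
    (hN : σ.v .N = 2 ^ (u + 1)) (hpw : σ.v .pw = 2 ^ u.size)
    (hNV : 8 * 2 ^ (u + 1) * 2 ^ u.size < V)
    {φ : ℕ → ℤ → ZMod (2 ^ w)} (hφ : ∀ b, Anti (2 ^ (u + 1)) (φ b))
    (hX : Rep w (σ.a .work) (rows u u.size) 2 fun b =>
      negMul 2 (levels u φ u.size b) (levels u φ u.size (rows u u.size + b)))
    (hQ : ∀ σ' t', Frame bwdCmd σ σ' → σ'.v .dv = rows u u.size →
      Rep w (σ'.a .work) 1 (2 ^ (u + 1)) (fun _ => (rows u u.size : ZMod (2 ^ w)) •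
        negMul (2 ^ (u + 1)) (φ 0) (φ 1)) →
      t' ≤ t + 10 + u.size * (100 + (u + 2) * (4 * 2 ^ (u + 1) * 2 ^ u.size * 200 + 24)) →
      Q σ' t') :
    WP w bwdCmd Q σ t := by
  refine WP.mono (R := fun σ' t' => _ ∧ _ ∧ _) ?_
    (fun σ' t' hf h => hQ σ' t' hf h.1 h.2.1 h.2.2)
  have h17 := hV.num
  simp only [numArr] at h17
  set D := u.size with hD
  have hzero : u / 2 ^ D = 0 := Nat.div_eq_of_lt (Nat.lt_size_self u)
  have huV : u < V := by
    have h1 : u < 2 ^ (u + 1) := u.lt_two_pow_self.trans_le (Nat.pow_le_pow_right (by norm_num) (by omega))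
    have h2 : 8 * 2 ^ (u + 1) ≤ 8 * 2 ^ (u + 1) * 2 ^ D := Nat.le_mul_of_pos_right _ (by positivity)
    omega
  have hpV : ∀ i ≤ D, 8 * 2 ^ (u + 1) * 2 ^ i < V := fun i hi =>
    lt_of_le_of_lt (Nat.mul_le_mul_left _ (Nat.pow_le_pow_right (by norm_num) hi)) hNV
  have hpV' : ∀ i ≤ D, 2 ^ i < V := fun i hi =>
    lt_of_le_of_lt (Nat.le_mul_of_pos_left _ (by positivity)) (hpV i hi)
  have hrD : rows u D < V := by
    have h1 := rows_mul u D
    have h2 : rows u D ≤ rows u D * 2 ^ (u / 2 ^ D + 1) := Nat.le_mul_of_pos_right _ (by positivity)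
    have h3 : 8 * 2 ^ (u + 1) * 2 ^ D = 8 * (2 ^ (u + 1) * 2 ^ D) := by ring
    omega
  refine wp_seq (wp_set_bd hV hn 1 (by decide) (by simp; omega) (by decide) (by simp) ?_)
  set Bd := 100 + (u + 2) * (4 * 2 ^ (u + 1) * 2 ^ D * 200 + 24) with hBd
  refine wp_loop (fun k σ' t' => k ≤ D ∧ σ'.v .n = n ∧ σ'.v .u = u ∧ σ'.v .N = 2 ^ (u + 1) ∧
    σ'.v .pw = 2 ^ k ∧ σ'.v .dv * rows u k = rows u D ∧
    Rep w (σ'.a .work) (rows u k) (2 ^ (u / 2 ^ k + 1)) (fun b => (σ'.v .dv : ZMod (2 ^ w)) •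
      negMul (2 ^ (u / 2 ^ k + 1)) (levels u φ k b) (levels u φ k (rows u k + b))) ∧
    t' + k * Bd ≤ t + 2 + D * Bd) D ?_ ?_ ?_ ?_
  · refine ⟨le_rfl, by simp [hn], by simp [hu], by simp [hN], by simp [hpw], by simp, ?_, by simp⟩
    simpa [hzero] using hX
  · rintro k σ' t' ⟨hk, hn', -, -, hpw', -, -, -⟩
    refine ⟨Ex.bd.ok hV hn' ?_ (by decide), ?_⟩
    · simp only [Ex.bd_lt, Ex.bd_v, Ex.bd_c, hpw']
      exact ⟨by omega, hpV' k hk⟩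
    · have hlt : 1 < 2 ^ k ↔ k ≠ 0 := Nat.one_lt_two_pow_iff
      simp only [Ex.ev_lt, Ex.ev_v, Ex.ev_c, hpw', hlt]
      split_ifs <;> simp_all
  · rintro k σ' t' ⟨hk, hn', hu', hN', hpw', hdv, hX', ht'⟩
    refine wp_seq (wp_set_bd hV hn' (2 ^ k) (by decide)
      (by simp [hpw', hpV' (k + 1) hk]; omega) (by decide) (by simp [hpw', pow_succ]) ?_)
    refine wp_seq (wp_set_bd hV (by simp [hn']) (u / 2 ^ k) (by decide)
      (by simp [hu', huV, hpV' k (by omega)]) (by decide) (by simp [hu']) ?_)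
    have hc0 : 0 < σ'.v .dv := by
      have := rows_pos u D
      rw [← hdv] at this
      exact Nat.pos_of_mul_pos_right this
    have hcr : σ'.v .dv * 2 ^ (u / 2 ^ k - u / 2 ^ k / 2 + 1) * rows u k = rows u D := by
      rw [← hdv, rows]; ring
    refine wp_bwdLevel hV (σ := (σ'.set _ _).set _ _) (by simp [hn']) (U := u / 2 ^ k)
      (P := 2 ^ k) (N := 2 ^ (u + 1)) (B := rows u k) (c := σ'.v .dv) (φ := levels u φ k)
      (by simp) (by simp) (by simp [hN']) (by simp) ((Nat.div_le_self _ _).trans_lt huV)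
      (rows_mul u k).symm ?_ hc0 (hpV k (by omega)) (by positivity) (rows_pos u k)
      (fun b => levels_anti hφ k b) ?_ ?_
    · refine lt_of_le_of_lt (Nat.le_mul_of_pos_right _ (rows_pos u k)) (hcr ▸ hrD)
    · rw [rows, div_two_pow_succ] at hX'
      exact hX'
    intro σ₁ t₁ hf₁ hdv₁ hX₁ ht₁
    refine ⟨by omega, by rw [hf₁.v _ (by decide)]; simp [hn'],
      by rw [hf₁.v _ (by decide)]; simp [hu'], by rw [hf₁.v _ (by decide)]; simp [hN'],
      by rw [hf₁.v _ (by decide)]; simp, by rw [hdv₁, hcr], by rw [hdv₁]; exact hX₁, ?_⟩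
    have h1 : (u / 2 ^ k + 2) * (2 * 2 ^ (u + 1) * 2 ^ k * 200 + 24) ≤
        (u + 2) * (4 * 2 ^ (u + 1) * 2 ^ D * 200 + 24) := by
      gcongr
      · exact Nat.div_le_self _ _
      · norm_num
      · norm_num
      · omega
    rw [add_mul k, one_mul] at ht'
    simp at ht₁ ⊢
    omega
  · rintro σ' t' ⟨-, -, -, -, -, hdv, hX', ht'⟩
    simp only [rows, mul_one, pow_zero, Nat.div_one] at hdv hX'
    refine ⟨hdv, ?_, ?_⟩
    · rw [hdv] at hX'
      refine hX'.congr fun r hr => ?_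
      obtain rfl : r = 0 := by omega
      rfl
    · simp
      omega

/-- A bound on the number of steps of a multiplication of polynomials of degree less than `N`. -/
def mulTime (u : ℕ) : ℕ := 5000 * 2 ^ (u + 1) * (u + 2) ^ 3

/-- The data doubles on each of the `u.size` levels; the total growth is therefore only linear in u,
that is, logarithmic in the length of the polynomials. -/
theorem two_pow_size_le (u : ℕ) : 2 ^ u.size ≤ 2 * (u + 1) := by
  rcases Nat.eq_zero_or_pos u with rfl | h
  · simp
  · have h1 : 0 < u.size := Nat.size_pos.2 h
    have h2 : 2 ^ (u.size - 1) ≤ u := Nat.lt_size.1 (by omega)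
    have h3 : 2 ^ u.size = 2 * 2 ^ (u.size - 1) := by rw [← pow_succ']; congr 1; omega
    omega

theorem size_le_self (u : ℕ) : u.size ≤ u := Nat.size_le.2 u.lt_two_pow_self

/-- The computation is modulo 2^w, but the number of rows and the true coefficients are both below V
and V² ≤ 2^w. The scaled coefficients are thus represented exactly, and dividing words by the number
of rows gives the coefficients themselves. -/
theorem wp_mulCmd (hV : Fits w n V) (hn : σ.v .n = n) {u : ℕ} (hu : σ.v .u = u)
    (hN : σ.v .N = 2 ^ (u + 1)) (hNV : 32 * 2 ^ (u + 1) * (u + 1) < V)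
    {φ : ℕ → ℤ → ZMod (2 ^ w)} (hφ : ∀ b, Anti (2 ^ (u + 1)) (φ b))
    (hX : Rep w (σ.a .work) 2 (2 ^ (u + 1)) φ) {p : ℕ → ℕ}
    (hp : ∀ k : ℕ, k < 2 ^ (u + 1) →
      negMul (2 ^ (u + 1)) (φ 0) (φ 1) (k : ℤ) = ((p k : ℕ) : ZMod (2 ^ w)))
    (hpV : ∀ k < 2 ^ (u + 1), p k < V)
    (hQ : ∀ σ' t', Frame mulCmd σ σ' → (∀ k < 2 ^ (u + 1), σ'.a .work k = p k) →
      t' ≤ t + mulTime u → Q σ' t') :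
    WP w mulCmd Q σ t := by
  refine WP.mono (R := fun σ' t' => _ ∧ _) ?_ (fun σ' t' hf h => hQ σ' t' hf h.1 h.2)
  have h17 := hV.num
  simp only [numArr] at h17
  have hsz := two_pow_size_le u
  have hNV' : 8 * 2 ^ (u + 1) * 2 ^ u.size < V := by
    refine lt_of_le_of_lt ?_ hNV
    calc 8 * 2 ^ (u + 1) * 2 ^ u.size ≤ 8 * 2 ^ (u + 1) * (2 * (u + 1)) := by gcongr
      _ ≤ 32 * 2 ^ (u + 1) * (u + 1) := by nlinarith [Nat.zero_le (2 ^ (u + 1) * (u + 1))]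
  have hzero : u / 2 ^ u.size = 0 := Nat.div_eq_of_lt (Nat.lt_size_self u)
  have hr2 : rows u u.size * 2 = 2 ^ (u + 1) * 2 ^ u.size := by
    have := rows_mul u u.size
    rwa [hzero, zero_add, pow_one] at this
  have hrV : rows u u.size < V := by
    have : 8 * 2 ^ (u + 1) * 2 ^ u.size = 8 * (2 ^ (u + 1) * 2 ^ u.size) := by ring
    omega
  have hle1 : 2 ^ (u + 1) ≤ 2 ^ (u + 1) * 2 ^ u.size := Nat.le_mul_of_pos_right _ (by positivity)
  have hle2 : 2 ^ u.size ≤ 2 ^ (u + 1) * 2 ^ u.size := Nat.le_mul_of_pos_left _ (by positivity)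
  have hNV2 : 8 * (2 ^ (u + 1) * 2 ^ u.size) < V := by rwa [← mul_assoc]
  refine wp_seq (wp_fwdCmd hV hn hu hN hNV' hφ hX ?_)
  intro σ₁ t₁ hf₁ hpw₁ hX₁ ht₁
  have hn₁ : σ₁.v .n = n := by rw [hf₁.v _ (by decide), hn]
  have hu₁ : σ₁.v .u = u := by rw [hf₁.v _ (by decide), hu]
  have hN₁ : σ₁.v .N = 2 ^ (u + 1) := by rw [hf₁.v _ (by decide), hN]
  refine wp_seq (wp_set_bd hV hn₁ (2 ^ (u + 1) * 2 ^ u.size) (by decide)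
    (by simp [hN₁, hpw₁]; omega) (by decide) (by simp [hN₁, hpw₁]) ?_)
  refine wp_seq (wp_base hV (by simp [hn₁]) (by simp; omega) ?_)
  intro σ₂ t₂ hf₂ hw₂ ht₂
  have hn₂ : σ₂.v .n = n := by rw [hf₂.v _ (by decide)]; simp [hn₁]
  have hu₂ : σ₂.v .u = u := by rw [hf₂.v _ (by decide)]; simp [hu₁]
  have hN₂ : σ₂.v .N = 2 ^ (u + 1) := by rw [hf₂.v _ (by decide)]; simp [hN₁]
  have hpw₂ : σ₂.v .pw = 2 ^ u.size := by rw [hf₂.v _ (by decide)]; simp [hpw₁]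
  have hanti : ∀ b, Anti 2 (levels u φ u.size b) := fun b => by
    have := levels_anti hφ u.size b
    rwa [hzero, zero_add, pow_one] at this
  have hX₂ := Rep.base (Y := σ₂.a .work) hanti hX₁ (by
    intro k hk
    rw [hw₂ k (by simpa [hr2] using hk)]
    simp [hr2])
  refine wp_seq (wp_bwdCmd hV hn₂ hu₂ hN₂ hpw₂ hNV' hφ hX₂ ?_)
  intro σ₃ t₃ hf₃ hdv₃ hX₃ ht₃
  have hn₃ : σ₃.v .n = n := by rw [hf₃.v _ (by decide), hn₂]
  have hN₃ : σ₃.v .N = 2 ^ (u + 1) := by rw [hf₃.v _ (by decide), hN₂]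
  have hval : ∀ k < 2 ^ (u + 1), σ₃.a .work k = rows u u.size * p k := by
    intro k hk
    have h := hX₃ 0 (by norm_num) k hk
    rw [zero_mul, zero_add] at h
    have hlt : rows u u.size * p k < 2 ^ w := by
      calc rows u u.size * p k < V * V := Nat.mul_lt_mul'' hrV (hpV k hk)
        _ = V ^ 2 := (sq V).symm
        _ ≤ 2 ^ w := hV.pow_le (by norm_num)
    have h2 := h.2
    simp only [Pi.smul_apply] at h2
    rw [hp k hk, smul_eq_mul, ← Nat.cast_mul, ZMod.natCast_eq_natCast_iff'] at h2
    rwa [Nat.mod_eq_of_lt h.1, Nat.mod_eq_of_lt hlt] at h2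
  refine wp_for_frame (fun k τ => ∀ j < 2 ^ (u + 1),
      τ.a .work j = if j < k then p j else rows u u.size * p j) (fun _ => 30)
    (by decide) (by decide) rfl rfl (by rw [hN₃]; exact hV.lt (by omega)) hV.one_lt ?_ ?_ ?_
  · intro j hj; simp [hval j hj]
  · intro k τ t' hk hi hb hf hinv
    have hn' : τ.v .n = n := by rw [hf.v _ (by decide), hn₃]
    have hdv : τ.v .dv = rows u u.size := by rw [hf.v _ (by decide), hdv₃]
    rw [hN₃] at hk
    have hkV : k < V := by omega
    refine wp_wr_val hV hn' k (p k) (by simp [hi, hkV]) (by decide) (by simp) ?_ (by simp [hi])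
      (by simp [hi, hdv, hinv k hk, Nat.mul_div_cancel_left _ (rows_pos u u.size)]) ⟨?_, ?_⟩
    · exact ⟨ok_rd hV hn' (by simp [hi, hkV]) (by decide) (by simp), trivial, trivial⟩
    · intro j hj
      simp only [Store.set_a, Store.put_a, if_true, Function.update_apply]
      split_ifs with h1 h2 h2
      · rw [h1]
      · omega
      · rw [hinv j hj, if_pos (by omega)]
      · rw [hinv j hj, if_neg (by omega)]
    · simp [addrCost]
  · intro σ₄ t₄ hf₄ h4 ht₄
    rw [hN₃] at h4 ht₄
    refine ⟨fun k hk => by rw [h4 k hk, if_pos hk], ?_⟩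
    simp only [sum_const, card_range, smul_eq_mul] at ht₄
    simp at ht₁ ht₂ ht₃ ht₄
    have hs := size_le_self u
    have hT : u.size * (100 + (u + 2) * (4 * 2 ^ (u + 1) * 2 ^ u.size * 200 + 24)) ≤
        u * (100 + (u + 2) * (4 * 2 ^ (u + 1) * (2 * (u + 1)) * 200 + 24)) := by gcongr
    have hE : 2 ^ (u + 1) * 2 ^ u.size ≤ 2 ^ (u + 1) * (2 * (u + 1)) := by gcongr
    have hone : 2 ≤ 2 ^ (u + 1) := by
      calc 2 = 2 ^ 1 := rfl
        _ ≤ _ := Nat.pow_le_pow_right (by norm_num) (by omega)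
    unfold mulTime
    generalize 2 ^ (u + 1) = E at *
    -- Terms without the factor E are absorbed by means of E ≥ 2; what remains is a comparison of
    -- cubic polynomials in u.
    have hfin : 2 * (u * (100 + (u + 2) * (4 * E * (2 * (u + 1)) * 200 + 24))) +
        E * (2 * (u + 1)) * 200 + E * 38 + 100 ≤ 5000 * E * (u + 2) ^ 3 := by
      have h1 : 2 * (24 * (u * (u + 2)) + 50) ≤ E * (24 * (u * (u + 2)) + 50) :=
        Nat.mul_le_mul_right _ hone
      have h2 : 2 * (100 * u) ≤ E * (100 * u) := Nat.mul_le_mul_right _ hone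
      have h3 : 3200 * (u * (u + 1) * (u + 2)) + (24 * (u * (u + 2)) + 50) + 500 * u + 438 ≤
          5000 * (u + 2) ^ 3 := by nlinarith [Nat.zero_le (u ^ 3), Nat.zero_le (u ^ 2)]
      calc _ = E * (3200 * (u * (u + 1) * (u + 2)) + 400 * u + 438) +
            (2 * (24 * (u * (u + 2)) + 50) + 2 * (100 * u)) := by ring
        _ ≤ E * (3200 * (u * (u + 1) * (u + 2)) + 400 * u + 438) +
            (E * (24 * (u * (u + 2)) + 50) + E * (100 * u)) := by omega
        _ = E * (3200 * (u * (u + 1) * (u + 2)) + (24 * (u * (u + 2)) + 50) + 500 * u + 438) := by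
          ring
        _ ≤ E * (5000 * (u + 2) ^ 3) := Nat.mul_le_mul_left _ h3
        _ = _ := by ring
    omega

end mul

end WordRAM

/-! ### Counting pairs by the residue of their sum. -/

namespace WordRAM

open Negacyclic

/-- The number of `i < a` with `f i` congruent to `x` modulo `m`. -/
def hist (f : ℕ → ℕ) (a m x : ℕ) : ℕ := #{i ∈ range a | f i % m = x}

/-- The number of pairs with `f i + g j` congruent to `x` modulo `m`. -/
def pairCount (f g : ℕ → ℕ) (a b m x : ℕ) : ℕ :=
  #{p ∈ range a ×ˢ range b | (f p.1 + g p.2) % m = x}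

theorem hist_succ (f : ℕ → ℕ) (a m x : ℕ) :
    hist f (a + 1) m x = if f a % m = x then hist f a m x + 1 else hist f a m x := by
  unfold hist
  rw [range_add_one, filter_insert]
  split_ifs with h
  · rw [card_insert_of_notMem (by simp)]
  · rfl

theorem hist_le (f : ℕ → ℕ) (a m x : ℕ) : hist f a m x ≤ a :=
  (card_filter_le _ _).trans (by simp)

theorem hist_eq_zero {f : ℕ → ℕ} {a m x : ℕ} (hm : 0 < m) (hx : m ≤ x) : hist f a m x = 0 := by
  rw [hist, card_eq_zero, filter_eq_empty_iff]
  intro i _ h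
  have := Nat.mod_lt (f i) hm
  omega

/-- Group the pairs by the residue of the first element; each group is a product of two fibres. -/
theorem sum_hist_mul_hist (f g : ℕ → ℕ) (a b m k : ℕ) :
    ∑ i ∈ range (k + 1), hist f a m i * hist g b m (k - i) =
      #{p ∈ range a ×ˢ range b | f p.1 % m + g p.2 % m = k} := by
  rw [card_eq_sum_card_fiberwise (f := fun p : ℕ × ℕ => f p.1 % m) (t := range (k + 1))]
  · refine sum_congr rfl fun r hr => ?_
    rw [mem_range] at hr
    rw [hist, hist, ← card_product]
    congr 1
    ext ⟨i, j⟩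
    simp only [mem_product, mem_filter, mem_range]
    constructor
    · rintro ⟨⟨h1, h2⟩, h3, h4⟩; exact ⟨⟨⟨h1, h3⟩, by omega⟩, h2⟩
    · rintro ⟨⟨⟨h1, h3⟩, h4⟩, h2⟩; exact ⟨⟨h1, h2⟩, h3, by omega⟩
  · intro p hp
    simp only [coe_filter, Set.mem_ofPred_eq] at hp
    simp only [coe_range, Set.mem_Iio]
    omega

/-- Two residues add up to less than 2m, so a sum in the class of x is either x or x + m. Hence two
entries of the convolution are read for each class, and its length must be at least 2m. -/
theorem card_residues_add (f g : ℕ → ℕ) (a b : ℕ) {m x : ℕ} (hx : x < m) :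
    #{p ∈ range a ×ˢ range b | f p.1 % m + g p.2 % m = x} +
      #{p ∈ range a ×ˢ range b | f p.1 % m + g p.2 % m = x + m} = pairCount f g a b m x := by
  rw [pairCount, ← card_union_of_disjoint]
  · congr 1
    ext p
    simp only [mem_union, mem_filter, ← and_or_left]
    refine and_congr_right fun _ => ?_
    have h1 := Nat.mod_lt (f p.1) (by omega : 0 < m)
    have h2 := Nat.mod_lt (g p.2) (by omega : 0 < m)
    rw [Nat.add_mod]
    generalize f p.1 % m = A at *
    generalize g p.2 % m = B at *
    rcases lt_or_ge (A + B) m with h | h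
    · rw [Nat.mod_eq_of_lt h]; omega
    · rw [Nat.mod_eq_sub_mod h, Nat.mod_eq_of_lt (by omega)]; omega
  · rw [disjoint_filter]
    intro p _ h; omega

/-- Set the first `Z` entries of the array `work` to zero. -/
def clearCmd : Cmd := .for .i .Z (.wr .work (.v .i) (.c 0))

/-- Add to the array `work`, from entry `o` on, the histogram of a segment of the array `raw` modulo
`mm`. -/
def histCmd (off len : Var) : Cmd :=
  .for .i len (.l ≔ Ex.v .o + .rd .raw (Ex.v off + .v .i) % .v .mm ;;
    .wr .work (.v .l) (.rd .work (.v .l) + Ex.c 1))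

/-- Count the pairs of elements of two segments of the array `raw` by the sum of the residues modulo
`mm`. -/
def convCmd : Cmd :=
  .Z ≔ Ex.c 2 * .v .N ;; clearCmd ;;
  .o ≔ .c 0 ;; histCmd .oA .lA ;;
  .o ≔ .v .N ;; histCmd .oB .lB ;;
  mulCmd

/-- A bound on the number of steps of `convCmd`. -/
def convTime (u n : ℕ) : ℕ := mulTime u + 100 * 2 ^ (u + 1) + 200 * n + 100

section conv

variable {w n V : ℕ} {Q : Store → ℕ → Prop} {σ : Store} {t : ℕ}

theorem wp_clear (hV : Fits w n V) (hn : σ.v .n = n) {Z : ℕ} (hZ : σ.v .Z = Z) (hZV : Z < V)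
    (hQ : ∀ σ' t', Frame clearCmd σ σ' → (∀ j < Z, σ'.a .work j = 0) →
      t' ≤ t + 38 * Z + 6 → Q σ' t') : WP w clearCmd Q σ t := by
  subst hZ
  refine wp_for_frame (fun k τ => ∀ j < k, τ.a .work j = 0) (fun _ => 30)
    (by decide) (by decide) rfl rfl (hV.lt hZV) hV.one_lt (by simp) ?_ ?_
  · intro k τ t' hk hi hb hf hinv
    have hn' : τ.v .n = n := by rw [hf.v _ (by decide), hn]
    have := hV.two_le
    refine wp_wr_val hV hn' k 0 (by simp [hi]; omega) (by decide) (by simp)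
      (hV.lt (by omega)) (by simp [hi]) (by simp) ⟨?_, by simp [addrCost]⟩
    intro j hj
    simp only [Store.set_a, Store.put_a, if_true, Function.update_apply]
    split_ifs with h1
    · rfl
    · exact hinv j (by omega)
  · intro σ' t' hf h ht
    refine hQ σ' t' hf h ?_
    simp only [sum_const, card_range, smul_eq_mul] at ht
    omega

theorem wp_hist (hV : Fits w n V) (hn : σ.v .n = n) {off len : Var} {f : ℕ → ℕ} {m o a s : ℕ}
    (hoff : off ≠ .i ∧ off ≠ .l) (hlen : len ≠ .i ∧ len ≠ .l)
    (hm : σ.v .mm = m) (hm0 : 0 < m) (hmV : m < V) (ho : σ.v .o = o) (hoV : o + m < V)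
    (hs : σ.v off = s) (ha : σ.v len = a) (hsa : s + a ≤ 6 * n)
    (hf : ∀ i < a, σ.a .raw (s + i) = f i) (hfV : ∀ i < a, f i < V)
    (hw : ∀ j < m, σ.a .work (o + j) = 0)
    (hQ : ∀ σ' t', Frame (histCmd off len) σ σ' →
      (∀ j < m, σ'.a .work (o + j) = hist f a m j) →
      (∀ j, j < o ∨ o + m ≤ j → σ'.a .work j = σ.a .work j) →
      t' ≤ t + 60 * a + 6 → Q σ' t') : WP w (histCmd off len) Q σ t := by
  have hlV : a < V := by have := hV.six; omega
  have hmv : ∀ x, x ≠ .i → x ≠ .l → (histCmd off len).mv x = false := by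
    intro x h1 h2
    simp [histCmd, Cmd.for, Cmd.mv, h1.symm, h2.symm]
  have hma : ∀ b, b ≠ .work → (histCmd off len).ma b = false := by
    intro b h1
    simp [histCmd, Cmd.for, Cmd.ma, h1.symm]
  refine wp_for_frame (fun k τ => (∀ j < m, τ.a .work (o + j) = hist f k m j) ∧
      (∀ j, j < o ∨ o + m ≤ j → τ.a .work j = σ.a .work j)) (fun _ => 50)
    (by decide) (Ne.symm hlen.1) (by simp [Cmd.mv]) (by simp [Cmd.mv, hlen.2.symm])
    (by rw [ha]; exact hV.lt hlV) hV.one_lt ?_ ?_ ?_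
  · refine ⟨fun j hj => ?_, fun j _ => rfl⟩
    rw [Store.set_a, hw j hj]; simp [hist]
  · intro k τ t' hk hi hb hfr ⟨h1, h2⟩
    rw [ha] at hk
    have hn' : τ.v .n = n := by rw [hfr.v _ (hmv _ (by decide) (by decide)), hn]
    have hm' : τ.v .mm = m := by rw [hfr.v _ (hmv _ (by decide) (by decide)), hm]
    have ho' : τ.v .o = o := by rw [hfr.v _ (hmv _ (by decide) (by decide)), ho]
    have hs' : τ.v off = s := by rw [hfr.v _ (hmv _ hoff.1 hoff.2), hs]
    have hr' : τ.a .raw (s + k) = f k := by rw [hfr.a _ (hma _ (by decide)), hf k hk]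
    have hmod := Nat.mod_lt (f k) hm0
    have h6 := hV.six
    have hfk := hfV k hk
    have hhist : hist f k m (f k % m) < V := (hist_le _ _ _ _).trans_lt (by omega)
    have h2V := hV.two_le
    refine wp_seq (wp_set_bd hV hn' (o + f k % m) (by decide) ?_ (by simp [Ex.deg])
      (by simp [ho', hs', hi, hr', hm']) ?_)
    · simp [ho', hs', hi, hr', hm', hn']
      omega
    · have hrw : τ.a .work (o + f k % m) = hist f k m (f k % m) := h1 _ hmod
      refine wp_wr_val hV (by simp [hn']) (o + f k % m) (hist f k m (f k % m) + 1)
        (by simp; omega) (by decide) (by simp) ?_ (by simp) (by simp [hrw]) ⟨⟨?_, ?_⟩, ?_⟩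
      · refine Ex.bd.ok hV (by simp [hn']) ?_ (by decide)
        simp [hrw]
        omega
      · intro j hj
        simp only [Store.set_a, Store.put_a, if_true, Function.update_apply, hist_succ,
          Nat.add_left_cancel_iff, h1 j hj]
        split_ifs with g1 g2 g2 <;> first | rfl | omega | rw [g1]
      · intro j hj
        simp only [Store.set_a, Store.put_a, if_true, Function.update_apply]
        rw [if_neg (by omega), h2 j hj]
      · simp [addrCost]
  · intro σ' t' hfr h ht
    rw [ha] at h ht
    simp only [sum_const, card_range, smul_eq_mul] at ht
    exact hQ σ' t' hfr h.1 h.2 (by omega)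

/-- The histograms vanish from m on and 2m ≤ N, so the negacyclic convolution does not wrap around
and is an ordinary product. Its coefficients count pairs and are at most a b < V, as the exact
division in `wp_mulCmd` requires. -/
theorem wp_convCmd (hV : Fits w n V) (hn : σ.v .n = n) {u m sA sB a b : ℕ} (hu : σ.v .u = u)
    (hN : σ.v .N = 2 ^ (u + 1)) (hNV : 32 * 2 ^ (u + 1) * (u + 1) < V)
    (hm : σ.v .mm = m) (hm0 : 0 < m) (hmN : 2 * m ≤ 2 ^ (u + 1))
    (hoA : σ.v .oA = sA) (hoB : σ.v .oB = sB) (hlA : σ.v .lA = a) (hlB : σ.v .lB = b)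
    (hsA : sA + a ≤ 6 * n) (hsB : sB + b ≤ 6 * n) (habV : a * b < V) (ha : a ≤ n) (hb : b ≤ n)
    {f g : ℕ → ℕ} (hf : ∀ i < a, σ.a .raw (sA + i) = f i) (hg : ∀ i < b, σ.a .raw (sB + i) = g i)
    (hfV : ∀ i < a, f i < V) (hgV : ∀ i < b, g i < V)
    (hQ : ∀ σ' t', Frame convCmd σ σ' →
      (∀ x < m, σ'.a .work x + σ'.a .work (x + m) = pairCount f g a b m x) →
      t' ≤ t + convTime u n → Q σ' t') : WP w convCmd Q σ t := by
  refine WP.mono (R := fun σ' t' => _ ∧ _) ?_ (fun σ' t' hf h => hQ σ' t' hf h.1 h.2)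
  have h17 := hV.num
  simp only [numArr] at h17
  have hN0 : 0 < 2 ^ (u + 1) := by positivity
  have hN32 : 32 * 2 ^ (u + 1) ≤ 32 * 2 ^ (u + 1) * (u + 1) := Nat.le_mul_of_pos_right _ (by omega)
  refine wp_seq (wp_set_bd hV hn (2 * 2 ^ (u + 1)) (by decide) (by simp [hN]; omega) (by decide)
    (by simp [hN]) ?_)
  refine wp_seq (wp_clear hV (by simp [hn]) rfl (by simp; omega) ?_)
  intro σ₁ t₁ hf₁ hw₁ ht₁
  have h0 : ∀ x, x ∉ [Var.Z, .i] → σ₁.v x = σ.v x := by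
    intro x hx
    simp only [List.mem_cons, List.not_mem_nil, or_false, not_or] at hx
    rw [hf₁.v x (by simp [clearCmd, Cmd.for, Cmd.mv, Ne.symm hx.2])]
    simp [hx.1]
  have hr₁ : σ₁.a .raw = σ.a .raw := by rw [hf₁.a _ (by decide)]; simp
  refine wp_seq (wp_set_bd hV (by rw [h0 _ (by decide), hn]) 0 (by decide) (by simp; omega)
    (by decide) (by simp) ?_)
  refine wp_seq (wp_hist hV (by simp [h0, hn]) (f := f) (m := m) (o := 0) (a := a) (s := sA)
    (by decide) (by decide) (by simp [h0, hm]) hm0 (by omega) (by simp) (by omega)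
    (by simp [h0, hoA]) (by simp [h0, hlA]) hsA (by simpa [hr₁] using hf) hfV
    (fun j hj => by simpa using hw₁ j (by simp; omega)) ?_)
  intro σ₂ t₂ hf₂ hw₂ hk₂ ht₂
  have h02 : ∀ x, x ∉ [Var.Z, .i, .o, .l] → σ₂.v x = σ.v x := by
    intro x hx
    simp only [List.mem_cons, List.not_mem_nil, or_false, not_or] at hx
    rw [hf₂.v x (by simp [histCmd, Cmd.for, Cmd.mv, Ne.symm hx.2.1, Ne.symm hx.2.2.2])]
    simp [hx.2.2.1, h0 x (by simp [hx])]
  have hr₂ : σ₂.a .raw = σ.a .raw := by rw [hf₂.a _ (by decide)]; simp [hr₁]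
  refine wp_seq (wp_set_bd hV (by rw [h02 _ (by decide), hn]) (2 ^ (u + 1)) (by decide)
    (by simp [h02 .N, hN]; omega) (by decide) (by simp [h02 .N, hN]) ?_)
  refine wp_seq (wp_hist hV (by simp [h02, hn]) (f := g) (m := m) (o := 2 ^ (u + 1)) (a := b)
    (s := sB) (by decide) (by decide) (by simp [h02, hm]) hm0 (by omega) (by simp) (by omega)
    (by simp [h02, hoB]) (by simp [h02, hlB]) hsB (by simpa [hr₂] using hg) hgV
    (fun j hj => by
      rw [Store.set_a, hk₂ _ (by omega), Store.set_a]
      exact hw₁ _ (by simp; omega)) ?_)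
  intro σ₃ t₃ hf₃ hw₃ hk₃ ht₃
  have h03 : ∀ x, x ∉ [Var.Z, .i, .o, .l] → σ₃.v x = σ.v x := by
    intro x hx
    have hx' := hx
    simp only [List.mem_cons, List.not_mem_nil, or_false, not_or] at hx
    rw [hf₃.v x (by simp [histCmd, Cmd.for, Cmd.mv, Ne.symm hx.2.1, Ne.symm hx.2.2.2])]
    simp [hx.2.2.1, h02 x hx']
  have hA : ∀ j < 2 ^ (u + 1), σ₃.a .work j = hist f a m j := by
    intro j hj
    rw [hk₃ _ (by omega), Store.set_a]
    rcases lt_or_ge j m with h | h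
    · simpa using hw₂ j h
    · rw [hk₂ _ (by omega), Store.set_a, hw₁ _ (by simp; omega), hist_eq_zero hm0 h]
  have hB : ∀ j < 2 ^ (u + 1), σ₃.a .work (2 ^ (u + 1) + j) = hist g b m j := by
    intro j hj
    rcases lt_or_ge j m with h | h
    · exact hw₃ j h
    · rw [hk₃ _ (by omega), Store.set_a, hk₂ _ (by omega), Store.set_a, hw₁ _ (by simp; omega),
        hist_eq_zero hm0 h]
  have h6 := hV.six
  have hanti : ∀ F : ℕ → ZMod (2 ^ w), Anti (2 ^ (u + 1)) (ext (2 ^ (u + 1)) F) := ext_anti hN0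
  refine wp_mulCmd hV (by rw [h03 _ (by decide), hn]) (u := u) (by rw [h03 _ (by decide), hu])
    (by rw [h03 _ (by decide), hN]) hNV
    (φ := fun r => ext (2 ^ (u + 1)) fun j =>
      if r = 0 then (hist f a m j : ZMod (2 ^ w)) else (hist g b m j : ZMod (2 ^ w)))
    (fun r => hanti _) ?_
    (p := fun k => ∑ i ∈ range (k + 1), hist f a m i * hist g b m (k - i)) ?_ ?_ ?_
  · intro r hr l hl
    obtain rfl | rfl : r = 0 ∨ r = 1 := by omega
    · dsimp only
      rw [zero_mul, zero_add, hA l hl, ext_apply _ hl]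
      exact ⟨hV.lt ((hist_le _ _ _ _).trans_lt (by omega)), by simp⟩
    · dsimp only
      rw [one_mul, hB l hl, ext_apply _ hl]
      exact ⟨hV.lt ((hist_le _ _ _ _).trans_lt (by omega)), by simp⟩
  · intro k hk
    rw [negMul_ext hmN (fun i hi => by simp [hist_eq_zero hm0 hi])
      (fun i hi => by simp [hist_eq_zero hm0 hi]) hk]
    push_cast
    simp
  · intro k hk
    rw [sum_hist_mul_hist]
    exact (card_filter_le _ _).trans_lt (by simpa using habV)
  · intro σ₄ t₄ hf₄ h₄ ht₄
    refine ⟨fun x hx => ?_, ?_⟩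
    · rw [h₄ x (by omega), h₄ (x + m) (by omega), sum_hist_mul_hist, sum_hist_mul_hist]
      exact card_residues_add f g a b hx
    · simp at ht₁ ht₂ ht₃
      unfold convTime
      omega

end conv

end WordRAM

/-! ### Prime factors and collisions. -/

namespace WordRAM

section primes

/-- The product of the distinct prime divisors divides d, and each of them is at least 2. -/
theorem card_prime_dvd_le {d Λ : ℕ} (hd : d ≠ 0) (hΛ : d < 2 ^ Λ) (s : Finset ℕ)
    (hs : ∀ p ∈ s, p.Prime ∧ p ∣ d) : #s ≤ Λ := by
  have h1 : s ⊆ d.primeFactors := fun p hp => by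
    rw [Nat.mem_primeFactors]; exact ⟨(hs p hp).1, (hs p hp).2, hd⟩
  have h2 : 2 ^ #d.primeFactors ≤ ∏ p ∈ d.primeFactors, p :=
    Finset.pow_card_le_prod _ _ _ fun p hp => (Nat.prime_of_mem_primeFactors hp).two_le
  have h3 : ∏ p ∈ d.primeFactors, p ≤ d :=
    Nat.le_of_dvd (Nat.pos_of_ne_zero hd) (Nat.prod_primeFactors_dvd d)
  have h4 : 2 ^ #d.primeFactors < 2 ^ Λ := by omega
  exact (card_le_card h1).trans ((Nat.pow_lt_pow_iff_right (by norm_num)).1 h4).le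

/-- Chebyshev's lower bound. Every prime power in the central binomial coefficient of h' is at most
2h', so this coefficient is at most (2h')^π(2h'), whereas it exceeds 4^h' / h'. Comparing exponents
of 2 gives the claim, with small x checked by hand. -/
theorem two_pow_le_mul_primesLE {x : ℕ} (hx : 1 ≤ x) :
    2 ^ x ≤ 2 * x * #(Nat.primesLE (2 ^ x)) := by
  have hpos : 1 ≤ #(Nat.primesLE (2 ^ x)) := by
    rw [Nat.one_le_iff_ne_zero, ← Nat.pos_iff_ne_zero, card_pos]
    exact ⟨2, by
      rw [Nat.mem_primesLE]
      exact ⟨by simpa using Nat.pow_le_pow_right (n := 2) (by norm_num) hx, Nat.prime_two⟩⟩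
  rcases lt_or_ge x 3 with h | h
  · interval_cases x
    · omega
    · omega
  · obtain ⟨y, rfl⟩ : ∃ y, x = y + 1 := ⟨x - 1, by omega⟩
    set h' := 2 ^ y with hh
    have hX : 2 ^ (y + 1) = 2 * h' := by rw [pow_succ, mul_comm]
    have h4 : 4 ≤ h' := by
      calc 4 = 2 ^ 2 := rfl
        _ ≤ _ := Nat.pow_le_pow_right (by norm_num) (by omega)
    have hb := Nat.four_pow_lt_mul_centralBinom h' h4
    rw [← Nat.prod_pow_factorization_centralBinom] at hb
    have hsub : ∏ p ∈ range (2 * h' + 1), p ^ (Nat.centralBinom h').factorization p =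
        ∏ p ∈ Nat.primesLE (2 * h'), p ^ (Nat.centralBinom h').factorization p := by
      symm
      refine prod_subset (fun p hp => ?_) fun p hp hnp => ?_
      · rw [Nat.mem_primesLE] at hp; rw [mem_range]; omega
      · rw [Nat.mem_primesLE, not_and] at hnp
        rw [Nat.factorization_eq_zero_of_not_prime _ (hnp (by rw [mem_range] at hp; omega)),
          pow_zero]
    have hle : ∏ p ∈ Nat.primesLE (2 * h'), p ^ (Nat.centralBinom h').factorization p ≤
        (2 * h') ^ #(Nat.primesLE (2 * h')) := by
      refine prod_le_pow_card _ _ _ fun p _ => ?_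
      exact Nat.pow_factorization_choose_le (by omega)
    rw [hsub] at hb
    set π := #(Nat.primesLE (2 * h')) with hπ
    have h5 : 2 ^ (2 * h') < 2 ^ (y + (y + 1) * π) := by
      calc 2 ^ (2 * h') = 4 ^ h' := by rw [pow_mul]; norm_num
        _ < _ := hb
        _ ≤ h' * (2 * h') ^ π := Nat.mul_le_mul_left _ hle
        _ = 2 ^ (y + (y + 1) * π) := by rw [← hX, hh, ← pow_mul, ← pow_add]
    have h6 := (Nat.pow_lt_pow_iff_right (a := 2) (by norm_num)).1 h5
    rw [hX] at hpos ⊢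
    rw [← hπ] at hpos ⊢
    nlinarith

end primes

section collisions

variable (S : ℕ → ℕ) (P : ℕ)

/-- The number of indices below `P` whose value is congruent but not equal to `s`. -/
def coll (m s : ℕ) : ℕ := #{p ∈ range P | S p % m = s % m ∧ S p ≠ s}

theorem coll_le (m s : ℕ) : coll S P m s ≤ P := (card_filter_le _ _).trans (by simp)

/-- The total number of collisions with the values in a list. -/
def totalColl (l : List ℕ) (m : ℕ) : ℕ := (l.map (coll S P m)).sum

theorem totalColl_le (l : List ℕ) (m : ℕ) : totalColl S P l m ≤ l.length * P := by
  unfold totalColl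
  refine (List.sum_le_card_nsmul _ P ?_).trans (by simp)
  simpa using fun a _ => coll_le S P m a

theorem mod_eq_iff_dvd (a s m : ℕ) : a % m = s % m ↔ m ∣ ((s : ℤ) - a).natAbs := by
  rw [← Int.natCast_dvd, ← Nat.modEq_iff_dvd]; rfl

/-- Exchange the sums. A value colliding modulo m q collides modulo m already, and then its distance
from s is m e with e ≠ 0, where q must divide e; at most Λ primes do. -/
theorem sum_coll_le {Λ X m s : ℕ} (hm : 0 < m) (hS : ∀ p < P, S p < 2 ^ Λ) (hs : s < 2 ^ Λ) :
    ∑ q ∈ Nat.primesLE X, coll S P (m * q) s ≤ Λ * coll S P m s := by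
  simp only [coll, card_filter]
  rw [sum_comm, mul_sum]
  refine sum_le_sum fun p hp => ?_
  rw [mem_range] at hp
  rw [← card_filter]
  set d := ((s : ℤ) - S p).natAbs with hd
  split_ifs with h
  · rw [mod_eq_iff_dvd] at h
    obtain ⟨e, he⟩ := h.1
    have hd0 : d ≠ 0 := by have := h.2; omega
    have hdΛ : d < 2 ^ Λ := by have := hS p hp; generalize 2 ^ Λ = E at *; omega
    rw [← hd] at he
    have he0 : e ≠ 0 := by rintro rfl; simp at he; exact hd0 he
    rw [mul_one]
    refine card_prime_dvd_le he0 (lt_of_le_of_lt ?_ hdΛ) _ fun q hq => ?_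
    · rw [he]; exact Nat.le_mul_of_pos_left _ hm
    · rw [mem_filter, Nat.mem_primesLE, mod_eq_iff_dvd, ← hd, he] at hq
      exact ⟨hq.1.2, Nat.dvd_of_mul_dvd_mul_left hm hq.2.1⟩
  · rw [mul_zero, Nat.le_zero, card_eq_zero, filter_eq_empty_iff]
    intro q _ hq
    refine h ⟨?_, hq.2⟩
    rw [mod_eq_iff_dvd] at hq ⊢
    exact (Nat.dvd_mul_right m q).trans hq.1

theorem sum_totalColl_le {Λ X m : ℕ} {l : List ℕ} (hm : 0 < m) (hS : ∀ p < P, S p < 2 ^ Λ)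
    (hl : ∀ s ∈ l, s < 2 ^ Λ) :
    ∑ q ∈ Nat.primesLE X, totalColl S P l (m * q) ≤ Λ * totalColl S P l m := by
  induction l with
  | nil => simp [totalColl]
  | cons s l ih =>
    simp only [totalColl, List.map_cons, List.sum_cons, sum_add_distrib, mul_add] at ih ⊢
    exact add_le_add (sum_coll_le S P hm hS (hl s (by simp))) (ih fun s hs => hl s (by simp [hs]))

/-- Some factor `q` reduces the number of collisions considerably. -/
theorem exists_totalColl_le {Λ X m : ℕ} {l : List ℕ} (hm : 0 < m) (hX : 1 ≤ X)
    (hS : ∀ p < P, S p < 2 ^ Λ) (hl : ∀ s ∈ l, s < 2 ^ Λ) :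
    ∃ q, 1 ≤ q ∧ q ≤ X ∧
      totalColl S P l (m * q) * #(Nat.primesLE X) ≤ Λ * totalColl S P l m := by
  rcases (Nat.primesLE X).eq_empty_or_nonempty with h | h
  · exact ⟨1, le_rfl, hX, by simp [h]⟩
  · have h1 : ∑ q ∈ Nat.primesLE X, totalColl S P l (m * q) * #(Nat.primesLE X) ≤
        ∑ q ∈ Nat.primesLE X, Λ * totalColl S P l m := by
      rw [← sum_mul, sum_const, smul_eq_mul, mul_comm]
      exact Nat.mul_le_mul_left _ (sum_totalColl_le S P hm hS hl)
    obtain ⟨q, hq, h2⟩ := exists_le_of_sum_le h h1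
    rw [Nat.mem_primesLE] at hq
    exact ⟨q, hq.2.one_lt.le, hq.1, h2⟩

/-- At most half of the values have more than twice the average number of collisions. -/
theorem length_filter_le (l : List ℕ) (m : ℕ) :
    2 * (l.filter fun s => decide (2 * totalColl S P l m < coll S P m s * l.length)).length ≤
      l.length := by
  set Φ := totalColl S P l m with hΦ
  -- Markov's inequality, by induction on the list that is summed over while the threshold stays
  -- fixed. A strict inequality of integers gives 2Φ + 1 per listed value, so the case Φ = 0 is
  -- covered as well.
  have key : ∀ l' : List ℕ, ∀ c : ℕ, (l'.filter fun s => decide (2 * Φ < coll S P m s * c)).length *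
      (2 * Φ + 1) ≤ totalColl S P l' m * c := by
    intro l' c
    induction l' with
    | nil => simp
    | cons s l' ih =>
      simp only [totalColl, List.map_cons, List.sum_cons] at ih ⊢
      rw [List.filter_cons]
      split_ifs with h
      · simp only [decide_eq_true_eq] at h
        rw [List.length_cons]
        nlinarith
      · nlinarith [Nat.zero_le (coll S P m s * c)]
  have h := key l l.length
  rw [← hΦ] at h
  rcases Nat.eq_zero_or_pos Φ with h0 | h0
  · rw [h0] at h ⊢
    simp only [mul_zero, zero_add, mul_one, zero_mul] at h ⊢
    omega
  · by_contra hc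
    push Not at hc
    generalize (l.filter _).length = c at *
    nlinarith

end collisions

/-! ### Pairs of elements as single indices. -/

section pairs

theorem card_filter_range_mul {n b : ℕ} (hb : 0 < b) (R : ℕ → ℕ → Prop) [∀ i j, Decidable (R i j)] :
    #{p ∈ range (n * b) | R (p / b) (p % b)} = #{p ∈ range n ×ˢ range b | R p.1 p.2} := by
  refine card_bij (fun p _ => (p / b, p % b)) ?_ ?_ ?_
  · intro p hp
    simp only [mem_filter, mem_range, mem_product] at hp ⊢
    exact ⟨⟨Nat.div_lt_of_lt_mul (by rw [mul_comm]; exact hp.1), Nat.mod_lt _ hb⟩, hp.2⟩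
  · intro p _ p' _ h
    simp only [Prod.mk.injEq] at h
    rw [← Nat.div_add_mod p b, ← Nat.div_add_mod p' b, h.1, h.2]
  · rintro ⟨i, j⟩ h
    simp only [mem_filter, mem_range, mem_product] at h
    have h1 : (j + b * i) / b = i := by rw [Nat.add_mul_div_left _ _ hb, Nat.div_eq_of_lt h.1.2, zero_add]
    have h2 : (j + b * i) % b = j := by rw [Nat.add_mul_mod_self_left, Nat.mod_eq_of_lt h.1.2]
    refine ⟨j + b * i, ?_, ?_⟩
    · simp only [mem_filter, mem_range, h1, h2]
      refine ⟨?_, h.2⟩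
      nlinarith [h.1.1, h.1.2]
    · simp only [h1, h2]

/-- The sum of the `p`-th pair. -/
def pairSum (a b : ℕ → ℕ) (n p : ℕ) : ℕ := a (p / n) + b (p % n)

theorem pairCount_eq (a b : ℕ → ℕ) {n : ℕ} (hn : 0 < n) (m x : ℕ) :
    pairCount a b n n m x = #{p ∈ range (n * n) | pairSum a b n p % m = x} :=
  (card_filter_range_mul hn fun i j => (a i + b j) % m = x).symm

/-- The pairs in a residue class either have the sum s or collide with it. As multiplicities are
tabulated, the number of collisions is the convolution minus a table entry, computable without
enumerating any pair. -/
theorem pairCount_eq_add (a b : ℕ → ℕ) {n : ℕ} (hn : 0 < n) (m s : ℕ) :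
    pairCount a b n n m (s % m) = coll (pairSum a b n) (n * n) m s +
      #{p ∈ range (n * n) | pairSum a b n p = s} := by
  rw [pairCount_eq _ _ hn, coll, ← card_union_of_disjoint]
  · congr 1
    ext p
    simp only [mem_union, mem_filter]
    by_cases h : pairSum a b n p = s <;> simp [h]
  · rw [disjoint_filter]
    intro p _ h
    simp [h.2]

/-- The pairs of elements of subsets can be counted among all pairs. -/
theorem pairCount_subset {a b : ℕ → ℕ} {n : ℕ} (hn : 0 < n)
    (ha : Set.InjOn a (Set.Iio n)) (hb : Set.InjOn b (Set.Iio n)) {A B : List ℕ}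
    (hA : A.Nodup) (hB : B.Nodup) (hAa : ∀ z ∈ A, ∃ i < n, a i = z)
    (hBb : ∀ z ∈ B, ∃ i < n, b i = z) (m x : ℕ) :
    pairCount (fun i => A.getD i 0) (fun i => B.getD i 0) A.length B.length m x =
      #{p ∈ range (n * n) | (a (p / n) ∈ A ∧ b (p % n) ∈ B) ∧ pairSum a b n p % m = x} := by
  have e2 := card_filter_range_mul (n := n) hn
    fun i j => (a i ∈ A ∧ b j ∈ B) ∧ (a i + b j) % m = x
  have h1 : #{p ∈ range A.length ×ˢ range B.length | (A.getD p.1 0 + B.getD p.2 0) % m = x} =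
      #{z ∈ A.toFinset ×ˢ B.toFinset | (z.1 + z.2) % m = x} := by
    refine card_bij (fun p _ => (A.getD p.1 0, B.getD p.2 0)) ?_ ?_ ?_
    · rintro ⟨i, j⟩ h
      simp only [mem_filter, mem_product, mem_range, List.mem_toFinset] at h ⊢
      refine ⟨⟨?_, ?_⟩, h.2⟩
      · rw [List.getD_eq_getElem _ _ h.1.1]; exact List.getElem_mem _
      · rw [List.getD_eq_getElem _ _ h.1.2]; exact List.getElem_mem _
    · rintro ⟨i, j⟩ h ⟨i', j'⟩ h' he
      simp only [mem_filter, mem_product, mem_range, Prod.mk.injEq] at h h' he ⊢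
      obtain ⟨⟨hi, hj⟩, -⟩ := h
      obtain ⟨⟨hi', hj'⟩, -⟩ := h'
      rwa [List.getD_eq_getElem _ _ hi, List.getD_eq_getElem _ _ hi',
        List.getD_eq_getElem _ _ hj, List.getD_eq_getElem _ _ hj', hA.getElem_inj_iff,
        hB.getElem_inj_iff] at he
    · rintro ⟨y, z⟩ h
      simp only [mem_filter, mem_product, List.mem_toFinset] at h
      obtain ⟨i, hi, rfl⟩ := List.getElem_of_mem h.1.1
      obtain ⟨j, hj, rfl⟩ := List.getElem_of_mem h.1.2
      refine ⟨(i, j), ?_, ?_⟩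
      · simp only [mem_filter, mem_product, mem_range, List.getD_eq_getElem _ _ hi,
          List.getD_eq_getElem _ _ hj]
        exact ⟨⟨hi, hj⟩, h.2⟩
      · simp only [List.getD_eq_getElem _ _ hi, List.getD_eq_getElem _ _ hj]
  rw [pairCount, h1]
  unfold pairSum
  rw [e2]
  symm
  refine card_bij (fun p _ => (a p.1, b p.2)) ?_ ?_ ?_
  · rintro ⟨i, j⟩ h
    simp only [mem_filter, mem_product, mem_range, List.mem_toFinset] at h ⊢
    exact ⟨h.2.1, h.2.2⟩
  · rintro ⟨i, j⟩ h ⟨i', j'⟩ h' he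
    simp only [mem_filter, mem_product, mem_range, Prod.mk.injEq] at h h' he ⊢
    exact ⟨ha h.1.1 h'.1.1 he.1, hb h.1.2 h'.1.2 he.2⟩
  · rintro ⟨y, z⟩ h
    simp only [mem_filter, mem_product, List.mem_toFinset] at h
    obtain ⟨i, hi, rfl⟩ := hAa y h.1.1
    obtain ⟨j, hj, rfl⟩ := hBb z h.1.2
    refine ⟨(i, j), ?_, rfl⟩
    simp only [mem_filter, mem_product, mem_range]
    exact ⟨⟨hi, hj⟩, h.1, h.2⟩

end pairs

end WordRAM

/-! ### Linked lists, the table of sums and the popular sums. -/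

namespace WordRAM

section lists

/-- `l` is the linked list with head `h`: pointers are successors of indices, and `0` is the end. -/
def Chain (nx : ℕ → ℕ) : ℕ → List ℕ → Prop
  | h, [] => h = 0
  | h, p :: l => h = p + 1 ∧ Chain nx (nx p) l

theorem Chain.congr {nx ny : ℕ → ℕ} {h : ℕ} {l : List ℕ} (hc : Chain nx h l)
    (hl : ∀ p ∈ l, ny p = nx p) : Chain ny h l := by
  induction l generalizing h with
  | nil => exact hc
  | cons p l ih =>
    refine ⟨hc.1, ?_⟩
    rw [hl p (by simp)]
    exact ih hc.2 fun q hq => hl q (by simp [hq])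

theorem Chain.eq_succ_iff {nx : ℕ → ℕ} {h p : ℕ} {l : List ℕ} (hc : Chain nx h l) :
    h = p + 1 ↔ l.head? = some p := by
  cases l with
  | nil => rw [show h = 0 from hc]; simp
  | cons q l => rw [hc.1]; simp

/-- The numbers below `k` that satisfy `P`, in decreasing order. -/
def sel (P : ℕ → Prop) [DecidablePred P] (k : ℕ) : List ℕ :=
  ((List.range k).filter fun p => decide (P p)).reverse

variable {P : ℕ → Prop} [DecidablePred P] {k p : ℕ}

@[simp] theorem sel_zero : sel P 0 = [] := rfl

theorem sel_succ : sel P (k + 1) = if P k then k :: sel P k else sel P k := by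
  unfold sel
  rw [List.range_succ, List.filter_append, List.reverse_append]
  split_ifs with h <;> simp [h]

@[simp] theorem mem_sel : p ∈ sel P k ↔ p < k ∧ P p := by simp [sel]

theorem sum_map_sel (g : ℕ → ℕ) : ((sel P k).map g).sum = ∑ p ∈ range k with P p, g p := by
  induction k with
  | zero => simp
  | succ k ih =>
    rw [sel_succ, range_add_one, filter_insert]
    split_ifs
    · rw [sum_insert (by simp), List.map_cons, List.sum_cons, ih]
    · exact ih

theorem length_sel : (sel P k).length = #{p ∈ range k | P p} := by
  rw [card_eq_sum_ones, ← sum_map_sel]; simp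

/-- The numbers `p < P` with `S p = s`. -/
abbrev fib (S : ℕ → ℕ) (P s : ℕ) : List ℕ := sel (fun p => S p = s) P

/-- The number `p` represents all numbers `p' < P` with the same value. -/
def IsRep (S : ℕ → ℕ) (P p : ℕ) : Prop := (fib S P (S p)).head? = some p

instance (S : ℕ → ℕ) (P : ℕ) : DecidablePred (IsRep S P) := fun p =>
  inferInstanceAs (Decidable ((fib S P (S p)).head? = some p))

theorem IsRep.eq {S : ℕ → ℕ} {P p q : ℕ} (hp : IsRep S P p) (hq : IsRep S P q) (h : S p = S q) :
    p = q := by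
  unfold IsRep at hp hq
  rw [h, hq] at hp
  simpa using hp.symm

theorem exists_isRep (S : ℕ → ℕ) {P p : ℕ} (hp : p < P) : ∃ q < P, IsRep S P q ∧ S q = S p := by
  have hmem : p ∈ fib S P (S p) := by simp [hp]
  obtain ⟨q, hq⟩ : ∃ q, (fib S P (S p)).head? = some q := by
    cases h : fib S P (S p) with
    | nil => rw [h] at hmem; simp at hmem
    | cons q l => exact ⟨q, rfl⟩
  have hq' := List.mem_of_mem_head? hq
  rw [mem_sel] at hq'
  exact ⟨q, hq'.1, by rw [IsRep, hq'.2, hq], hq'.2⟩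

/-- The array `f` begins with the list `l`. -/
def Holds (f : ℕ → ℕ) (l : List ℕ) : Prop := ∀ i (h : i < l.length), f i = l[i]

theorem Holds.snoc {f : ℕ → ℕ} {l : List ℕ} (h : Holds f l) (x : ℕ) :
    Holds (Function.update f l.length x) (l ++ [x]) := by
  intro i hi
  rw [List.length_append, List.length_singleton] at hi
  rcases Nat.lt_succ_iff_lt_or_eq.1 hi with h' | h'
  · rw [Function.update_of_ne (by omega), List.getElem_append_left h', h i h']
  · subst h'; simp

end lists

/-- The bounds for the sums of the elements of two arrays. -/
structure Input (w n V : ℕ) (a b : ℕ → ℕ) : Prop where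
  fits : Fits w n V
  two : 2 ≤ n
  left : ∀ i < n, a i < V
  right : ∀ i < n, b i < V
  sum : ∀ i < n, ∀ j < n, a i + b j + 1 < V
  four : 4 * n ^ 4 < V

/-- The two arrays are held in the input area. -/
structure Inp (n : ℕ) (a b : ℕ → ℕ) (σ : Store) : Prop where
  size : σ.v .n = n
  left : ∀ i < n, σ.a .raw i = a i
  right : ∀ i < n, σ.a .raw (n + i) = b i

theorem Inp.congr {n : ℕ} {a b : ℕ → ℕ} {σ τ : Store} (h : Inp n a b σ) (hn : τ.v .n = σ.v .n)
    (hr : τ.a .raw = σ.a .raw) : Inp n a b τ :=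
  ⟨by rw [hn, h.size], by rw [hr]; exact h.left, by rw [hr]; exact h.right⟩

theorem Inp.frame {n : ℕ} {a b : ℕ → ℕ} {σ τ : Store} {p : Cmd} (h : Inp n a b σ)
    (hf : Frame p σ τ) (hn : p.mv .n = false) (hr : p.ma .raw = false) : Inp n a b τ :=
  h.congr (hf.v _ hn) (hf.a _ hr)

/-- The sum of the pair with index `e`. -/
def sumEx (e : Ex) : Ex := .rd .raw (e / .v .n) + .rd .raw (Ex.v .n + e % .v .n)

section sumEx

variable {w n V : ℕ} {a b : ℕ → ℕ} (hI : Input w n V a b)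
include hI

theorem Input.sq_lt : n * n < V := by
  have h2 := hI.two
  have h := hI.four
  have : n * n ≤ n ^ 4 := by
    calc n * n = n ^ 2 := (sq n).symm
      _ ≤ n ^ 4 := Nat.pow_le_pow_right (by omega) (by norm_num)
  omega

theorem Input.pairSum_lt {p : ℕ} (hp : p < n * n) : pairSum a b n p + 1 < V :=
  hI.sum _ (Nat.div_lt_of_lt_mul hp) _ (Nat.mod_lt _ (by have := hI.two; omega))

theorem sumEx_spec {σ : Store} (hσ : Inp n a b σ) {e : Ex} {p : ℕ} (he : e.bd w V σ)
    (hev : e.ev w σ = p) (hp : p < n * n) :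
    (sumEx e).bd w V σ ∧ (sumEx e).ev w σ = pairSum a b n p := by
  have h1 : p / n < n := Nat.div_lt_of_lt_mul hp
  have h2 : p % n < n := Nat.mod_lt _ (by have := hI.two; omega)
  have h6 := hI.fits.six
  have h3 := hI.left _ h1
  have h4 := hI.right _ h2
  simp [sumEx, pairSum, hev, hσ.size, hσ.left _ h1, hσ.right _ h2, he]
  omega

end sumEx

/-- The linked lists of the pairs with a given sum. -/
structure Table (S : ℕ → ℕ) (V k : ℕ) (σ : Store) : Prop where
  chain : ∀ s, Chain (σ.a .nxt) (σ.a .head s) (fib S k s)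
  cnt : ∀ s, σ.a .cnt s = (fib S k s).length
  top : ∀ p < k, S p < σ.v .top
  top_lt : σ.v .top < V

theorem Table.congr {S : ℕ → ℕ} {V k : ℕ} {σ τ : Store} (h : Table S V k σ)
    (h1 : τ.a .nxt = σ.a .nxt) (h2 : τ.a .head = σ.a .head) (h3 : τ.a .cnt = σ.a .cnt)
    (h4 : τ.v .top = σ.v .top) : Table S V k τ :=
  ⟨by rw [h1, h2]; exact h.chain, by rw [h3]; exact h.cnt, by rw [h4]; exact h.top,
    by rw [h4]; exact h.top_lt⟩

theorem Table.frame {S : ℕ → ℕ} {V k : ℕ} {σ τ : Store} {p : Cmd} (h : Table S V k σ)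
    (hf : Frame p σ τ) (hm : (p.ma .nxt || p.ma .head || p.ma .cnt || p.mv .top) = false) :
    Table S V k τ := by
  simp only [Bool.or_eq_false_iff] at hm
  exact h.congr (hf.a _ hm.1.1.1) (hf.a _ hm.1.1.2) (hf.a _ hm.1.2) (hf.v _ hm.2)

/-- Pairs are inserted at the front, so the representative of a sum is its last pair, and one
comparison with the head recognises it. This visits each distinct sum once without a separate list
of them. -/
theorem Table.rep_iff {S : ℕ → ℕ} {V k : ℕ} {σ : Store} (h : Table S V k σ) (p : ℕ) :
    σ.a .head (S p) = p + 1 ↔ IsRep S k p := (h.chain (S p)).eq_succ_iff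

theorem Table.head_le {S : ℕ → ℕ} {V k : ℕ} {σ : Store} (h : Table S V k σ) (s : ℕ) :
    σ.a .head s ≤ k := by
  have := h.chain s
  cases hl : fib S k s with
  | nil => rw [hl] at this; rw [show σ.a .head s = 0 from this]; omega
  | cons p l =>
    rw [hl] at this
    have hp : p ∈ fib S k s := by rw [hl]; simp
    rw [mem_sel] at hp
    rw [this.1]; omega

theorem length_fib_le (S : ℕ → ℕ) (k s : ℕ) : (fib S k s).length ≤ k := by
  rw [length_sel]; exact (card_filter_le _ _).trans (by simp)

/-- Build the linked lists. -/
def buildCmd : Cmd :=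
  .y ≔ Ex.v .n * .v .n ;; .top ≔ .c 0 ;;
  .for .p .y (.s ≔ sumEx (.v .p) ;; .wr .nxt (.v .p) (.rd .head (.v .s)) ;;
    .wr .head (.v .s) (Ex.v .p + .c 1) ;; .wr .cnt (.v .s) (.rd .cnt (.v .s) + Ex.c 1) ;;
    .ite (.bin .lt (.v .s) (.v .top)) .skip (.top ≔ Ex.v .s + .c 1))

/-- The list of the values that are taken often. -/
def popList (S : ℕ → ℕ) (P n k : ℕ) : List ℕ :=
  ((List.range k).filter fun p =>
    decide (IsRep S P p ∧ n < (fib S P (S p)).length * (fib S P (S p)).length)).map S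

theorem popList_succ (S : ℕ → ℕ) (P n k : ℕ) : popList S P n (k + 1) =
    if IsRep S P k ∧ n < (fib S P (S k)).length * (fib S P (S k)).length then
      popList S P n k ++ [S k] else popList S P n k := by
  unfold popList
  rw [List.range_succ, List.filter_append, List.map_append]
  split_ifs with h <;> simp [h]

theorem mem_popList {S : ℕ → ℕ} {P n s : ℕ} : s ∈ popList S P n P ↔
    (∃ p < P, S p = s) ∧ n < (fib S P s).length * (fib S P s).length := by
  unfold popList
  simp only [List.mem_map, List.mem_filter, List.mem_range, decide_eq_true_eq]
  constructor
  · rintro ⟨p, ⟨hp, -, h⟩, rfl⟩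
    exact ⟨⟨p, hp, rfl⟩, h⟩
  · rintro ⟨⟨p, hp, rfl⟩, h⟩
    obtain ⟨q, hq, hr, he⟩ := exists_isRep S hp
    exact ⟨q, ⟨hq, hr, by rwa [he]⟩, he⟩

theorem nodup_popList (S : ℕ → ℕ) (P n k : ℕ) : (popList S P n k).Nodup := by
  refine List.Nodup.map_on ?_ (List.nodup_range.filter _)
  intro p hp q hq h
  simp only [List.mem_filter, decide_eq_true_eq] at hp hq
  exact hp.2.1.eq hq.2.1 h

theorem length_popList_le (S : ℕ → ℕ) (P n k : ℕ) : (popList S P n k).length ≤ k := by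
  unfold popList
  rw [List.length_map]
  exact (List.length_filter_le _ _).trans (by simp)

/-- A popular value is attained more than √n times, hence at least `n.sqrt + 1` times, and the
fibres of different values are disjoint. -/
theorem length_popList_mul_le (S : ℕ → ℕ) (P n : ℕ) :
    (popList S P n P).length * (n.sqrt + 1) ≤ P := by
  have h1 : ∀ s ∈ popList S P n P, n.sqrt + 1 ≤ #{p ∈ range P | S p = s} := by
    intro s hs
    have h2 := (mem_popList.1 hs).2
    rw [← length_sel]
    by_contra hc
    have h3 : (fib S P s).length ≤ n.sqrt := Nat.lt_succ_iff.1 (not_le.1 hc)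
    have h4 := Nat.mul_le_mul h3 h3
    have h5 := Nat.sqrt_le n
    omega
  calc (popList S P n P).length * (n.sqrt + 1)
      = ∑ s ∈ (popList S P n P).toFinset, (n.sqrt + 1) := by
        rw [sum_const, List.toFinset_card_of_nodup (nodup_popList S P n P), smul_eq_mul]
    _ ≤ ∑ s ∈ (popList S P n P).toFinset, #{p ∈ range P | S p = s} :=
        sum_le_sum fun s hs => h1 s (by simpa using hs)
    _ ≤ #(range P) := by
        rw [← card_biUnion]
        · exact card_le_card (biUnion_subset.2 fun s _ => filter_subset _ _)
        · intro s _ s' _ hss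
          rw [Function.onFun, disjoint_filter]
          intro p _ h h'
          exact hss (h.symm.trans h')
    _ = P := card_range P

/-- List the values that are taken often. -/
def popCmd : Cmd :=
  .pop ≔ .c 0 ;;
  .for .p .y (.s ≔ sumEx (.v .p) ;; .ite (.bin .eq (.rd .head (.v .s)) (Ex.v .p + .c 1))
    (.ite (.bin .lt (.v .n) (Ex.rd .cnt (.v .s) * .rd .cnt (.v .s)))
      (.wr .popular (.v .pop) (.v .s) ;; .pop ≔ Ex.v .pop + .c 1) .skip) .skip)

section table

variable {w n V : ℕ} {a b : ℕ → ℕ} {Q : Store → ℕ → Prop} {σ : Store} {t : ℕ}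

/-- The lists are addressed by the sum itself. Clearing an array of that length would take too long,
so it matters that it is zero from the start, which is also why pointers are successors of indices.
The variable `top` ends above all sums and later protects against queries that are out of range. -/
theorem wp_build (hI : Input w n V a b) (hσ : Inp n a b σ) (h0 : σ.a .head = fun _ => 0)
    (hc0 : σ.a .cnt = fun _ => 0)
    (hQ : ∀ σ' t', Frame buildCmd σ σ' → σ'.v .y = n * n →
      Table (pairSum a b n) V (n * n) σ' → t' ≤ t + 100 * (n * n) + 20 → Q σ' t') :
    WP w buildCmd Q σ t := by
  refine WP.mono (R := fun σ' t' => _ ∧ _ ∧ _) ?_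
    (fun σ' t' hf h => hQ σ' t' hf h.1 h.2.1 h.2.2)
  have hV := hI.fits
  have h17 := hV.num
  simp only [numArr] at h17
  have hnn := hI.sq_lt
  have h6 := hV.six
  refine wp_seq (wp_set_bd hV hσ.size (n * n) (by decide) (by simp [hσ.size]; omega) (by decide)
    (by simp [hσ.size]) ?_)
  refine wp_seq (wp_set_bd hV (by simp [hσ.size]) 0 (by decide) (by simp; omega) (by decide)
    (by simp) ?_)
  refine wp_for_frame (fun k τ => Table (pairSum a b n) V k τ) (fun _ => 90)
    (by decide) (by decide) (by decide) (by decide) (hV.lt (by simpa using hnn)) hV.one_lt ?_ ?_ ?_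
  · exact ⟨fun s => by simp [h0, Chain], fun s => by simp [hc0], by simp, by simp; omega⟩
  · intro k τ t' hk hp hb hf hT
    replace hk : k < n * n := by simpa using hk
    have hin : Inp n a b τ := hσ.congr (by rw [hf.v _ (by decide)]; simp)
      (by rw [hf.a _ (by decide)]; simp)
    have hsp := sumEx_spec hI hin (e := .v .p) (by simp [hp]; omega) (by simpa using hp) hk
    have hS := hI.pairSum_lt hk
    set s := pairSum a b n k with hs
    have hhd := hT.head_le s
    have hcn : τ.a .cnt s ≤ k := by rw [hT.cnt]; exact length_fib_le _ _ _
    have htop := hT.top_lt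
    refine wp_seq (wp_set_bd hV hin.size s (by decide) hsp.1 (by decide) hsp.2 ?_)
    refine wp_seq (wp_wr_val hV (by simp [hin.size]) k (τ.a .head s) (by simp [hp]; omega) (by decide)
      (by simp) (Ex.bd.ok hV (by simp [hin.size]) (by simp; omega) (by decide)) (by simp [hp])
      (by simp) ?_)
    refine wp_seq (wp_wr_val hV (by simp [hin.size]) s (k + 1) (by simp; omega) (by decide)
      (by simp) (Ex.bd.ok hV (by simp [hin.size]) (by simp [hp]; omega) (by decide)) (by simp)
      (by simp [hp]) ?_)
    refine wp_seq (wp_wr_val hV (by simp [hin.size]) s (τ.a .cnt s + 1) (by simp; omega) (by decide)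
      (by simp) (Ex.bd.ok hV (by simp [hin.size]) (by simp; omega) (by decide)) (by simp)
      (by simp) ?_)
    have hch : ∀ s', Chain (Function.update (τ.a .nxt) k (τ.a .head s))
        (Function.update (τ.a .head) s (k + 1) s') (fib (pairSum a b n) (k + 1) s') := by
      intro s'
      have hold : Chain (Function.update (τ.a .nxt) k (τ.a .head s)) (τ.a .head s')
          (fib (pairSum a b n) k s') := (hT.chain s').congr fun p hp => by
        rw [mem_sel] at hp
        rw [Function.update_of_ne (by omega)]
      rw [fib, sel_succ, Function.update_apply]
      by_cases h : s' = s
      · subst h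
        rw [if_pos rfl, if_pos hs.symm]
        exact ⟨rfl, by simpa using hold⟩
      · rw [if_neg h, if_neg (by rw [← hs]; exact Ne.symm h)]
        exact hold
    have hct : ∀ s', Function.update (τ.a .cnt) s (τ.a .cnt s + 1) s' =
        (fib (pairSum a b n) (k + 1) s').length := by
      intro s'
      rw [fib, sel_succ, Function.update_apply]
      by_cases h : s' = s
      · subst h
        rw [if_pos rfl, if_pos hs.symm, hT.cnt, List.length_cons]
      · rw [if_neg h, if_neg (by rw [← hs]; exact Ne.symm h), hT.cnt]
    refine wp_ite_bd hV (by simp [hin.size]) (by simp; omega) (by decide) (fun h => ?_) (fun h => ?_)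
    · simp only [Ex.ev_lt, Ex.ev_v, Store.put_v, Store.set_v] at h
      refine wp_skip ⟨⟨by simpa using hch, by simpa using hct, ?_, by simpa using htop⟩, ?_⟩
      · intro p hp
        rcases Nat.lt_succ_iff_lt_or_eq.1 hp with h1 | rfl
        · simpa using hT.top p h1
        · simp at h ⊢; omega
      · simp [addrCost, sumEx]
    · simp only [Ex.ev_lt, Ex.ev_v, Store.put_v, Store.set_v] at h
      refine wp_set_bd hV (by simp [hin.size]) (s + 1) (by decide) (by simp; omega) (by decide)
        (by simp) ⟨⟨by simpa using hch, by simpa using hct, ?_, by simpa using hS⟩, ?_⟩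
      · intro p hp
        rcases Nat.lt_succ_iff_lt_or_eq.1 hp with h1 | rfl
        · have := hT.top p h1
          simp at h ⊢; omega
        · simp [← hs]
      · simp [addrCost, sumEx]
  · intro σ' t' hf h ht
    refine ⟨by rw [hf.v _ (by decide)]; simp, by simpa using h, ?_⟩
    simp only [sum_const, card_range, smul_eq_mul] at ht
    simp at ht
    omega

theorem wp_pop (hI : Input w n V a b) (hσ : Inp n a b σ) (hy : σ.v .y = n * n)
    (hT : Table (pairSum a b n) V (n * n) σ)
    (hQ : ∀ σ' t', Frame popCmd σ σ' →
      σ'.v .pop = (popList (pairSum a b n) (n * n) n (n * n)).length →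
      Holds (σ'.a .popular) (popList (pairSum a b n) (n * n) n (n * n)) →
      t' ≤ t + 100 * (n * n) + 20 → Q σ' t') :
    WP w popCmd Q σ t := by
  refine WP.mono (R := fun σ' t' => _ ∧ _ ∧ _) ?_
    (fun σ' t' hf h => hQ σ' t' hf h.1 h.2.1 h.2.2)
  have hV := hI.fits
  have h17 := hV.num
  simp only [numArr] at h17
  have hnn := hI.sq_lt
  have h6 := hV.six
  set S := pairSum a b n with hSd
  refine wp_seq (wp_set_bd hV hσ.size 0 (by decide) (by simp; omega) (by decide) (by simp) ?_)
  refine wp_for_frame (fun k τ => τ.v .pop = (popList S (n * n) n k).length ∧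
      Holds (τ.a .popular) (popList S (n * n) n k)) (fun _ => 90)
    (by decide) (by decide) (by decide) (by decide) (hV.lt (by simpa [hy] using hnn)) hV.one_lt
    ?_ ?_ ?_
  · exact ⟨by simp [popList], by intro i hi; simp [popList] at hi⟩
  · rintro k τ t' hk hp hb hf ⟨h1, h2⟩
    replace hk : k < n * n := by simpa [hy] using hk
    have hin : Inp n a b τ := hσ.congr (by rw [hf.v _ (by decide)]; simp)
      (by rw [hf.a _ (by decide)]; simp)
    have hT' : Table S V (n * n) τ := hT.congr (by rw [hf.a _ (by decide)]; simp)
      (by rw [hf.a _ (by decide)]; simp) (by rw [hf.a _ (by decide)]; simp)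
      (by rw [hf.v _ (by decide)]; simp)
    have hsp := sumEx_spec hI hin (e := .v .p) (by simp [hp]; omega) (by simpa using hp) hk
    have hS := hI.pairSum_lt hk
    rw [← hSd] at hsp hS
    have hhd := hT'.head_le (S k)
    have hcn : τ.a .cnt (S k) ≤ n * n := by rw [hT'.cnt]; exact length_fib_le _ _ _
    have hpl := length_popList_le S (n * n) n k
    refine wp_seq (wp_set_bd hV hin.size (S k) (by decide) hsp.1 (by decide) hsp.2 ?_)
    refine wp_ite_bd hV (by simp [hin.size]) (by simp [hp]; omega) (by decide)
      (fun h => ?_) (fun h => ?_)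
    · have hrep : IsRep S (n * n) k := by
        rw [← hT'.rep_iff]; simpa [hp] using h
      refine wp_ite_bd hV (by simp [hin.size]) (by simp [hin.size]; omega) (by decide)
        (fun h' => ?_) (fun h' => ?_)
      · have hlt : n < (fib S (n * n) (S k)).length * (fib S (n * n) (S k)).length := by
          rw [← hT'.cnt]; simpa [hin.size] using h'
        refine wp_seq (wp_wr_val hV (by simp [hin.size]) (popList S (n * n) n k).length (S k)
          (by simp [h1]; omega) (by decide) (by simp) trivial (by simp [h1]) (by simp) ?_)
        refine wp_set_bd hV (by simp [hin.size]) ((popList S (n * n) n k).length + 1) (by decide)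
          (by simp [h1]; omega) (by decide) (by simp [h1]) ⟨⟨?_, ?_⟩, ?_⟩
        · rw [popList_succ, if_pos ⟨hrep, hlt⟩]; simp
        · rw [popList_succ, if_pos ⟨hrep, hlt⟩]; simpa using h2.snoc (S k)
        · simp [addrCost, sumEx]
      · have hlt : ¬ n < (fib S (n * n) (S k)).length * (fib S (n * n) (S k)).length := by
          rw [← hT'.cnt]; simpa [hin.size] using h'
        refine wp_skip ⟨⟨?_, ?_⟩, ?_⟩
        · rw [popList_succ, if_neg (fun h => hlt h.2)]; simp [h1]
        · rw [popList_succ, if_neg (fun h => hlt h.2)]; simpa using h2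
        · simp [addrCost, sumEx]
    · have hrep : ¬ IsRep S (n * n) k := by
        rw [← hT'.rep_iff]; simpa [hp] using h
      refine wp_skip ⟨⟨?_, ?_⟩, ?_⟩
      · rw [popList_succ, if_neg (fun h => hrep h.1)]; simp [h1]
      · rw [popList_succ, if_neg (fun h => hrep h.1)]; simpa using h2
      · simp [addrCost, sumEx]
  · intro σ' t' hf h ht
    simp only [sum_const, card_range, smul_eq_mul] at ht
    simp [hy] at ht h
    exact ⟨h.1, h.2, by omega⟩

end table

end WordRAM

/-! ### The greedy choice of a modulus. -/

namespace WordRAM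

/-- The number of binary digits of the number of pairs. -/
def pairBits (n : ℕ) : ℕ := (n * n).size

/-- The logarithm of the bound for the factors of the moduli. -/
def logX (n : ℕ) : ℕ := (3 * pairBits n + 15) / 16

/-- Compute the parameters. -/
def setupCmd : Cmd :=
  .J ≔ .c 0 ;; .z ≔ .c 1 ;;
  .loop (.bin .lt (.v .z) (Ex.v .y + .c 1)) (.z ≔ Ex.c 2 * .v .z ;; .J ≔ Ex.v .J + .c 1) ;;
  .x ≔ (Ex.c 3 * .v .J + .c 15) / .c 16 ;; .u ≔ Ex.c 4 * .v .x ;;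
  .X ≔ .bin .shl (.c 1) (.v .x) ;; .N ≔ .bin .shl (.c 2) (.v .u) ;;
  .oA ≔ .c 0 ;; .oB ≔ .v .n ;; .lA ≔ .v .n ;; .lB ≔ .v .n

/-- The parameters have been computed. -/
structure Setup (n : ℕ) (σ : Store) : Prop where
  y : σ.v .y = n * n
  J : σ.v .J = pairBits n
  u : σ.v .u = 4 * logX n
  X : σ.v .X = 2 ^ logX n
  N : σ.v .N = 2 ^ (4 * logX n + 1)
  oA : σ.v .oA = 0
  oB : σ.v .oB = n
  lA : σ.v .lA = n
  lB : σ.v .lB = n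

theorem Setup.congr {n : ℕ} {σ τ : Store} (h : Setup n σ)
    (hv : ∀ x ∈ [Var.y, .J, .u, .X, .N, .oA, .oB, .lA, .lB], τ.v x = σ.v x) : Setup n τ := by
  constructor
  all_goals rw [hv _ (by decide)]
  exacts [h.y, h.J, h.u, h.X, h.N, h.oA, h.oB, h.lA, h.lB]

theorem Setup.frame {n : ℕ} {σ τ : Store} {p : Cmd} (h : Setup n σ) (hf : Frame p σ τ)
    (hm : ∀ x ∈ [Var.y, .J, .u, .X, .N, .oA, .oB, .lA, .lB], p.mv x = false) : Setup n τ :=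
  h.congr fun x hx => hf.v x (hm x hx)

/-- The words are long enough for the convolution. -/
def ConvFits (n V : ℕ) : Prop := 32 * 2 ^ (4 * logX n + 1) * (4 * logX n + 1) < V

/-- The number of collisions of `s`, from the convolution. -/
def collEx : Ex :=
  (.rd .work (Ex.v .s % .v .mm) + .rd .work (Ex.v .s % .v .mm + .v .mm)) - .rd .cnt (.v .s)

/-- Count the collisions of the listed values. -/
def phiCmd : Cmd :=
  .phi ≔ .c 0 ;; .for .d .pop (.s ≔ .rd .popular (.v .d) ;; .phi ≔ Ex.v .phi + collEx)

/-- Multiply the modulus by the factor that leads to the smallest number of collisions. -/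
def chooseCmd : Cmd :=
  .for .q .X (.mm ≔ Ex.v .m * (Ex.v .q + .c 1) ;; convCmd ;; phiCmd ;;
    .ite (.bin .eq (.v .q) (.c 0)) (.best ≔ .v .phi ;; .bq ≔ Ex.v .q + .c 1)
      (.ite (.bin .lt (.v .phi) (.v .best)) (.best ≔ .v .phi ;; .bq ≔ Ex.v .q + .c 1) .skip)) ;;
  .m ≔ Ex.v .m * .v .bq

section choose

variable {w n V : ℕ} {a b : ℕ → ℕ} {Q : Store → ℕ → Prop} {σ : Store} {t : ℕ}

theorem wp_setup (hI : Input w n V a b) (hC : ConvFits n V) (hσ : Inp n a b σ)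
    (hy : σ.v .y = n * n)
    (hQ : ∀ σ' t', Frame setupCmd σ σ' → Setup n σ' → t' ≤ t + 20 * pairBits n + 60 → Q σ' t') :
    WP w setupCmd Q σ t := by
  refine WP.mono (R := fun σ' t' => _ ∧ _) ?_ (fun σ' t' hf h => hQ σ' t' hf h.1 h.2)
  have hV := hI.fits
  have h17 := hV.num
  simp only [numArr] at h17
  have hnn := hI.sq_lt
  have h6 := hV.six
  refine wp_seq (wp_set_bd hV hσ.size 0 (by decide) (by simp; omega) (by decide) (by simp) ?_)
  refine wp_seq (wp_set_bd hV (by simp [hσ.size]) 1 (by decide) (by simp; omega) (by decide)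
    (by simp) ?_)
  have hsz : pairBits n ≤ n * n := Nat.size_le.2 (Nat.lt_two_pow_self)
  refine wp_seq (wp_loop (fun k τ t' => Inp n a b τ ∧ τ.v .y = n * n ∧ k ≤ pairBits n ∧
    τ.v .J = pairBits n - k ∧ τ.v .z = 2 ^ (pairBits n - k) ∧ t' + 18 * k ≤ t + 4 + 18 * pairBits n)
    (pairBits n) ?_ ?_ ?_ ?_)
  · exact ⟨hσ.congr (by simp) (by simp), by simp [hy], le_rfl, by simp, by simp, by simp⟩
  · rintro k τ t' ⟨hin, hy', hk, hJ, hz, -⟩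
    have hz2 : 2 ^ (pairBits n - k) ≤ n * n ↔ k ≠ 0 := by
      rw [← Nat.lt_size]; unfold pairBits at *; omega
    refine ⟨⟨trivial, Ex.bd.ok hV hin.size (by simp [hy']; omega) (by decide), hV.one_lt⟩, ?_⟩
    simp only [Ex.ev_lt, Ex.ev_v, Ex.ev_add, Ex.ev_c, hz, hy', Nat.lt_succ_iff, hz2]
    split_ifs <;> simp_all
  · rintro k τ t' ⟨hin, hy', hk, hJ, hz, ht⟩
    have hz2 : 2 ^ (pairBits n - (k + 1)) ≤ n * n := by
      rw [← Nat.lt_size]; unfold pairBits at *; omega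
    have he : pairBits n - k = pairBits n - (k + 1) + 1 := by omega
    refine wp_seq (wp_set_bd hV hin.size (2 ^ (pairBits n - k)) (by decide) (by simp [hz]; omega)
      (by decide) (by simp [hz, he, pow_succ']) ?_)
    refine wp_set_bd hV (by simp [hin.size]) (pairBits n - k) (by decide) (by simp [hJ]; omega)
      (by decide) (by simp [hJ]; omega) ?_
    exact ⟨hin.congr (by simp) (by simp), by simp [hy'], by omega, by simp, by simp, by simp; omega⟩
  rintro τ t' ⟨hin, hy', -, hJ, -, ht⟩
  rw [Nat.sub_zero] at hJ
  unfold ConvFits at hC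
  set x := logX n with hx
  have hpos : 32 * 2 ^ (4 * x + 1) ≤ 32 * 2 ^ (4 * x + 1) * (4 * x + 1) :=
    Nat.le_mul_of_pos_right _ (by omega)
  have hxlt : 4 * x + 1 < 2 ^ (4 * x + 1) := Nat.lt_two_pow_self
  have hXN : 2 ^ x ≤ 2 ^ (4 * x + 1) := Nat.pow_le_pow_right (by norm_num) (by omega)
  refine wp_seq (wp_set_bd hV hin.size x (by decide) (by simp [hJ]; omega) (by decide)
    (by simp [hJ, hx, logX]) ?_)
  refine wp_seq (wp_set_bd hV (by simp [hin.size]) (4 * x) (by decide) (by simp; omega) (by decide)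
    (by simp) ?_)
  refine wp_seq (wp_set_bd hV (by simp [hin.size]) (2 ^ x) (by decide) (by simp; omega) (by decide)
    (by simp) ?_)
  refine wp_seq (wp_set_bd hV (by simp [hin.size]) (2 ^ (4 * x + 1)) (by decide)
    (by simp [← pow_succ']; omega) (by decide) (by simp [← pow_succ']) ?_)
  refine wp_seq (wp_set_bd hV (by simp [hin.size]) 0 (by decide) (by simp; omega) (by decide)
    (by simp) ?_)
  refine wp_seq (wp_set_bd hV (by simp [hin.size]) n (by decide) (by simp [hin.size]; omega)
    (by decide) (by simp [hin.size]) ?_)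
  refine wp_seq (wp_set_bd hV (by simp [hin.size]) n (by decide) (by simp [hin.size]; omega)
    (by decide) (by simp [hin.size]) ?_)
  refine wp_set_bd hV (by simp [hin.size]) n (by decide) (by simp [hin.size]; omega) (by decide)
    (by simp [hin.size]) ?_
  refine ⟨⟨by simp [hy'], by simp [hJ], by simp [hx], by simp [hx], by simp [hx], by simp, by simp, by simp,
    by simp⟩, ?_⟩
  simp
  omega

theorem wp_conv_input (hI : Input w n V a b) (hC : ConvFits n V) (hσ : Inp n a b σ)
    (hS : Setup n σ) {m : ℕ} (hm : σ.v .mm = m) (hm0 : 0 < m)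
    (hmN : 2 * m ≤ 2 ^ (4 * logX n + 1))
    (hQ : ∀ σ' t', Frame convCmd σ σ' →
      (∀ x < m, σ'.a .work x + σ'.a .work (x + m) = pairCount a b n n m x) →
      t' ≤ t + convTime (4 * logX n) n → Q σ' t') : WP w convCmd Q σ t := by
  refine wp_convCmd hI.fits hσ.size hS.u hS.N hC hm hm0 hmN hS.oA hS.oB hS.lA hS.lB
    (by omega) (by omega) hI.sq_lt le_rfl le_rfl (f := a) (g := b)
    (fun i hi => by rw [zero_add]; exact hσ.left i hi) hσ.right hI.left hI.right hQ

/-- By `pairCount_eq_add` the subtraction is exact and never negative, so it satisfies its side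
condition. -/
theorem collEx_spec (hI : Input w n V a b) (hσ : Inp n a b σ)
    (hT : Table (pairSum a b n) V (n * n) σ) {m s : ℕ} (hm : σ.v .mm = m) (hm0 : 0 < m)
    (hmV : m < V) (hw : ∀ x < m, σ.a .work x + σ.a .work (x + m) = pairCount a b n n m x)
    (hs : σ.v .s = s) (hsV : s < V) :
    collEx.bd w V σ ∧ collEx.ev w σ = coll (pairSum a b n) (n * n) m s := by
  have h1 := hw _ (Nat.mod_lt s hm0)
  have hn0 : 0 < n := by have := hI.two; omega
  have h2 := pairCount_eq_add a b hn0 m s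
  have h3 : pairCount a b n n m (s % m) ≤ n * n := by
    rw [pairCount_eq _ _ hn0]; exact (card_filter_le _ _).trans (by simp)
  have h4 := hI.sq_lt
  have h5 := hT.cnt s
  rw [length_sel] at h5
  simp [collEx, hm, hs]
  omega

/-- The list of values at work. -/
structure Listed (S : ℕ → ℕ) (P n : ℕ) (l : List ℕ) (σ : Store) : Prop where
  pop : σ.v .pop = l.length
  holds : Holds (σ.a .popular) l
  sub : l.Sublist (popList S P n P)

theorem Listed.congr {S : ℕ → ℕ} {P n : ℕ} {l : List ℕ} {σ τ : Store} (h : Listed S P n l σ)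
    (h1 : τ.v .pop = σ.v .pop) (h2 : τ.a .popular = σ.a .popular) : Listed S P n l τ :=
  ⟨by rw [h1, h.pop], by rw [h2]; exact h.holds, h.sub⟩

theorem Listed.length_le {S : ℕ → ℕ} {P n : ℕ} {l : List ℕ} {σ : Store} (h : Listed S P n l σ) :
    l.length ≤ P := h.sub.length_le.trans (length_popList_le S P n P)

theorem Listed.exists_eq {S : ℕ → ℕ} {P n : ℕ} {l : List ℕ} {σ : Store} (h : Listed S P n l σ)
    {s : ℕ} (hs : s ∈ l) : ∃ p < P, S p = s :=
  (mem_popList.1 (h.sub.subset hs)).1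

theorem Listed.lt (hI : Input w n V a b) {l : List ℕ}
    (h : Listed (pairSum a b n) (n * n) n l σ) {s : ℕ} (hs : s ∈ l) : s < V := by
  obtain ⟨p, hp, rfl⟩ := h.exists_eq hs
  have := hI.pairSum_lt hp
  omega

theorem totalColl_lt (hI : Input w n V a b) {S : ℕ → ℕ} {l : List ℕ} (hl : l.length ≤ n * n) (m : ℕ) :
    4 * totalColl S (n * n) l m < V := by
  have h1 := totalColl_le S (n * n) l m
  have h2 : l.length * (n * n) ≤ n ^ 4 := by
    calc l.length * (n * n) ≤ n * n * (n * n) := Nat.mul_le_mul_right _ hl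
      _ = n ^ 4 := by ring
  have h3 := hI.four
  omega

theorem totalColl_take_succ {S : ℕ → ℕ} {P m k : ℕ} {l : List ℕ} (hk : k < l.length) :
    totalColl S P (l.take (k + 1)) m = totalColl S P (l.take k) m + coll S P m l[k] := by
  unfold totalColl
  rw [List.take_succ_eq_append_getElem hk, List.map_append, List.sum_append]
  simp

theorem wp_phi (hI : Input w n V a b) (hσ : Inp n a b σ)
    (hT : Table (pairSum a b n) V (n * n) σ) {l : List ℕ}
    (hl : Listed (pairSum a b n) (n * n) n l σ) {m : ℕ} (hm : σ.v .mm = m) (hm0 : 0 < m)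
    (hmV : m < V) (hw : ∀ x < m, σ.a .work x + σ.a .work (x + m) = pairCount a b n n m x)
    (hQ : ∀ σ' t', Frame phiCmd σ σ' → σ'.v .phi = totalColl (pairSum a b n) (n * n) l m →
      t' ≤ t + 100 * l.length + 20 → Q σ' t') : WP w phiCmd Q σ t := by
  refine WP.mono (R := fun σ' t' => _ ∧ _) ?_ (fun σ' t' hf h => hQ σ' t' hf h.1 h.2)
  have hV := hI.fits
  have h17 := hV.num
  simp only [numArr] at h17
  have hnn := hI.sq_lt
  have hll := hl.length_le
  set S := pairSum a b n with hSd
  refine wp_seq (wp_set_bd hV hσ.size 0 (by decide) (by simp; omega) (by decide) (by simp) ?_)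
  refine wp_for_frame (fun k τ => τ.v .phi = totalColl S (n * n) (l.take k) m) (fun _ => 90)
    (by decide) (by decide) (by decide) (by decide) (hV.lt (by simp [hl.pop]; omega)) hV.one_lt
    (by simp [totalColl]) ?_ ?_
  · intro k τ t' hk hd hb hf h1
    replace hk : k < l.length := by simpa [hl.pop] using hk
    have hin : Inp n a b τ := hσ.congr (by rw [hf.v _ (by decide)]; simp)
      (by rw [hf.a _ (by decide)]; simp)
    have hT' : Table S V (n * n) τ := hT.congr (by rw [hf.a _ (by decide)]; simp)
      (by rw [hf.a _ (by decide)]; simp) (by rw [hf.a _ (by decide)]; simp)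
      (by rw [hf.v _ (by decide)]; simp)
    have hpk : τ.a .popular k = l[k] := by
      rw [hf.a _ (by decide)]; exact hl.holds k hk
    have hlk := hl.lt hI (List.getElem_mem hk)
    refine wp_seq (wp_set_bd hV hin.size l[k] (by decide) (by simp [hd, hpk]; omega) (by decide)
      (by simp [hd, hpk]) ?_)
    have hsp := collEx_spec hI (σ := τ.set .s l[k]) (hin.congr (by simp) (by simp))
      (hT'.congr (by simp) (by simp) (by simp) (by simp)) (m := m) (s := l[k])
      (by rw [Store.set_v, if_neg (by decide), hf.v _ (by decide)]; simp [hm]) hm0 hmV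
      (by rw [Store.set_a, hf.a _ (by decide)]; exact hw) (by simp) hlk
    have hphi : 4 * totalColl S (n * n) (l.take k) m < V :=
      totalColl_lt hI ((List.length_take_le' _ _).trans hll) m
    refine wp_set_bd hV (by simp [hin.size]) (totalColl S (n * n) (l.take (k + 1)) m) (by decide)
      ⟨by simp [h1]; omega, hsp.1⟩ (by decide) ?_ ⟨by simp, by simp [collEx, addrCost]⟩
    rw [totalColl_take_succ hk, Ex.ev_add, hsp.2, ← hSd]
    simp [h1]
  · intro σ' t' hf h ht
    simp only [sum_const, card_range, smul_eq_mul] at ht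
    simp [hl.pop] at ht h
    exact ⟨h, by omega⟩

/-- All factors up to X are tried, not only primes. The minimum is at least as good as the factor
found by averaging over the primes in `exists_totalColl_le`, so no test for primality is needed. -/
theorem wp_choose (hI : Input w n V a b) (hC : ConvFits n V) (hσ : Inp n a b σ)
    (hT : Table (pairSum a b n) V (n * n) σ) (hS : Setup n σ) {l : List ℕ}
    (hl : Listed (pairSum a b n) (n * n) n l σ) {m Λ : ℕ} (hm : σ.v .m = m) (hm0 : 0 < m)
    (hmN : 2 * (m * 2 ^ logX n) ≤ 2 ^ (4 * logX n + 1)) (hΛ : V ≤ 2 ^ Λ)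
    (hQ : ∀ σ' t' q, Frame chooseCmd σ σ' → 1 ≤ q → q ≤ 2 ^ logX n → σ'.v .m = m * q →
      σ'.v .best = totalColl (pairSum a b n) (n * n) l (m * q) →
      totalColl (pairSum a b n) (n * n) l (m * q) * #(Nat.primesLE (2 ^ logX n)) ≤
        Λ * totalColl (pairSum a b n) (n * n) l m →
      t' ≤ t + 2 ^ logX n * (convTime (4 * logX n) n + 100 * l.length + 200) + 20 → Q σ' t') :
    WP w chooseCmd Q σ t := by
  set S := pairSum a b n with hSd
  refine WP.mono (R := fun σ' t' => ∃ q, 1 ≤ q ∧ q ≤ 2 ^ logX n ∧ σ'.v .m = m * q ∧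
      σ'.v .best = totalColl S (n * n) l (m * q) ∧
      totalColl S (n * n) l (m * q) * #(Nat.primesLE (2 ^ logX n)) ≤ Λ * totalColl S (n * n) l m ∧
      t' ≤ t + 2 ^ logX n * (convTime (4 * logX n) n + 100 * l.length + 200) + 20) ?_
    (fun σ' t' hf ⟨q, h1, h2, h3, h4, h5, h6⟩ => hQ σ' t' q hf h1 h2 h3 h4 h5 h6)
  have hV := hI.fits
  have h17 := hV.num
  simp only [numArr] at h17
  have hnn := hI.sq_lt
  have hll := hl.length_le
  have hCC := hC
  unfold ConvFits at hC
  have hpos : 32 * 2 ^ (4 * logX n + 1) ≤ 32 * 2 ^ (4 * logX n + 1) * (4 * logX n + 1) :=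
    Nat.le_mul_of_pos_right _ (by omega)
  have hX0 : 0 < 2 ^ logX n := by positivity
  have hmm : m ≤ m * 2 ^ logX n := Nat.le_mul_of_pos_right _ hX0
  have hXm : 2 ^ logX n ≤ m * 2 ^ logX n := Nat.le_mul_of_pos_left _ hm0
  -- Before the first candidate the variables for the optimum hold values from earlier use, so the
  -- invariant is silent at k = 0; the command accepts the first candidate without a comparison.
  refine wp_seq (wp_for_frame (fun k τ => 0 < k → 1 ≤ τ.v .bq ∧ τ.v .bq ≤ k ∧
      τ.v .best = totalColl S (n * n) l (m * τ.v .bq) ∧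
      ∀ q, 1 ≤ q → q ≤ k → totalColl S (n * n) l (m * τ.v .bq) ≤ totalColl S (n * n) l (m * q))
    (fun _ => convTime (4 * logX n) n + 100 * l.length + 100)
    (by decide) (by decide) (by decide) (by decide) (hV.lt (by rw [hS.X]; omega)) hV.one_lt
    (by simp) ?_ ?_)
  · intro k τ t' hk hq hb hf h1
    rw [hS.X] at hk
    have hmk : m * (k + 1) ≤ m * 2 ^ logX n := Nat.mul_le_mul_left _ hk
    have hm' : τ.v .m = m := by rw [hf.v _ (by decide), hm]
    have hn' : τ.v .n = n := by rw [hf.v _ (by decide), hσ.size]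
    refine wp_seq (wp_set_bd hV hn' (m * (k + 1)) (by decide)
      (by simp [hm', hq]; omega) (by decide) (by simp [hm', hq]) ?_)
    refine wp_seq (wp_conv_input hI hCC (σ := τ.set .mm (m * (k + 1))) (m := m * (k + 1))
      (hσ.congr (by simp [hσ.size, hn']) (by rw [Store.set_a, hf.a _ (by decide)]))
      (hS.congr fun x hx => by
        rw [Store.set_v, if_neg (by rintro rfl; simp at hx), hf.v]
        revert x; decide) (by simp) (by positivity) (by omega) ?_)
    intro σ₁ t₁ hf₁ hw₁ ht₁
    have hn₁ : σ₁.v .n = n := by rw [hf₁.v _ (by decide)]; simp [hn']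
    refine wp_seq (wp_phi hI (l := l) (m := m * (k + 1)) (σ := σ₁)
      (hσ.congr (by rw [hn₁, hσ.size])
        (by rw [hf₁.a _ (by decide), Store.set_a, hf.a _ (by decide)]))
      (hT.congr (by rw [hf₁.a _ (by decide), Store.set_a, hf.a _ (by decide)])
        (by rw [hf₁.a _ (by decide), Store.set_a, hf.a _ (by decide)])
        (by rw [hf₁.a _ (by decide), Store.set_a, hf.a _ (by decide)])
        (by rw [hf₁.v _ (by decide), Store.set_v, if_neg (by decide), hf.v _ (by decide)]))
      (hl.congr (by rw [hf₁.v _ (by decide), Store.set_v, if_neg (by decide), hf.v _ (by decide)])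
        (by rw [hf₁.a _ (by decide), Store.set_a, hf.a _ (by decide)]))
      (by rw [hf₁.v _ (by decide)]; simp) (by positivity) (by omega) hw₁ ?_)
    intro σ₂ t₂ hf₂ hphi ht₂
    have hn₂ : σ₂.v .n = n := by rw [hf₂.v _ (by decide), hn₁]
    have hq₂ : σ₂.v .q = k := by
      rw [hf₂.v _ (by decide), hf₁.v _ (by decide)]; simp [hq]
    have hbq : σ₂.v .bq = τ.v .bq := by
      rw [hf₂.v _ (by decide), hf₁.v _ (by decide)]; simp
    have hbest : σ₂.v .best = τ.v .best := by
      rw [hf₂.v _ (by decide), hf₁.v _ (by decide)]; simp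
    have hphiV : 4 * totalColl S (n * n) l (m * (k + 1)) < V := totalColl_lt hI hll _
    rw [← hSd] at hphi
    simp at ht₁
    refine wp_ite_bd hV hn₂ (by simp [hq₂]; omega) (by decide) (fun h => ?_) (fun h => ?_)
    · have hk0 : k = 0 := by simpa [hq₂] using h
      refine wp_seq (wp_set_bd hV hn₂ (totalColl S (n * n) l (m * (k + 1))) (by decide)
        (by simp [hphi]; omega) (by decide) (by simp [hphi]) ?_)
      refine wp_set_bd hV (by simp [hn₂]) (k + 1) (by decide) (by simp [hq₂]; omega) (by decide)
        (by simp [hq₂]) ⟨fun _ => ?_, by simp; omega⟩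
      subst hk0
      refine ⟨by simp, by simp, by simp, ?_⟩
      intro q hq1 hq2
      obtain rfl : q = 1 := by omega
      simp
    · have hk0 : k ≠ 0 := by simpa [hq₂] using h
      obtain ⟨g1, g2, g3, g4⟩ := h1 (by omega)
      have hbestV : 4 * totalColl S (n * n) l (m * τ.v .bq) < V := totalColl_lt hI hll _
      refine wp_ite_bd hV hn₂ (by simp [hphi, hbest, g3]; omega) (by decide)
        (fun h' => ?_) (fun h' => ?_)
      · have hlt : totalColl S (n * n) l (m * (k + 1)) < totalColl S (n * n) l (m * τ.v .bq) := by
          simpa [hphi, hbest, g3] using h'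
        refine wp_seq (wp_set_bd hV hn₂ (totalColl S (n * n) l (m * (k + 1))) (by decide)
          (by simp [hphi]; omega) (by decide) (by simp [hphi]) ?_)
        refine wp_set_bd hV (by simp [hn₂]) (k + 1) (by decide) (by simp [hq₂]; omega) (by decide)
          (by simp [hq₂]) ⟨fun _ => ⟨by simp, by simp, by simp, ?_⟩, by simp; omega⟩
        intro q hq1 hq2
        rcases Nat.lt_succ_iff_lt_or_eq.1 (Nat.lt_succ_of_le hq2) with h3 | rfl
        · have := g4 q hq1 (by omega)
          simp; omega
        · simp
      · have hlt : ¬ totalColl S (n * n) l (m * (k + 1)) < totalColl S (n * n) l (m * τ.v .bq) := by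
          simpa [hphi, hbest, g3] using h'
        refine wp_skip ⟨fun _ => ?_, by simp; omega⟩
        simp only [Store.set_v, reduceCtorEq, if_false, hbq, hbest]
        refine ⟨g1, by omega, g3, ?_⟩
        intro q hq1 hq2
        rcases Nat.lt_succ_iff_lt_or_eq.1 (Nat.lt_succ_of_le hq2) with h3 | rfl
        · exact g4 q hq1 (by omega)
        · omega
  · intro σ' t' hf h ht
    rw [hS.X] at h ht
    obtain ⟨g1, g2, g3, g4⟩ := h hX0
    have hm' : σ'.v .m = m := by rw [hf.v _ (by decide), hm]
    obtain ⟨q, hq1, hq2, hq3⟩ := exists_totalColl_le S (n * n) (Λ := Λ) (l := l) hm0 hX0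
      (fun p hp => by have := hI.pairSum_lt hp; rw [← hSd] at this; omega)
      (fun s hs => (hl.lt hI hs).trans_le hΛ)
    refine wp_set_bd hV (by rw [hf.v _ (by decide), hσ.size]) (m * σ'.v .bq) (by decide)
      (by simp [hm']; omega) (by decide) (by simp [hm']) ⟨σ'.v .bq, g1, g2, by simp, by simp [g3],
        (Nat.mul_le_mul_right _ (g4 q hq1 hq2)).trans hq3, ?_⟩
    simp only [sum_const, card_range, smul_eq_mul] at ht
    simp
    have h1 : 2 ^ logX n * (convTime (4 * logX n) n + 100 * l.length + 100 + 8) ≤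
      2 ^ logX n * (convTime (4 * logX n) n + 100 * l.length + 200) :=
      Nat.mul_le_mul_left _ (by omega)
    omega

end choose

end WordRAM

/-! ### The rounds of the preprocessing. -/

namespace WordRAM

/-- The representatives of the values in a residue class. -/
abbrev bucket (S : ℕ → ℕ) (P m x k : ℕ) : List ℕ := sel (fun p => IsRep S P p ∧ S p % m = x) k

theorem Chain.le {nx : ℕ → ℕ} {h k : ℕ} {R : ℕ → Prop} [DecidablePred R]
    (hc : Chain nx h (sel R k)) : h ≤ k := by
  cases hl : sel R k with
  | nil => rw [hl] at hc; rw [show h = 0 from hc]; omega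
  | cons p l =>
    have hp : p ∈ sel R k := by rw [hl]; simp
    rw [hl] at hc
    rw [mem_sel] at hp
    rw [hc.1]; omega

/-- Distribute the representatives to the residue classes modulo `mm`. -/
def bucketCmd : Cmd :=
  .for .p .y (.s ≔ sumEx (.v .p) ;; .ite (.bin .eq (.rd .head (.v .s)) (Ex.v .p + .c 1))
    (.l ≔ Ex.v .j * .v .N + Ex.v .s % .v .mm ;;
      .wr .bnxt (Ex.v .j * .v .y + .v .p) (.rd .bhead (.v .l)) ;;
      .wr .bhead (.v .l) (Ex.v .p + .c 1)) .skip)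

/-- Label the listed values with few collisions, and remove them from the list. -/
def filterCmd : Cmd :=
  .r ≔ .c 0 ;;
  .for .d .pop (.s ≔ .rd .popular (.v .d) ;; .phi ≔ collEx ;;
    .ite (.bin .lt (Ex.c 2 * .v .best) (Ex.v .phi * .v .pop))
      (.wr .popular (.v .r) (.v .s) ;; .r ≔ Ex.v .r + .c 1)
      (.wr .label (.v .s) (Ex.v .j + .c 1))) ;;
  .pop ≔ .v .r

/-- Choose a modulus with few collisions. -/
def selectCmd : Cmd := .m ≔ .c 1 ;; chooseCmd ;; chooseCmd ;; chooseCmd ;; chooseCmd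

/-- One round of the preprocessing. -/
def roundCmd : Cmd :=
  selectCmd ;; .mm ≔ .v .m ;; convCmd ;; bucketCmd ;; filterCmd ;; .wr .moduli (.v .j) (.v .m)

/-- The preprocessing. -/
def preCmd : Cmd :=
  buildCmd ;; popCmd ;; setupCmd ;; .for .j .J roundCmd

/-- The data for the `j`-th modulus. -/
structure Level (S : ℕ → ℕ) (n : ℕ) (σ : Store) (j : ℕ) : Prop where
  pos : 0 < σ.a .moduli j
  le : 2 * σ.a .moduli j ≤ 2 ^ (4 * logX n + 1)
  chain : ∀ x < σ.a .moduli j, Chain (fun p => σ.a .bnxt (j * (n * n) + p))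
    (σ.a .bhead (j * 2 ^ (4 * logX n + 1) + x)) (bucket S (n * n) (σ.a .moduli j) x (n * n))

/-- The modulus `m` leads to few collisions of `s`. -/
def Good (S : ℕ → ℕ) (n Λ m s : ℕ) : Prop :=
  coll S (n * n) m s * #(Nat.primesLE (2 ^ logX n)) ^ 4 ≤ 2 * Λ ^ 4 * (n * n)

/-- The state of the data structure after `k` rounds. -/
structure Rounds (S : ℕ → ℕ) (n Λ k : ℕ) (σ : Store) : Prop where
  list : ∃ l, Listed S (n * n) n l σ ∧ 2 ^ k * l.length ≤ n * n ∧
    ∀ s ∈ popList S (n * n) n (n * n), s ∉ l → σ.a .label s ≠ 0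
  level : ∀ j < k, Level S n σ j
  label : ∀ s, σ.a .label s ≠ 0 →
    σ.a .label s ≤ k ∧ Good S n Λ (σ.a .moduli (σ.a .label s - 1)) s
  fresh : ∀ i, k * 2 ^ (4 * logX n + 1) ≤ i → σ.a .bhead i = 0

section rounds

variable {w n V : ℕ} {a b : ℕ → ℕ} {Q : Store → ℕ → Prop} {σ : Store} {t : ℕ}

/-- Every modulus owns a segment of N heads and a segment of n² links, so the buckets of earlier
moduli stay valid. The heads in the new segment are still zero, meaning that all buckets start
empty. -/
theorem wp_bucket (hI : Input w n V a b) (hσ : Inp n a b σ)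
    (hT : Table (pairSum a b n) V (n * n) σ) {j m N : ℕ} (hy : σ.v .y = n * n) (hj : σ.v .j = j)
    (hjV : j < V) (hN : σ.v .N = N) (hNV : N < V) (hm : σ.v .mm = m) (hm0 : 0 < m) (hmN : 2 * m ≤ N)
    (hjN : (j + 1) * N < V)
    (h0 : ∀ i, j * N ≤ i → σ.a .bhead i = 0)
    (hQ : ∀ σ' t', Frame bucketCmd σ σ' →
      (∀ x < m, Chain (fun p => σ'.a .bnxt (j * (n * n) + p)) (σ'.a .bhead (j * N + x))
        (bucket (pairSum a b n) (n * n) m x (n * n))) →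
      (∀ i, i < j * N ∨ j * N + N ≤ i → σ'.a .bhead i = σ.a .bhead i) →
      (∀ i < j * (n * n), σ'.a .bnxt i = σ.a .bnxt i) →
      t' ≤ t + 150 * (n * n) + 20 → Q σ' t') :
    WP w bucketCmd Q σ t := by
  refine WP.mono (R := fun σ' t' => _ ∧ _ ∧ _ ∧ _) ?_
    (fun σ' t' hf h => hQ σ' t' hf h.1 h.2.1 h.2.2.1 h.2.2.2)
  have hV := hI.fits
  have h17 := hV.num
  simp only [numArr] at h17
  have hnn := hI.sq_lt
  have h6 := hV.six
  set S := pairSum a b n with hSd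
  rw [add_mul, one_mul] at hjN
  refine wp_for_frame (fun k τ =>
      (∀ x < m, Chain (fun p => τ.a .bnxt (j * (n * n) + p)) (τ.a .bhead (j * N + x))
        (bucket S (n * n) m x k)) ∧
      (∀ i, i < j * N ∨ j * N + N ≤ i → τ.a .bhead i = σ.a .bhead i) ∧
      (∀ i < j * (n * n), τ.a .bnxt i = σ.a .bnxt i)) (fun _ => 140)
    (by decide) (by decide) (by decide) (by decide) (hV.lt (by simpa [hy] using hnn)) hV.one_lt
    ?_ ?_ ?_
  · refine ⟨fun x hx => ?_, fun i _ => rfl, fun i _ => rfl⟩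
    rw [bucket, sel_zero, Store.set_a, h0 _ (by omega)]
    rfl
  · rintro k τ t' hk hp hb hf ⟨h1, h2, h3⟩
    rw [hy] at hk
    have hin : Inp n a b τ := hσ.congr (hf.v _ (by decide)) (hf.a _ (by decide))
    have hT' : Table S V (n * n) τ := hT.congr (hf.a _ (by decide))
      (hf.a _ (by decide)) (hf.a _ (by decide)) (hf.v _ (by decide))
    have hj' : τ.v .j = j := by rw [hf.v _ (by decide), hj]
    have hN' : τ.v .N = N := by rw [hf.v _ (by decide), hN]
    have hm' : τ.v .mm = m := by rw [hf.v _ (by decide), hm]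
    have hy' : τ.v .y = n * n := by rw [hf.v _ (by decide), hy]
    have hsp := sumEx_spec hI hin (e := .v .p) (by simp [hp]; omega) (by simpa using hp) hk
    have hS := hI.pairSum_lt hk
    rw [← hSd] at hsp hS
    have hhd := hT'.head_le (S k)
    refine wp_seq (wp_set_bd hV hin.size (S k) (by decide) hsp.1 (by decide) hsp.2 ?_)
    refine wp_ite_bd hV (by simp [hin.size]) (by simp [hp]; omega) (by decide)
      (fun h => ?_) (fun h => ?_)
    · have hrep : IsRep S (n * n) k := by
        rw [← hT'.rep_iff]; simpa [hp] using h
      set y := S k % m with hyd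
      have hym : y < m := Nat.mod_lt _ hm0
      have hle := (h1 y hym).le
      refine wp_seq (wp_set_bd hV (by simp [hin.size]) (j * N + y) (by decide)
        (by simp [hj', hN', hm']; omega) (by decide) (by simp [hj', hN', hm', hyd]) ?_)
      refine wp_seq (wp_wr_val hV (by simp [hin.size]) (j * (n * n) + k) (τ.a .bhead (j * N + y))
        (by simp [hj', hy', hp]; omega) (by decide) (by simp) ?_ (by simp [hj', hy', hp])
        (by simp) ?_)
      · exact ok_rd hV (by simp [hin.size]) (by simp; omega) (by decide) (by simp)
      refine wp_wr_val hV (by simp [hin.size]) (j * N + y) (k + 1) (by simp; omega) (by decide)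
        (by simp) (Ex.bd.ok hV (by simp [hin.size]) (by simp [hp]; omega) (by decide)) (by simp)
        (by simp [hp]) ⟨⟨?_, ?_, ?_⟩, ?_⟩
      · intro x hx
        simp only [Store.set_a, Store.put_a, reduceCtorEq, if_false, if_true]
        have hold : Chain (fun p => Function.update (τ.a .bnxt) (j * (n * n) + k)
            (τ.a .bhead (j * N + y)) (j * (n * n) + p)) (τ.a .bhead (j * N + x))
            (bucket S (n * n) m x k) := (h1 x hx).congr fun p hp => by
          rw [mem_sel] at hp
          exact Function.update_of_ne (by omega) _ _
        rw [bucket, sel_succ, Function.update_apply]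
        by_cases hxy : x = y
        · rw [if_pos (by rw [hxy]), if_pos ⟨hrep, by rw [hxy]⟩]
          refine ⟨rfl, ?_⟩
          simp only [Function.update_self]
          rw [← hxy]
          rw [← hxy] at hold
          exact hold
        · rw [if_neg (by omega), if_neg (fun h => hxy h.2.symm)]
          exact hold
      · intro i hi
        simp only [Store.set_a, Store.put_a, reduceCtorEq, if_false, if_true]
        rw [Function.update_of_ne (by omega), h2 i hi]
      · intro i hi
        simp only [Store.set_a, Store.put_a, reduceCtorEq, if_false, if_true]
        rw [Function.update_of_ne (by omega), h3 i hi]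
      · simp [addrCost, sumEx]
    · have hrep : ¬ IsRep S (n * n) k := by
        rw [← hT'.rep_iff]; simpa [hp] using h
      refine wp_skip ⟨⟨fun x hx => ?_, h2, h3⟩, by simp [addrCost, sumEx]⟩
      rw [bucket, sel_succ, if_neg (fun h => hrep h.1)]
      exact h1 x hx
  · intro σ' t' hf h ht
    rw [hy] at h ht
    simp only [sum_const, card_range, smul_eq_mul] at ht
    exact ⟨h.1, h.2.1, h.2.2, by omega⟩

/-- The list is compacted in place: the writing position is the number of values kept so far and
never overtakes the reading position, so unread entries are intact. -/
theorem wp_filter (hI : Input w n V a b) (hσ : Inp n a b σ)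
    (hT : Table (pairSum a b n) V (n * n) σ) {l : List ℕ}
    (hl : Listed (pairSum a b n) (n * n) n l σ) {m j : ℕ} (hm : σ.v .mm = m) (hm0 : 0 < m)
    (hmV : m < V) (hw : ∀ x < m, σ.a .work x + σ.a .work (x + m) = pairCount a b n n m x)
    (hj : σ.v .j = j) (hjV : j < V)
    (hbest : σ.v .best = totalColl (pairSum a b n) (n * n) l m)
    (hQ : ∀ σ' t', Frame filterCmd σ σ' →
      Listed (pairSum a b n) (n * n) n (l.filter fun s => decide
        (2 * totalColl (pairSum a b n) (n * n) l m <
          coll (pairSum a b n) (n * n) m s * l.length)) σ' →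
      (∀ s, σ'.a .label s = if s ∈ l ∧ ¬ 2 * totalColl (pairSum a b n) (n * n) l m <
          coll (pairSum a b n) (n * n) m s * l.length then j + 1 else σ.a .label s) →
      t' ≤ t + 150 * l.length + 30 → Q σ' t') : WP w filterCmd Q σ t := by
  refine WP.mono (R := fun σ' t' => _ ∧ _ ∧ _) ?_
    (fun σ' t' hf h => hQ σ' t' hf h.1 h.2.1 h.2.2)
  have hV := hI.fits
  have h17 := hV.num
  simp only [numArr] at h17
  have hnn := hI.sq_lt
  have hll := hl.length_le
  set S := pairSum a b n with hSd
  set Φ := totalColl S (n * n) l m with hΦ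
  set bad : ℕ → Bool := fun s => decide (2 * Φ < coll S (n * n) m s * l.length) with hbad
  have hΦV : 4 * Φ < V := totalColl_lt hI hll m
  refine wp_seq (wp_set_bd hV hσ.size 0 (by decide) (by simp; omega) (by decide) (by simp) ?_)
  refine wp_seq (wp_for_frame (fun k τ => τ.v .r = ((l.take k).filter bad).length ∧
      Holds (τ.a .popular) ((l.take k).filter bad) ∧
      (∀ i (h : i < l.length), k ≤ i → τ.a .popular i = l[i]) ∧
      ∀ s, τ.a .label s = if s ∈ l.take k ∧ bad s = false then j + 1 else σ.a .label s)
    (fun _ => 140)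
    (by decide) (by decide) (by decide) (by decide) (hV.lt (by simp [hl.pop]; omega)) hV.one_lt
    ?_ ?_ ?_)
  · exact ⟨by simp, by intro i hi; simp at hi, fun i hi _ => by simpa using hl.holds i hi,
      fun s => by simp⟩
  · rintro k τ t' hk hd hb hf ⟨h1, h2, h3, h4⟩
    replace hk : k < l.length := by simpa [hl.pop] using hk
    have hin : Inp n a b τ := hσ.congr (by rw [hf.v _ (by decide)]; simp)
      (by rw [hf.a _ (by decide)]; simp)
    have hT' : Table S V (n * n) τ := hT.congr (by rw [hf.a _ (by decide)]; simp)
      (by rw [hf.a _ (by decide)]; simp) (by rw [hf.a _ (by decide)]; simp)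
      (by rw [hf.v _ (by decide)]; simp)
    have hpk := h3 k hk le_rfl
    have hlk := hl.lt hI (List.getElem_mem hk)
    have hfl : ((l.take k).filter bad).length ≤ k :=
      (List.length_filter_le _ _).trans (List.length_take_le _ _)
    have htake : l.take (k + 1) = l.take k ++ [l[k]] := List.take_succ_eq_append_getElem hk
    have hj' : τ.v .j = j := by rw [hf.v _ (by decide)]; simp [hj]
    have hpop : τ.v .pop = l.length := by rw [hb]; simp [hl.pop]
    have hbest' : τ.v .best = Φ := by rw [hf.v _ (by decide)]; simp [hbest]
    refine wp_seq (wp_set_bd hV hin.size l[k] (by decide) (by simp [hd, hpk]; omega) (by decide)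
      (by simp [hd, hpk]) ?_)
    have hsp := collEx_spec hI (σ := τ.set .s l[k]) (hin.congr (by simp) (by simp))
      (hT'.congr (by simp) (by simp) (by simp) (by simp)) (m := m) (s := l[k])
      (by rw [Store.set_v, if_neg (by decide), hf.v _ (by decide)]; simp [hm]) hm0 hmV
      (by rw [Store.set_a, hf.a _ (by decide)]; exact hw) (by simp) hlk
    rw [← hSd] at hsp
    have hcl := coll_le S (n * n) m l[k]
    refine wp_seq (wp_set_bd hV (by simp [hin.size]) (coll S (n * n) m l[k]) (by decide)
      hsp.1 (by decide) hsp.2 ?_)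
    refine wp_ite_bd hV (by simp [hin.size]) (by simp [hpop, hbest']; omega) (by decide)
      (fun h => ?_) (fun h => ?_)
    · have hb1 : bad l[k] = true := by
        simp only [hbad, decide_eq_true_eq]; simpa [hpop, hbest'] using h
      refine wp_seq (wp_wr_val hV (by simp [hin.size]) ((l.take k).filter bad).length l[k]
        (by simp [h1]; omega) (by decide) (by simp) trivial (by simp [h1]) (by simp) ?_)
      refine wp_set_bd hV (by simp [hin.size]) (((l.take k).filter bad).length + 1) (by decide)
        (by simp [h1]; omega) (by decide) (by simp [h1]) ⟨⟨?_, ?_, ?_, ?_⟩, ?_⟩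
      · rw [htake, List.filter_append]; simp [hb1]
      · rw [htake, List.filter_append]; simpa [hb1] using h2.snoc l[k]
      · intro i hi hki
        simp only [Store.set_a, Store.put_a, if_true]
        rw [Function.update_of_ne (by omega), h3 i hi (by omega)]
      · intro s
        simp only [Store.set_a, Store.put_a, reduceCtorEq, if_false, h4 s, htake, List.mem_append,
          List.mem_singleton]
        congr 1
        apply propext
        constructor
        · rintro ⟨g1, g2⟩; exact ⟨.inl g1, g2⟩
        · rintro ⟨g1 | rfl, g2⟩
          · exact ⟨g1, g2⟩
          · rw [hb1] at g2; cases g2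
      · simp [addrCost, collEx]
    · have hb1 : bad l[k] = false := by
        simp only [hbad, decide_eq_false_iff_not]; simpa [hpop, hbest'] using h
      refine wp_wr_val hV (by simp [hin.size]) l[k] (j + 1) (by simp; omega) (by decide) (by simp)
        (Ex.bd.ok hV (by simp [hin.size]) (by simp [hj']; omega) (by decide)) (by simp)
        (by simp [hj']) ⟨⟨?_, ?_, ?_, ?_⟩, ?_⟩
      · rw [htake, List.filter_append]; simp [hb1, h1]
      · rw [htake, List.filter_append]; simpa [hb1] using h2
      · intro i hi hki
        simp only [Store.set_a, Store.put_a, reduceCtorEq, if_false]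
        exact h3 i hi (by omega)
      · intro s
        simp only [Store.set_a, Store.put_a, if_true, Function.update_apply, htake,
          List.mem_append, List.mem_singleton, h4 s]
        by_cases hs : s = l[k]
        · rw [if_pos hs, if_pos ⟨.inr hs, by rw [hs, hb1]⟩]
        · simp [hs]
      · simp [addrCost, collEx]
  · intro σ' t' hf h ht
    simp only [Store.set_v, reduceCtorEq, if_false, hl.pop, List.take_length] at h ht
    obtain ⟨h1, h2, h3, h4⟩ := h
    simp only [sum_const, card_range, smul_eq_mul] at ht
    have hfl : (l.filter bad).length ≤ l.length := List.length_filter_le _ _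
    refine wp_set_bd hV (by rw [hf.v _ (by decide)]; simp [hσ.size]) (l.filter bad).length
      (by decide) (by simp [h1]; omega) (by decide) (by simp [h1]) ⟨⟨by simp, by simpa using h2,
        List.filter_sublist.trans hl.sub⟩, ?_, ?_⟩
    · intro s
      rw [Store.set_a, h4 s]
      simp [hbad]
    · simp at ht ⊢
      omega

/-- What the rounds of the preprocessing start from. -/
structure Base (a b : ℕ → ℕ) (n V : ℕ) (l : List ℕ) (σ : Store) : Prop where
  inp : Inp n a b σ
  table : Table (pairSum a b n) V (n * n) σ
  setup : Setup n σ
  listed : Listed (pairSum a b n) (n * n) n l σ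

theorem Base.frame {l : List ℕ} {p : Cmd} {τ : Store} (h : Base a b n V l σ) (hf : Frame p σ τ)
    (hv : ∀ x ∈ [Var.n, .pop, .top, .y, .J, .u, .X, .N, .oA, .oB, .lA, .lB], p.mv x = false)
    (ha : ∀ x ∈ [Arr.raw, .nxt, .head, .cnt, .popular], p.ma x = false) : Base a b n V l τ :=
  ⟨h.inp.frame hf (hv _ (by decide)) (ha _ (by decide)),
    h.table.congr (hf.a _ (ha _ (by decide))) (hf.a _ (ha _ (by decide)))
      (hf.a _ (ha _ (by decide))) (hf.v _ (hv _ (by decide))),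
    h.setup.frame hf fun x hx => hv x (by revert x; decide),
    h.listed.congr (hf.v _ (hv _ (by decide))) (hf.a _ (ha _ (by decide)))⟩

theorem Base.set {l : List ℕ} {x : Var} {z : ℕ} (h : Base a b n V l σ)
    (hx : x ∉ [Var.n, .pop, .top, .y, .J, .u, .X, .N, .oA, .oB, .lA, .lB]) :
    Base a b n V l (σ.set x z) :=
  h.frame (p := x ≔ .c 0) ⟨fun y hy => by
    simp only [Cmd.mv, decide_eq_false_iff_not] at hy; simp [Ne.symm hy], fun _ _ => rfl⟩
    (fun y hy => by simp only [Cmd.mv, decide_eq_false_iff_not]; rintro rfl; exact hx hy)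
    fun _ _ => rfl

/-- Starting from m = 1, where at most n² collisions occur per listed value, each of four greedy
factors gains Λ / π(X). The intermediate products stay below X⁴, so one length of convolution serves
all four searches. -/
theorem wp_select (hI : Input w n V a b) (hC : ConvFits n V) {l : List ℕ}
    (hB : Base a b n V l σ) {Λ : ℕ} (hΛ : V ≤ 2 ^ Λ)
    (hQ : ∀ σ' t' m, Frame selectCmd σ σ' → 0 < m → 2 * m ≤ 2 ^ (4 * logX n + 1) → σ'.v .m = m →
      σ'.v .best = totalColl (pairSum a b n) (n * n) l m →
      totalColl (pairSum a b n) (n * n) l m * #(Nat.primesLE (2 ^ logX n)) ^ 4 ≤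
        Λ ^ 4 * (l.length * (n * n)) →
      t' ≤ t + 4 * (2 ^ logX n * (convTime (4 * logX n) n + 100 * l.length + 200)) + 100 →
      Q σ' t') :
    WP w selectCmd Q σ t := by
  refine WP.mono (R := fun σ' t' => ∃ m, _ ∧ _ ∧ _ ∧ _ ∧ _ ∧ _) ?_
    (fun σ' t' hf ⟨m, h1, h2, h3, h4, h5, h6⟩ => hQ σ' t' m hf h1 h2 h3 h4 h5 h6)
  have hV := hI.fits
  have h17 := hV.num
  simp only [numArr] at h17
  have hX0 : 0 < 2 ^ logX n := by positivity
  have hXX : 2 ^ (4 * logX n + 1) = 2 * (2 ^ logX n) ^ 4 := by rw [← pow_mul, pow_succ']; ring_nf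
  refine wp_seq (wp_set_bd hV hB.inp.size 1 (by decide) (by simp; omega) (by decide) (by simp) ?_)
  have hB0 := hB.set (x := .m) (z := 1) (by decide)
  rw [hXX]
  generalize hX : 2 ^ logX n = X at *
  have p1 : X ≤ X ^ 4 := Nat.le_self_pow (by norm_num) X
  have p2 : X ^ 2 ≤ X ^ 4 := Nat.pow_le_pow_right hX0 (by norm_num)
  have p3 : X ^ 3 ≤ X ^ 4 := Nat.pow_le_pow_right hX0 (by norm_num)
  refine wp_seq (wp_choose hI hC hB0.inp hB0.table hB0.setup hB0.listed (m := 1) (Λ := Λ) (by simp)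
    (by norm_num) (by rw [hX, hXX]; omega) hΛ ?_)
  intro σ₁ t₁ q₁ hf₁ hq₁ hq₁' hm₁ hb₁ hΦ₁ ht₁
  have hB1 := hB0.frame hf₁ (by decide) (by decide)
  rw [one_mul] at hm₁ hΦ₁
  rw [hX] at hΦ₁ ht₁ hq₁'
  have e1 : q₁ * X ≤ X ^ 2 := by rw [sq]; gcongr
  refine wp_seq (wp_choose hI hC hB1.inp hB1.table hB1.setup hB1.listed (m := q₁) (Λ := Λ) hm₁
    hq₁ (by rw [hX, hXX]; omega) hΛ ?_)
  intro σ₂ t₂ q₂ hf₂ hq₂ hq₂' hm₂ hb₂ hΦ₂ ht₂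
  have hB2 := hB1.frame hf₂ (by decide) (by decide)
  rw [hX] at hΦ₂ ht₂ hq₂'
  have e2 : q₁ * q₂ * X ≤ X ^ 3 := by rw [pow_succ, sq]; gcongr
  refine wp_seq (wp_choose hI hC hB2.inp hB2.table hB2.setup hB2.listed (m := q₁ * q₂) (Λ := Λ) hm₂
    (by positivity) (by rw [hX, hXX]; omega) hΛ ?_)
  intro σ₃ t₃ q₃ hf₃ hq₃ hq₃' hm₃ hb₃ hΦ₃ ht₃
  have hB3 := hB2.frame hf₃ (by decide) (by decide)
  rw [hX] at hΦ₃ ht₃ hq₃'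
  have e3 : q₁ * q₂ * q₃ * X ≤ X ^ 4 := by rw [pow_succ, pow_succ, sq]; gcongr
  refine wp_choose hI hC hB3.inp hB3.table hB3.setup hB3.listed (m := q₁ * q₂ * q₃) (Λ := Λ) hm₃
    (by positivity) (by rw [hX, hXX]; omega) hΛ ?_
  intro σ₄ t₄ q₄ hf₄ hq₄ hq₄' hm₄ hb₄ hΦ₄ ht₄
  rw [hX] at hΦ₄ ht₄ hq₄'
  have e4 : q₁ * q₂ * q₃ * q₄ ≤ X ^ 4 := le_trans (Nat.mul_le_mul_left _ hq₄') e3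
  refine ⟨q₁ * q₂ * q₃ * q₄, by positivity, by omega, hm₄, hb₄, ?_, ?_⟩
  · set π := #(Nat.primesLE X)
    have h1 := totalColl_le (pairSum a b n) (n * n) l 1
    calc _ = totalColl (pairSum a b n) (n * n) l (q₁ * q₂ * q₃ * q₄) * π * π ^ 3 := by ring
      _ ≤ Λ * totalColl (pairSum a b n) (n * n) l (q₁ * q₂ * q₃) * π ^ 3 := by gcongr
      _ = Λ * π ^ 2 * (totalColl (pairSum a b n) (n * n) l (q₁ * q₂ * q₃) * π) := by ring
      _ ≤ Λ * π ^ 2 * (Λ * totalColl (pairSum a b n) (n * n) l (q₁ * q₂)) := by gcongr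
      _ = Λ ^ 2 * π * (totalColl (pairSum a b n) (n * n) l (q₁ * q₂) * π) := by ring
      _ ≤ Λ ^ 2 * π * (Λ * totalColl (pairSum a b n) (n * n) l q₁) := by gcongr
      _ = Λ ^ 3 * (totalColl (pairSum a b n) (n * n) l q₁ * π) := by ring
      _ ≤ Λ ^ 3 * (Λ * totalColl (pairSum a b n) (n * n) l 1) := by gcongr
      _ = Λ ^ 4 * totalColl (pairSum a b n) (n * n) l 1 := by ring
      _ ≤ _ := by gcongr
  · simp at ht₁
    omega

theorem pairBits_le (n : ℕ) : pairBits n ≤ 6 * logX n := by unfold logX; omega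

/-- A bound on the number of steps of a round, for a list of `s` values. -/
def roundTime (n s : ℕ) : ℕ :=
  4 * (2 ^ logX n * (convTime (4 * logX n) n + 100 * s + 200)) + convTime (4 * logX n) n +
    150 * (n * n) + 150 * s + 300

/-- By `length_filter_le` at most half of the list survives. The values removed have at most twice
the average number of collisions, which is the content of `Good`; older labels and levels refer to
segments that the round leaves alone. -/
theorem wp_round (hI : Input w n V a b) (hC : ConvFits n V) (hσ : Inp n a b σ)
    (hT : Table (pairSum a b n) V (n * n) σ) (hS : Setup n σ) {Λ k : ℕ} (hΛ : V ≤ 2 ^ Λ)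
    (hk : k < pairBits n) (hj : σ.v .j = k) (hR : Rounds (pairSum a b n) n Λ k σ)
    (hQ : ∀ σ' t', Frame roundCmd σ σ' → Rounds (pairSum a b n) n Λ (k + 1) σ' →
      t' ≤ t + roundTime n (popList (pairSum a b n) (n * n) n (n * n)).length → Q σ' t') :
    WP w roundCmd Q σ t := by
  refine WP.mono (R := fun σ' t' => _ ∧ _) ?_ (fun σ' t' hf h => hQ σ' t' hf h.1 h.2)
  have hV := hI.fits
  have h17 := hV.num
  simp only [numArr] at h17
  have hCC := hC
  unfold ConvFits at hC
  set N := 2 ^ (4 * logX n + 1) with hNd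
  set S := pairSum a b n with hSd
  have hbits := pairBits_le n
  have hN0 : 0 < N := by positivity
  have hNb : (6 * logX n + 1) * N ≤ 32 * N * (4 * logX n + 1) := by
    nlinarith [Nat.zero_le (N * logX n)]
  have hkN : (k + 1) * N ≤ (6 * logX n + 1) * N := Nat.mul_le_mul_right _ (by omega)
  have hkk : k ≤ (k + 1) * N := by nlinarith
  have hNN : N ≤ (k + 1) * N := Nat.le_mul_of_pos_left _ (by omega)
  obtain ⟨⟨l, hl, hlen, hlab⟩, hlev, hlabel, hfresh⟩ := hR
  have hB : Base a b n V l σ := ⟨hσ, hT, hS, hl⟩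
  refine wp_seq (wp_select hI hCC hB hΛ ?_)
  intro σ₁ t₁ m hf₁ hm0 hmN hm₁ hb₁ hΦ ht₁
  rw [← hSd] at hb₁ hΦ
  have hB1 := hB.frame hf₁ (by decide) (by decide)
  refine wp_seq (wp_set_bd hV hB1.inp.size m (by decide) (by simp [hm₁]; omega) (by decide)
    (by simp [hm₁]) ?_)
  have hB1' := hB1.set (x := .mm) (z := m) (by decide)
  refine wp_seq (wp_conv_input hI hCC hB1'.inp hB1'.setup (m := m) (by simp) hm0 hmN ?_)
  intro σ₂ t₂ hf₂ hw₂ ht₂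
  have hB2 := hB1'.frame hf₂ (by decide) (by decide)
  have hmm₂ : σ₂.v .mm = m := by rw [hf₂.v _ (by decide)]; simp
  have hj₂ : σ₂.v .j = k := by
    rw [hf₂.v _ (by decide), Store.set_v, if_neg (by decide), hf₁.v _ (by decide), hj]
  have hbh₂ : σ₂.a .bhead = σ.a .bhead := by
    rw [hf₂.a _ (by decide), Store.set_a, hf₁.a _ (by decide)]
  refine wp_seq (wp_bucket hI hB2.inp hB2.table (j := k) (m := m) (N := N) hB2.setup.y hj₂
    (by omega) hB2.setup.N (by omega) hmm₂ hm0 hmN (by omega) (by rw [hbh₂]; exact hfresh) ?_)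
  intro σ₃ t₃ hf₃ hch₃ hbh₃ hbn₃ ht₃
  have hB3 := hB2.frame hf₃ (by decide) (by decide)
  have hmm₃ : σ₃.v .mm = m := by rw [hf₃.v _ (by decide), hmm₂]
  have hj₃ : σ₃.v .j = k := by rw [hf₃.v _ (by decide), hj₂]
  refine wp_seq (wp_filter hI hB3.inp hB3.table hB3.listed (m := m) (j := k) hmm₃ hm0 (by omega)
    (by rw [hf₃.a _ (by decide)]; exact hw₂) hj₃ (by omega)
    (by rw [hf₃.v _ (by decide), hf₂.v _ (by decide), Store.set_v, if_neg (by decide), hb₁]) ?_)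
  intro σ₄ t₄ hf₄ hl₄ hlab₄ ht₄
  rw [← hSd] at hl₄ hlab₄
  have hn₄ : σ₄.v .n = n := by rw [hf₄.v _ (by decide), hB3.inp.size]
  have hj₄ : σ₄.v .j = k := by rw [hf₄.v _ (by decide), hj₃]
  have hm₄ : σ₄.v .m = m := by
    rw [hf₄.v _ (by decide), hf₃.v _ (by decide), hf₂.v _ (by decide), Store.set_v,
      if_neg (by decide), hm₁]
  have hmod₄ : σ₄.a .moduli = σ.a .moduli := by
    rw [hf₄.a _ (by decide), hf₃.a _ (by decide), hf₂.a _ (by decide), Store.set_a,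
      hf₁.a _ (by decide)]
  have hbn₀ : σ₂.a .bnxt = σ.a .bnxt := by
    rw [hf₂.a _ (by decide), Store.set_a, hf₁.a _ (by decide)]
  have hlab₃ : σ₃.a .label = σ.a .label := by
    rw [hf₃.a _ (by decide), hf₂.a _ (by decide), Store.set_a, hf₁.a _ (by decide)]
  have hbh₄ : σ₄.a .bhead = σ₃.a .bhead := hf₄.a _ (by decide)
  have hbn₄ : σ₄.a .bnxt = σ₃.a .bnxt := hf₄.a _ (by decide)
  rw [hlab₃] at hlab₄
  refine wp_wr_val hV hn₄ k m (by simp [hj₄]; omega) (by decide) (by simp) trivial (by simp [hj₄])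
    (by simp [hm₄]) ⟨⟨⟨_, hl₄.congr (by simp) (by simp), ?_, ?_⟩, ?_, ?_, ?_⟩, ?_⟩
  · have := length_filter_le S (n * n) l m
    calc _ = 2 ^ k * (2 * _) := by rw [pow_succ, mul_assoc]
      _ ≤ 2 ^ k * l.length := Nat.mul_le_mul_left _ this
      _ ≤ _ := hlen
  · intro s hs hsl
    simp only [Store.put_a, reduceCtorEq, if_false, hlab₄ s]
    split_ifs with h
    · omega
    · refine hlab s hs fun hsl' => h ⟨hsl', fun hb => hsl ?_⟩
      rw [List.mem_filter]
      exact ⟨hsl', by simpa using hb⟩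
  · intro j hjk
    rcases Nat.lt_succ_iff_lt_or_eq.1 hjk with h | rfl
    · obtain ⟨h1, h2, h3⟩ := hlev j h
      have hmj : (σ₄.put .moduli k m).a .moduli j = σ.a .moduli j := by
        simp only [Store.put_a, if_true]
        rw [Function.update_of_ne (by omega), hmod₄]
      refine ⟨by rw [hmj]; exact h1, by rw [hmj]; exact h2, ?_⟩
      rw [hmj]
      intro x hx
      have hjN : (j + 1) * N ≤ k * N := Nat.mul_le_mul_right _ h
      have hjn : (j + 1) * (n * n) ≤ k * (n * n) := Nat.mul_le_mul_right _ h
      rw [add_mul, one_mul] at hjN hjn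
      simp only [Store.put_a, reduceCtorEq, if_false, hbh₄, hbn₄]
      rw [← hNd] at h2 ⊢
      rw [hbh₃ _ (by left; omega), hbh₂]
      refine (h3 x hx).congr fun p hp => ?_
      rw [mem_sel] at hp
      rw [hbn₃ _ (by omega), hbn₀]
    · have hmj : (σ₄.put .moduli j m).a .moduli j = m := by simp
      refine ⟨by rw [hmj]; exact hm0, by rw [hmj]; exact hmN, ?_⟩
      rw [hmj]
      intro x hx
      simp only [Store.put_a, reduceCtorEq, if_false, hbh₄, hbn₄]
      exact hch₃ x hx
  · intro s
    simp only [Store.put_a, reduceCtorEq, if_false, if_true, hlab₄ s]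
    split_ifs with h
    · intro _
      refine ⟨le_rfl, ?_⟩
      rw [Nat.add_sub_cancel, Function.update_self]
      -- The average carries the length of the list as a denominator; since s itself is listed, this
      -- length is positive and can be cancelled.
      have hpos : 0 < l.length := List.length_pos_of_mem h.1
      have h1 := not_lt.1 h.2
      refine Nat.le_of_mul_le_mul_left ?_ hpos
      calc _ = coll S (n * n) m s * l.length * #(Nat.primesLE (2 ^ logX n)) ^ 4 := by ring
        _ ≤ 2 * totalColl S (n * n) l m * #(Nat.primesLE (2 ^ logX n)) ^ 4 := by gcongr
        _ = 2 * (totalColl S (n * n) l m * #(Nat.primesLE (2 ^ logX n)) ^ 4) := by ring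
        _ ≤ 2 * (Λ ^ 4 * (l.length * (n * n))) := by gcongr
        _ = _ := by ring
    · intro h0
      obtain ⟨h1, h2⟩ := hlabel s h0
      refine ⟨by omega, ?_⟩
      rw [Function.update_of_ne (by omega), hmod₄]
      exact h2
  · intro i hi
    simp only [Store.put_a, reduceCtorEq, if_false, hbh₄]
    rw [hbh₃ i (by right; rw [add_mul, one_mul] at hi; omega), hbh₂]
    exact hfresh i (by rw [add_mul, one_mul] at hi; omega)
  · have hs := hl.sub.length_le
    rw [← hSd] at *
    have h1 : 2 ^ logX n * (convTime (4 * logX n) n + 100 * l.length + 200) ≤ 2 ^ logX n *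
      (convTime (4 * logX n) n + 100 * (popList S (n * n) n (n * n)).length + 200) := by gcongr
    simp [addrCost] at ht₂ ⊢
    unfold roundTime
    omega

/-- The data structure that the preprocessing builds. -/
structure DataStructure (S : ℕ → ℕ) (n V Λ : ℕ) (σ : Store) : Prop where
  y : σ.v .y = n * n
  J : σ.v .J = pairBits n
  u : σ.v .u = 4 * logX n
  N : σ.v .N = 2 ^ (4 * logX n + 1)
  table : Table S V (n * n) σ
  level : ∀ j < pairBits n, Level S n σ j
  label_le : ∀ s, σ.a .label s ≤ pairBits n
  good : ∀ s, σ.a .label s ≠ 0 → Good S n Λ (σ.a .moduli (σ.a .label s - 1)) s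
  unlabelled : ∀ s, σ.a .label s = 0 →
    (fib S (n * n) s).length * (fib S (n * n) s).length ≤ n

/-- A bound on the number of steps of the preprocessing, for `s` popular values. -/
def preTime (n s : ℕ) : ℕ := 200 * (n * n) + pairBits n * (roundTime n s + 48) + 200

theorem wp_pre (hI : Input w n V a b) (hC : ConvFits n V) (hσ : Inp n a b σ) {Λ : ℕ}
    (hΛ : V ≤ 2 ^ Λ) (h0 : ∀ x, x ≠ .raw → σ.a x = fun _ => 0) :
    WP w preCmd (fun σ' t' => DataStructure (pairSum a b n) n V Λ σ' ∧ Frame preCmd σ σ' ∧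
      t' ≤ t + preTime n (popList (pairSum a b n) (n * n) n (n * n)).length) σ t := by
  refine WP.mono (R := fun σ' t' => _ ∧ _) ?_ (fun σ' t' hf h => ⟨h.1, hf, h.2⟩)
  have hV := hI.fits
  set S := pairSum a b n with hSd
  refine wp_seq (wp_build hI hσ (h0 _ (by decide)) (h0 _ (by decide)) ?_)
  intro σ₁ t₁ hf₁ hy₁ hT₁ ht₁
  have hin₁ := hσ.frame hf₁ (by decide) (by decide)
  refine wp_seq (wp_pop hI hin₁ hy₁ hT₁ ?_)
  intro σ₂ t₂ hf₂ hp₂ hh₂ ht₂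
  have hin₂ := hin₁.frame hf₂ (by decide) (by decide)
  refine wp_seq (wp_setup hI hC hin₂ (by rw [hf₂.v _ (by decide), hy₁]) ?_)
  intro σ₃ t₃ hf₃ hS₃ ht₃
  have hin₃ := hin₂.frame hf₃ (by decide) (by decide)
  have hT₃ := (hT₁.frame hf₂ (by decide)).frame hf₃ (by decide)
  have h03 : ∀ x, x ∉ [Arr.raw, .head, .nxt, .cnt, .popular] → σ₃.a x = fun _ => 0 := by
    intro x hx
    rw [hf₃.a x (by revert hx; cases x <;> decide), hf₂.a x (by revert hx; cases x <;> decide),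
      hf₁.a x (by revert hx; cases x <;> decide)]
    exact h0 x (by rintro rfl; simp at hx)
  have hbits : pairBits n < V := by
    have h1 := hI.sq_lt
    have h2 : pairBits n ≤ n * n := Nat.size_le.2 Nat.lt_two_pow_self
    omega
  refine wp_for_frame (fun k τ => Rounds S n Λ k τ)
    (fun _ => roundTime n (popList S (n * n) n (n * n)).length + 20)
    (by decide) (by decide) (by decide) (by decide) (by rw [hS₃.J]; exact hV.lt hbits) hV.one_lt
    ?_ ?_ ?_
  · refine ⟨⟨_, ⟨?_, ?_, List.Sublist.refl _⟩, ?_, ?_⟩, ?_, ?_, ?_⟩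
    · rw [Store.set_v, if_neg (by decide), hf₃.v _ (by decide), hp₂]
    · rw [Store.set_a, hf₃.a _ (by decide)]; exact hh₂
    · rw [pow_zero, one_mul]; exact length_popList_le S (n * n) n (n * n)
    · intro s hs hns; exact absurd hs hns
    · simp
    · intro s hs; simp [h03] at hs
    · intro i _; simp [h03]
  · intro k τ t' hk hj hb hf hR
    rw [hS₃.J] at hk
    refine wp_round hI hC (hin₃.frame hf (by decide) (by decide)) (hT₃.frame hf (by decide))
      (hS₃.frame hf (by decide)) hΛ hk hj hR ?_
    intro τ' t'' hf' hR' ht'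
    rw [← hSd] at ht'
    refine ⟨?_, by omega⟩
    obtain ⟨⟨l, g1, g2, g3⟩, h2, h3, h4⟩ := hR'
    exact ⟨⟨l, g1.congr (by simp) (by simp), g2, g3⟩, fun j hj => ⟨(h2 j hj).1, (h2 j hj).2, (h2 j hj).3⟩,
      h3, h4⟩
  · intro σ' t' hf hR ht
    rw [hS₃.J] at hR ht
    have hS' := hS₃.frame hf (by decide)
    obtain ⟨⟨l, hl, hlen, hlab⟩, hlev, hlabel, -⟩ := hR
    -- After J = `pairBits n` halvings, 2^J times the length is at most n², but n² < 2^J.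
    have hl0 : l = [] := by
      rw [← List.length_eq_zero_iff]
      by_contra hne
      have h1 : n * n < 2 ^ pairBits n := Nat.lt_size_self _
      have h2 : 2 ^ pairBits n ≤ 2 ^ pairBits n * l.length :=
        Nat.le_mul_of_pos_right _ (Nat.pos_of_ne_zero hne)
      omega
    refine ⟨⟨hS'.y, hS'.J, hS'.u, hS'.N, hT₃.frame hf (by decide), hlev, ?_, fun s hs =>
      (hlabel s hs).2, ?_⟩, ?_⟩
    · intro s
      by_cases h : σ'.a .label s = 0
      · omega
      · exact (hlabel s h).1
    · intro s hs
      by_contra hc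
      push Not at hc
      have hne : fib S (n * n) s ≠ [] := by rintro h; rw [h] at hc; simp at hc
      obtain ⟨p, hp⟩ := List.exists_mem_of_ne_nil _ hne
      rw [mem_sel] at hp
      refine hlab s (mem_popList.2 ⟨⟨p, hp⟩, hc⟩) ?_ hs
      rw [hl0]; simp
    · simp only [sum_const, card_range, smul_eq_mul] at ht
      unfold preTime
      have e : pairBits n * (roundTime n (popList S (n * n) n (n * n)).length + 20 + 8) +
        20 * pairBits n = pairBits n * (roundTime n (popList S (n * n) n (n * n)).length + 48) := by
        ring
      omega

end rounds

end WordRAM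

/-! ### Queries: marking the subsets and answering unlabelled sums. -/

namespace WordRAM

theorem Chain.next_le {nx : ℕ → ℕ} {h k r : ℕ} {l : List ℕ} (hc : Chain nx h l)
    (hl : ∀ p ∈ l, p < k) (hr : r ∈ l) : nx r ≤ k := by
  induction l generalizing h with
  | nil => simp at hr
  | cons p l ih =>
    rcases List.mem_cons.1 hr with rfl | hr'
    · cases l with
      | nil => rw [show nx r = 0 from hc.2]; omega
      | cons q l => rw [hc.2.1]; exact hl q (by simp)
    · exact ih hc.2 (fun p hp => hl p (by simp [hp])) hr'

/-- A loop along a linked list. -/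
theorem wp_chain {w : ℕ} {Q : Store → ℕ → Prop} {σ : Store} {t : ℕ} {x : Var} {p : Cmd}
    {nx : ℕ → ℕ} (inv : List ℕ → Store → Prop) (B : ℕ → ℕ) {l : List ℕ}
    (hc : Chain nx (σ.v x) l) (h0 : inv l σ)
    (hbody : ∀ r l' τ t, r ∈ l → Frame (.loop (.v x) p) σ τ → τ.v x = r + 1 → inv (r :: l') τ →
      WP w p (fun τ' t' => τ'.v x = nx r ∧ inv l' τ' ∧ t' ≤ t + B r) τ t)
    (hQ : ∀ σ' t', Frame (.loop (.v x) p) σ σ' → inv [] σ' →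
      t' ≤ t + (l.map fun r => B r + 2).sum + 2 → Q σ' t') : WP w (.loop (.v x) p) Q σ t := by
  refine WP.mono (R := fun σ' t' => _ ∧ _) ?_ (fun σ' t' hf h => hQ σ' t' hf h.1 h.2)
  clear hQ
  induction l generalizing σ t with
  | nil => exact ⟨_, _, .loop_exit trivial hc, h0, by simp⟩
  | cons r l ih =>
    obtain ⟨t₁, σ₁, h₁, h₂, h₃, h₄⟩ := hbody r l σ t (by simp) ⟨fun _ _ => rfl, fun _ _ => rfl⟩
      hc.1 h0
    have hf₁ := h₁.frame
    obtain ⟨t₂, σ₂, g₁, g₂, g₃⟩ := ih (σ := σ₁) (t := t + 2 + t₁) (by rw [h₂]; exact hc.2) h₃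
      fun r' l' τ t' hr' hf => hbody r' l' τ t' (by simp [hr'])
        ⟨fun y hy => by rw [hf.v y hy, hf₁.v y hy], fun y hy => by rw [hf.a y hy, hf₁.a y hy]⟩
    refine ⟨_, _, .loop_step trivial (by simp [hc.1]) h₁ g₁, g₂, ?_⟩
    simp only [List.map_cons, List.sum_cons, Ex.cost_v]
    omega

/-- Mark the elements of the subsets. -/
def flagsCmd : Cmd :=
  .for .i .n (.wr .flagA (.rd .raw (.v .i)) (.c 0) ;;
    .wr .flagB (.rd .raw (Ex.v .n + .v .i)) (.c 0)) ;;
  .for .i .la (.wr .flagA (.rd .raw (Ex.c 2 * .v .n + .v .i)) (.c 1)) ;;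
  .for .i .lb (.wr .flagB (.rd .raw (Ex.c 3 * .v .n + .v .i)) (.c 1))

/-- Whether both elements of a pair are marked. -/
def flagEx (e : Ex) : Ex :=
  .rd .flagA (.rd .raw (e / .v .n)) * .rd .flagB (.rd .raw (Ex.v .n + e % .v .n))

/-- Count the marked pairs with sum `s`. -/
def countCmd : Cmd :=
  .r ≔ .rd .head (.v .s) ;;
  .loop (.v .r) (.acc ≔ Ex.v .acc + flagEx (Ex.v .r - .c 1) ;; .r ≔ .rd .nxt (Ex.v .r - .c 1))

/-- Answer the queries for sums without label. -/
def directCmd : Cmd :=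
  .for .d .n (.c ≔ .rd .raw (Ex.c 4 * .v .n + .v .d) ;; .ans ≔ .c 0 ;;
    .ite (.bin .lt (.v .c) (.v .top)) (.ite (.rd .label (.v .c)) .skip
      (.s ≔ .v .c ;; .acc ≔ .c 0 ;; countCmd ;; .ans ≔ .bin .lt (.c 0) (.v .acc))) .skip ;;
    .wr .raw (Ex.c 5 * .v .n + .v .d) (.v .ans))

/-- Count the marked pairs whose sums are congruent but not equal to `c`, and compare their number
with the result of the convolution. -/
def checkCmd : Cmd :=
  .acc ≔ .c 0 ;; .q ≔ .rd .bhead (Ex.v .j * .v .N + Ex.v .c % .v .mm) ;;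
  .loop (.v .q) (.s ≔ sumEx (Ex.v .q - .c 1) ;;
    .ite (.bin .eq (.v .s) (.v .c)) .skip countCmd ;;
    .q ≔ .rd .bnxt (Ex.v .j * .v .y + (Ex.v .q - .c 1))) ;;
  .wr .raw (Ex.c 5 * .v .n + .v .d) (.bin .lt (.v .acc)
    (.rd .work (Ex.v .c % .v .mm) + .rd .work (Ex.v .c % .v .mm + .v .mm)))

/-- Answer the queries for the sums with label `j + 1`. -/
def levelCmd : Cmd :=
  .mm ≔ .rd .moduli (.v .j) ;; .oA ≔ Ex.c 2 * .v .n ;; .oB ≔ Ex.c 3 * .v .n ;;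
  .lA ≔ .v .la ;; .lB ≔ .v .lb ;; convCmd ;;
  .for .d .n (.c ≔ .rd .raw (Ex.c 4 * .v .n + .v .d) ;;
    .ite (.bin .lt (.v .c) (.v .top))
      (.ite (.bin .eq (.rd .label (.v .c)) (Ex.v .j + .c 1)) checkCmd .skip) .skip)

/-- The query algorithm. -/
def queryCmd : Cmd := flagsCmd ;; directCmd ;; .for .j .J levelCmd

/-- `A` lists a subset of the set of the `n` numbers `a i`. -/
structure Sub (n : ℕ) (a : ℕ → ℕ) (A : List ℕ) : Prop where
  inj : Set.InjOn a (Set.Iio n)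
  nodup : A.Nodup
  mem : ∀ z ∈ A, ∃ i < n, a i = z

theorem Sub.length_le {n : ℕ} {a : ℕ → ℕ} {A : List ℕ} (h : Sub n a A) : A.length ≤ n := by
  rw [← List.toFinset_card_of_nodup h.nodup]
  calc #A.toFinset ≤ #((range n).image a) := card_le_card fun z hz => by
        obtain ⟨i, hi, rfl⟩ := h.mem z (by simpa using hz)
        exact mem_image_of_mem _ (mem_range.2 hi)
    _ ≤ n := card_image_le.trans (by simp)

/-- The query is held in the input area. -/
structure Asked (n : ℕ) (A B : List ℕ) (C : ℕ → ℕ) (σ : Store) : Prop where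
  la : σ.v .la = A.length
  lb : σ.v .lb = B.length
  left : ∀ i < A.length, σ.a .raw (2 * n + i) = A.getD i 0
  right : ∀ i < B.length, σ.a .raw (3 * n + i) = B.getD i 0
  third : ∀ i < n, σ.a .raw (4 * n + i) = C i

/-- The elements of the subsets are marked. -/
structure Flagged (n : ℕ) (a b : ℕ → ℕ) (A B : List ℕ) (σ : Store) : Prop where
  left : ∀ i < n, σ.a .flagA (a i) = if a i ∈ A then 1 else 0
  right : ∀ i < n, σ.a .flagB (b i) = if b i ∈ B then 1 else 0

/-- Both elements of the pair `p` are in the subsets. -/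
abbrev InSub (a b : ℕ → ℕ) (n : ℕ) (A B : List ℕ) (p : ℕ) : Prop := a (p / n) ∈ A ∧ b (p % n) ∈ B

section query

variable {w n V : ℕ} {a b : ℕ → ℕ} {A B : List ℕ} {C : ℕ → ℕ} {Q : Store → ℕ → Prop} {σ : Store}
  {t : ℕ}

/-- Only the entries at elements of the universes are cleared. Marks are never read elsewhere, so
this takes O(n) steps and removes the traces of earlier queries. -/
theorem wp_flags (hI : Input w n V a b) (hσ : Inp n a b σ) (hA : Sub n a A) (hB : Sub n b B)
    (hq : Asked n A B C σ)
    (hQ : ∀ σ' t', Frame flagsCmd σ σ' → Flagged n a b A B σ' → t' ≤ t + 200 * n + 30 → Q σ' t') :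
    WP w flagsCmd Q σ t := by
  refine WP.mono (R := fun σ' t' => _ ∧ _) ?_ (fun σ' t' hf h => hQ σ' t' hf h.1 h.2)
  have hV := hI.fits
  have h17 := hV.num
  simp only [numArr] at h17
  have h6 := hV.six
  have hAn := hA.length_le
  have hBn := hB.length_le
  have hAV : ∀ i < A.length, A.getD i 0 < V := fun i hi => by
    rw [List.getD_eq_getElem _ _ hi]
    obtain ⟨j, hj, he⟩ := hA.mem _ (List.getElem_mem hi)
    rw [← he]; exact hI.left j hj
  have hBV : ∀ i < B.length, B.getD i 0 < V := fun i hi => by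
    rw [List.getD_eq_getElem _ _ hi]
    obtain ⟨j, hj, he⟩ := hB.mem _ (List.getElem_mem hi)
    rw [← he]; exact hI.right j hj
  refine wp_seq (wp_for_frame (fun k τ => (∀ i < k, τ.a .flagA (a i) = 0) ∧
    (∀ i < k, τ.a .flagB (b i) = 0)) (fun _ => 50)
    (by decide) (by decide) (by decide) (by decide) (by rw [hσ.size]; exact hV.lt (by omega)) hV.one_lt
    (by simp) ?_ ?_)
  · rintro k τ t' hk hi hb hf ⟨h1, h2⟩
    rw [hσ.size] at hk
    have hin : Inp n a b τ := hσ.frame hf (by decide) (by decide)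
    have ha := hI.left k hk
    have hb := hI.right k hk
    have hra := hin.left k hk
    have hrb := hin.right k hk
    refine wp_seq (wp_wr_val hV hin.size (a k) 0 (by simp [hi, hra, ha, hin.size]; omega) (by decide)
      (by simp) (hV.lt (by omega)) (by simp [hi, hra]) (by simp) ?_)
    refine wp_wr_val hV (by simp [hin.size]) (b k) 0 (by simp [hi, hrb, hb, hin.size]; omega)
      (by decide) (by simp) (hV.lt (by omega)) (by simp [hi, hrb, hin.size]) (by simp)
      ⟨⟨?_, ?_⟩, by simp [addrCost]⟩
    · intro i hi
      simp only [Store.set_a, Store.put_a, reduceCtorEq, if_false, if_true, Function.update_apply]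
      split_ifs with g
      · rfl
      · refine h1 i (lt_of_le_of_ne (by omega) ?_); rintro rfl; exact g rfl
    · intro i hi
      simp only [Store.set_a, Store.put_a, reduceCtorEq, if_false, if_true, Function.update_apply]
      split_ifs with g
      · rfl
      · refine h2 i (lt_of_le_of_ne (by omega) ?_); rintro rfl; exact g rfl
  intro σ₁ t₁ hf₁ ⟨h1, h2⟩ ht₁
  rw [hσ.size] at h1 h2 ht₁
  have hin₁ := hσ.frame hf₁ (by decide) (by decide)
  have hla : σ₁.v .la = A.length := by rw [hf₁.v _ (by decide), hq.la]
  refine wp_seq (wp_for_frame (fun k τ => ∀ i < n,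
    τ.a .flagA (a i) = if a i ∈ A.take k then 1 else 0) (fun _ => 50)
    (by decide) (by decide) (by decide) (by decide) (by rw [hla]; exact hV.lt (by omega)) hV.one_lt
    (by simpa using h1) ?_ ?_)
  · intro k τ t' hk hi hb hf hinv
    rw [hla] at hk
    have hin := hin₁.frame hf (by decide) (by decide)
    have hr : τ.a .raw (2 * n + k) = A.getD k 0 := by
      rw [hf.a _ (by decide), hf₁.a _ (by decide)]; exact hq.left k hk
    have hAk := hAV k hk
    refine wp_wr_val hV hin.size (A.getD k 0) 1 (by simp [hi, hr, hin.size] at hAk ⊢; omega)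
      (by decide) (by simp) (hV.lt (by omega)) (by simp [hi, hr, hin.size]) (by simp)
      ⟨?_, by simp [addrCost]⟩
    intro i hi
    simp only [Store.set_a, Store.put_a, if_true, Function.update_apply, hinv i hi,
      List.take_succ_eq_append_getElem hk, List.mem_append, List.mem_singleton,
      List.getD_eq_getElem _ _ hk]
    by_cases g : a i = A[k] <;> simp [g]
  intro σ₂ t₂ hf₂ h3 ht₂
  rw [hla] at h3 ht₂
  have hin₂ := hin₁.frame hf₂ (by decide) (by decide)
  have hlb : σ₂.v .lb = B.length := by rw [hf₂.v _ (by decide), hf₁.v _ (by decide), hq.lb]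
  refine wp_for_frame (fun k τ => ∀ i < n,
    τ.a .flagB (b i) = if b i ∈ B.take k then 1 else 0) (fun _ => 50)
    (by decide) (by decide) (by decide) (by decide) (by rw [hlb]; exact hV.lt (by omega)) hV.one_lt
    (by rw [Store.set_a, hf₂.a _ (by decide)]; simpa using h2) ?_ ?_
  · intro k τ t' hk hi hb hf hinv
    rw [hlb] at hk
    have hin := hin₂.frame hf (by decide) (by decide)
    have hr : τ.a .raw (3 * n + k) = B.getD k 0 := by
      rw [hf.a _ (by decide), hf₂.a _ (by decide), hf₁.a _ (by decide)]; exact hq.right k hk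
    have hBk := hBV k hk
    refine wp_wr_val hV hin.size (B.getD k 0) 1 (by simp [hi, hr, hin.size] at hBk ⊢; omega)
      (by decide) (by simp) (hV.lt (by omega)) (by simp [hi, hr, hin.size]) (by simp)
      ⟨?_, by simp [addrCost]⟩
    intro i hi
    simp only [Store.set_a, Store.put_a, if_true, Function.update_apply, hinv i hi,
      List.take_succ_eq_append_getElem hk, List.mem_append, List.mem_singleton,
      List.getD_eq_getElem _ _ hk]
    by_cases g : b i = B[k] <;> simp [g]
  intro σ₃ t₃ hf₃ h4 ht₃
  rw [hlb] at h4 ht₃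
  rw [List.take_length] at h3 h4
  simp only [sum_const, card_range, smul_eq_mul] at ht₁ ht₂ ht₃
  refine ⟨⟨?_, h4⟩, by omega⟩
  rw [hf₃.a _ (by decide)]
  exact h3

theorem flagEx_spec (hI : Input w n V a b) (hσ : Inp n a b σ) (hF : Flagged n a b A B σ) {e : Ex}
    {p : ℕ} (he : e.bd w V σ) (hev : e.ev w σ = p) (hp : p < n * n) :
    (flagEx e).bd w V σ ∧ (flagEx e).ev w σ = if InSub a b n A B p then 1 else 0 := by
  have h1 : p / n < n := Nat.div_lt_of_lt_mul hp
  have h2 : p % n < n := Nat.mod_lt _ (by have := hI.two; omega)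
  have h6 := hI.fits.six
  have h3 := hI.left _ h1
  have h4 := hI.right _ h2
  have h5 := hI.fits.two_le
  have g1 := hF.left _ h1
  have g2 := hF.right _ h2
  have g3 : σ.a .flagA (a (p / n)) < V := by rw [g1]; split_ifs <;> omega
  have g4 : σ.a .flagB (b (p % n)) < V := by rw [g2]; split_ifs <;> omega
  constructor
  · simp [flagEx, hev, hσ.size, hσ.left _ h1, hσ.right _ h2, he, g3, g4, h3, h4]
    omega
  · simp only [flagEx, Ex.ev_mul, Ex.ev_rd, Ex.ev_div, Ex.ev_add, Ex.ev_mod, Ex.ev_v, hev, hσ.size,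
      hσ.left _ h1, hσ.right _ h2, g1, g2]
    split_ifs <;> simp_all

theorem wp_count (hI : Input w n V a b) (hσ : Inp n a b σ)
    (hT : Table (pairSum a b n) V (n * n) σ) (hF : Flagged n a b A B σ) {s x : ℕ}
    (hs : σ.v .s = s) (hsV : s < V) (hx : σ.v .acc = x)
    (hxV : x + #{p ∈ range (n * n) | pairSum a b n p = s ∧ InSub a b n A B p} ≤ n * n)
    (hQ : ∀ σ' t', Frame countCmd σ σ' →
      σ'.v .acc = x + #{p ∈ range (n * n) | pairSum a b n p = s ∧ InSub a b n A B p} →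
      t' ≤ t + 70 * (fib (pairSum a b n) (n * n) s).length + 20 → Q σ' t') :
    WP w countCmd Q σ t := by
  refine WP.mono (R := fun σ' t' => _ ∧ _) ?_ (fun σ' t' hf h => hQ σ' t' hf h.1 h.2)
  have hV := hI.fits
  have h17 := hV.num
  simp only [numArr] at h17
  have hnn := hI.sq_lt
  set S := pairSum a b n with hSd
  have hhd := hT.head_le s
  have htot : ((fib S (n * n) s).map fun p => if InSub a b n A B p then 1 else 0).sum =
      #{p ∈ range (n * n) | S p = s ∧ InSub a b n A B p} := by
    rw [sum_map_sel, ← card_filter, filter_filter]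
  set tot := #{p ∈ range (n * n) | S p = s ∧ InSub a b n A B p} with htd
  refine wp_seq (wp_set_bd hV hσ.size (σ.a .head s) (by decide) (by simp [hs]; omega) (by decide)
    (by simp [hs]) ?_)
  refine wp_chain (fun l τ => τ.v .acc +
      (l.map fun p => if InSub a b n A B p then 1 else 0).sum = x + tot) (fun _ => 60)
    (nx := σ.a .nxt) (l := fib S (n * n) s) (by simpa using hT.chain s) (by simp [hx, htot]) ?_ ?_
  · intro r l' τ t' hr hf hrv hinv
    rw [mem_sel] at hr
    have hin : Inp n a b τ := hσ.congr (by rw [hf.v _ (by decide)]; simp)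
      (by rw [hf.a _ (by decide)]; simp)
    have hF' : Flagged n a b A B τ := ⟨by rw [hf.a _ (by decide)]; exact hF.left,
      by rw [hf.a _ (by decide)]; exact hF.right⟩
    have hsp := flagEx_spec hI hin hF' (e := Ex.v .r - .c 1) (p := r) (by simp [hrv]; omega)
      (by simp [hrv]) hr.1
    rw [List.map_cons, List.sum_cons] at hinv
    have hnx : σ.a .nxt r < V := by
      have := (hT.chain s).next_le (fun p hp => (mem_sel.1 hp).1) (mem_sel.2 hr)
      omega
    refine wp_seq (wp_set_bd hV hin.size (τ.v .acc + if InSub a b n A B r then 1 else 0) (by decide)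
      ⟨by simp; omega, hsp.1⟩ (by decide) (by rw [Ex.ev_add, hsp.2]; rfl) ?_)
    refine wp_set_bd hV (by simp [hin.size]) (σ.a .nxt r) (by decide) ?_ (by decide) ?_
      ⟨by simp, ?_, ?_⟩
    · have := hf.a .nxt (by decide)
      simp [hrv, this]; omega
    · have := hf.a .nxt (by decide)
      simp [hrv, this]
    · simp only [Store.set_v, reduceCtorEq, if_false, if_true]; omega
    · simp [addrCost, flagEx]
  · intro σ' t' hf h ht
    simp only [List.map_nil, List.sum_nil, add_zero] at h
    refine ⟨h, ?_⟩
    simp [addrCost] at ht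
    omega

/-- The number of pairs in the subsets with sum `s`. -/
def hits (a b : ℕ → ℕ) (n : ℕ) (A B : List ℕ) (s : ℕ) : ℕ :=
  #{p ∈ range (n * n) | pairSum a b n p = s ∧ InSub a b n A B p}

theorem hits_le (a b : ℕ → ℕ) (n : ℕ) (A B : List ℕ) (s : ℕ) : hits a b n A B s ≤ n * n :=
  (card_filter_le _ _).trans (by simp)

theorem Inp.raw {τ : Store} (h : Inp n a b σ) (hn : τ.v .n = n)
    (hr : ∀ i < 5 * n, τ.a .raw i = σ.a .raw i) : Inp n a b τ :=
  ⟨hn, fun i hi => by rw [hr i (by omega), h.left i hi],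
    fun i hi => by rw [hr _ (by omega), h.right i hi]⟩

theorem Asked.raw {τ : Store} (h : Asked n A B C σ) (hA : A.length ≤ n) (hB : B.length ≤ n)
    (h1 : τ.v .la = σ.v .la) (h2 : τ.v .lb = σ.v .lb)
    (hr : ∀ i < 5 * n, τ.a .raw i = σ.a .raw i) : Asked n A B C τ :=
  ⟨by rw [h1, h.la], by rw [h2, h.lb], fun i hi => by rw [hr _ (by omega), h.left i hi],
    fun i hi => by rw [hr _ (by omega), h.right i hi],
    fun i hi => by rw [hr _ (by omega), h.third i hi]⟩

theorem Flagged.congr {τ : Store} (h : Flagged n a b A B σ) (h1 : τ.a .flagA = σ.a .flagA)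
    (h2 : τ.a .flagB = σ.a .flagB) : Flagged n a b A B τ :=
  ⟨by rw [h1]; exact h.left, by rw [h2]; exact h.right⟩

theorem DataStructure.frame {S : ℕ → ℕ} {Λ : ℕ} {τ : Store} {p : Cmd}
    (h : DataStructure S n V Λ σ) (hf : Frame p σ τ)
    (hv : ∀ x ∈ [Var.y, .J, .u, .N, .top], p.mv x = false)
    (ha : ∀ x ∈ [Arr.nxt, .head, .cnt, .label, .moduli, .bhead, .bnxt], p.ma x = false) :
    DataStructure S n V Λ τ := by
  have e1 := hf.a .label (ha _ (by decide))
  have e2 := hf.a .moduli (ha _ (by decide))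
  have e3 := hf.a .bhead (ha _ (by decide))
  have e4 := hf.a .bnxt (ha _ (by decide))
  refine ⟨?_, ?_, ?_, ?_, h.table.congr (hf.a _ (ha _ (by decide))) (hf.a _ (ha _ (by decide)))
      (hf.a _ (ha _ (by decide))) (hf.v _ (hv _ (by decide))), fun j hj => ?_, ?_, ?_, ?_⟩
  · rw [hf.v _ (hv _ (by decide)), h.y]
  · rw [hf.v _ (hv _ (by decide)), h.J]
  · rw [hf.v _ (hv _ (by decide)), h.u]
  · rw [hf.v _ (hv _ (by decide)), h.N]
  · obtain ⟨h1, h2, h3⟩ := h.level j hj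
    refine ⟨?_, ?_, ?_⟩
    all_goals rw [e2]
    exacts [h1, h2, by rw [e3, e4]; exact h3]
  · rw [e1]; exact h.label_le
  · rw [e1, e2]; exact h.good
  · rw [e1]; exact h.unlabelled

/-- The output area tells which indices satisfy `R`. -/
def Output (n : ℕ) (R : ℕ → Prop) (σ : Store) : Prop :=
  ∀ d < n, (R d → σ.a .raw (5 * n + d) = 1) ∧ (¬ R d → σ.a .raw (5 * n + d) = 0)

theorem ite_eq_of {R : Prop} [Decidable R] {z : ℕ} (h : z = if R then 1 else 0) :
    (R → z = 1) ∧ (¬ R → z = 0) :=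
  ⟨fun hR => by rw [h, if_pos hR], fun hR => by rw [h, if_neg hR]⟩

theorem pairBits_lt (hI : Input w n V a b) : pairBits n < V := by
  have h1 := hI.sq_lt
  have h2 : pairBits n ≤ n * n := Nat.size_le.2 Nat.lt_two_pow_self
  omega

/-- An unlabelled sum has at most √n pairs, and these are tested one by one. Values from `top` on
are rejected before any array is indexed by them; every other answer is zero for now and is
overwritten when its label comes up. -/
theorem wp_direct (hI : Input w n V a b) (hσ : Inp n a b σ) {Λ : ℕ}
    (hD : DataStructure (pairSum a b n) n V Λ σ) (hF : Flagged n a b A B σ)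
    (hA : A.length ≤ n) (hB : B.length ≤ n) (hq : Asked n A B C σ)
    (hQ : ∀ σ' t', Frame directCmd σ σ' → (∀ i < 5 * n, σ'.a .raw i = σ.a .raw i) →
      Output n (fun d => C d < σ.v .top ∧ σ.a .label (C d) = 0 ∧ 0 < hits a b n A B (C d)) σ' →
      t' ≤ t + n * (70 * n.sqrt + 200) + 10 → Q σ' t') :
    WP w directCmd Q σ t := by
  refine WP.mono (R := fun σ' t' => _ ∧ _ ∧ _) ?_
    (fun σ' t' hf h => hQ σ' t' hf h.1 h.2.1 h.2.2)
  have hV := hI.fits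
  have h17 := hV.num
  simp only [numArr] at h17
  have hnn := hI.sq_lt
  have h6 := hV.six
  set S := pairSum a b n with hSd
  have htop := hD.table.top_lt
  set T := σ.v .top with hTd
  refine wp_for_frame (fun k τ => (∀ i < 5 * n, τ.a .raw i = σ.a .raw i) ∧
    ∀ d < k, (C d < T ∧ σ.a .label (C d) = 0 ∧ 0 < hits a b n A B (C d) →
      τ.a .raw (5 * n + d) = 1) ∧ (¬ (C d < T ∧ σ.a .label (C d) = 0 ∧ 0 < hits a b n A B (C d)) →
      τ.a .raw (5 * n + d) = 0)) (fun _ => 70 * n.sqrt + 190)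
    (by decide) (by decide) (by decide) (by decide) (by rw [hσ.size]; exact hV.lt (by omega))
    hV.one_lt ⟨fun i _ => rfl, by simp⟩ ?_ ?_
  · rintro k τ t' hk hd hb hf ⟨h1, h2⟩
    rw [hσ.size] at hk
    have hin : Inp n a b τ := hσ.raw (by rw [hf.v _ (by decide), hσ.size]) h1
    have hD' := hD.frame hf (by decide) (by decide)
    have hF' : Flagged n a b A B τ := hF.congr (hf.a _ (by decide)) (hf.a _ (by decide))
    have hq' : Asked n A B C τ := hq.raw hA hB (hf.v _ (by decide)) (hf.v _ (by decide)) h1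
    have hlab : τ.a .label = σ.a .label := hf.a _ (by decide)
    have htop' : τ.v .top = T := hf.v _ (by decide)
    have hCk := hq'.third k hk
    have hset : ((Ex.rd .raw (Ex.c 4 * .v .n + .v .d)).ev w τ) = C k := by
      simp [hd, hin.size, hCk]
    -- The queried number may be any word and need not be below V, so the rule for bounded values
    -- does not apply to this read.
    refine wp_seq (wp_set (by decide) (ok_rd hV hin.size (by simp [hd, hin.size]; omega)
      (by decide) (by simp [hd, hin.size]; omega)) ?_)
    rw [hset]
    refine wp_seq (wp_set_bd hV (by simp [hin.size]) 0 (by decide) (by simp; omega) (by decide)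
      (by simp) ?_)
    set τ₀ := (τ.set .c (C k)).set .ans 0 with hτ₀
    set val := if C k < T ∧ σ.a .label (C k) = 0 ∧ 0 < hits a b n A B (C k) then 1 else 0 with hval
    refine wp_seq (WP.mono (R := fun τ' t'' => τ'.v .ans = val ∧ t'' ≤ t' + 70 * n.sqrt + 120)
      ?_ ?_)
    · refine wp_ite ⟨trivial, trivial, hV.one_lt⟩ (fun h => ?_) (fun h => ?_)
      · have hlt : C k < T := by
          simpa [hτ₀, htop'] using h
        have hlle := hD.label_le (C k)
        have hbits := pairBits_lt hI
        refine wp_ite_bd hV (by simp [hτ₀, hin.size]) (by simp [hτ₀, hlab]; omega) (by decide)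
          (fun h' => ?_) (fun h' => ?_)
        · have hne : σ.a .label (C k) ≠ 0 := by simpa [hτ₀, hlab] using h'
          refine wp_skip ⟨?_, ?_⟩
          · rw [hval, if_neg (fun h => hne h.2.1)]; simp [hτ₀]
          · simp [addrCost]; omega
        · have he : σ.a .label (C k) = 0 := by simpa [hτ₀, hlab] using h'
          have hlen := Nat.le_sqrt.2 (hD.unlabelled _ he)
          refine wp_seq (wp_set_bd hV (by simp [hτ₀, hin.size]) (C k) (by decide)
            (by simp [hτ₀]; omega) (by decide) (by simp [hτ₀]) ?_)
          refine wp_seq (wp_set_bd hV (by simp [hτ₀, hin.size]) 0 (by decide)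
            (by simp; omega) (by decide) (by simp) ?_)
          refine wp_seq (wp_count hI (hin.congr (by simp [hτ₀]) (by simp [hτ₀]))
            (hD'.table.congr (by simp [hτ₀]) (by simp [hτ₀]) (by simp [hτ₀]) (by simp [hτ₀]))
            (hF'.congr (by simp [hτ₀]) (by simp [hτ₀])) (s := C k) (x := 0) (by simp)
            (by omega) (by simp) (by rw [zero_add]; exact hits_le _ _ _ _ _ _) ?_)
          intro σ₁ t₁ hf₁ hacc ht₁
          have hacc' : σ₁.v .acc = hits a b n A B (C k) := by rw [hacc, zero_add]; rfl
          have hhl := hits_le a b n A B (C k)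
          refine wp_set_bd hV (by rw [hf₁.v _ (by decide)]; simp [hτ₀, hin.size]) val (by decide)
            (by simp [hacc']; omega) (by decide) ?_ ⟨by simp, ?_⟩
          · rw [hval]
            simp [hacc', hlt, he]
          · rw [← hSd] at ht₁
            simp [addrCost] at ht₁ ⊢
            omega
      · have hlt : ¬ C k < T := by
          simpa [hτ₀, htop'] using h
        refine wp_skip ⟨?_, ?_⟩
        · rw [hval, if_neg (fun h => hlt h.1)]; simp [hτ₀]
        · simp [addrCost]; omega
    · rintro τ₁ t₁ hf₁ ⟨hans, ht₁⟩
      have hn₁ : τ₁.v .n = n := by rw [hf₁.v _ (by decide)]; simp [hτ₀, hin.size]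
      have hd₁ : τ₁.v .d = k := by rw [hf₁.v _ (by decide)]; simp [hτ₀, hd]
      have hr₁ : τ₁.a .raw = τ.a .raw := by rw [hf₁.a _ (by decide)]; simp [hτ₀]
      refine wp_wr_val hV hn₁ (5 * n + k) val (by simp [hn₁, hd₁]; omega) (by decide)
        (by simp [hn₁, hd₁]; omega) trivial (by simp [hn₁, hd₁]) (by simp [hans]) ⟨⟨?_, ?_⟩, ?_⟩
      · intro i hi
        simp only [Store.set_a, Store.put_a, if_true]
        rw [Function.update_of_ne (by omega), hr₁, h1 i hi]
      · intro d hdk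
        simp only [Store.set_a, Store.put_a, if_true, hr₁]
        rcases Nat.lt_succ_iff_lt_or_eq.1 hdk with g | rfl
        · rw [Function.update_of_ne (by omega)]; exact h2 d g
        · rw [Function.update_self]; exact ite_eq_of hval
      · simp [addrCost]
        omega
  · intro σ' t' hf h ht
    rw [hσ.size] at h ht
    simp only [sum_const, card_range, smul_eq_mul] at ht
    refine ⟨h.1, h.2, ?_⟩
    have : n * (70 * n.sqrt + 190 + 8) ≤ n * (70 * n.sqrt + 200) := Nat.mul_le_mul_left _ (by omega)
    omega

end query

end WordRAM

/-! ### Queries: labelled sums. -/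

namespace WordRAM

section buckets

variable (S : ℕ → ℕ) (P m s : ℕ) (R : ℕ → Prop) [DecidablePred R]

/-- Each pair in the residue class lies in the fibre of exactly one representative, so running over
the bucket and over the fibres meets every colliding pair once; the fibre of s is left out. -/
theorem sum_bucket : ((bucket S P m (s % m) P).map fun r =>
      if S r = s then 0 else #{p ∈ range P | S p = S r ∧ R p}).sum =
    #{p ∈ range P | (S p % m = s % m ∧ S p ≠ s) ∧ R p} := by
  rw [sum_map_sel]
  have h1 : ∀ r ∈ (range P).filter (fun p => IsRep S P p ∧ S p % m = s % m),
      (if S r = s then 0 else #{p ∈ range P | S p = S r ∧ R p}) =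
      #{p ∈ range P | (S p = S r ∧ S p ≠ s) ∧ R p} := by
    intro r _
    split_ifs with h
    · symm
      rw [card_eq_zero, filter_eq_empty_iff]
      rintro p _ ⟨⟨h1, h2⟩, -⟩
      exact h2 (h1.trans h)
    · congr 1
      ext p
      simp only [mem_filter]
      constructor
      · rintro ⟨h1, h2, h3⟩; exact ⟨h1, ⟨h2, by rwa [h2]⟩, h3⟩
      · rintro ⟨h1, ⟨h2, -⟩, h3⟩; exact ⟨h1, h2, h3⟩
  rw [sum_congr rfl h1, ← card_biUnion]
  · congr 1
    ext p
    simp only [mem_biUnion, mem_filter, mem_range]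
    constructor
    · rintro ⟨r, ⟨-, -, h2⟩, h3, ⟨h4, h5⟩, h6⟩
      exact ⟨h3, ⟨by rw [h4, h2], h5⟩, h6⟩
    · rintro ⟨h1, ⟨h2, h3⟩, h4⟩
      obtain ⟨q, hq, hr, he⟩ := exists_isRep S h1
      exact ⟨q, ⟨hq, hr, by rw [he, h2]⟩, h1, ⟨he.symm, h3⟩, h4⟩
  · intro r hr r' hr' hne
    rw [mem_coe, mem_filter] at hr hr'
    rw [Function.onFun, disjoint_filter]
    rintro p _ ⟨⟨h1, -⟩, -⟩ ⟨⟨h2, -⟩, -⟩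
    exact hne (hr.2.1.eq hr'.2.1 (h1.symm.trans h2))

/-- All representatives in the bucket are collisions, except possibly the one of s itself. -/
theorem length_bucket_le : (bucket S P m (s % m) P).length ≤ coll S P m s + 1 := by
  rw [length_sel]
  have h1 : #{r ∈ range P | IsRep S P r ∧ S r = s} ≤ 1 := by
    rw [card_le_one]
    intro r hr r' hr'
    rw [mem_filter] at hr hr'
    exact hr.2.1.eq hr'.2.1 (hr.2.2.trans hr'.2.2.symm)
  refine le_trans ?_ (Nat.add_le_add_left h1 _)
  rw [coll]
  refine le_trans (card_le_card ?_) (card_union_le _ _)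
  intro r hr
  simp only [mem_union, mem_filter] at hr ⊢
  by_cases h : S r = s
  · right; exact ⟨hr.1, hr.2.1, h⟩
  · left; exact ⟨hr.1, hr.2.2, h⟩

end buckets

section query

variable {w n V : ℕ} {a b : ℕ → ℕ} {A B : List ℕ} {C : ℕ → ℕ} {Q : Store → ℕ → Prop} {σ : Store}
  {t : ℕ}

/-- The convolution counts the marked pairs in the class of s, which are the marked collisions plus
the hits. The loop computes the former, so a strict excess means that a hit exists. Time is
proportional to all collisions, marked or not, which is what the choice of the modulus controls. -/
theorem wp_check (hI : Input w n V a b) (hσ : Inp n a b σ)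
    (hT : Table (pairSum a b n) V (n * n) σ) (hF : Flagged n a b A B σ) {j N m s d F : ℕ}
    (hy : σ.v .y = n * n) (hN : σ.v .N = N) (hNV : N < V) (hj : σ.v .j = j) (hjV : j < V)
    (hm : σ.v .mm = m) (hm0 : 0 < m) (hmV : m < V) (hs : σ.v .c = s) (hsV : s < V)
    (hd : σ.v .d = d) (hdn : d < n)
    (hc : Chain (fun p => σ.a .bnxt (j * (n * n) + p)) (σ.a .bhead (j * N + s % m))
      (bucket (pairSum a b n) (n * n) m (s % m) (n * n)))
    (hw : σ.a .work (s % m) + σ.a .work (s % m + m) =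
      #{p ∈ range (n * n) | InSub a b n A B p ∧ pairSum a b n p % m = s % m})
    (hcF : coll (pairSum a b n) (n * n) m s ≤ F)
    (hQ : ∀ σ' t', Frame checkCmd σ σ' → σ'.a .raw = Function.update (σ.a .raw) (5 * n + d)
        (if 0 < hits a b n A B s then 1 else 0) →
      t' ≤ t + 200 * F + 300 → Q σ' t') : WP w checkCmd Q σ t := by
  refine WP.mono (R := fun σ' t' => _ ∧ _) ?_ (fun σ' t' hf h => hQ σ' t' hf h.1 h.2)
  have hV := hI.fits
  have h17 := hV.num
  simp only [numArr] at h17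
  have hnn := hI.sq_lt
  have h6 := hV.six
  set S := pairSum a b n with hSd
  have htot := sum_bucket S (n * n) m s (InSub a b n A B)
  set tot := #{p ∈ range (n * n) | (S p % m = s % m ∧ S p ≠ s) ∧ InSub a b n A B p} with htd
  have htotn : tot ≤ n * n := (card_filter_le _ _).trans (by simp)
  have hle := hc.le
  refine wp_seq (wp_set_bd hV hσ.size 0 (by decide) (by simp; omega) (by decide) (by simp) ?_)
  refine wp_seq (wp_set_bd hV (by simp [hσ.size]) (σ.a .bhead (j * N + s % m)) (by decide)
    (by simp [hj, hN, hs, hm]; omega) (by decide) (by simp [hj, hN, hs, hm]) ?_)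
  refine wp_seq (wp_chain (fun l τ => τ.v .acc + (l.map fun r =>
      if S r = s then 0 else #{p ∈ range (n * n) | S p = S r ∧ InSub a b n A B p}).sum = tot)
    -- The conjunct `True` gives the cost the shape of `sum_bucket` with a trivial predicate, so
    -- that the same identity evaluates both the counter and the running time.
    (fun r => 70 * (if S r = s then 0 else #{p ∈ range (n * n) | S p = S r ∧ True}) + 118)
    (nx := fun p => σ.a .bnxt (j * (n * n) + p))
    (l := bucket S (n * n) m (s % m) (n * n)) (by simpa using hc) (by simpa using htot) ?_ ?_)
  · intro r l' τ t' hr hf hq hinv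
    have hnx := hc.next_le (fun p hp => (mem_sel.1 hp).1) hr
    rw [mem_sel] at hr
    have hin : Inp n a b τ := hσ.congr (by rw [hf.v _ (by decide)]; simp)
      (by rw [hf.a _ (by decide)]; simp)
    have hF' : Flagged n a b A B τ := hF.congr (by rw [hf.a _ (by decide)]; simp)
      (by rw [hf.a _ (by decide)]; simp)
    have hT' : Table S V (n * n) τ := hT.congr (by rw [hf.a _ (by decide)]; simp)
      (by rw [hf.a _ (by decide)]; simp) (by rw [hf.a _ (by decide)]; simp)
      (by rw [hf.v _ (by decide)]; simp)
    have hj' : τ.v .j = j := by rw [hf.v _ (by decide)]; simp [hj]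
    have hy' : τ.v .y = n * n := by rw [hf.v _ (by decide)]; simp [hy]
    have hs' : τ.v .c = s := by rw [hf.v _ (by decide)]; simp [hs]
    have hbn' : τ.a .bnxt = σ.a .bnxt := by rw [hf.a _ (by decide)]; simp
    have hsp := sumEx_spec hI hin (e := Ex.v .q - .c 1) (p := r) (by simp [hq]; omega)
      (by simp [hq]) hr.1
    have hSr := hI.pairSum_lt hr.1
    rw [← hSd] at hsp hSr
    rw [List.map_cons, List.sum_cons] at hinv
    refine wp_seq (wp_set_bd hV hin.size (S r) (by decide) hsp.1 (by decide) hsp.2 ?_)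
    refine wp_seq (WP.mono (R := fun τ' t'' => τ'.v .acc = τ.v .acc +
      (if S r = s then 0 else #{p ∈ range (n * n) | S p = S r ∧ InSub a b n A B p}) ∧
      t'' ≤ t' + 70 * (if S r = s then 0 else #{p ∈ range (n * n) | S p = S r ∧ True}) + 80)
      ?_ ?_)
    · refine wp_ite_bd hV (by simp [hin.size]) (by simp [hs']; omega) (by decide)
        (fun h => ?_) (fun h => ?_)
      · have he : S r = s := by simpa [hs'] using h
        refine wp_skip ⟨by simp [he], ?_⟩
        simp [sumEx, addrCost]; omega
      · have he : ¬ S r = s := by simpa [hs'] using h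
        rw [if_neg he] at hinv
        refine wp_count hI (hin.congr (by simp) (by simp))
          (hT'.congr (by simp) (by simp) (by simp) (by simp)) (hF'.congr (by simp) (by simp))
          (s := S r) (x := τ.v .acc) (by simp) (by omega) (by simp) (by rw [← hSd]; omega) ?_
        intro σ₁ t₁ hf₁ hacc ht₁
        rw [← hSd] at ht₁ hacc
        rw [length_sel] at ht₁
        refine ⟨by rw [hacc, if_neg he], ?_⟩
        simp only [and_true, if_neg he]
        simp [addrCost, sumEx] at ht₁
        omega
    · rintro τ₁ t₁ hf₁ ⟨hacc, ht₁⟩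
      generalize (if S r = s then 0 else #{p ∈ range (n * n) | S p = S r ∧ True}) = g at ht₁ ⊢
      have hn₁ : τ₁.v .n = n := by rw [hf₁.v _ (by decide)]; simp [hin.size]
      have hq₁ : τ₁.v .q = r + 1 := by rw [hf₁.v _ (by decide)]; simp [hq]
      have hj₁ : τ₁.v .j = j := by rw [hf₁.v _ (by decide)]; simp [hj']
      have hy₁ : τ₁.v .y = n * n := by rw [hf₁.v _ (by decide)]; simp [hy']
      have hbn₁ : τ₁.a .bnxt = σ.a .bnxt := by rw [hf₁.a _ (by decide)]; simp [hbn']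
      have hrn := hr.1
      refine wp_set_bd hV hn₁ (σ.a .bnxt (j * (n * n) + r)) (by decide)
        (by simp [hq₁, hj₁, hy₁, hbn₁]; omega) (by decide) (by simp [hq₁, hj₁, hy₁, hbn₁])
        ⟨by simp, ?_, ?_⟩
      · simp only [Store.set_v, reduceCtorEq, if_false, hacc]
        omega
      · simp [addrCost]
        omega
  · intro σ₁ t₁ hf₁ hacc ht₁
    simp only [List.map_nil, List.sum_nil, add_zero] at hacc
    have hn₁ : σ₁.v .n = n := by rw [hf₁.v _ (by decide)]; simp [hσ.size]
    have hd₁ : σ₁.v .d = d := by rw [hf₁.v _ (by decide)]; simp [hd]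
    have hs₁ : σ₁.v .c = s := by rw [hf₁.v _ (by decide)]; simp [hs]
    have hm₁ : σ₁.v .mm = m := by rw [hf₁.v _ (by decide)]; simp [hm]
    have hw₁ : σ₁.a .work = σ.a .work := by rw [hf₁.a _ (by decide)]; simp
    have hr₁ : σ₁.a .raw = σ.a .raw := by rw [hf₁.a _ (by decide)]; simp
    have hsplit : #{p ∈ range (n * n) | InSub a b n A B p ∧ S p % m = s % m} =
        tot + hits a b n A B s := by
      rw [htd, hits, ← card_union_of_disjoint]
      · congr 1
        ext p
        simp only [mem_union, mem_filter, ← hSd]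
        by_cases h : S p = s
        · simp [h]
        · simp only [h, not_false_eq_true, ne_eq, and_true, false_and, and_false, or_false]
          tauto
      · rw [disjoint_filter]
        rintro p _ ⟨⟨-, h1⟩, -⟩ ⟨h2, -⟩
        exact h1 h2
    have hsum : tot + hits a b n A B s ≤ n * n := by
      rw [← hsplit]; exact (card_filter_le _ _).trans (by simp)
    rw [hsplit] at hw
    refine wp_wr_val hV hn₁ (5 * n + d) (if 0 < hits a b n A B s then 1 else 0)
      (by simp [hn₁, hd₁]; omega) (by decide) (by simp [hn₁, hd₁]; omega)
      (Ex.bd.ok hV hn₁ (by simp [hacc, hs₁, hm₁, hw₁]; omega) (by decide))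
      (by simp [hn₁, hd₁]) (by simp [hacc, hs₁, hm₁, hw₁, hw]) ⟨by simp [hr₁], ?_⟩
    have hlen := length_bucket_le S (n * n) m s
    have hsumt : ((bucket S (n * n) m (s % m) (n * n)).map fun r =>
        70 * (if S r = s then 0 else #{p ∈ range (n * n) | S p = S r ∧ True}) + 118 + 2).sum =
        70 * coll S (n * n) m s + 120 * (bucket S (n * n) m (s % m) (n * n)).length := by
      have h1 := sum_bucket S (n * n) m s (fun _ => True)
      have h2 : #{p ∈ range (n * n) | (S p % m = s % m ∧ S p ≠ s) ∧ True} = coll S (n * n) m s := by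
        simp [coll]
      rw [h2] at h1
      rw [← h1]
      generalize bucket S (n * n) m (s % m) (n * n) = l
      clear * -
      induction l with
      | nil => simp
      | cons r l ih => simp only [List.map_cons, List.sum_cons, List.length_cons, ih]; ring
    rw [hsumt] at ht₁
    simp [addrCost] at ht₁ ⊢
    omega

/-- One convolution of the query's subsets modulo the j-th modulus serves all queried numbers with
label j + 1, and each of these then costs time proportional to F only. Answers for other labels are
not touched. -/
theorem wp_level (hI : Input w n V a b) (hC : ConvFits n V) (hσ : Inp n a b σ) {Λ j F : ℕ}
    (hD : DataStructure (pairSum a b n) n V Λ σ) (hF : Flagged n a b A B σ)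
    (hA : Sub n a A) (hB : Sub n b B) (hq : Asked n A B C σ) (hj : σ.v .j = j)
    (hjJ : j < pairBits n)
    (hGF : ∀ m s, Good (pairSum a b n) n Λ m s → coll (pairSum a b n) (n * n) m s ≤ F)
    (hO : Output n (fun d => C d < σ.v .top ∧ σ.a .label (C d) ≤ j ∧ 0 < hits a b n A B (C d)) σ)
    (hQ : ∀ σ' t', Frame levelCmd σ σ' → (∀ i < 5 * n, σ'.a .raw i = σ.a .raw i) →
      Output n (fun d => C d < σ.v .top ∧ σ.a .label (C d) ≤ j + 1 ∧
        0 < hits a b n A B (C d)) σ' →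
      t' ≤ t + convTime (4 * logX n) n + n * (200 * F + 500) + 200 → Q σ' t') :
    WP w levelCmd Q σ t := by
  refine WP.mono (R := fun σ' t' => _ ∧ _ ∧ _) ?_
    (fun σ' t' hf h => hQ σ' t' hf h.1 h.2.1 h.2.2)
  have hV := hI.fits
  have h17 := hV.num
  simp only [numArr] at h17
  have hnn := hI.sq_lt
  have h6 := hV.six
  have hAn := hA.length_le
  have hBn := hB.length_le
  have hn0 : 0 < n := by have := hI.two; omega
  have hAV : ∀ i < A.length, A.getD i 0 < V := fun i hi => by
    rw [List.getD_eq_getElem _ _ hi]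
    obtain ⟨j, hj, he⟩ := hA.mem _ (List.getElem_mem hi)
    rw [← he]; exact hI.left j hj
  have hBV : ∀ i < B.length, B.getD i 0 < V := fun i hi => by
    rw [List.getD_eq_getElem _ _ hi]
    obtain ⟨j, hj, he⟩ := hB.mem _ (List.getElem_mem hi)
    rw [← he]; exact hI.right j hj
  have hCC := hC
  unfold ConvFits at hC
  have hpos : 32 * 2 ^ (4 * logX n + 1) ≤ 32 * 2 ^ (4 * logX n + 1) * (4 * logX n + 1) :=
    Nat.le_mul_of_pos_right _ (by omega)
  have hbits := pairBits_lt hI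
  set S := pairSum a b n with hSd
  obtain ⟨hm0, hmN, hch⟩ := hD.level j hjJ
  set m := σ.a .moduli j with hmd
  have htop := hD.table.top_lt
  set T := σ.v .top with hTd
  refine wp_seq (wp_set_bd hV hσ.size m (by decide) (by simp [hj, ← hmd]; omega) (by decide)
    (by simp [hj, ← hmd]) ?_)
  refine wp_seq (wp_set_bd hV (by simp [hσ.size]) (2 * n) (by decide) (by simp [hσ.size]; omega)
    (by decide) (by simp [hσ.size]) ?_)
  refine wp_seq (wp_set_bd hV (by simp [hσ.size]) (3 * n) (by decide) (by simp [hσ.size]; omega)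
    (by decide) (by simp [hσ.size]) ?_)
  refine wp_seq (wp_set_bd hV (by simp [hσ.size]) A.length (by decide) (by simp [hq.la]; omega)
    (by decide) (by simp [hq.la]) ?_)
  refine wp_seq (wp_set_bd hV (by simp [hσ.size]) B.length (by decide) (by simp [hq.lb]; omega)
    (by decide) (by simp [hq.lb]) ?_)
  refine wp_seq (wp_convCmd hV (by simp [hσ.size]) (u := 4 * logX n) (m := m) (sA := 2 * n)
    (sB := 3 * n) (a := A.length) (b := B.length) (f := fun i => A.getD i 0)
    (g := fun i => B.getD i 0) (by simp [hD.u]) (by simp [hD.N]) hCC (by simp) hm0 hmN (by simp)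
    (by simp) (by simp) (by simp) (by omega) (by omega)
    (lt_of_le_of_lt (Nat.mul_le_mul hAn hBn) hnn) hAn hBn (by simpa using hq.left)
    (by simpa using hq.right) hAV hBV ?_)
  intro σ₁ t₁ hf₁ hw₁ ht₁
  have hv₁ : ∀ x, x ∉ [Var.mm, .oA, .oB, .lA, .lB] → convCmd.mv x = false → σ₁.v x = σ.v x := by
    intro x hx hx'
    simp only [List.mem_cons, List.not_mem_nil, or_false, not_or] at hx
    rw [hf₁.v x hx']
    simp [hx]
  have ha₁ : ∀ x, convCmd.ma x = false → σ₁.a x = σ.a x := by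
    intro x hx
    rw [hf₁.a x hx]; simp
  have hm₁ : σ₁.v .mm = m := by rw [hf₁.v _ (by decide)]; simp
  have hn₁ : σ₁.v .n = n := by rw [hv₁ _ (by decide) (by decide), hσ.size]
  have hN₁ : σ₁.v .N = 2 ^ (4 * logX n + 1) := by rw [hv₁ _ (by decide) (by decide), hD.N]
  have hy₁ : σ₁.v .y = n * n := by rw [hv₁ _ (by decide) (by decide), hD.y]
  have hj₁ : σ₁.v .j = j := by rw [hv₁ _ (by decide) (by decide), hj]
  have hT₁ : Table S V (n * n) σ₁ := hD.table.congr (ha₁ _ (by decide)) (ha₁ _ (by decide))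
    (ha₁ _ (by decide)) (hv₁ _ (by decide) (by decide))
  have hF₁ : Flagged n a b A B σ₁ := hF.congr (ha₁ _ (by decide)) (ha₁ _ (by decide))
  have hr₁ : σ₁.a .raw = σ.a .raw := ha₁ _ (by decide)
  -- Within the level, labels up to j are settled for all positions and label j + 1 for the
  -- positions below k; positions of other labels still hold the answer zero.
  refine wp_for_frame (fun k τ => (∀ i < 5 * n, τ.a .raw i = σ.a .raw i) ∧
    Output n (fun d => C d < T ∧ (σ.a .label (C d) ≤ j ∨ (σ.a .label (C d) = j + 1 ∧ d < k)) ∧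
      0 < hits a b n A B (C d)) τ) (fun _ => 200 * F + 400)
    (by decide) (by decide) (by decide) (by decide) (by rw [hn₁]; exact hV.lt (by omega))
    hV.one_lt ⟨fun i _ => by simp [hr₁], ?_⟩ ?_ ?_
  · intro d hd
    simp only [not_lt_zero, and_false, or_false, Store.set_a, hr₁]
    exact hO d hd
  · rintro k τ t' hk hd hb hf ⟨h1, h2⟩
    rw [hn₁] at hk
    have hin : Inp n a b τ := hσ.raw (by rw [hf.v _ (by decide), hn₁]) h1
    have hF' : Flagged n a b A B τ := hF₁.congr (hf.a _ (by decide)) (hf.a _ (by decide))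
    have hT' : Table S V (n * n) τ := hT₁.frame hf (by decide)
    have hCk : τ.a .raw (4 * n + k) = C k := by rw [h1 _ (by omega), hq.third k hk]
    have hlab : τ.a .label = σ.a .label := by rw [hf.a _ (by decide), ha₁ _ (by decide)]
    have htop' : τ.v .top = T := by rw [hf.v _ (by decide), hv₁ _ (by decide) (by decide)]
    have hj' : τ.v .j = j := by rw [hf.v _ (by decide), hj₁]
    have hset : ((Ex.rd .raw (Ex.c 4 * .v .n + .v .d)).ev w τ) = C k := by
      simp [hd, hin.size, hCk]
    refine wp_seq (wp_set (by decide) (ok_rd hV hin.size (by simp [hd, hin.size]; omega)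
      (by decide) (by simp [hd, hin.size]; omega)) ?_)
    rw [hset]
    have hskip : ∀ (τ' : Store), τ'.a .raw = τ.a .raw → ¬ (C k < T ∧ σ.a .label (C k) = j + 1) →
        (∀ i < 5 * n, τ'.a .raw i = σ.a .raw i) ∧
        Output n (fun d => C d < T ∧ (σ.a .label (C d) ≤ j ∨ (σ.a .label (C d) = j + 1 ∧
          d < k + 1)) ∧ 0 < hits a b n A B (C d)) τ' := by
      intro τ' hr hno
      rw [hr]
      refine ⟨h1, fun e he => ?_⟩
      have h3 := h2 e he
      rw [hr]
      by_cases hek : e = k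
      · subst hek
        refine ⟨fun ⟨g1, g2, g3⟩ => h3.1 ⟨g1, ?_, g3⟩, fun g => h3.2 fun ⟨g1, g2, g3⟩ => g ⟨g1, ?_, g3⟩⟩
        · rcases g2 with g2 | g2
          · exact .inl g2
          · exact absurd ⟨g1, g2.1⟩ hno
        · rcases g2 with g2 | g2
          · exact .inl g2
          · exact absurd ⟨g1, g2.1⟩ hno
      · have : e < k + 1 ↔ e < k := by omega
        simp only [this]
        exact h3
    refine wp_ite ⟨trivial, trivial, hV.one_lt⟩ (fun h => ?_) (fun h => ?_)
    · have hlt : C k < T := by simpa [htop'] using h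
      have hlle := hD.label_le (C k)
      refine wp_ite_bd hV (by simp [hin.size]) (by simp [hlab, hj']; omega) (by decide)
        (fun h' => ?_) (fun h' => ?_)
      · have he : σ.a .label (C k) = j + 1 := by simpa [hlab, hj'] using h'
        have hgood := hD.good (C k) (by omega)
        rw [he, Nat.add_sub_cancel, ← hmd] at hgood
        have hmod := Nat.mod_lt (C k) hm0
        refine wp_check hI (hin.congr (by simp) (by simp))
          (hT'.congr (by simp) (by simp) (by simp) (by simp)) (hF'.congr (by simp) (by simp))
          (j := j) (N := 2 ^ (4 * logX n + 1)) (m := m) (s := C k) (d := k) (F := F)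
          (by simp; rw [hf.v _ (by decide), hy₁]) (by simp; rw [hf.v _ (by decide), hN₁]) (by omega)
          (by simp [hj']) (by omega) (by simp; rw [hf.v _ (by decide), hm₁]) hm0 (by omega)
          (by simp) (by omega) (by simp [hd]) hk ?_ ?_ (hGF _ _ hgood) ?_
        · rw [Store.set_a, hf.a _ (by decide), hf.a _ (by decide), ha₁ _ (by decide),
            ha₁ _ (by decide)]
          exact hch _ hmod
        · rw [Store.set_a, hf.a _ (by decide), hw₁ _ hmod]
          exact pairCount_subset hn0 hA.inj hB.inj hA.nodup hB.nodup hA.mem hB.mem m _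
        · intro σ₂ t₂ hf₂ hr₂ ht₂
          refine ⟨⟨?_, ?_⟩, ?_⟩
          · intro i hi
            rw [Store.set_a, hr₂, Function.update_of_ne (by omega), Store.set_a, h1 i hi]
          · intro e hen
            have h3 := h2 e hen
            rw [Store.set_a, hr₂, Store.set_a]
            by_cases hek : e = k
            · subst hek
              rw [Function.update_self]
              refine ⟨fun g => if_pos g.2.2, fun g => if_neg fun g' => g ⟨hlt, .inr ⟨he, by omega⟩, g'⟩⟩
            · rw [Function.update_of_ne (by omega)]
              beta_reduce
              rwa [show e < k + 1 ↔ e < k by omega]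
          · simp [addrCost] at ht₂
            linarith
      · have he : ¬ σ.a .label (C k) = j + 1 := by simpa [hlab, hj'] using h'
        exact wp_skip ⟨hskip _ (by simp) (fun h => he h.2), by simp [addrCost]; omega⟩
    · have hlt : ¬ C k < T := by simpa [htop'] using h
      exact wp_skip ⟨hskip _ (by simp) (fun h => hlt h.1), by simp [addrCost]; omega⟩
  · intro σ' t' hf h ht
    rw [hn₁] at h ht
    simp only [sum_const, card_range, smul_eq_mul] at ht
    refine ⟨h.1, fun d hd => ?_, ?_⟩
    · have h3 := h.2 d hd
      have : (σ.a .label (C d) ≤ j ∨ (σ.a .label (C d) = j + 1 ∧ d < n)) ↔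
          σ.a .label (C d) ≤ j + 1 := by omega
      simp only [this] at h3
      exact h3
    · have e : n * (200 * F + 400 + 8) ≤ n * (200 * F + 500) := Nat.mul_le_mul_left _ (by omega)
      simp [addrCost] at ht₁
      omega

/-- A bound on the number of steps of a query. -/
def queryTime (n F : ℕ) : ℕ :=
  200 * n + n * (70 * n.sqrt + 200) +
    pairBits n * (convTime (4 * logX n) n + n * (200 * F + 500) + 220) + 100

/-- The direct phase settles label 0 and each level the next label, until all labels are covered.
The query rewrites only scratch space, marks and the output area, so the data structure is ready for
the next query. -/
theorem wp_query (hI : Input w n V a b) (hC : ConvFits n V) (hσ : Inp n a b σ) {Λ F : ℕ}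
    (hD : DataStructure (pairSum a b n) n V Λ σ) (hA : Sub n a A) (hB : Sub n b B)
    (hq : Asked n A B C σ)
    (hGF : ∀ m s, Good (pairSum a b n) n Λ m s → coll (pairSum a b n) (n * n) m s ≤ F) :
    WP w queryCmd (fun σ' t' => Inp n a b σ' ∧ DataStructure (pairSum a b n) n V Λ σ' ∧
      Output n (fun d => 0 < hits a b n A B (C d)) σ' ∧ t' ≤ t + queryTime n F) σ t := by
  have hV := hI.fits
  have hAn := hA.length_le
  have hBn := hB.length_le
  have hbits := pairBits_lt hI
  refine wp_seq (wp_flags hI hσ hA hB hq ?_)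
  intro σ₁ t₁ hf₁ hF₁ ht₁
  have hin₁ := hσ.frame hf₁ (by decide) (by decide)
  have hD₁ := hD.frame hf₁ (by decide) (by decide)
  have hr₁ : σ₁.a .raw = σ.a .raw := hf₁.a _ (by decide)
  have hq₁ : Asked n A B C σ₁ := hq.raw hAn hBn (hf₁.v _ (by decide)) (hf₁.v _ (by decide))
    fun i _ => by rw [hr₁]
  refine wp_seq (wp_direct hI hin₁ hD₁ hF₁ hAn hBn hq₁ ?_)
  intro σ₂ t₂ hf₂ hr₂ hO₂ ht₂
  have hin₂ := hin₁.raw (by rw [hf₂.v _ (by decide), hin₁.size]) hr₂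
  have hD₂ := hD₁.frame hf₂ (by decide) (by decide)
  have hF₂ : Flagged n a b A B σ₂ := hF₁.congr (hf₂.a _ (by decide)) (hf₂.a _ (by decide))
  have hq₂ : Asked n A B C σ₂ := hq₁.raw hAn hBn (hf₂.v _ (by decide)) (hf₂.v _ (by decide)) hr₂
  have hlab₂ : σ₂.a .label = σ₁.a .label := hf₂.a _ (by decide)
  have htop₂ : σ₂.v .top = σ₁.v .top := hf₂.v _ (by decide)
  refine wp_for_frame (fun k τ => (∀ i < 5 * n, τ.a .raw i = σ₂.a .raw i) ∧
      Output n (fun d => C d < σ₂.v .top ∧ σ₂.a .label (C d) ≤ k ∧ 0 < hits a b n A B (C d)) τ)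
    (fun _ => convTime (4 * logX n) n + n * (200 * F + 500) + 210)
    (by decide) (by decide) (by decide) (by decide) (by rw [hD₂.J]; exact hV.lt hbits)
    hV.one_lt ⟨fun i _ => rfl, ?_⟩ ?_ ?_
  · intro d hd
    rw [hlab₂, htop₂]
    simp only [Nat.le_zero]
    exact hO₂ d hd
  · rintro k τ t' hk hj hb hf ⟨h1, h2⟩
    rw [hD₂.J] at hk
    have hin := hin₂.raw (by rw [hf.v _ (by decide), hin₂.size]) h1
    have hD' := hD₂.frame hf (by decide) (by decide)
    have hF' : Flagged n a b A B τ := hF₂.congr (hf.a _ (by decide)) (hf.a _ (by decide))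
    have hq' : Asked n A B C τ := hq₂.raw hAn hBn (hf.v _ (by decide)) (hf.v _ (by decide)) h1
    have hlab : τ.a .label = σ₂.a .label := hf.a _ (by decide)
    have htop : τ.v .top = σ₂.v .top := hf.v _ (by decide)
    rw [← hlab, ← htop] at h2 ⊢
    refine wp_level hI hC hin hD' hF' hA hB hq' hj hk hGF h2 ?_
    intro σ₃ t₃ hf₃ hr₃ hO₃ ht₃
    exact ⟨⟨fun i hi => by rw [Store.set_a, hr₃ i hi, h1 i hi], hO₃⟩, by omega⟩
  · rintro σ' t' hf ⟨h1, h2⟩ ht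
    rw [hD₂.J] at h2 ht
    have hD' := hD₂.frame hf (by decide) (by decide)
    refine ⟨hin₂.raw (by rw [hf.v _ (by decide), hin₂.size]) h1, hD', fun d hd => ?_, ?_⟩
    · have h3 := h2 d hd
      have hl := hD₂.label_le (C d)
      -- The restriction to numbers below `top` loses nothing, because every attained sum is below
      -- it.
      have htop : 0 < hits a b n A B (C d) → C d < σ₂.v .top := by
        intro h
        rw [hits, card_pos] at h
        obtain ⟨p, hp⟩ := h
        rw [mem_filter, mem_range] at hp
        rw [← hp.2.1]
        exact hD₂.table.top p hp.1
      exact ⟨fun h => h3.1 ⟨htop h, hl, h⟩, fun h => h3.2 fun h' => h h'.2.2⟩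
    · simp only [sum_const, card_range, smul_eq_mul] at ht
      unfold queryTime
      have e : pairBits n * (convTime (4 * logX n) n + n * (200 * F + 500) + 210 + 8) ≤
          pairBits n * (convTime (4 * logX n) n + n * (200 * F + 500) + 220) :=
        Nat.mul_le_mul_left _ (by omega)
      omega

end query

end WordRAM

/-! ### Arrival of the universes and of the queries in memory. -/

namespace WordRAM

section arrival

/-- Overwrite a segment of the input area. -/
def Store.write (σ : Store) (base : ℕ) (l : List ℕ) : Store :=
  ⟨σ.v, fun a i => if a = .raw ∧ base ≤ i ∧ i < base + l.length then l.getD (i - base) 0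
    else σ.a a i⟩

@[simp] theorem Store.write_v (σ : Store) (base : ℕ) (l : List ℕ) : (σ.write base l).v = σ.v := rfl

theorem Store.write_of_ne (σ : Store) (base : ℕ) (l : List ℕ) {a : Arr} (h : a ≠ .raw) :
    (σ.write base l).a a = σ.a a := by
  ext i; simp [write, h]

theorem Store.write_raw (σ : Store) (base : ℕ) (l : List ℕ) {i : ℕ} (h : i < l.length) :
    (σ.write base l).a .raw (base + i) = l.getD i 0 := by
  simp [write, h]

theorem Store.write_raw_of_lt (σ : Store) {base : ℕ} (l : List ℕ) {i : ℕ} (h : i < base) :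
    (σ.write base l).a .raw i = σ.a .raw i := by
  simp only [write]
  rw [if_neg (by omega)]

/-- The segment lies below 6n, where only the array `raw` lives, and `raw` is not interleaved. -/
theorem Sim.write {s : State} {σ : Store} (h : Sim s σ) {base : ℕ} {l : List ℕ}
    (hb : base + l.length ≤ 6 * σ.v .n) : Sim (s.write base l) (σ.write base l) := by
  refine ⟨h.reg, fun a i hi => ?_⟩
  have h' := h.mem a i hi
  simp only [State.write, Store.write]
  by_cases ha : a = .raw
  · subst ha
    have e : addr (σ.v .n) .raw i = i := if_pos rfl
    rw [e] at h' ⊢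
    simp [h']
  · have e : 6 * σ.v .n ≤ addr (σ.v .n) a i := by
      simp only [addr, if_neg ha]; omega
    simp only [Store.write_v, ha, false_and, if_false] at h' ⊢
    rw [if_neg (by omega), h']

theorem Sim.raw {s : State} {σ : Store} (h : Sim s σ) {i : ℕ} (hi : i < 6 * σ.v .n) :
    s.mem i = σ.a .raw i := by
  simpa [addr] using h.mem .raw i fun _ => hi

/-- The store that holds the universes, and nothing else. -/
def startStore (n : ℕ) (A B : List ℕ) : Store :=
  ((⟨fun x => if x = .n then n else 0, fun _ _ => 0⟩ : Store).write 0 A).write n B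

theorem sim_start {n : ℕ} {A B : List ℕ} (hA : A.length = n) (hB : B.length = n) :
    Sim (ThreeSum.start n A B) (startStore n A B) := by
  have h0 : Sim (State.zero.setReg 0 n) ⟨fun x => if x = .n then n else 0, fun _ _ => 0⟩ := by
    refine ⟨fun x => ?_, fun a i _ => rfl⟩
    simp only [State.setReg, State.zero, Function.update_apply]
    have : x.ctorIdx = 0 ↔ x = .n := ⟨fun h => Var.ctorIdx_inj h, fun h => by rw [h]; rfl⟩
    simp only [this]
  exact (h0.write (by simp; omega)).write (by simp; omega)

theorem inp_start {n : ℕ} {A B : List ℕ} (hA : A.length = n) (hB : B.length = n) :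
    Inp n (fun i => A.getD i 0) (fun i => B.getD i 0) (startStore n A B) := by
  refine ⟨rfl, fun i hi => ?_, fun i hi => Store.write_raw _ _ _ (hB.symm ▸ hi)⟩
  rw [startStore, Store.write_raw_of_lt _ _ hi]
  have := Store.write_raw ⟨fun x => if x = .n then n else 0, fun _ _ => 0⟩ 0 A (hA.symm ▸ hi)
  rwa [zero_add] at this

theorem startStore_of_ne (n : ℕ) (A B : List ℕ) {x : Arr} (hx : x ≠ .raw) :
    (startStore n A B).a x = fun _ => 0 := by
  rw [startStore, Store.write_of_ne _ _ _ hx, Store.write_of_ne _ _ _ hx]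

/-- The store after the arrival of a query. -/
def Store.arrive (w n : ℕ) (q : ThreeSum.Query) (σ : Store) : Store :=
  (((((σ.set .la q.A'.length).set .lb q.B'.length).write (2 * n) q.A').write (3 * n) q.B').write
    (4 * n) (q.C'.map (ofInt w)))

section

variable {w n : ℕ} {q : ThreeSum.Query} {σ : Store}

theorem Inp.arrive {a b : ℕ → ℕ} (h : Inp n a b σ) : Inp n a b (σ.arrive w n q) := by
  have hr : ∀ i < 2 * n, (σ.arrive w n q).a .raw i = σ.a .raw i := fun i hi => by
    rw [Store.arrive, Store.write_raw_of_lt _ _ (by omega), Store.write_raw_of_lt _ _ (by omega),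
      Store.write_raw_of_lt _ _ (by omega)]
    rfl
  refine ⟨?_, fun i hi => ?_, fun i hi => ?_⟩
  · simp [Store.arrive, h.size]
  · rw [hr _ (by omega), h.left i hi]
  · rw [hr _ (by omega), h.right i hi]

variable (hA : q.A'.length ≤ n) (hB : q.B'.length ≤ n) (hC : q.C'.length = n)
include hA hB hC

theorem Sim.arrive {s : State} (h : Sim s σ) (hn : σ.v .n = n) :
    Sim (q.arrive w n s) (σ.arrive w n q) := by
  have h0 : Sim (s.setReg 0 n) σ := by
    refine ⟨fun x => ?_, h.mem⟩
    by_cases hx : x = .n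
    · subst hx; rw [hn]; exact Function.update_self (0 : ℕ) n s.reg
    · have : x.ctorIdx ≠ 0 := fun h' => hx (Var.ctorIdx_inj h')
      simp [State.setReg, Function.update_apply, this, h.reg]
  -- The order of the constructors of `Var` makes `la` and `lb` the registers 1 and 2.
  have h2 : Sim (((s.setReg 0 n).setReg 1 q.A'.length).setReg 2 q.B'.length)
      ((σ.set .la q.A'.length).set .lb q.B'.length) :=
    (h0.setReg (x := .la) (by decide) _).setReg (x := .lb) (by decide) _
  refine ((h2.write ?_).write ?_).write ?_ <;> simp [hn] <;> omega

theorem Store.asked_arrive : Asked n q.A' q.B' (fun i => (q.C'.map (ofInt w)).getD i 0)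
    (σ.arrive w n q) := by
  refine ⟨?_, ?_, fun i hi => ?_, fun i hi => ?_, fun i hi => ?_⟩
  · simp [Store.arrive]
  · simp [Store.arrive]
  · rw [Store.arrive, Store.write_raw_of_lt _ _ (by omega), Store.write_raw_of_lt _ _ (by omega),
      Store.write_raw _ _ _ hi]
  · rw [Store.arrive, Store.write_raw_of_lt _ _ (by omega), Store.write_raw _ _ _ hi]
  · rw [Store.arrive, Store.write_raw _ _ _ (by simpa [hC] using hi)]

end

theorem DataStructure.arrive {S : ℕ → ℕ} {n V Λ w : ℕ} {q : ThreeSum.Query} {σ : Store}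
    (h : DataStructure S n V Λ σ) : DataStructure S n V Λ (σ.arrive w n q) := by
  have hv : ∀ x, x ≠ .la → x ≠ .lb → (σ.arrive w n q).v x = σ.v x := fun x h1 h2 => by
    simp [Store.arrive, h1, h2]
  have ha : ∀ x, x ≠ .raw → (σ.arrive w n q).a x = σ.a x := fun x hx => by
    rw [Store.arrive, Store.write_of_ne _ _ _ hx, Store.write_of_ne _ _ _ hx,
      Store.write_of_ne _ _ _ hx]
    rfl
  have e1 := ha .label (by decide)
  have e2 := ha .moduli (by decide)
  have e3 := ha .bnxt (by decide)
  have e4 := ha .bhead (by decide)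
  refine ⟨?_, ?_, ?_, ?_, ?_, ?_, ?_, ?_, ?_⟩
  · rw [hv _ (by decide) (by decide), h.y]
  · rw [hv _ (by decide) (by decide), h.J]
  · rw [hv _ (by decide) (by decide), h.u]
  · rw [hv _ (by decide) (by decide), h.N]
  · exact h.table.congr (ha _ (by decide)) (ha _ (by decide)) (ha _ (by decide))
      (hv _ (by decide) (by decide))
  · intro j hj
    obtain ⟨h1, h2, h3⟩ := h.level j hj
    exact ⟨by rwa [e2], by rwa [e2], by rwa [e2, e3, e4]⟩
  · rw [e1]; exact h.label_le
  · rw [e1, e2]; exact h.good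
  · rw [e1]; exact h.unlabelled

end arrival

/-! ### From counts of index pairs to the answers. -/

section correctness

theorem getD_mem {l : List ℕ} {i : ℕ} (hi : i < l.length) : l.getD i 0 ∈ l := by
  rw [List.getD_eq_getElem _ _ hi]
  exact List.getElem_mem hi

theorem sub_of_subset {n : ℕ} {A A' : List ℕ} (hA : A.Nodup) (hn : A.length = n) (h : A'.Nodup)
    (hs : A' ⊆ A) : Sub n (fun i => A.getD i 0) A' := by
  refine ⟨fun i hi j hj hij => ?_, h, fun z hz => ?_⟩
  · rw [Set.mem_Iio] at hi hj
    change A.getD i 0 = A.getD j 0 at hij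
    rw [List.getD_eq_getElem _ _ (by omega), List.getD_eq_getElem _ _ (by omega)] at hij
    exact (hA.getElem_inj_iff).1 hij
  · obtain ⟨i, hi, rfl⟩ := List.getElem_of_mem (hs hz)
    exact ⟨i, by omega, List.getD_eq_getElem _ _ hi⟩

theorem hits_pos_iff {n : ℕ} {a b : ℕ → ℕ} {A B : List ℕ} (hA : Sub n a A) (hB : Sub n b B)
    (s : ℕ) : 0 < hits a b n A B s ↔ ∃ x ∈ A, ∃ y ∈ B, x + y = s := by
  unfold hits pairSum
  rw [card_pos]
  constructor
  · rintro ⟨p, hp⟩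
    rw [mem_filter] at hp
    exact ⟨_, hp.2.2.1, _, hp.2.2.2, hp.2.1⟩
  · rintro ⟨x, hx, y, hy, h⟩
    obtain ⟨i, hi, rfl⟩ := hA.mem x hx
    obtain ⟨j, hj, rfl⟩ := hB.mem y hy
    have h1 : (i * n + j) / n = i := by
      rw [Nat.mul_comm, Nat.mul_add_div (by omega), Nat.div_eq_of_lt hj, add_zero]
    have h2 : (i * n + j) % n = j := by
      rw [Nat.mul_comm, Nat.mul_add_mod, Nat.mod_eq_of_lt hj]
    refine ⟨i * n + j, ?_⟩
    rw [mem_filter, mem_range]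
    refine ⟨by nlinarith, ?_, ?_, ?_⟩
    · rw [h1, h2, h]
    · rwa [h1]
    · rwa [h2]

/-- A negative c is represented by a word that is at least half of 2^w, whereas sums are below half;
so a negative c equals no sum, either as an integer or as a word. -/
theorem add_eq_ofInt_iff {w x y : ℕ} {c : ℤ} (hxy : 2 * (x + y) < 2 ^ w)
    (h1 : -(2 : ℤ) ^ w ≤ 2 * c) (h2 : 2 * c < 2 ^ w) : x + y = ofInt w c ↔ (x : ℤ) + y = c := by
  have h3 : (2 : ℤ) * (x + y) < 2 ^ w := by exact_mod_cast hxy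
  unfold ofInt
  generalize (2 : ℤ) ^ w = M at h1 h2 h3
  rcases le_or_gt 0 c with h | h
  · rw [Int.emod_eq_of_lt h (by omega)]
    omega
  · rw [← Int.add_emod_right, Int.emod_eq_of_lt (by omega) (by omega)]
    omega

end correctness

/-! ### Numerical parameters. -/

section parameters

theorem two_pow_pairBits_le {n : ℕ} (hn : 2 ≤ n) : 2 ^ (pairBits n - 1) ≤ n * n := by
  have h1 : 0 < pairBits n := Nat.size_pos.2 (by positivity)
  exact Nat.lt_size.1 (by unfold pairBits at *; omega)

theorem lt_two_pow_pairBits (n : ℕ) : n * n < 2 ^ pairBits n := Nat.lt_size_self _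

theorem three_le_pairBits {n : ℕ} (hn : 2 ≤ n) : 3 ≤ pairBits n :=
  Nat.lt_size.2 (by nlinarith)

/-- The factors are bounded by about n^(3/8). With J binary digits in n², rounding up gives 16 `logX
n` ≤ 3J + 15 = 3(J - 1) + 18, and 2^(J-1) ≤ n². -/
theorem two_pow_logX_pow_le {n : ℕ} (hn : 2 ≤ n) : (2 ^ logX n) ^ 16 ≤ 2 ^ 18 * n ^ 6 := by
  have h3 := three_le_pairBits hn
  calc (2 ^ logX n) ^ 16 = 2 ^ (logX n * 16) := (pow_mul _ _ _).symm
    _ ≤ 2 ^ (18 + (pairBits n - 1) * 3) := Nat.pow_le_pow_right (by norm_num) (by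
        unfold logX; omega)
    _ = 2 ^ 18 * (2 ^ (pairBits n - 1)) ^ 3 := by rw [pow_add, pow_mul]
    _ ≤ 2 ^ 18 * (n * n) ^ 3 := by gcongr; exact two_pow_pairBits_le hn
    _ = 2 ^ 18 * n ^ 6 := by ring

theorem le_two_pow_logX_pow (n : ℕ) : n ^ 6 ≤ (2 ^ logX n) ^ 16 := by
  calc n ^ 6 = (n * n) ^ 3 := by ring
    _ ≤ (2 ^ pairBits n) ^ 3 := by gcongr; exact (lt_two_pow_pairBits n).le
    _ = 2 ^ (pairBits n * 3) := (pow_mul _ _ _).symm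
    _ ≤ 2 ^ (logX n * 16) := Nat.pow_le_pow_right (by norm_num) (by unfold logX; omega)
    _ = (2 ^ logX n) ^ 16 := pow_mul _ _ _

/-- Only N⁴ is bounded by an integral power of n, so the comparison is made after squaring 32 N².
Constants are turned into powers of n by means of n ≥ 2, whence the generous exponent 30. -/
theorem convFits_pow {n : ℕ} (hn : 2 ≤ n) (k : ℕ) : ConvFits n (n ^ (k + 30)) := by
  have h1 := two_pow_logX_pow_le hn
  unfold ConvFits
  set N := 2 ^ (4 * logX n + 1) with hN
  have h2 : 4 * logX n + 1 < N := Nat.lt_two_pow_self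
  have h3 : N ^ 4 = 16 * (2 ^ logX n) ^ 16 := by rw [hN]; ring
  have h4 : (32 * N ^ 2) ^ 2 < (n ^ 30) ^ 2 := by
    calc (32 * N ^ 2) ^ 2 = 2 ^ 10 * N ^ 4 := by ring
      _ ≤ 2 ^ 10 * (16 * (2 ^ 18 * n ^ 6)) := by rw [h3]; gcongr
      _ = 2 ^ 32 * n ^ 6 := by ring
      _ ≤ n ^ 32 * n ^ 6 := by gcongr
      _ = n ^ 38 := by ring
      _ < n ^ 60 := Nat.pow_lt_pow_right (by omega) (by norm_num)
      _ = (n ^ 30) ^ 2 := by ring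
  calc 32 * N * (4 * logX n + 1) ≤ 32 * N * N := by gcongr
    _ = 32 * N ^ 2 := by ring
    _ < n ^ 30 := lt_of_pow_lt_pow_left₀ 2 (by positivity) h4
    _ ≤ n ^ (k + 30) := Nat.pow_le_pow_right (by omega) (by omega)

theorem pow_le_two_pow (n k : ℕ) : n ^ (k + 30) ≤ 2 ^ ((k + 30) * n.size) := by
  rw [Nat.mul_comm, pow_mul]
  exact Nat.pow_le_pow_left (Nat.lt_size_self n).le _

theorem input_of_isUniverse {n k w : ℕ} {A B : List ℕ} (hn : 2 ≤ n)
    (hw : n ^ (14 * (k + 30)) ≤ 2 ^ w) (hA : ThreeSum.IsUniverse n k A)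
    (hB : ThreeSum.IsUniverse n k B) :
    Input w n (n ^ (k + 30)) (fun i => A.getD i 0) (fun i => B.getD i 0) := by
  have hpow : ∀ j, n ^ (k + j + 1) ≥ 2 * n ^ (k + j) := fun j => by
    rw [pow_succ, Nat.mul_comm]; gcongr
  have h1 : ∀ i < n, A.getD i 0 < n ^ k := fun i hi => hA.2.2 _ (getD_mem (hA.2.1.symm ▸ hi))
  have h2 : ∀ i < n, B.getD i 0 < n ^ k := fun i hi => hB.2.2 _ (getD_mem (hB.2.1.symm ▸ hi))
  have h3 : 4 * n ^ k ≤ n ^ (k + 30) := by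
    calc 4 * n ^ k ≤ n ^ 2 * n ^ k := by gcongr; nlinarith
      _ = n ^ (k + 2) := by ring
      _ ≤ _ := Nat.pow_le_pow_right (by omega) (by omega)
  have h4 : 16 * n ^ 4 ≤ n ^ (k + 30) := by
    calc 16 * n ^ 4 ≤ n ^ 4 * n ^ 4 := by
          gcongr; exact (show 16 = 2 ^ 4 by norm_num) ▸ Nat.pow_le_pow_left hn 4
      _ = n ^ 8 := by ring
      _ ≤ _ := Nat.pow_le_pow_right (by omega) (by omega)
  have h5 : 8 * n ≤ n ^ 4 := by
    calc 8 * n ≤ n ^ 3 * n := by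
          gcongr; exact (show 8 = 2 ^ 3 by norm_num) ▸ Nat.pow_le_pow_left hn 3
      _ = n ^ 4 := by ring
  have h6 : 0 < n ^ k := by positivity
  refine ⟨⟨?_, by omega, by unfold numArr; omega⟩, hn, fun i hi => ?_, fun i hi => ?_,
    fun i hi j hj => ?_, by omega⟩
  · rw [← pow_mul, Nat.mul_comm]; exact hw
  · have := h1 i hi; omega
  · have := h2 i hi; omega
  · have := h1 i hi
    have := h2 j hj
    omega

/-- A bound on the number of collisions of a value with a label. -/
def collBound (n Λ : ℕ) : ℕ := 32 * logX n ^ 4 * Λ ^ 4 * (n * n) / (2 ^ logX n) ^ 4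

theorem one_le_logX {n : ℕ} (hn : 2 ≤ n) : 1 ≤ logX n := by
  have := three_le_pairBits hn
  unfold logX; omega

/-- Replace the number of primes by Chebyshev's bound X / (2 log₂ X); its fourth power turns the
constant 2 into 2 · 2⁴ = 32. -/
theorem Good.coll_le {S : ℕ → ℕ} {n Λ m s : ℕ} (hn : 2 ≤ n) (h : Good S n Λ m s) :
    coll S (n * n) m s ≤ collBound n Λ := by
  unfold Good at h
  have h1 := two_pow_le_mul_primesLE (one_le_logX hn)
  unfold collBound
  rw [Nat.le_div_iff_mul_le (by positivity)]
  calc coll S (n * n) m s * (2 ^ logX n) ^ 4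
      ≤ coll S (n * n) m s * (2 * logX n * #(Nat.primesLE (2 ^ logX n))) ^ 4 := by gcongr
    _ = 16 * logX n ^ 4 * (coll S (n * n) m s * #(Nat.primesLE (2 ^ logX n)) ^ 4) := by ring
    _ ≤ 16 * logX n ^ 4 * (2 * Λ ^ 4 * (n * n)) := by gcongr
    _ = 32 * logX n ^ 4 * Λ ^ 4 * (n * n) := by ring

end parameters

/-! ### Execution of the two programs. -/

section programs

variable {k n w : ℕ} {A B : List ℕ} (hn : 2 ≤ n) (hw : n ^ (14 * (k + 30)) ≤ 2 ^ w)
  (hA : ThreeSum.IsUniverse n k A) (hB : ThreeSum.IsUniverse n k B)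
include hn hw hA hB

/-- The state represents a store with a valid data structure. -/
def Prepared (k n : ℕ) (A B : List ℕ) (s : State) : Prop :=
  ∃ σ, Sim s σ ∧ Inp n (fun i => A.getD i 0) (fun i => B.getD i 0) σ ∧
    DataStructure (pairSum (fun i => A.getD i 0) (fun i => B.getD i 0) n) n (n ^ (k + 30))
      ((k + 30) * n.size) σ

theorem exec_pre : ∃ t s, Exec w preCmd.comp (ThreeSum.start n A B) t s ∧ Prepared k n A B s ∧
    ∃ l, l * (n.sqrt + 1) ≤ n * n ∧ t ≤ preTime n l := by
  have hI := input_of_isUniverse hn hw hA hB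
  have hin := inp_start hA.2.1 hB.2.1
  obtain ⟨t, σ, h1, h2, h3, h4⟩ := wp_pre (t := 0) hI (convFits_pow hn k) hin (pow_le_two_pow n k)
    fun x hx => startStore_of_ne n A B hx
  obtain ⟨s, h5, h6⟩ := h1.sim (sim_start hA.2.1 hB.2.1)
  exact ⟨t, s, h5, ⟨σ, h6, hin.frame h3 (by decide) (by decide), h2⟩, _,
    length_popList_mul_le _ _ _, (zero_add t ▸ h4).trans (zero_add _).le⟩

theorem exec_query {s : State} (hs : Prepared k n A B s) {q : ThreeSum.Query}
    (hq : q.Valid w n A B) : ∃ t s', Exec w queryCmd.comp (q.arrive w n s) t s' ∧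
      Prepared k n A B s' ∧ t ≤ queryTime n (collBound n ((k + 30) * n.size)) ∧
      q.Answered n s' := by
  obtain ⟨σ, h1, h2, h3⟩ := hs
  obtain ⟨⟨hA1, hA2⟩, ⟨hB1, hB2⟩, -, hC2, hC3⟩ := hq
  have hI := input_of_isUniverse hn hw hA hB
  have hSA := sub_of_subset hA.1 hA.2.1 hA1 hA2
  have hSB := sub_of_subset hB.1 hB.2.1 hB1 hB2
  obtain ⟨t, σ', g1, g2, g3, g4, g5⟩ := wp_query (t := 0) hI (convFits_pow hn k)
    h2.arrive h3.arrive hSA hSB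
    (Store.asked_arrive (w := w) hSA.length_le hSB.length_le hC2)
    (fun m s hg => hg.coll_le hn)
  obtain ⟨s', g6, g7⟩ := g1.sim (h1.arrive hSA.length_le hSB.length_le hC2 h2.size)
  refine ⟨t, s', g6, ⟨σ', g7, g2, g3⟩, by omega, fun j hj => ?_⟩
  have h4 := g4 j (by omega)
  rw [g7.raw (by rw [g2.size]; omega)]
  have h5 : ∀ x ∈ q.A', ∀ y ∈ q.B', (x + y = (q.C'.map (ofInt w)).getD j 0 ↔
      (x : ℤ) + (y : ℤ) = q.C'[j]) := by
    intro x hx y hy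
    rw [List.getD_eq_getElem _ _ (by simpa using hj), List.getElem_map]
    have h6 := hC3 _ (List.getElem_mem hj)
    refine add_eq_ofInt_iff ?_ h6.1 h6.2
    obtain ⟨i, hi, rfl⟩ := hSA.mem x hx
    obtain ⟨i', hi', rfl⟩ := hSB.mem y hy
    -- Twice a sum is below 2V ≤ V² ≤ 2^w, so the sum lies in the lower half of the words.
    have h7 := hI.sum i hi i' hi'
    have h8 := hI.fits.pow_le (d := 2) (by norm_num)
    have h9 := hI.fits.two_le
    nlinarith
  have h6 : (∃ x ∈ q.A', ∃ y ∈ q.B', (x : ℤ) + (y : ℤ) = q.C'[j]) ↔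
      0 < hits (fun i => A.getD i 0) (fun i => B.getD i 0) n q.A' q.B'
        ((q.C'.map (ofInt w)).getD j 0) := by
    rw [hits_pos_iff hSA hSB]
    constructor
    · rintro ⟨x, hx, y, hy, h⟩
      exact ⟨x, hx, y, hy, (h5 x hx y hy).2 h⟩
    · rintro ⟨x, hx, y, hy, h⟩
      exact ⟨x, hx, y, hy, (h5 x hx y hy).1 h⟩
  rw [h6]
  exact h4

/-- `Ready` speaks of arbitrary executions, while the previous results construct particular ones;
determinism of the machine identifies the two, and the property is carried through any number of
queries. -/
theorem prepared_of_ready {s : State}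
    (hs : ThreeSum.Ready w preCmd.comp queryCmd.comp n A B s) : Prepared k n A B s := by
  induction hs with
  | preprocessed h =>
    obtain ⟨t, s', h1, h2, -⟩ := exec_pre hn hw hA hB
    obtain ⟨-, rfl⟩ := h.deterministic h1
    exact h2
  | queried _ hq h ih =>
    obtain ⟨t, s', h1, h2, -⟩ := exec_query hn hw hA hB ih hq
    obtain ⟨-, rfl⟩ := h.deterministic h1
    exact h2

end programs

end WordRAM

/-! ### Asymptotic running times. -/

namespace WordRAM

section bounds

variable {n : ℕ} (hn : 2 ≤ n)
include hn

theorem half_le_log : 1 / 2 ≤ Real.log n := by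
  have h1 : Real.log 2 ≤ Real.log n := Real.log_le_log (by norm_num) (by exact_mod_cast hn)
  have := Real.log_two_gt_d9
  linarith

theorem pairBits_le_log : (pairBits n : ℝ) ≤ 5 * Real.log n := by
  have h1 : ((2 : ℝ) ^ (pairBits n - 1)) ≤ (n : ℝ) ^ 2 := by
    have := two_pow_pairBits_le hn
    rw [sq]
    exact_mod_cast this
  have h2 := Real.log_le_log (by positivity) h1
  rw [Real.log_pow, Real.log_pow, Nat.cast_sub (by have := three_le_pairBits hn; omega)] at h2
  push_cast at h2
  have h3 := Real.log_two_gt_d9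
  have h4 : (3 : ℝ) ≤ pairBits n := by exact_mod_cast three_le_pairBits hn
  have h5 : ((pairBits n : ℝ) - 1) * (3 / 5) ≤ (pairBits n - 1) * Real.log 2 := by gcongr; linarith; linarith
  nlinarith

theorem logX_le_log : (logX n : ℝ) ≤ 5 / 2 * Real.log n := by
  have h1 := pairBits_le_log hn
  have h2 : 2 * logX n ≤ pairBits n := by
    have := three_le_pairBits hn
    unfold logX; omega
  have h3 : (2 : ℝ) * logX n ≤ pairBits n := by exact_mod_cast h2
  linarith

variable {h : ℝ} (h0 : 0 ≤ h) (hh : h ^ 8 = n)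
include h0 hh

/-- The eighth root h of n makes all exponents integral: X is about h³, √n is h⁴, the modulus is at
most about h¹², and n² is h¹⁶. -/
theorem one_le_root : 1 ≤ h := by
  by_contra hc
  have h1 : h ^ 8 ≤ 1 := pow_le_one₀ h0 (by linarith)
  have h2 : (2 : ℝ) ≤ n := by exact_mod_cast hn
  linarith

/-- The three logarithms of a convolution are absorbed by the spare factor n^(1/8) of the
preprocessing. From log h ≤ 3 h^(1/3) and log n = 8 log h one gets the constant 24³. -/
theorem log_pow_le_root : Real.log n ^ 3 ≤ 13824 * h := by
  have h1 := one_le_root hn h0 hh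
  have h2 : Real.log h ≤ h ^ (1 / 3 : ℝ) / (1 / 3) := Real.log_le_rpow_div h0 (by norm_num)
  have h3 : Real.log n = 8 * Real.log h := by rw [← hh, Real.log_pow]; norm_num
  have h4 : (h ^ (1 / 3 : ℝ)) ^ 3 = h := by
    rw [← Real.rpow_natCast, ← Real.rpow_mul h0]; norm_num
  have h5 := Real.log_nonneg h1
  calc Real.log n ^ 3 = (8 * Real.log h) ^ 3 := by rw [h3]
    _ ≤ (8 * (h ^ (1 / 3 : ℝ) / (1 / 3))) ^ 3 := by gcongr
    _ = 13824 * (h ^ (1 / 3 : ℝ)) ^ 3 := by ring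
    _ = 13824 * h := by rw [h4]

theorem two_pow_logX_le_root : (2 : ℝ) ^ logX n ≤ 3 * h ^ 3 := by
  have h1 : ((2 : ℝ) ^ logX n) ^ 16 ≤ 2 ^ 18 * (n : ℝ) ^ 6 := by
    exact_mod_cast two_pow_logX_pow_le hn
  refine le_of_pow_le_pow_left₀ (n := 16) (by norm_num) (by positivity) (h1.trans ?_)
  rw [← hh]
  have : 0 ≤ h ^ 48 := by positivity
  ring_nf
  linarith

omit hn h0 in
theorem root_le_two_pow_logX : h ^ 12 ≤ ((2 : ℝ) ^ logX n) ^ 4 := by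
  have h1 : (n : ℝ) ^ 6 ≤ ((2 : ℝ) ^ logX n) ^ 16 := by
    exact_mod_cast le_two_pow_logX_pow n
  refine le_of_pow_le_pow_left₀ (n := 4) (by norm_num) (by positivity) ?_
  rw [← hh] at h1
  calc (h ^ 12) ^ 4 = (h ^ 8) ^ 6 := by ring
    _ ≤ _ := h1
    _ = _ := by ring

omit h0 in
theorem two_pow_le_root : (2 : ℝ) ^ (4 * logX n + 1) ≤ 64 * h ^ 12 := by
  have h1 : ((2 : ℝ) ^ logX n) ^ 16 ≤ 2 ^ 18 * (n : ℝ) ^ 6 := by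
    exact_mod_cast two_pow_logX_pow_le hn
  refine le_of_pow_le_pow_left₀ (n := 4) (by norm_num) (by positivity) ?_
  calc ((2 : ℝ) ^ (4 * logX n + 1)) ^ 4 = 16 * (2 ^ logX n) ^ 16 := by ring
    _ ≤ 16 * (2 ^ 18 * (n : ℝ) ^ 6) := by gcongr
    _ ≤ 2 ^ 24 * (n : ℝ) ^ 6 := by have : 0 ≤ (n : ℝ) ^ 6 := by positivity
                                   linarith
    _ = (64 * h ^ 12) ^ 4 := by rw [← hh]; ring

omit hn h0 in
theorem sqrt_le_root : (n.sqrt : ℝ) ≤ h ^ 4 := by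
  refine le_of_pow_le_pow_left₀ (n := 2) (by norm_num) (by positivity) ?_
  have : (n.sqrt : ℝ) ^ 2 ≤ n := by exact_mod_cast Nat.sqrt_le' n
  calc _ ≤ _ := this
    _ = _ := by rw [← hh]; ring

omit h0 in
theorem root_le_sqrt : h ^ 4 ≤ n.sqrt + 1 := by
  refine le_of_pow_le_pow_left₀ (n := 2) (by norm_num) (by positivity) ?_
  have : (n : ℝ) ≤ (n.sqrt + 1) ^ 2 := by exact_mod_cast (Nat.lt_succ_sqrt' n).le
  calc _ = h ^ 8 := by ring
    _ = n := hh
    _ ≤ _ := this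

theorem convTime_le : (convTime (4 * logX n) n : ℝ) ≤ 2 * 10 ^ 9 * h ^ 12 * Real.log n ^ 3 := by
  have hL := half_le_log hn
  have h1 := one_le_root hn h0 hh
  have hN := two_pow_le_root hn hh
  have hx := logX_le_log hn
  have hx1 : (1 : ℝ) ≤ logX n := by exact_mod_cast one_le_logX hn
  set L := Real.log n
  have hL3 : (1 / 2 : ℝ) ^ 3 ≤ L ^ 3 := by gcongr
  have hn12 : (n : ℝ) ≤ h ^ 12 := by rw [← hh]; exact pow_le_pow_right₀ h1 (by norm_num)
  have h12 : 1 ≤ h ^ 12 := one_le_pow₀ h1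
  unfold convTime mulTime
  push_cast
  have e1 : 5000 * (2 : ℝ) ^ (4 * logX n + 1) * (4 * (logX n : ℝ) + 2) ^ 3 ≤
      5000 * (64 * h ^ 12) * (15 * L) ^ 3 := by gcongr; linarith
  have e2 : h ^ 12 ≤ 8 * (h ^ 12 * L ^ 3) := by nlinarith
  calc _ ≤ 5000 * (64 * h ^ 12) * (15 * L) ^ 3 + 100 * (64 * h ^ 12) + 200 * h ^ 12 +
        100 * h ^ 12 := by gcongr; linarith
    _ = 1080000000 * (h ^ 12 * L ^ 3) + 6700 * h ^ 12 := by ring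
    _ ≤ 2 * 10 ^ 9 * h ^ 12 * L ^ 3 := by nlinarith

/-- The dominant term is the search for a factor: X convolutions of cost O(h¹² log³ n) = O(h¹³)
each, with X = O(h³), give O(h¹⁶), which is O(n²) without a logarithm. -/
theorem roundTime_le {l : ℕ} (hl : l * (n.sqrt + 1) ≤ n * n) :
    (roundTime n l : ℝ) ≤ 10 ^ 15 * h ^ 16 := by
  have hL := half_le_log hn
  have h1 := one_le_root hn h0 hh
  have hX := two_pow_logX_le_root hn h0 hh
  have hT := convTime_le hn h0 hh
  have hL3 := log_pow_le_root hn h0 hh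
  have hl' : (l : ℝ) ≤ h ^ 12 := by
    have h2 : (l : ℝ) * (n.sqrt + 1) ≤ n * n := by exact_mod_cast hl
    have h3 := root_le_sqrt hn hh
    have h4 : (l : ℝ) * h ^ 4 ≤ h ^ 12 * h ^ 4 := by
      calc (l : ℝ) * h ^ 4 ≤ l * (n.sqrt + 1) := by gcongr
        _ ≤ _ := h2
        _ = h ^ 12 * h ^ 4 := by rw [← hh]; ring
    exact le_of_mul_le_mul_right h4 (by positivity)
  have hT' : (convTime (4 * logX n) n : ℝ) ≤ 2 * 10 ^ 9 * 13824 * h ^ 13 := by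
    calc _ ≤ _ := hT
      _ ≤ 2 * 10 ^ 9 * h ^ 12 * (13824 * h) := by gcongr
      _ = _ := by ring
  have p1 : h ^ 12 ≤ h ^ 13 := pow_le_pow_right₀ h1 (by norm_num)
  have p2 : h ^ 13 ≤ h ^ 16 := pow_le_pow_right₀ h1 (by norm_num)
  have p3 : 1 ≤ h ^ 12 := one_le_pow₀ h1
  unfold roundTime
  push_cast
  calc _ ≤ 4 * (3 * h ^ 3 * (2 * 10 ^ 9 * 13824 * h ^ 13 + 100 * h ^ 13 + 200 * h ^ 13)) +
        2 * 10 ^ 9 * 13824 * h ^ 13 + 150 * (h ^ 8 * h ^ 8) + 150 * h ^ 12 + 300 := by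
        rw [hh]; gcongr <;> linarith
    _ = 331776000003750 * h ^ 16 + 27648000000000 * h ^ 13 + 150 * h ^ 12 + 300 := by ring
    _ ≤ _ := by linarith

/-- A round costs O(n²), so the single logarithm comes from the number of rounds. -/
theorem preTime_le {l : ℕ} (hl : l * (n.sqrt + 1) ≤ n * n) :
    (preTime n l : ℝ) ≤ 10 ^ 17 * ((n : ℝ) ^ 2 * Real.log n) := by
  have hL := half_le_log hn
  have h1 := one_le_root hn h0 hh
  have hR := roundTime_le hn h0 hh hl
  have hJ := pairBits_le_log hn
  have p3 : 1 ≤ h ^ 16 := one_le_pow₀ h1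
  have hn2 : (n : ℝ) ^ 2 = h ^ 16 := by rw [← hh]; ring
  rw [hn2]
  unfold preTime
  push_cast
  set L := Real.log n
  calc _ ≤ 200 * h ^ 16 + 5 * L * (10 ^ 15 * h ^ 16 + 48 * h ^ 16) + 200 * h ^ 16 := by
        rw [← hn2, sq] at p3 ⊢; gcongr <;> linarith
    _ ≤ _ := by nlinarith

/-- Here n² / X⁴ is at most √n = h⁴. Four logarithms come from the density of the primes and four
from the number Λ of possible prime divisors, which also brings in (k + 30)⁴. -/
theorem collBound_le (k : ℕ) : (collBound n ((k + 30) * n.size) : ℝ) ≤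
    800000 * (k + 30) ^ 4 * Real.log n ^ 8 * h ^ 4 := by
  have hL := half_le_log hn
  have h1 := one_le_root hn h0 hh
  have hX := root_le_two_pow_logX hh
  have hx := logX_le_log hn
  have hs : (n.size : ℝ) ≤ 5 * Real.log n := by
    have : n.size ≤ pairBits n := Nat.size_le_size (Nat.le_mul_self n)
    have : (n.size : ℝ) ≤ pairBits n := by exact_mod_cast this
    linarith [pairBits_le_log hn]
  set L := Real.log n
  unfold collBound
  refine Nat.cast_div_le.trans ?_
  push_cast
  rw [div_le_iff₀ (by positivity)]
  calc 32 * (logX n : ℝ) ^ 4 * ((k + 30) * n.size) ^ 4 * (n * n)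
      ≤ 32 * (5 / 2 * L) ^ 4 * ((k + 30) * (5 * L)) ^ 4 * (n * n) := by gcongr
    _ = 781250 * (k + 30) ^ 4 * L ^ 8 * h ^ 4 * h ^ 12 := by rw [← hh]; ring
    _ ≤ 800000 * (k + 30) ^ 4 * L ^ 8 * h ^ 4 * (2 ^ logX n) ^ 4 := by gcongr; norm_num

/-- For each modulus, n checks of cost `collBound` dominate up to logarithms: n √n log⁸ n. The
number of moduli adds the ninth logarithm. Writing everything in 3/2 log n, which is at least 1,
allows lower powers to be raised to the ninth. -/
theorem queryTime_le (k : ℕ) : (queryTime n (collBound n ((k + 30) * n.size)) : ℝ) ≤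
    10 ^ 13 * (k + 30) ^ 4 * (h ^ 12 * (3 / 2 * Real.log n) ^ 9) := by
  have hL := half_le_log hn
  have hL' : 1 ≤ 3 / 2 * Real.log n := by
    have h1 : Real.log 2 ≤ Real.log n := Real.log_le_log (by norm_num) (by exact_mod_cast hn)
    linarith [Real.log_two_gt_d9]
  have h1 := one_le_root hn h0 hh
  have hT := convTime_le hn h0 hh
  have hF := collBound_le hn h0 hh k
  have hJ := pairBits_le_log hn
  have hr := sqrt_le_root hh
  have hk : (1 : ℝ) ≤ (k + 30) ^ 4 := one_le_pow₀ (by linarith [(Nat.cast_nonneg k : (0 : ℝ) ≤ k)])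
  have hnn : (n : ℝ) ≤ h ^ 12 := by rw [← hh]; exact pow_le_pow_right₀ h1 (by norm_num)
  have p : 1 ≤ h ^ 12 := one_le_pow₀ h1
  set M := 3 / 2 * Real.log n with hM
  set c : ℝ := (k + 30) ^ 4
  have hLM : Real.log n ≤ M := by linarith
  generalize Real.log n = L at *
  set F := collBound n ((k + 30) * n.size)
  have hL0 : 0 ≤ L := by linarith
  have m8 : 1 ≤ M ^ 8 := one_le_pow₀ hL'
  have m38 : M ^ 3 ≤ M ^ 8 := pow_le_pow_right₀ hL' (by norm_num)
  have m9 : 1 ≤ M ^ 9 := one_le_pow₀ hL'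
  have q8 : 1 ≤ c * M ^ 8 := one_le_mul_of_one_le_of_one_le hk m8
  have q9 : 1 ≤ c * M ^ 9 := one_le_mul_of_one_le_of_one_le hk m9
  have e1 : (convTime (4 * logX n) n : ℝ) ≤ 2 * 10 ^ 9 * (h ^ 12 * (c * M ^ 8)) := by
    calc _ ≤ _ := hT
      _ ≤ 2 * 10 ^ 9 * h ^ 12 * M ^ 3 := by gcongr
      _ ≤ 2 * 10 ^ 9 * h ^ 12 * (1 * M ^ 8) := by rw [one_mul]; gcongr
      _ ≤ 2 * 10 ^ 9 * h ^ 12 * (c * M ^ 8) := by gcongr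
      _ = _ := by ring
  have e2 : (n : ℝ) * F ≤ 800000 * (h ^ 12 * (c * M ^ 8)) := by
    calc (n : ℝ) * F ≤ h ^ 8 * (800000 * c * L ^ 8 * h ^ 4) := by rw [hh]; gcongr
      _ ≤ h ^ 8 * (800000 * c * M ^ 8 * h ^ 4) := by gcongr
      _ = _ := by ring
  have e3 : (n : ℝ) * n.sqrt ≤ h ^ 12 := by
    calc (n : ℝ) * n.sqrt ≤ h ^ 8 * h ^ 4 := by rw [hh]; gcongr
      _ = _ := by ring
  have e4 : h ^ 12 ≤ h ^ 12 * (c * M ^ 8) := le_mul_of_one_le_right (by positivity) q8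
  have e5 : h ^ 12 ≤ h ^ 12 * (c * M ^ 9) := le_mul_of_one_le_right (by positivity) q9
  have e6 : (convTime (4 * logX n) n : ℝ) + n * (200 * F + 500) + 220 ≤
      10 ^ 11 * (h ^ 12 * (c * M ^ 8)) := by linarith
  have e7 : (pairBits n : ℝ) * (convTime (4 * logX n) n + n * (200 * F + 500) + 220) ≤
      5 * M * (10 ^ 11 * (h ^ 12 * (c * M ^ 8))) := by gcongr; linarith
  have e8 : 5 * M * (10 ^ 11 * (h ^ 12 * (c * M ^ 8))) =
      5 * 10 ^ 11 * (h ^ 12 * (c * M ^ 9)) := by ring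
  unfold queryTime
  push_cast
  calc _ ≤ 10 ^ 13 * (h ^ 12 * (c * M ^ 9)) := by linarith
    _ = _ := by ring

end bounds

end WordRAM

end

open WordRAM in
theorem theorem3 :
    ∃ (pre query : WordRAM.Prog) (e : ℕ), ∀ k : ℕ, ∃ κ K : ℕ, ∀ n w : ℕ, 2 ≤ n → n ^ κ ≤ 2 ^ w →
      ∀ A B : List ℕ, ThreeSum.IsUniverse n k A → ThreeSum.IsUniverse n k B →
        (∃ (t : ℕ) (s : WordRAM.State), WordRAM.Exec w pre (ThreeSum.start n A B) t s ∧
          (t : ℝ) ≤ K * ((n : ℝ) ^ 2 * Real.log n)) ∧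
        (∀ s : WordRAM.State, ThreeSum.Ready w pre query n A B s →
          ∀ q : ThreeSum.Query, q.Valid w n A B →
            ∃ (t : ℕ) (s' : WordRAM.State), WordRAM.Exec w query (q.arrive w n s) t s' ∧
              (t : ℝ) ≤ K * ((n : ℝ) ^ (3 / 2 : ℝ) * Real.log ((n : ℝ) ^ (3 / 2 : ℝ)) ^ e) ∧
              q.Answered n s') := by
  -- The exponent κ expresses V^14 ≤ 2^w for V = n^(k+30). The exponent 9 is that of `queryTime_le`,
  -- and the constant covers 10^17 from `preTime_le` and 10^13 (k + 30)⁴ from `queryTime_le`.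
  refine ⟨preCmd.comp, queryCmd.comp, 9, fun k => ⟨14 * (k + 30), 10 ^ 17 * (k + 30) ^ 4, ?_⟩⟩
  intro n w hn hw A B hA hB
  have hn0 : (0 : ℝ) < n := by exact_mod_cast (show 0 < n by omega)
  have h0 : (0 : ℝ) ≤ (n : ℝ) ^ (1 / 8 : ℝ) := by positivity
  have hh : ((n : ℝ) ^ (1 / 8 : ℝ)) ^ 8 = n := by
    rw [← Real.rpow_natCast, ← Real.rpow_mul hn0.le]; norm_num
  have h12 : ((n : ℝ) ^ (1 / 8 : ℝ)) ^ 12 = (n : ℝ) ^ (3 / 2 : ℝ) := by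
    rw [← Real.rpow_natCast, ← Real.rpow_mul hn0.le]; norm_num
  have hL := half_le_log hn
  have hk : (1 : ℝ) ≤ (k + 30) ^ 4 := one_le_pow₀ (by linarith [(Nat.cast_nonneg k : (0 : ℝ) ≤ k)])
  refine ⟨?_, fun s hs q hq => ?_⟩
  · obtain ⟨t, s, h1, -, l, h2, h3⟩ := exec_pre hn hw hA hB
    refine ⟨t, s, h1, ?_⟩
    have h4 : (t : ℝ) ≤ preTime n l := by exact_mod_cast h3
    refine (h4.trans (preTime_le hn h0 hh h2)).trans ?_
    push_cast
    gcongr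
    linarith
  · obtain ⟨t, s', h1, -, h2, h3⟩ :=
      exec_query hn hw hA hB (prepared_of_ready hn hw hA hB hs) hq
    refine ⟨t, s', h1, ?_, h3⟩
    have h4 : (t : ℝ) ≤ queryTime n (collBound n ((k + 30) * n.size)) := by exact_mod_cast h2
    refine (h4.trans (queryTime_le hn h0 hh k)).trans ?_
    rw [h12, Real.log_rpow hn0]
    push_cast
    gcongr
    norm_num
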